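/- Let $n\ge 1$, $m>0$, $T>0$. Write $\mathcal D=D\oplus D$ with $D=C_0^\infty(\mathbb R^n;\mathbb C)$, identify $\mathbb C\equiv\mathbb R^2$, and let $\langle Y,\Psi\rangle=\langle Y^0,\Psi^0\rangle+\langle Y^1,\Psi^1\rangle$ be the real pairing of a pair $Y=(Y^0,Y^1)$ of complex distributions with $\Psi\in\mathcal D$. Let $\mathcal H=H^1_{\rm loc}(\mathbb R^n)\oplus L^2_{\rm loc}(\mathbb R^n)$ (complex valued), $\mathcal H^{-\varepsilon}=H^{1-\varepsilon}_{\rm loc}\oplus H^{-\varepsilon}_{\rm loc}$, and $\mathcal H^{s,\alpha}=H^{1+s,\alpha}\oplus H^{s,\alpha}$, where $H^{s,\alpha}$ is the space of $w\in S'(\mathbb R^n)$ with $\|w\|_{s,\alpha}=\|\langle x\rangle^{\alpha}\Lambda^s w\|_{L^2}<\infty$, $\Lambda^s$ being the Fourier multiplier $\langle k\rangle^s=(1+|k|^2)^{s/2}$. A Gaussian probability measure (GPM) is a probability measure $\mu$ with $\int e^{i\langle Y,\Psi\rangle}\mu(dY)=e^{-\frac12\mathcal Q(\Psi)}$, $\Psi\in\mathcal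 D$, for a nonnegative real quadratic form $\mathcal Q$. For $r\in(0,1]$ let $\mu_{0,r}$ be a GPM on $\mathcal H$ with translation-invariant covariance functions $E\big(Y^i(x)\otimes Y^j(y)\big)=q^{ij}_{0,r}(x-y)$, $i,j=0,1$, which are real $2\times2$ matrix functions, with $q^{00}_{0,r}\in C^2$ and the other $q^{ij}_{0,r}$ continuous (so that the mean energy density is finite). Assume - **G0** $q^{01}_{0,r}(z)=q^{10}_{0,r}(z)$ for all $z$, i.e. $E\,u_0(x)\otimes v_0(y)=E\,v_0(x)\otimes u_0(y)$ for $(u_0,v_0)=(Y^0,Y^1)$; - **G1** $q^{11}_{0,r}(z)-\Delta q^{00}_{0,r}(z)+m^2q^{00}_{0,r}(z)=0$ for $|z|\ge r$; - **G2** $\frac12\int\big(q^{11}_{0,r}-\Delta q^{00}_{0,r}+m^2q^{00}_{0,r}\big)(z)\,dz\to T\,I$ as $r\to0$, $I$ the $2\times 2$ unit matrix; - **G3** $\sup_{r\in(0,1]}\int\big(|q^{11}_{0,r}|+|\Delta q^{00}_{0,r}|+m^2|q^{00}_{0,r}|\big)(z)\,dz<\infty$. Let $\mu_{t,r}$ be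 the distribution of $Y(t)=(u(t),\dot u(t))$, where $Y\in C(\mathbb R,\mathcal H)$ is the random (generalised) solution of the Klein--Gordon equation $\ddot u=\Delta u-m^2u$ whose initial state $Y(0)$ has the distribution $\mu_{0,r}$. Then: 1. For every $r\in(0,1]$ there is exactly one limiting measure $\mu_{\infty,r}$, that is, one probability measure on $\mathcal H$ such that $\mu_{t,r}\to\mu_{\infty,r}$ weakly on $\mathcal H^{-\varepsilon}$ as $t\to\infty$, for every $\varepsilon>0$. 2. There is exactly one GPM $g_T$ on pairs of distributions (the canonical Gibbs distribution) with covariance functions $g_T^{00}=T\mathcal P(x-y)$, $g_T^{11}=T\delta(x-y)$ (each times $I$), $g_T^{01}=g_T^{10}=0$, where $\mathcal P$ is the fundamental solution of $-\Delta+m^2$, $\hat{\mathcal P}(k)=(|k|^2+m^2)^{-1}$. 3. For all $s,\alpha<-n/2$ the measures $\mu_{\infty,r}$, $r\in(0,1]$, and $g_T$ are concentrated on $\mathcal H^{s,\alpha}$, and $\mu_{\infty,r}\to g_T$ weakly on $\mathcal H^{s,\alpha}$ as $r\to0$. -/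

import Mathlib

open MeasureTheory Filter Topology Set
open scoped ENNReal NNReal Distributions SchwartzMap LineDeriv Laplacian

noncomputable section

namespace KleinGordon

/-- The Euclidean space `ℝⁿ`. -/
abbrev E (n : ℕ) : Type := EuclideanSpace ℝ (Fin n)

/-- Real-valued test functions on `ℝⁿ`. -/
abbrev RTest (n : ℕ) : Type := 𝓓((⊤ : TopologicalSpace.Opens (E n)), ℝ)

/-- Complex-valued test functions on `ℝⁿ`, the space `D`. -/
abbrev CTest (n : ℕ) : Type := 𝓓((⊤ : TopologicalSpace.Opens (E n)), ℂ)

/-- Complex-valued distributions on `ℝⁿ`, the space `D'` (acting on real test functions). -/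
abbrev Distr (n : ℕ) : Type := 𝓓'((⊤ : TopologicalSpace.Opens (E n)), ℂ)

/-- Pairs `Y = (Y⁰, Y¹) = (u, v)` of complex distributions. All phase spaces below are
subspaces of this space, and all measures below are measures on it. -/
def State (n : ℕ) : Type := Fin 2 → Distr n

instance (n : ℕ) : AddCommGroup (State n) := inferInstanceAs (AddCommGroup (Fin 2 → Distr n))

/-- The σ-algebra generated by the linear functionals `Y ↦ Yⁱ(φ)`. On each of the separable
Fréchet spaces of distributions below its trace is the Borel σ-algebra. -/
instance (n : ℕ) : MeasurableSpace (State n) :=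
  ⨆ (i : Fin 2) (φ : RTest n), MeasurableSpace.comap (fun Y : State n => Y i φ) (borel ℂ)

variable {n : ℕ}

/-! ### Test functions and pairings -/

/-- A real test function as a complex Schwartz function. -/
def RTest.toSchwartz (φ : RTest n) : 𝓢(E n, ℂ) :=
  HasCompactSupport.toSchwartzMap (f := fun x => (φ x : ℂ))
    (φ.hasCompactSupport.comp_left (g := fun t : ℝ => (t : ℂ)) Complex.ofReal_zero)
    (Complex.ofRealCLM.contDiff.comp φ.contDiff)

/-- A complex test function as a Schwartz function. -/
def CTest.toSchwartz (ψ : CTest n) : 𝓢(E n, ℂ) :=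
  HasCompactSupport.toSchwartzMap ψ.hasCompactSupport ψ.contDiff

/-- The product of two real test functions. -/
def RTest.mul (χ φ : RTest n) : RTest n :=
  ⟨fun x => χ x * φ x, χ.contDiff.mul φ.contDiff, φ.hasCompactSupport.mul_left, subset_univ _⟩

/-- The real scalar product `⟨u, ψ⟩ = ∫ (Re u Re ψ + Im u Im ψ) dx` of `u ∈ D'` and `ψ ∈ D`,
with `ℂ` identified with `ℝ²`. -/
def pairing (u : Distr n) (ψ : CTest n) : ℝ :=
  (u (TestFunction.postcompCLM (𝕜 := ℝ) Complex.reCLM ψ)).re +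
    (u (TestFunction.postcompCLM (𝕜 := ℝ) Complex.imCLM ψ)).im

/-- `⟨Y, Ψ⟩ = ⟨Y⁰, Ψ⁰⟩ + ⟨Y¹, Ψ¹⟩`. -/
def pairing₂ (Y : State n) (Ψ : Fin 2 → CTest n) : ℝ :=
  ∑ i, pairing (Y i) (Ψ i)

/-- The characteristic functional of a measure on pairs of distributions. -/
def charFunctional (μ : Measure (State n)) (Ψ : Fin 2 → CTest n) : ℂ :=
  ∫ Y, Complex.exp (Complex.I * (pairing₂ Y Ψ : ℂ)) ∂μ

/-- Gaussian probability measures of mean zero. -/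
def IsGPM (μ : Measure (State n)) : Prop :=
  IsProbabilityMeasure μ ∧
    ∃ Q : QuadraticForm ℝ (Fin 2 → CTest n), (∀ Ψ, 0 ≤ Q Ψ) ∧
      ∀ Ψ, charFunctional μ Ψ = Complex.exp (-(Q Ψ : ℂ) / 2)

/-- The real components of a complex number, `ℂ ≡ ℝ²`. -/
def comp (z : ℂ) : Fin 2 → ℝ := ![z.re, z.im]

/-- Matrix functions `(qⁱʲ(z))`, `i, j = 0, 1`, with values in the real `2 × 2` matrices. -/
abbrev CovFun (n : ℕ) : Type := Fin 2 → Fin 2 → E n → Matrix (Fin 2) (Fin 2) ℝ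

/-- `μ` has the translation-invariant covariance functions
`E (Yⁱ(x) ⊗ Yʲ(y)) = qⁱʲ(x - y)`, understood after integration against test functions in
`x` and `y`. -/
def HasCovFun (μ : Measure (State n)) (q : CovFun n) : Prop :=
  ∀ (i j : Fin 2) (φ ψ : CTest n),
    Integrable (fun Y : State n => pairing (Y i) φ * pairing (Y j) ψ) μ ∧
    ∫ Y, pairing (Y i) φ * pairing (Y j) ψ ∂μ =
      ∫ x, ∫ y, ∑ a, ∑ b, comp (φ x) a * q i j (x - y) a b * comp (ψ y) b

/-- The regularity of the covariance functions that expresses a finite mean energy density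
`tr (q¹¹(0) - Δq⁰⁰(0) + m² q⁰⁰(0))`: `q⁰⁰` is of class `C²` and the other `qⁱʲ` are continuous. -/
def IsRegularCovFun (q : CovFun n) : Prop :=
  (∀ a b, ContDiff ℝ 2 fun z => q 0 0 z a b) ∧
    ∀ i j a b, Continuous fun z => q i j z a b

/-- The entries of `q¹¹ - Δq⁰⁰ + m² q⁰⁰`. -/
def energyCovFun (m : ℝ) (q : CovFun n) (a b : Fin 2) (z : E n) : ℝ :=
  q 1 1 z a b - Δ (fun y => q 0 0 y a b) z + m ^ 2 * q 0 0 z a b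

/-! ### The phase space of states of finite local energy and the dynamics -/

/-- The functions `u`, `v` and `∇u = (g₁, …, gₙ)`, all of them locally square integrable,
represent the pair of distributions `Y`. -/
structure IsLocalEnergyRep (Y : State n) (u v : E n → ℂ) (g : Fin n → E n → ℂ) : Prop where
  memLp_u : ∀ R : ℝ, MemLp u 2 (volume.restrict (Metric.ball 0 R))
  memLp_v : ∀ R : ℝ, MemLp v 2 (volume.restrict (Metric.ball 0 R))
  memLp_g : ∀ (k : Fin n) (R : ℝ), MemLp (g k) 2 (volume.restrict (Metric.ball 0 R))
  rep_u : ∀ φ : RTest n, Y 0 φ = ∫ x, φ x • u x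
  rep_v : ∀ φ : RTest n, Y 1 φ = ∫ x, φ x • v x
  rep_g : ∀ (k : Fin n) (φ : RTest n),
    (∂_{(EuclideanSpace.single k (1 : ℝ) : E n)} (Y 0)) φ = ∫ x, φ x • g k x

/-- The phase space `H¹_loc ⊕ H⁰_loc`. -/
def phaseSpace (n : ℕ) : Set (State n) :=
  {Y | ∃ u v g, IsLocalEnergyRep Y u v g}

/-- The square of the local energy seminorm,
`‖Y‖²_R = ∫_{|x| < R} (|v|² + |∇u|² + m² |u|²) dx`; it is `∞` off the phase space. The
representing functions are unique almost everywhere, so the infimum is over equal numbers. -/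
def localEnergy (m R : ℝ) (Y : State n) : ℝ≥0∞ :=
  ⨅ (u : E n → ℂ) (v : E n → ℂ) (g : Fin n → E n → ℂ) (_ : IsLocalEnergyRep Y u v g),
    ∫⁻ x in Metric.ball 0 R,
      (‖v x‖ₑ ^ 2 + ∑ k, ‖g k x‖ₑ ^ 2 + ENNReal.ofReal (m ^ 2) * ‖u x‖ₑ ^ 2)

/-- The Laplacian of a distribution. -/
def distrLaplacian (u : Distr n) : Distr n :=
  ∑ k : Fin n, ∂_{(EuclideanSpace.single k (1 : ℝ) : E n)}
    (∂_{(EuclideanSpace.single k (1 : ℝ) : E n)} u)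

/-- `Y ∈ C(ℝ, H¹_loc ⊕ H⁰_loc)` is a generalised solution `Y(t) = (u(t), u̇(t))` of the
Klein–Gordon equation `ü = Δu - m² u`. -/
structure IsKGSolution (m : ℝ) (Y : ℝ → State n) : Prop where
  mem : ∀ t, Y t ∈ phaseSpace n
  continuous : ∀ (R t₀ : ℝ), Tendsto (fun t => localEnergy m R (Y t - Y t₀)) (𝓝 t₀) (𝓝 0)
  deriv_zero : ∀ (φ : RTest n) (t : ℝ), HasDerivAt (fun τ => Y τ 0 φ) (Y t 1 φ) t
  deriv_one : ∀ (φ : RTest n) (t : ℝ),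
    HasDerivAt (fun τ => Y τ 1 φ) (distrLaplacian (Y t 0) φ - (m : ℂ) ^ 2 * Y t 0 φ) t

/-- `Y(t)`, `t ∈ ℝ`, is the random solution of the Klein–Gordon equation whose initial state
`Y(0)` has the distribution `μ₀`. -/
structure IsRandomSolution (m : ℝ) {Ω : Type*} [MeasurableSpace Ω] (P : Measure Ω)
    (Y : ℝ → Ω → State n) (μ₀ : Measure (State n)) : Prop where
  measurable : ∀ t, Measurable (Y t)
  solution : ∀ᵐ ω ∂P, IsKGSolution m fun t => Y t ω
  initial : P.map (Y 0) = μ₀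

/-! ### Sobolev spaces -/

/-- The symbol `(c² + |k|²)^p`, written in the variable `ξ` of the Fourier transform with
kernel `exp (-2πi ξ·x)`, so that `k = 2πξ` up to a sign. -/
def symbol (c p : ℝ) (ξ : E n) : ℂ :=
  (((c ^ 2 + (2 * Real.pi * ‖ξ‖) ^ 2) ^ p : ℝ) : ℂ)

/-- The operator `Λˢ` with the symbol `⟨k⟩ˢ = (1 + |k|²)^(s/2)` on tempered distributions. -/
def Lam (s : ℝ) : 𝓢'(E n, ℂ) →L[ℂ] 𝓢'(E n, ℂ) :=
  TemperedDistribution.fourierMultiplierCLM ℂ (symbol 1 (s / 2))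

/-- The distribution `u` is tempered and `⟨x⟩^α Λˢ u = g ∈ L²`. -/
def IsWeightedRep (s α : ℝ) (u : Distr n) (g : Lp ℂ 2 (volume : Measure (E n))) : Prop :=
  ∃ w : 𝓢'(E n, ℂ), (∀ φ : RTest n, u φ = w φ.toSchwartz) ∧
    TemperedDistribution.smulLeftCLM ℂ (fun x : E n => (((1 + ‖x‖ ^ 2) ^ (α / 2) : ℝ) : ℂ))
      (Lam s w) = Lp.toTemperedDistribution g

/-- The norm of the weighted Sobolev space `H^{s,α}`; it is `∞` off this space. -/
def weightedNorm (s α : ℝ) (u : Distr n) : ℝ≥0∞ :=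
  ⨅ (g : Lp ℂ 2 (volume : Measure (E n))) (_ : IsWeightedRep s α u g), ‖g‖ₑ

/-- The norm of `𝓗^{s,α} = H^{1+s,α} ⊕ H^{s,α}`. -/
def weightedNorm₂ (s α : ℝ) (Y : State n) : ℝ≥0∞ :=
  weightedNorm (1 + s) α (Y 0) + weightedNorm s α (Y 1)

/-- The space `𝓗^{s,α} = H^{1+s,α} ⊕ H^{s,α}`. -/
def weightedSpace (n : ℕ) (s α : ℝ) : Set (State n) :=
  {Y | (∃ g, IsWeightedRep (1 + s) α (Y 0) g) ∧ ∃ g, IsWeightedRep s α (Y 1) g}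

/-- For the cut-off `χ`, the compactly supported distribution `χu` has `Λˢ(χu) = g ∈ L²`. -/
def IsLocalRep (s : ℝ) (χ : RTest n) (u : Distr n) (g : Lp ℂ 2 (volume : Measure (E n))) : Prop :=
  ∃ w : 𝓢'(E n, ℂ), (∀ φ : RTest n, u (RTest.mul χ φ) = w φ.toSchwartz) ∧
    Lam s w = Lp.toTemperedDistribution g

/-- The seminorm `‖Λˢ(χu)‖_{L²}` of `H^s_loc`; it is `∞` if `Λˢ(χu)` is not in `L²`. -/
def localSeminorm (s : ℝ) (χ : RTest n) (u : Distr n) : ℝ≥0∞ :=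
  ⨅ (g : Lp ℂ 2 (volume : Measure (E n))) (_ : IsLocalRep s χ u g), ‖g‖ₑ

/-- The seminorms of `𝓗^s = H^{1+s}_loc ⊕ H^s_loc`. -/
def localSeminorm₂ (s : ℝ) (χ : RTest n) (Y : State n) : ℝ≥0∞ :=
  localSeminorm (1 + s) χ (Y 0) + localSeminorm s χ (Y 1)

/-- The space `𝓗^s = H^{1+s}_loc ⊕ H^s_loc`. -/
def localSpace (n : ℕ) (s : ℝ) : Set (State n) :=
  {Y | ∀ χ : RTest n, (∃ g, IsLocalRep (1 + s) χ (Y 0) g) ∧ ∃ g, IsLocalRep s χ (Y 1) g}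

/-! ### Weak convergence of measures -/

/-- The topology generated by the balls of a family of (extended) seminorms. -/
@[reducible] def seminormTopology {ι : Type*} (N : ι → State n → ℝ≥0∞) : TopologicalSpace (State n) :=
  TopologicalSpace.generateFrom
    {B | ∃ (i : ι) (Y : State n) (ρ : ℝ≥0∞), 0 < ρ ∧ B = {Z | N i (Z - Y) < ρ}}

/-- Weak convergence on the space `V`, topologised by the seminorms `N`, of measures which are
concentrated on `V`: `∫ f dμ_a → ∫ f dν` for all bounded continuous functionals `f` on `V`. The
values of `f` off `V` do not matter. -/
def WeaklyConverges {ι A : Type*} (V : Set (State n)) (N : ι → State n → ℝ≥0∞) (l : Filter A)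
    (μ : A → Measure (State n)) (ν : Measure (State n)) : Prop :=
  (∀ᶠ a in l, ∀ᵐ Y ∂μ a, Y ∈ V) ∧ (∀ᵐ Y ∂ν, Y ∈ V) ∧
    ∀ f : State n → ℝ, (∃ C : ℝ, ∀ Y ∈ V, |f Y| ≤ C) →
      @ContinuousOn _ _ (seminormTopology N) _ f V →
      Tendsto (fun a => ∫ Y, f Y ∂μ a) l (𝓝 (∫ Y, f Y ∂ν))

/-- `ν` is the limiting measure, as `t → ∞`, of the measures `μ_t`: a probability measure on
`H¹_loc ⊕ H⁰_loc` to which `μ_t` converges weakly in `H^{1-ε}_loc ⊕ H^{-ε}_loc` for all `ε > 0`. -/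
structure IsLimitingMeasure (μ : ℝ → Measure (State n)) (ν : Measure (State n)) : Prop where
  prob : IsProbabilityMeasure ν
  concentrated : ∀ᵐ Y ∂ν, Y ∈ phaseSpace n
  tendsto : ∀ ε : ℝ, 0 < ε →
    WeaklyConverges (localSpace n (-ε)) (localSeminorm₂ (-ε)) atTop μ ν

/-! ### The canonical Gibbs distribution -/

/-- `𝒫 * ψ`, where `𝒫` is the fundamental solution of `-Δ + m²`, that is
`𝒫̂(k) = (m² + |k|²)⁻¹`. -/
def potential (m : ℝ) (ψ : CTest n) : 𝓢(E n, ℂ) :=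
  SchwartzMap.fourierMultiplierCLM ℂ (symbol m (-1)) ψ.toSchwartz

/-- The quadratic form with the kernel `g⁰⁰ = T 𝒫(x - y)`, `g¹¹ = T δ(x - y)`, `g⁰¹ = g¹⁰ = 0`. -/
def gibbsForm (m T : ℝ) (Ψ : Fin 2 → CTest n) : ℝ :=
  T * (∫ x, (star (Ψ 0 x) * potential m (Ψ 0) x).re) + T * ∫ x, ‖Ψ 1 x‖ ^ 2

/-- `g` is the canonical Gibbs distribution `g_T`: the Gaussian probability measure of mean zero
with the covariance functions `T 𝒫(x - y)`, `T δ(x - y)` and `0`. -/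
def IsCanonicalGibbs (m T : ℝ) (g : Measure (State n)) : Prop :=
  IsProbabilityMeasure g ∧
    ∀ Ψ : Fin 2 → CTest n, charFunctional g Ψ = Complex.exp (-(gibbsForm m T Ψ : ℂ) / 2)

end KleinGordon

end

open MeasureTheory Filter Topology Set
open scoped ENNReal NNReal Distributions SchwartzMap LineDeriv Laplacian

set_option linter.unusedSectionVars false

noncomputable section

namespace KleinGordon

/-! All measures involved are Gaussian, so each is determined by its covariance form through its
characteristic functional (`measure_ext_of_charFunctional`). Weak convergence then splits into two
tasks: convergence of the covariance form on every fixed test function, and tightness. Tightness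
comes from one trace-class form dominating all the covariances at once (`TraceBound`): in a Hilbert
space this bounds the second moments of the coordinates by a summable sequence, and Prokhorov's
theorem yields both existence of Gaussian measures (`exists_gaussian`) and their convergence
(`tendsto_gaussian`).

The dynamics enters by duality. Pairing Y(t) with a test function equals pairing Y(0) with the test
function evolved by the adjoint flow, whose symbols are cos(tω), sin(tω)/ω and ω sin(tω), with ω² =
m² + |k|² (`IsKGSolution.pairing₂_flow`). For this the evolved test functions must have compact
support, which a weighted energy estimate provides (`IsBoundedSystem.density_eq_zero`,
`re_propagation`). The covariance form at time t is therefore the initial one evaluated on the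
evolved test functions.

As t → ∞, the push-forward of an integrable density under ω is absolutely continuous, so the
Riemann–Lebesgue lemma kills every oscillating term (`tendsto_integral_exp_disp`). The squares cos²
and sin² average to 1/2, and the diagonal covariances combine into half the transform of q¹¹ - Δq⁰⁰
+ m²q⁰⁰, divided by ω² in the first component (`limitForm`). The mixed covariance q⁰¹ is not assumed
integrable. Its non-oscillating part cancels by G0 (`IsInitial.sum_cross`), and the rest vanishes by
a Hilbert space argument in L²(μ) (`HasCovFun.tendsto_kform_cross`).

The transform of a positive definite continuous integrable kernel is nonnegative and integrable
(`four_nonneg`, `integrable_four_of_nonneg`). Hence the spectral energy density is integrable, and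
the covariances at all times have a trace-class majorant on a weighted space of states of finite
local energy (`exists_traceBound_energy`). This places the limiting measure on the phase space and
gives convergence in all the spaces with ε > 0.

As r → 0, G1 and G3 make the transform of the energy covariance nearly constant on bounded sets of
frequencies, and G2 identifies the constant as 2T times the unit matrix, so the limit forms tend to
the Gibbs form (`tendsto_limitForm`). Their common bound C gives a majorant of white-noise type,
which is trace class on the weighted Sobolev space exactly because s and α lie below -n/2
(`exists_traceBound_weighted`). -/

/-! ### Gaussian measures on Hilbert spaces -/

section GaussianHilbert

open ProbabilityTheory

/-- A real random variable whose characteristic function is that of `N(0, σ)` has the law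
`N(0, σ)`. -/
theorem map_eq_gaussianReal {Ω : Type*} [MeasurableSpace Ω] {μ : Measure Ω}
    [IsProbabilityMeasure μ] {X : Ω → ℝ} (hX : AEMeasurable X μ) {σ : ℝ} (hσ : 0 ≤ σ)
    (h : ∀ t : ℝ, ∫ ω, Complex.exp (t * X ω * Complex.I) ∂μ = Complex.exp (-(t ^ 2 * σ : ℝ) / 2)) :
    μ.map X = gaussianReal 0 σ.toNNReal := by
  have := Measure.isProbabilityMeasure_map hX
  refine Measure.ext_of_charFun (funext fun t => ?_)
  rw [charFun_apply_real, integral_map hX (by fun_prop), h t, charFun_gaussianReal]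
  congr 1
  rw [Real.coe_toNNReal _ hσ]
  push_cast
  ring

theorem memLp_two_of_gaussian {Ω : Type*} [MeasurableSpace Ω] {μ : Measure Ω}
    [IsProbabilityMeasure μ] {X : Ω → ℝ} (hX : AEMeasurable X μ) {σ : ℝ} (hσ : 0 ≤ σ)
    (h : ∀ t : ℝ, ∫ ω, Complex.exp (t * X ω * Complex.I) ∂μ = Complex.exp (-(t ^ 2 * σ : ℝ) / 2)) :
    MemLp X 2 μ := by
  have h1 := map_eq_gaussianReal hX hσ h
  have h2 : MemLp (id : ℝ → ℝ) 2 (μ.map X) := by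
    rw [h1]; exact memLp_id_gaussianReal 2
  exact (memLp_map_measure_iff (by fun_prop) hX).1 h2

theorem integral_sq_of_gaussian {Ω : Type*} [MeasurableSpace Ω] {μ : Measure Ω}
    [IsProbabilityMeasure μ] {X : Ω → ℝ} (hX : AEMeasurable X μ) {σ : ℝ} (hσ : 0 ≤ σ)
    (h : ∀ t : ℝ, ∫ ω, Complex.exp (t * X ω * Complex.I) ∂μ = Complex.exp (-(t ^ 2 * σ : ℝ) / 2)) :
    ∫ ω, X ω ^ 2 ∂μ = σ := by
  have h1 := map_eq_gaussianReal hX hσ h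
  have h2 : ∫ x, x ^ 2 ∂(μ.map X) = σ := by
    rw [h1]
    have := variance_id_gaussianReal (μ := 0) (v := σ.toNNReal)
    rw [variance_eq_integral (by fun_prop)] at this
    simpa [hσ] using this
  rwa [integral_map hX (by fun_prop)] at h2

theorem lintegral_sq_of_gaussian {Ω : Type*} [MeasurableSpace Ω] {μ : Measure Ω}
    [IsProbabilityMeasure μ] {X : Ω → ℝ} (hX : AEMeasurable X μ) {σ : ℝ} (hσ : 0 ≤ σ)
    (h : ∀ t : ℝ, ∫ ω, Complex.exp (t * X ω * Complex.I) ∂μ = Complex.exp (-(t ^ 2 * σ : ℝ) / 2)) :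
    ∫⁻ ω, ‖X ω‖ₑ ^ 2 ∂μ = ENNReal.ofReal σ := by
  rw [← integral_sq_of_gaussian hX hσ h,
    ofReal_integral_eq_lintegral_ofReal (memLp_two_of_gaussian hX hσ h).integrable_sq
      (ae_of_all _ fun _ => sq_nonneg _)]
  refine lintegral_congr fun ω => ?_
  rw [← enorm_pow, Real.enorm_eq_ofReal (sq_nonneg _)]

/-! ### Trace-class majorants and Hilbert bases from a dense range -/

variable {V : Type*} [AddCommGroup V] [Module ℝ V]
  {H : Type*} [NormedAddCommGroup H] [InnerProductSpace ℝ H] [CompleteSpace H]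

/-- `D` is a trace-class majorant: it is bounded by the square of the norm of `e v`, and its sums
over orthonormal families are bounded. -/
def TraceBound (e : V →ₗ[ℝ] H) (D : V → ℝ) (K : ℝ) : Prop :=
  (∀ v, D v ≤ K * ‖e v‖ ^ 2) ∧ ∀ (ι : Type) (s : Finset ι) (w : ι → V),
    Orthonormal ℝ (fun i => e (w i)) → ∑ i ∈ s, D (w i) ≤ K

theorem TraceBound.add {e : V →ₗ[ℝ] H} {D₁ D₂ : V → ℝ} {K₁ K₂ : ℝ} (h₁ : TraceBound e D₁ K₁)
    (h₂ : TraceBound e D₂ K₂) : TraceBound e (fun v => D₁ v + D₂ v) (K₁ + K₂) := by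
  refine ⟨fun v => ?_, fun ι s w hw => ?_⟩
  · rw [add_mul]; exact add_le_add (h₁.1 v) (h₂.1 v)
  · rw [Finset.sum_add_distrib]; exact add_le_add (h₁.2 ι s w hw) (h₂.2 ι s w hw)

/-- A finite Bessel inequality. On v = Σ L(wᵢ) wᵢ the functional takes the value S, the sum to be
bounded, while orthonormality gives ‖e v‖² = S; hence S ≤ c √S. -/
theorem sum_sq_le_of_real_bound (e : V →ₗ[ℝ] H) (L : V →ₗ[ℝ] ℝ) {c : ℝ}
    (hL : ∀ v, |L v| ≤ c * ‖e v‖) {ι : Type} (s : Finset ι) (w : ι → V)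
    (hw : Orthonormal ℝ fun i => e (w i)) : ∑ i ∈ s, L (w i) ^ 2 ≤ c ^ 2 := by
  set S := ∑ i ∈ s, L (w i) ^ 2 with hS
  have hS0 : 0 ≤ S := Finset.sum_nonneg fun _ _ => sq_nonneg _
  have h1 : L (∑ i ∈ s, L (w i) • w i) = S := by
    simp [map_sum, hS, sq]
  have h2 : ‖e (∑ i ∈ s, L (w i) • w i)‖ ^ 2 = S := by
    rw [← real_inner_self_eq_norm_sq, map_sum]
    simp only [map_smul]
    rw [hw.inner_sum]
    simp [hS, sq]
  have h3 := hL (∑ i ∈ s, L (w i) • w i)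
  rw [h1, abs_of_nonneg hS0] at h3
  have h4 : S ^ 2 ≤ c ^ 2 * S := by
    calc S ^ 2 ≤ (c * ‖e (∑ i ∈ s, L (w i) • w i)‖) ^ 2 := by gcongr
      _ = c ^ 2 * S := by rw [mul_pow, h2]
  rcases hS0.eq_or_lt with h0 | h0
  · rw [← h0]; positivity
  · nlinarith

theorem sum_sq_le_of_bound (e : V →ₗ[ℝ] H) (L : V →ₗ[ℝ] ℂ) {c : ℝ}
    (hL : ∀ v, ‖L v‖ ≤ c * ‖e v‖) {ι : Type} (s : Finset ι) (w : ι → V)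
    (hw : Orthonormal ℝ fun i => e (w i)) : ∑ i ∈ s, ‖L (w i)‖ ^ 2 ≤ 2 * c ^ 2 := by
  have h1 := sum_sq_le_of_real_bound e (Complex.reLm ∘ₗ L)
    (fun v => (Complex.abs_re_le_norm _).trans (hL v)) s w hw
  have h2 := sum_sq_le_of_real_bound e (Complex.imLm ∘ₗ L)
    (fun v => (Complex.abs_im_le_norm _).trans (hL v)) s w hw
  have h3 : ∀ z : ℂ, ‖z‖ ^ 2 = z.re ^ 2 + z.im ^ 2 := fun z => by
    rw [Complex.sq_norm, Complex.normSq_apply]; ring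
  simp only [h3, Finset.sum_add_distrib]
  simp only [LinearMap.comp_apply, Complex.reLm_coe, Complex.imLm_coe] at h1 h2
  linarith

/-- Bessel's inequality for each functional `L ξ`, integrated against the weight `F`. The factor 2
arises because the real and imaginary parts of a complex functional are estimated separately. -/
theorem traceBound_integral (e : V →ₗ[ℝ] H) {X : Type*} [MeasurableSpace X] (ρ : Measure X)
    (L : X → V →ₗ[ℝ] ℂ) (F c : X → ℝ) (hF : ∀ ξ, 0 ≤ F ξ)
    (hFm : AEStronglyMeasurable F ρ) (hLm : ∀ v, AEStronglyMeasurable (fun ξ => L ξ v) ρ)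
    (hL : ∀ ξ v, ‖L ξ v‖ ≤ c ξ * ‖e v‖) (hint : Integrable (fun ξ => F ξ * c ξ ^ 2) ρ) :
    (∀ v, Integrable (fun ξ => F ξ * ‖L ξ v‖ ^ 2) ρ) ∧
    TraceBound e (fun v => ∫ ξ, F ξ * ‖L ξ v‖ ^ 2 ∂ρ) (2 * ∫ ξ, F ξ * c ξ ^ 2 ∂ρ) := by
  have hb : ∀ v ξ, F ξ * ‖L ξ v‖ ^ 2 ≤ (F ξ * c ξ ^ 2) * ‖e v‖ ^ 2 := fun v ξ => by
    rw [mul_assoc, ← mul_pow]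
    exact mul_le_mul_of_nonneg_left (pow_le_pow_left₀ (norm_nonneg _) (hL ξ v) 2) (hF ξ)
  have hi : ∀ v, Integrable (fun ξ => F ξ * ‖L ξ v‖ ^ 2) ρ := fun v => by
    refine (hint.mul_const (‖e v‖ ^ 2)).mono' (hFm.mul ((hLm v).norm.pow 2)) (ae_of_all _ ?_)
    intro ξ
    rw [Real.norm_of_nonneg (mul_nonneg (hF ξ) (sq_nonneg _))]
    exact hb v ξ
  refine ⟨hi, fun v => ?_, fun ι s w hw => ?_⟩
  · have h0 : 0 ≤ ∫ ξ, F ξ * c ξ ^ 2 ∂ρ :=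
      integral_nonneg fun ξ => mul_nonneg (hF ξ) (sq_nonneg _)
    calc ∫ ξ, F ξ * ‖L ξ v‖ ^ 2 ∂ρ ≤ ∫ ξ, (F ξ * c ξ ^ 2) * ‖e v‖ ^ 2 ∂ρ :=
          integral_mono (hi v) (hint.mul_const _) (hb v)
      _ = (∫ ξ, F ξ * c ξ ^ 2 ∂ρ) * ‖e v‖ ^ 2 := integral_mul_const _ _
      _ ≤ _ := by gcongr; linarith
  · rw [← integral_finsetSum _ fun i _ => hi (w i), ← integral_const_mul]
    refine integral_mono (integrable_finsetSum _ fun i _ => hi (w i)) (hint.const_mul 2) fun ξ => ?_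
    simp only
    rw [← Finset.mul_sum]
    have := mul_le_mul_of_nonneg_left (sum_sq_le_of_bound e (L ξ) (hL ξ) s w hw) (hF ξ)
    linarith

/-- Gram–Schmidt applied to a countable dense part of the range stays inside the range; the vectors
that vanish are discarded. The basis has to consist of images under `e`, since covariances are known
only on `V`. -/
theorem exists_hilbertBasis_of_denseRange [SecondCountableTopology H] (e : V →ₗ[ℝ] H)
    (he : DenseRange e) :
    ∃ (ι : Type) (_ : Countable ι) (b : HilbertBasis ι ℝ H) (w : ι → V), ∀ i, e (w i) = b i := by
  obtain ⟨t, ht, htc, htd⟩ := he.exists_countable_dense_subset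
  have hne : t.Nonempty := htd.nonempty
  obtain ⟨f, hf⟩ := htc.exists_eq_range hne
  have hspan : (⊤ : Submodule ℝ H) ≤ (Submodule.span ℝ (range fun
      i : {i | InnerProductSpace.gramSchmidtNormed ℝ f i ≠ 0} =>
        InnerProductSpace.gramSchmidtNormed ℝ f i)).topologicalClosure := by
    have h1 : Submodule.span ℝ (range f) ≤ Submodule.span ℝ (range fun
      i : {i | InnerProductSpace.gramSchmidtNormed ℝ f i ≠ 0} =>
        InnerProductSpace.gramSchmidtNormed ℝ f i) := by
      rw [← InnerProductSpace.span_gramSchmidt, ← InnerProductSpace.span_gramSchmidtNormed_range,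
        Submodule.span_le]
      rintro _ ⟨i, rfl⟩
      by_cases hi : InnerProductSpace.gramSchmidtNormed ℝ f i = 0
      · rw [hi]; exact Submodule.zero_mem _
      · exact Submodule.subset_span ⟨⟨i, hi⟩, rfl⟩
    intro x _
    have hx : x ∈ closure t := htd x
    rw [hf] at hx
    exact closure_mono (Submodule.subset_span.trans h1) hx
  have hmem : ∀ i, ∃ v, e v = InnerProductSpace.gramSchmidtNormed ℝ f i := by
    intro i
    have h1 : InnerProductSpace.gramSchmidtNormed ℝ f i ∈ Submodule.span ℝ (range f) := by
      rw [← InnerProductSpace.span_gramSchmidt, ← InnerProductSpace.span_gramSchmidtNormed_range]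
      exact Submodule.subset_span ⟨i, rfl⟩
    have h2 : Submodule.span ℝ (range f) ≤ LinearMap.range e := by
      rw [Submodule.span_le, ← hf]
      exact ht
    exact h2 h1
  choose w hw using hmem
  refine ⟨{i | InnerProductSpace.gramSchmidtNormed ℝ f i ≠ 0}, inferInstance,
    HilbertBasis.mk (InnerProductSpace.gramSchmidtNormed_orthonormal' f) hspan,
    fun i => w i, fun i => ?_⟩
  rw [HilbertBasis.coe_mk, hw]

/-- The projection to the span of finitely many vectors of a Hilbert basis. -/
def basisProj {ι : Type*} (b : HilbertBasis ι ℝ H) (s : Finset ι) (x : H) : H :=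
  ∑ i ∈ s, inner ℝ (b i) x • b i

theorem continuous_basisProj {ι : Type*} (b : HilbertBasis ι ℝ H) (s : Finset ι) :
    Continuous (basisProj b s) := by
  unfold basisProj; fun_prop

theorem inner_sub_basisProj {ι : Type*} [DecidableEq ι] (b : HilbertBasis ι ℝ H) (s : Finset ι)
    (x : H) (j : ι) :
    inner ℝ (b j) (x - basisProj b s x) = if j ∈ s then 0 else inner ℝ (b j) x := by
  have h : ∀ i, inner ℝ (b j) (b i) = if j = i then (1 : ℝ) else 0 :=
    fun i => orthonormal_iff_ite.1 b.orthonormal j i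
  simp only [basisProj, inner_sub_right, inner_sum, inner_smul_right, h, mul_ite, mul_one,
    mul_zero, Finset.sum_ite_eq]
  split_ifs <;> simp

theorem enorm_sq_eq_tsum {ι : Type*} (b : HilbertBasis ι ℝ H) (x : H) :
    ‖x‖ₑ ^ 2 = ∑' i, ‖(inner ℝ (b i) x : ℝ)‖ₑ ^ 2 := by
  have h := b.hasSum_inner_mul_inner x x
  have h2 : ∀ i, inner ℝ x (b i) * inner ℝ (b i) x = (inner ℝ (b i) x : ℝ) ^ 2 := fun i => by
    rw [real_inner_comm, sq]
  simp only [h2, real_inner_self_eq_norm_sq] at h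
  have h3 : ‖x‖ₑ ^ 2 = ENNReal.ofReal (‖x‖ ^ 2) := by
    rw [ENNReal.ofReal_pow (norm_nonneg _), ofReal_norm]
  rw [h3, ← h.tsum_eq, ENNReal.ofReal_tsum_of_nonneg (fun i => sq_nonneg _) h.summable]
  refine tsum_congr fun i => ?_
  rw [← enorm_pow, Real.enorm_eq_ofReal (sq_nonneg _)]

theorem tendsto_basisProj {ι : Type*} (b : HilbertBasis ι ℝ H) (x : H) :
    Tendsto (fun s => basisProj b s x) atTop (𝓝 x) := by
  have h := b.hasSum_repr x
  simp only [b.repr_apply_apply] at h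
  exact h

/-! ### Tightness from second moments, and finite-dimensional Gaussian measures -/

variable [MeasurableSpace H] [BorelSpace H]

/-- Parseval's identity and Tonelli: the mean square of the remainder is the sum of the variances of
the omitted coordinates. -/
theorem lintegral_sub_basisProj_le {ι : Type*} [Countable ι] (b : HilbertBasis ι ℝ H)
    (s : Finset ι) (μ : Measure H) (T : ι → ℝ≥0∞)
    (hT : ∀ i, ∫⁻ x, ‖(inner ℝ (b i) x : ℝ)‖ₑ ^ 2 ∂μ ≤ T i) :
    ∫⁻ x, ‖x - basisProj b s x‖ₑ ^ 2 ∂μ ≤ ∑' i : {i // i ∉ s}, T i := by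
  classical
  have h1 : ∀ x : H, ‖x - basisProj b s x‖ₑ ^ 2 =
      ∑' i, ({i | i ∉ s} : Set ι).indicator (fun i => ‖(inner ℝ (b i) x : ℝ)‖ₑ ^ 2) i := by
    intro x
    rw [enorm_sq_eq_tsum b]
    refine tsum_congr fun i => ?_
    rw [inner_sub_basisProj, indicator_apply]
    by_cases hi : i ∈ s <;> simp [hi]
  simp_rw [h1, ← tsum_subtype]
  rw [lintegral_tsum (fun i => by fun_prop)]
  exact ENNReal.tsum_le_tsum fun i => hT i

/-- The set lies within δₖ of a bounded subset of a finite-dimensional space, for every k, so it is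
totally bounded; it is closed because the projections are continuous. -/
theorem isCompact_of_tail {ι : Type*} (b : HilbertBasis ι ℝ H) (s : ℕ → Finset ι) (δ : ℕ → ℝ)
    (hδ : Tendsto δ atTop (𝓝 0)) (R : ℝ) :
    IsCompact {x : H | ‖x‖ ≤ R ∧ ∀ k, ‖x - basisProj b (s k) x‖ ≤ δ k} := by
  refine TotallyBounded.isCompact_of_isClosed ?_ ?_
  · rw [Metric.totallyBounded_iff]
    intro ε hε
    obtain ⟨k, hk⟩ := (hδ.eventually (gt_mem_nhds (half_pos hε))).exists
    let F : (s k → ℝ) → H := fun y => ∑ i, y i • b i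
    have hF : Continuous F := by fun_prop
    have hc : IsCompact (F '' (Metric.closedBall 0 R)) :=
      (isCompact_closedBall (0 : s k → ℝ) R).image hF
    obtain ⟨t, ht, htc⟩ := Metric.totallyBounded_iff.1 hc.totallyBounded (ε / 2) (half_pos hε)
    refine ⟨t, ht, fun x hx => ?_⟩
    have hx1 : basisProj b (s k) x ∈ F '' (Metric.closedBall 0 R) := by
      refine ⟨fun i => inner ℝ (b i) x, ?_, ?_⟩
      · rw [mem_closedBall_zero_iff]
        refine (pi_norm_le_iff_of_nonneg ((norm_nonneg x).trans hx.1)).2 fun i => ?_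
        refine (norm_inner_le_norm _ _).trans ?_
        rw [b.orthonormal.norm_eq_one, one_mul]
        exact hx.1
      · simp only [F, basisProj]
        exact Finset.sum_coe_sort (s k) (fun i => (inner ℝ (b i) x : ℝ) • b i)
    obtain ⟨y, hy, hxy⟩ := mem_iUnion₂.1 (htc hx1)
    refine mem_iUnion₂.2 ⟨y, hy, ?_⟩
    rw [Metric.mem_ball] at hxy ⊢
    calc dist x y ≤ dist x (basisProj b (s k) x) + dist (basisProj b (s k) x) y :=
          dist_triangle _ _ _
      _ < ε / 2 + ε / 2 := by
          refine add_lt_add ?_ hxy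
          rw [dist_eq_norm]
          exact (hx.2 k).trans_lt hk
      _ = ε := add_halves ε
  · simp only [ofPred_and, ofPred_forall]
    refine (isClosed_le continuous_norm continuous_const).inter (isClosed_iInter fun k => ?_)
    exact isClosed_le ((continuous_id.sub (continuous_basisProj b _)).norm) continuous_const

/-- Chebyshev's inequality for the norm and for the remainders after finitely many coordinates. The
summable variances allow finite sets of coordinates with remainders so small that all exceptional
probabilities add up to at most ε. -/
theorem isTightMeasureSet_of_second_moments {ι : Type*} [Countable ι] (b : HilbertBasis ι ℝ H)
    (T : ι → ℝ≥0∞) (hT : ∑' i, T i ≠ ∞) (S : Set (Measure H))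
    (hS : ∀ μ ∈ S, ∀ i, ∫⁻ x, ‖(inner ℝ (b i) x : ℝ)‖ₑ ^ 2 ∂μ ≤ T i) :
    IsTightMeasureSet S := by
  rw [isTightMeasureSet_iff_exists_isCompact_measure_compl_le]
  intro ε hε
  -- The index `none` is reserved for the event that the norm is large, `some k` for the event that
  -- the k-th remainder exceeds 2⁻ᵏ.
  obtain ⟨ε', hε', hε'sum⟩ := ENNReal.exists_pos_sum_of_countable hε.ne' (Option ℕ)
  have htail : ∀ k : ℕ, ∃ s : Finset ι,
      ∑' i : {i // i ∉ s}, T i ≤ (ε' (some k) : ℝ≥0∞) * (2⁻¹ ^ k) ^ 2 := by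
    intro k
    have h1 := ENNReal.tendsto_tsum_compl_atTop_zero hT
    have hpos : (0 : ℝ≥0∞) < (ε' (some k) : ℝ≥0∞) * (2⁻¹ ^ k) ^ 2 := by
      refine ENNReal.mul_pos (by simpa using (hε' (some k)).ne') ?_
      simp
    exact ((h1.eventually (ge_mem_nhds hpos)).exists)
  choose s hs using htail
  -- the radius of the ball
  obtain ⟨R, hR⟩ : ∃ R : ℝ≥0, 0 < R ∧ (∑' i, T i) / (R : ℝ≥0∞) ^ 2 ≤ ε' none := by
    have h1 : Tendsto (fun R : ℝ≥0 => (∑' i, T i) / (R : ℝ≥0∞) ^ 2) atTop (𝓝 0) := by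
      have h2 : Tendsto (fun R : ℝ≥0 => (R : ℝ≥0∞) ^ 2) atTop (𝓝 ∞) := by
        have := ENNReal.Tendsto.pow (n := 2)
          (ENNReal.tendsto_coe_nhds_top.2 (tendsto_id (α := ℝ≥0) (x := atTop)))
        simpa using this
      simpa using ENNReal.Tendsto.const_div h2 (Or.inr hT)
    exact ((eventually_gt_atTop 0).and
      (h1.eventually (ge_mem_nhds (by simpa using hε' none)))).exists
  refine ⟨{x : H | ‖x‖ ≤ R ∧ ∀ k, ‖x - basisProj b (s k) x‖ ≤ 2⁻¹ ^ k},
    isCompact_of_tail b s _ (tendsto_pow_atTop_nhds_zero_of_lt_one (by norm_num) (by norm_num)) R,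
    fun μ hμ => ?_⟩
  let U : Option ℕ → Set H := fun o => o.elim {x | (R : ℝ≥0∞) ^ 2 ≤ ‖x‖ₑ ^ 2}
    (fun k => {x | ((2⁻¹ : ℝ≥0∞) ^ k) ^ 2 ≤ ‖x - basisProj b (s k) x‖ₑ ^ 2})
  have hsub : {x : H | ‖x‖ ≤ R ∧ ∀ k, ‖x - basisProj b (s k) x‖ ≤ 2⁻¹ ^ k}ᶜ ⊆ ⋃ o, U o := by
    intro x hx
    rw [mem_compl_iff, mem_ofPred_eq, not_and_or, not_forall] at hx
    rcases hx with hx | ⟨k, hx⟩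
    · refine mem_iUnion.2 ⟨none, ?_⟩
      simp only [U, Option.elim, mem_ofPred_eq]
      gcongr
      rw [← ofReal_norm, ← ENNReal.ofReal_coe_nnreal]
      exact ENNReal.ofReal_le_ofReal (not_le.1 hx).le
    · refine mem_iUnion.2 ⟨some k, ?_⟩
      simp only [U, Option.elim, mem_ofPred_eq]
      gcongr
      have : (2⁻¹ : ℝ≥0∞) ^ k = ENNReal.ofReal (2⁻¹ ^ k) := by
        rw [ENNReal.ofReal_pow (by norm_num), ENNReal.ofReal_inv_of_pos (by norm_num)]
        simp
      rw [← ofReal_norm, this]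
      exact ENNReal.ofReal_le_ofReal (not_le.1 hx).le
  refine (measure_mono hsub).trans ((measure_iUnion_le _).trans ((ENNReal.tsum_le_tsum ?_).trans
    hε'sum.le))
  have hmeas : ∀ t, AEMeasurable (fun x => ‖x - basisProj b t x‖ₑ ^ 2) μ := fun t =>
    ((continuous_id.sub (continuous_basisProj b t)).enorm.measurable.pow_const 2).aemeasurable
  rintro (_ | k)
  · simp only [U, Option.elim]
    refine le_trans ?_ hR.2
    rw [ENNReal.le_div_iff_mul_le (by simp [hR.1.ne']) (by simp), mul_comm]
    refine (mul_meas_ge_le_lintegral₀ (by fun_prop) _).trans ?_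
    have := lintegral_sub_basisProj_le b ∅ μ T (hS μ hμ)
    simp only [basisProj, Finset.sum_empty, sub_zero] at this
    refine this.trans (le_of_eq ?_)
    exact (Equiv.subtypeUnivEquiv (fun i => by simp)).tsum_eq T
  · simp only [U, Option.elim]
    have hne : ((2⁻¹ : ℝ≥0∞) ^ k) ^ 2 ≠ 0 := by simp
    have hne' : ((2⁻¹ : ℝ≥0∞) ^ k) ^ 2 ≠ ∞ := by
      simp [ENNReal.pow_eq_top_iff]
    have h1 : (((2⁻¹ : ℝ≥0∞) ^ k) ^ 2) * μ {x | ((2⁻¹ : ℝ≥0∞) ^ k) ^ 2 ≤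
        ‖x - basisProj b (s k) x‖ₑ ^ 2} ≤ ((2⁻¹ : ℝ≥0∞) ^ k) ^ 2 * ε' (some k) := by
      refine (mul_meas_ge_le_lintegral₀ (hmeas (s k)) _).trans ?_
      rw [mul_comm]
      exact (lintegral_sub_basisProj_le b (s k) μ T (hS μ hμ)).trans (hs k)
    exact (ENNReal.mul_le_mul_iff_right hne hne').1 h1

/-- The centred Gaussian measure on the span of finitely many vectors of a Hilbert basis with the
covariance matrix `S`. -/
def finGaussian {ι : Type*} (b : HilbertBasis ι ℝ H) (s : Finset ι) (S : ι → ι → ℝ) : Measure H :=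
  open scoped Classical in
  (multivariateGaussian (0 : EuclideanSpace ℝ s) (Matrix.of fun i j : s => S i j)).map
    fun y => ∑ i : s, y i • b i

instance {ι : Type*} (b : HilbertBasis ι ℝ H) (s : Finset ι) (S : ι → ι → ℝ) :
    IsProbabilityMeasure (finGaussian b s S) := by
  classical
  unfold finGaussian
  exact Measure.isProbabilityMeasure_map
    (Continuous.measurable (by fun_prop)).aemeasurable

/-- The covariance matrix is positive semidefinite because its quadratic form at x is the value of
`β` at Σ xᵢ wᵢ. The measure sees h only through its coordinates in `s`, which are lifted back to `V`
by the same combination. -/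
theorem charFun_finGaussian {ι : Type*} (b : HilbertBasis ι ℝ H) (s : Finset ι)
    (β : LinearMap.BilinForm ℝ V) (hsymm : β.IsSymm) (hpos : ∀ v, 0 ≤ β v v) (w : ι → V) (h : H) :
    charFun (finGaussian b s fun i j => β (w i) (w j)) h =
      Complex.exp (-(β (∑ i ∈ s, (inner ℝ (b i) h : ℝ) • w i)
        (∑ i ∈ s, (inner ℝ (b i) h : ℝ) • w i) : ℝ) / 2) := by
  classical
  have hS : (Matrix.of fun i j : s => β (w i) (w j)).PosSemidef := by
    refine Matrix.PosSemidef.of_dotProduct_mulVec_nonneg ?_ fun x => ?_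
    · ext i j
      simpa using hsymm.eq (w j) (w i)
    · have := hpos (∑ i : s, x i • w i)
      simp only [map_sum, map_smul, LinearMap.sum_apply, LinearMap.smul_apply, smul_eq_mul] at this
      refine this.trans (le_of_eq ?_)
      simp only [dotProduct, Matrix.mulVec, Matrix.of_apply, Pi.star_apply, star_trivial,
        Finset.mul_sum]
      rw [Finset.sum_comm]
      refine Finset.sum_congr rfl fun i _ => Finset.sum_congr rfl fun j _ => by ring
  have hm : Measurable fun y : EuclideanSpace ℝ s => ∑ i : s, y i • b i :=
    Continuous.measurable (by fun_prop)
  let z : EuclideanSpace ℝ s := WithLp.toLp 2 fun i => inner ℝ (b i) h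
  have h1 : charFun (finGaussian b s fun i j => β (w i) (w j)) h =
      charFun (multivariateGaussian (0 : EuclideanSpace ℝ s)
        (Matrix.of fun i j : s => β (w i) (w j))) z := by
    rw [charFun_apply, charFun_apply, finGaussian, integral_map hm.aemeasurable (by fun_prop)]
    refine integral_congr_ae (ae_of_all _ fun y => ?_)
    beta_reduce
    congr 3
    rw [sum_inner, PiLp.inner_apply]
    refine Finset.sum_congr rfl fun i _ => ?_
    simp [z, inner_smul_left, mul_comm]
  rw [h1, charFun_multivariateGaussian hS]
  congr 1
  simp only [inner_zero_right, Complex.ofReal_zero, zero_mul, zero_sub]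
  rw [neg_div]
  congr 3
  rw [← Finset.sum_coe_sort s (fun i => (inner ℝ (b i) h : ℝ) • w i)]
  simp only [map_sum, map_smul, LinearMap.sum_apply, LinearMap.smul_apply, smul_eq_mul,
    dotProduct, Matrix.mulVec, Matrix.of_apply, Finset.mul_sum]
  rw [Finset.sum_comm]
  refine Finset.sum_congr rfl fun i _ => Finset.sum_congr rfl fun j _ => ?_
  simp only [z]
  ring

theorem charFun_smul_eq (μ : Measure H) (t : ℝ) (h : H) :
    charFun μ (t • h) = ∫ x, Complex.exp (t * (inner ℝ h x : ℝ) * Complex.I) ∂μ := by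
  rw [charFun_apply]
  refine integral_congr_ae (ae_of_all _ fun x => ?_)
  simp only [inner_smul_right, real_inner_comm h x]
  push_cast
  rfl

/-! ### Passage to infinite dimension by Prokhorov's theorem -/

variable [SecondCountableTopology H]

theorem continuous_charFun_hilbert (μ : Measure H) [IsProbabilityMeasure μ] :
    Continuous (charFun μ) := by
  have h : charFun μ = fun h => ∫ x, Complex.exp ((inner ℝ x h : ℝ) * Complex.I) ∂μ := by
    ext h; rw [charFun_apply]
  rw [h]
  refine continuous_of_dominated (bound := fun _ => 1) (fun h => by fun_prop)
    (fun h => ae_of_all _ fun x => (Complex.norm_exp_ofReal_mul_I _).le) (integrable_const _)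
    (ae_of_all _ fun x => by fun_prop)

/-- Existence of Gaussian measures on a Hilbert space whose covariance has a trace-class
majorant. -/
theorem exists_gaussian (e : V →ₗ[ℝ] H) (he : DenseRange e) {D : V → ℝ} {K : ℝ}
    (hD : TraceBound e D K) (β : LinearMap.BilinForm ℝ V) (hsymm : β.IsSymm)
    (hpos : ∀ v, 0 ≤ β v v) (hβ : ∀ v, β v v ≤ D v) :
    ∃ ν : ProbabilityMeasure H, ∀ v, charFun (ν : Measure H) (e v) =
      Complex.exp (-(β v v : ℝ) / 2) := by
  classical
  obtain ⟨ι, _, b, w, hw⟩ := exists_hilbertBasis_of_denseRange e he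
  have horth : Orthonormal ℝ fun i => e (w i) := by simpa only [hw] using b.orthonormal
  let ν : Finset ι → ProbabilityMeasure H := fun s =>
    ⟨finGaussian b s fun i j => β (w i) (w j), inferInstance⟩
  have hsum : ∑' i, ENNReal.ofReal (D (w i)) ≠ ∞ := by
    have : Summable fun i => D (w i) :=
      summable_of_sum_le (fun i => (hpos _).trans (hβ _)) fun s => hD.2 ι s w horth
    rw [← ENNReal.ofReal_tsum_of_nonneg (fun i => (hpos _).trans (hβ _)) this]
    exact ENNReal.ofReal_ne_top
  have hmom : ∀ s i, ∫⁻ x, ‖(inner ℝ (b i) x : ℝ)‖ₑ ^ 2 ∂(ν s : Measure H) ≤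
      ENNReal.ofReal (D (w i)) := by
    intro s i
    -- The i-th coordinate has variance `β (w i) (w i)` once i belongs to `s` and is zero before, so
    -- its second moment is bounded by `D (w i)` uniformly in `s`.
    have key : ∀ t : ℝ, ∫ x, Complex.exp (t * (inner ℝ (b i) x : ℝ) * Complex.I) ∂(ν s : Measure H)
        = Complex.exp (-(t ^ 2 * (if i ∈ s then β (w i) (w i) else 0) : ℝ) / 2) := by
      intro t
      rw [← charFun_smul_eq]
      simp only [ν, ProbabilityMeasure.coe_mk]
      rw [charFun_finGaussian b s β hsymm hpos w]
      congr 3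
      have h2 : ∑ j ∈ s, (inner ℝ (b j) (t • b i) : ℝ) • w j = if i ∈ s then t • w i else 0 := by
        have h : ∀ j, inner ℝ (b j) (b i) = if j = i then (1 : ℝ) else 0 :=
          fun j => orthonormal_iff_ite.1 b.orthonormal j i
        simp [inner_smul_right, h, Finset.sum_ite_eq']
      rw [h2]
      split_ifs <;> simp [sq, mul_assoc]
    have h0 : 0 ≤ (if i ∈ s then β (w i) (w i) else 0) := by
      split_ifs
      exacts [hpos _, le_rfl]
    have hX : AEMeasurable (fun x : H => (inner ℝ (b i) x : ℝ)) (ν s : Measure H) := by fun_prop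
    rw [lintegral_sq_of_gaussian hX h0 key]
    refine ENNReal.ofReal_le_ofReal ?_
    split_ifs
    exacts [hβ _, (hpos _).trans (hβ _)]
  have htight : IsTightMeasureSet {((μ : ProbabilityMeasure H) : Measure H) | μ ∈ range ν} := by
    refine isTightMeasureSet_of_second_moments b _ hsum _ ?_
    rintro _ ⟨_, ⟨s, rfl⟩, rfl⟩ i
    exact hmom s i
  -- Tightness makes the family relatively compact, so it converges along every ultrafilter;
  -- choosing one finer than `atTop` makes the limit inherit the limits of the characteristic
  -- functions.
  let U : Ultrafilter (Finset ι) := Ultrafilter.of atTop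
  obtain ⟨ν', -, hν' : Tendsto _ _ _⟩ :=
    (isCompact_closure_of_isTightMeasureSet htight).ultrafilter_le_nhds (U.map ν)
      (le_principal_iff.2 (mem_of_superset (Filter.mem_map.2 (by
        simp)) subset_closure))
  refine ⟨ν', fun v => ?_⟩
  have hlim1 : Tendsto (fun s => charFun (ν s : Measure H) (e v)) U
      (𝓝 (charFun (ν' : Measure H) (e v))) := by
    rw [ProbabilityMeasure.tendsto_iff_forall_integral_rclike_tendsto ℂ] at hν'
    simp_rw [charFun_eq_integral_innerProbChar]
    exact hν' (BoundedContinuousFunction.innerProbChar (e v))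
  -- The form `β` is continuous with respect to ‖e ·‖ by the first half of `TraceBound`: the lifted
  -- projections `p s` satisfy e(v - p s) → 0, so `β` vanishes on v - p s in the limit, and
  -- Cauchy–Schwarz disposes of the mixed term.
  have hlim2 : Tendsto (fun s => charFun (ν s : Measure H) (e v)) atTop
      (𝓝 (Complex.exp (-(β v v : ℝ) / 2))) := by
    simp only [ν, ProbabilityMeasure.coe_mk, charFun_finGaussian b _ β hsymm hpos w]
    let p : Finset ι → V := fun s => ∑ i ∈ s, (inner ℝ (b i) (e v) : ℝ) • w i
    have hp : ∀ s, e (p s) = basisProj b s (e v) := fun s => by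
      simp [p, basisProj, map_sum, hw]
    have h1 : Tendsto (fun s => β (v - p s) (v - p s)) atTop (𝓝 0) := by
      have h2 : Tendsto (fun s => K * ‖e v - basisProj b s (e v)‖ ^ 2) atTop (𝓝 0) := by
        have := ((tendsto_const_nhds (x := e v)).sub (tendsto_basisProj b (e v))).norm.pow 2
          |>.const_mul K
        simpa using this
      refine squeeze_zero (fun s => hpos _) (fun s => ?_) h2
      refine (hβ _).trans ((hD.1 _).trans ?_)
      rw [map_sub, hp]
    have h3 : Tendsto (fun s => β v (v - p s)) atTop (𝓝 0) := by
      have h4 : Tendsto (fun s => √(β v v * β (v - p s) (v - p s))) atTop (𝓝 0) := by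
        have := (h1.const_mul (β v v)).sqrt
        simpa using this
      refine squeeze_zero_norm (fun s => ?_) h4
      rw [Real.norm_eq_abs]
      refine Real.abs_le_sqrt ?_
      exact LinearMap.BilinForm.apply_sq_le_of_symm β hpos (LinearMap.BilinForm.isSymm_iff.1 hsymm) v (v - p s)
    have h5 : Tendsto (fun s => β (p s) (p s)) atTop (𝓝 (β v v)) := by
      have h6 : ∀ s, β (p s) (p s) = β v v - 2 * β v (v - p s) + β (v - p s) (v - p s) := by
        intro s
        have := hsymm.eq v (p s)
        simp only [map_sub, LinearMap.sub_apply, this]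
        ring
      simp_rw [h6]
      simpa using ((h3.const_mul 2).const_sub (β v v)).add h1
    exact (Complex.continuous_exp.tendsto _).comp
      (((Complex.continuous_ofReal.tendsto _).comp h5).neg.div_const 2)
  exact tendsto_nhds_unique hlim1 (hlim2.mono_left (Ultrafilter.of_le _))

/-- Gaussian measures with a common trace-class majorant converge weakly if their covariances
converge. -/
theorem tendsto_gaussian (e : V →ₗ[ℝ] H) (he : DenseRange e) {D : V → ℝ} {K : ℝ}
    (hD : TraceBound e D K) {A : Type*} {l : Filter A} {ν : A → ProbabilityMeasure H}
    {ν₀ : ProbabilityMeasure H} {Q : A → V → ℝ} {Q₀ : V → ℝ}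
    (hν : ∀ a v, charFun (ν a : Measure H) (e v) = Complex.exp (-(Q a v : ℝ) / 2))
    (hν₀ : ∀ v, charFun (ν₀ : Measure H) (e v) = Complex.exp (-(Q₀ v : ℝ) / 2))
    (hsmul : ∀ a (t : ℝ) v, Q a (t • v) = t ^ 2 * Q a v)
    (hpos : ∀ a v, 0 ≤ Q a v) (hQ : ∀ a v, Q a v ≤ D v)
    (hlim : ∀ v, Tendsto (fun a => Q a v) l (𝓝 (Q₀ v))) :
    Tendsto ν l (𝓝 ν₀) := by
  -- An index is needed only to see that `D` is nonnegative.
  rcases isEmpty_or_nonempty A with hA | ⟨⟨a₀⟩⟩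
  · exact tendsto_of_isEmpty
  obtain ⟨ι, _, b, w, hw⟩ := exists_hilbertBasis_of_denseRange e he
  have horth : Orthonormal ℝ fun i => e (w i) := by simpa only [hw] using b.orthonormal
  have hDpos : ∀ v, 0 ≤ D v := fun v => (hpos a₀ v).trans (hQ a₀ v)
  have hsum : ∑' i, ENNReal.ofReal (D (w i)) ≠ ∞ := by
    have : Summable fun i => D (w i) :=
      summable_of_sum_le (fun i => hDpos _) fun s => hD.2 ι s w horth
    rw [← ENNReal.ofReal_tsum_of_nonneg (fun i => hDpos _) this]
    exact ENNReal.ofReal_ne_top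
  have htight : IsTightMeasureSet {((μ : ProbabilityMeasure H) : Measure H) | μ ∈ range ν} := by
    refine isTightMeasureSet_of_second_moments b _ hsum _ ?_
    rintro _ ⟨_, ⟨a, rfl⟩, rfl⟩ i
    have hX : AEMeasurable (fun x : H => (inner ℝ (b i) x : ℝ)) (ν a : Measure H) := by fun_prop
    rw [lintegral_sq_of_gaussian hX (hpos a (w i)) fun t => ?_]
    · exact ENNReal.ofReal_le_ofReal (hQ _ _)
    · rw [← charFun_smul_eq, ← hw, ← map_smul, hν, hsmul]
  -- Along each ultrafilter Prokhorov's theorem supplies some limit. Its characteristic function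
  -- agrees with that of `ν₀` on the dense range of `e`, hence everywhere by continuity.
  refine (Filter.tendsto_iff_ultrafilter _ _ _).2 fun U hU => ?_
  obtain ⟨ν', -, hν' : Tendsto _ _ _⟩ :=
    (isCompact_closure_of_isTightMeasureSet htight).ultrafilter_le_nhds (U.map ν)
      (le_principal_iff.2 (mem_of_superset (Filter.mem_map.2 (by
        simp)) subset_closure))
  suffices h : ν' = ν₀ by rw [← h]; exact hν'
  refine Subtype.ext (Measure.ext_of_charFun (μ := (ν' : Measure H)) (ν := (ν₀ : Measure H)) ?_)
  refine he.equalizer (continuous_charFun_hilbert _) (continuous_charFun_hilbert _)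
    (funext fun v => ?_)
  have hlim1 : Tendsto (fun a => charFun (ν a : Measure H) (e v)) U
      (𝓝 (charFun (ν' : Measure H) (e v))) := by
    rw [ProbabilityMeasure.tendsto_iff_forall_integral_rclike_tendsto ℂ] at hν'
    simp_rw [charFun_eq_integral_innerProbChar]
    exact hν' (BoundedContinuousFunction.innerProbChar (e v))
  refine tendsto_nhds_unique hlim1 ?_
  rw [Function.comp_apply, hν₀]
  simp_rw [hν]
  exact (Complex.continuous_exp.tendsto _).comp
    (((Complex.continuous_ofReal.tendsto _).comp ((hlim v).mono_left hU)).neg.div_const 2)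

end GaussianHilbert

variable {n : ℕ}

/-! ### Real components -/

/-- The real components of a complex test function. -/
def CTest.comp (a : Fin 2) : CTest n →L[ℝ] RTest n :=
  if a = 0 then TestFunction.postcompCLM (𝕜 := ℝ) Complex.reCLM
  else TestFunction.postcompCLM (𝕜 := ℝ) Complex.imCLM

/-- The complex test function with the only nonzero real component `φ`, in the place `a`. -/
def RTest.toCTest (a : Fin 2) : RTest n →L[ℝ] CTest n :=
  TestFunction.postcompCLM (𝕜 := ℝ) ((ContinuousLinearMap.id ℝ ℝ).smulRight
    (if a = 0 then (1 : ℂ) else Complex.I))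

theorem CTest.comp_apply (a : Fin 2) (ψ : CTest n) (x : E n) :
    CTest.comp a ψ x = KleinGordon.comp (ψ x) a := by
  fin_cases a <;> rfl

theorem RTest.toCTest_apply (a : Fin 2) (φ : RTest n) (x : E n) :
    φ.toCTest a x = φ x * (if a = 0 then (1 : ℂ) else Complex.I) := by
  simp [RTest.toCTest]

theorem CTest.comp_toCTest (a b : Fin 2) (φ : RTest n) :
    CTest.comp a (φ.toCTest b) = if a = b then φ else 0 := by
  ext x
  rw [CTest.comp_apply, RTest.toCTest_apply]
  fin_cases a <;> fin_cases b <;> simp [KleinGordon.comp]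

theorem pairing_eq_sum (u : Distr n) (ψ : CTest n) :
    pairing u ψ = ∑ a, comp (u (CTest.comp a ψ)) a := by
  simp [pairing, Fin.sum_univ_two, CTest.comp, comp]

theorem pairing_toCTest (u : Distr n) (a : Fin 2) (φ : RTest n) :
    pairing u (φ.toCTest a) = comp (u φ) a := by
  rw [pairing_eq_sum]
  simp only [CTest.comp_toCTest]
  fin_cases a <;> simp [Fin.sum_univ_two, comp]

theorem pairing_add_right (u : Distr n) (ψ ψ' : CTest n) :
    pairing u (ψ + ψ') = pairing u ψ + pairing u ψ' := by
  simp only [pairing, map_add, Complex.add_re, Complex.add_im]; ring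

theorem pairing_smul_right (u : Distr n) (c : ℝ) (ψ : CTest n) :
    pairing u (c • ψ) = c * pairing u ψ := by
  simp only [pairing, map_smul, Complex.smul_re, Complex.smul_im, smul_eq_mul]; ring

/-- The pairing with `Y` as a linear functional on the test functions. -/
def pairingₗ (Y : State n) : (Fin 2 → CTest n) →ₗ[ℝ] ℝ where
  toFun := pairing₂ Y
  map_add' Ψ Φ := by
    simp [pairing₂, pairing_add_right, Finset.sum_add_distrib]
  map_smul' c Ψ := by
    simp [pairing₂, pairing_smul_right, ← mul_add]

theorem pairingₗ_apply (Y : State n) (Ψ : Fin 2 → CTest n) : pairingₗ Y Ψ = pairing₂ Y Ψ := rfl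

theorem State.apply_sub (Y Z : State n) (i : Fin 2) : (Y - Z) i = Y i - Z i := rfl

theorem pairing_sub_left (u v : Distr n) (ψ : CTest n) :
    pairing (u - v) ψ = pairing u ψ - pairing v ψ := by
  simp only [pairing, sub_apply, Complex.sub_re, Complex.sub_im]; ring

theorem pairing₂_sub_left (Y Z : State n) (Ψ : Fin 2 → CTest n) :
    pairing₂ (Y - Z) Ψ = pairing₂ Y Ψ - pairing₂ Z Ψ := by
  simp [pairing₂, State.apply_sub, pairing_sub_left, Finset.sum_sub_distrib]

theorem pairing₂_single (Y : State n) (i : Fin 2) (ψ : CTest n) :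
    pairing₂ Y (Pi.single i ψ) = pairing (Y i) ψ := by
  have h0 : ∀ u : Distr n, pairing u 0 = 0 := fun u => by simp [pairing]
  fin_cases i <;> simp [pairing₂, Fin.sum_univ_two, h0]

theorem apply_eq_pairing (u : Distr n) (φ : RTest n) :
    u φ = (pairing u (φ.toCTest 0) : ℂ) + (pairing u (φ.toCTest 1) : ℂ) * Complex.I := by
  simp [pairing_toCTest, comp, Complex.re_add_im]

theorem State.ext_pairing {Y Z : State n} (h : ∀ Ψ, pairing₂ Y Ψ = pairing₂ Z Ψ) : Y = Z := by
  funext i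
  refine ContinuousLinearMap.ext fun φ => ?_
  have h' : ∀ ψ, pairing (Y i) ψ = pairing (Z i) ψ := fun ψ => by
    rw [← pairing₂_single, ← pairing₂_single, h]
  exact (apply_eq_pairing (Y i) φ).trans (by rw [h', h', ← apply_eq_pairing (Z i) φ]; rfl)

/-! ### The measurable structure -/

theorem measurable_apply (i : Fin 2) (φ : RTest n) : Measurable fun Y : State n => Y i φ := by
  have h : Measurable[MeasurableSpace.comap (fun Y : State n => Y i φ) (borel ℂ)]
      fun Y : State n => Y i φ := by
    rw [BorelSpace.measurable_eq (α := ℂ)]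
    exact comap_measurable _
  exact h.mono (le_iSup₂_of_le i φ le_rfl) le_rfl

theorem measurable_pairing (i : Fin 2) (ψ : CTest n) :
    Measurable fun Y : State n => pairing (Y i) ψ := by
  unfold pairing
  exact (Complex.measurable_re.comp (measurable_apply _ _)).add
    (Complex.measurable_im.comp (measurable_apply _ _))

theorem measurable_pairing₂ (Ψ : Fin 2 → CTest n) :
    Measurable fun Y : State n => pairing₂ Y Ψ := by
  unfold pairing₂
  exact Finset.measurable_sum _ fun i _ => measurable_pairing i _

/-- The real pairings already generate the σ-algebra, so measures on states can be compared after
mapping to a product of real lines. -/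
theorem measurableSpace_le_comap :
    (inferInstance : MeasurableSpace (State n)) ≤
      MeasurableSpace.comap (fun Y (Ψ : Fin 2 → CTest n) => pairing₂ Y Ψ) inferInstance := by
  refine iSup₂_le fun i φ => ?_
  rw [← measurable_iff_comap_le]
  let T : State n → (Fin 2 → CTest n) → ℝ := fun Y Ψ => pairing₂ Y Ψ
  let _ : MeasurableSpace (State n) := MeasurableSpace.comap T MeasurableSpace.pi
  have hT : Measurable T := comap_measurable T
  have h : ∀ Ψ : Fin 2 → CTest n, Measurable fun Y : State n => pairing₂ Y Ψ := fun Ψ =>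
    (measurable_pi_apply Ψ).comp hT
  rw [← BorelSpace.measurable_eq (α := ℂ)]
  have h2 : (fun Y : State n => Y i φ) = fun Y => (pairing₂ Y (Pi.single i (φ.toCTest 0)) : ℂ) +
      (pairing₂ Y (Pi.single i (φ.toCTest 1)) : ℂ) * Complex.I := by
    funext Y
    rw [pairing₂_single, pairing₂_single, ← apply_eq_pairing]
  rw [h2]
  exact (Complex.measurable_ofReal.comp (h _)).add
    ((Complex.measurable_ofReal.comp (h _)).mul_const _)

theorem measurable_of_pairing {Ω : Type*} [MeasurableSpace Ω] {f : Ω → State n}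
    (hf : ∀ Ψ, Measurable fun ω => pairing₂ (f ω) Ψ) : Measurable f := by
  have h := measurable_pi_lambda (fun ω Ψ => pairing₂ (f ω) Ψ) hf
  have h2 : @Measurable _ _ _ (MeasurableSpace.comap
      (fun (Y : State n) (Ψ : Fin 2 → CTest n) => pairing₂ Y Ψ) inferInstance) f :=
    measurable_comap_iff.2 h
  exact h2.mono le_rfl measurableSpace_le_comap

/-- Finitely many pairings have a joint law determined by its characteristic function, and the
finite-dimensional marginals determine the law on the product of real lines indexed by all test
functions. -/
theorem measure_ext_of_charFunctional {μ ν : Measure (State n)} [IsProbabilityMeasure μ]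
    [IsProbabilityMeasure ν] (h : ∀ Ψ, charFunctional μ Ψ = charFunctional ν Ψ) : μ = ν := by
  classical
  let T : State n → (Fin 2 → CTest n) → ℝ := fun Y Ψ => pairing₂ Y Ψ
  have hT : Measurable T := measurable_pi_lambda _ fun Ψ => measurable_pairing₂ Ψ
  have hfin : ∀ s : Finset (Fin 2 → CTest n),
      (μ.map T).map s.restrict = (ν.map T).map s.restrict := by
    intro s
    have hs : Measurable (s.restrict : ((Fin 2 → CTest n) → ℝ) → s → ℝ) :=
      Finset.measurable_restrict s
    rw [Measure.map_map hs hT, Measure.map_map hs hT]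
    have := Measure.isProbabilityMeasure_map (μ := μ) (hs.comp hT).aemeasurable
    have := Measure.isProbabilityMeasure_map (μ := ν) (hs.comp hT).aemeasurable
    refine Measure.ext_of_charFunDual (funext fun L => ?_)
    -- By linearity of the pairing, a linear functional of finitely many pairings is the pairing
    -- with one combined test function.
    have key : ∀ ρ : Measure (State n), charFunDual (ρ.map (s.restrict ∘ T)) L =
        charFunctional ρ (∑ i : s, L (Pi.single i 1) • (i : Fin 2 → CTest n)) := by
      intro ρ
      rw [charFunDual_apply, integral_map (hs.comp hT).aemeasurable (by fun_prop), charFunctional]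
      refine integral_congr_ae (ae_of_all _ fun Y => ?_)
      beta_reduce
      rw [mul_comm]
      congr 3
      rw [← pairingₗ_apply, map_sum]
      have h1 := L.toLinearMap.pi_apply_eq_sum_univ ((s.restrict ∘ T) Y)
      have h2 : ∀ i : s, (fun j : s => if i = j then (1 : ℝ) else 0) = Pi.single i 1 := fun i => by
        ext j; simp [Pi.single_apply, eq_comm]
      simp only [ContinuousLinearMap.coe_coe] at h1
      rw [h1]
      refine Finset.sum_congr rfl fun i _ => ?_
      rw [h2, map_smul, pairingₗ_apply, smul_eq_mul, smul_eq_mul, mul_comm]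
      rfl
    rw [key, key, h]
  have := Measure.isProbabilityMeasure_map (μ := μ) hT.aemeasurable
  have := Measure.isProbabilityMeasure_map (μ := ν) hT.aemeasurable
  have hpi : μ.map T = ν.map T := by
    have : ∀ s : Finset (Fin 2 → CTest n), IsFiniteMeasure ((ν.map T).map s.restrict) :=
      fun s => inferInstance
    exact IsProjectiveLimit.unique (P := fun s => (ν.map T).map s.restrict) hfin fun s => rfl
  ext A hA
  obtain ⟨B, hB, rfl⟩ := measurableSpace_le_comap A hA
  rw [← Measure.map_apply hT hB, ← Measure.map_apply hT hB, hpi]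

/-! ### Countably many test functions separate distributions -/

/-- Restriction to `K` loses nothing in the sup norm, so the set embeds isometrically in the second
countable space C(K, G). -/
theorem isSeparable_bcf_supportedIn {X G : Type*} [TopologicalSpace X] [T2Space X] [NormedAddCommGroup G]
    [SecondCountableTopology G] [SecondCountableTopology X] (K : Set X) (hK : IsCompact K) :
    TopologicalSpace.IsSeparable {g : BoundedContinuousFunction X G | ∀ x ∉ K, g x = 0} := by
  have : CompactSpace K := isCompact_iff_compactSpace.1 hK
  let ρ : {g : BoundedContinuousFunction X G | ∀ x ∉ K, g x = 0} → C(K, G) :=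
    fun g => (g : BoundedContinuousFunction X G).toContinuousMap.restrict K
  have hρ : Isometry ρ := by
    refine Isometry.of_dist_eq fun f g => le_antisymm ?_ ?_
    · exact (ContinuousMap.dist_le dist_nonneg).2 fun x =>
        (f : BoundedContinuousFunction X G).dist_coe_le_dist (x : X)
    · refine (BoundedContinuousFunction.dist_le dist_nonneg).2 fun x => ?_
      by_cases hx : x ∈ K
      · exact ContinuousMap.dist_apply_le_dist (f := ρ f) (g := ρ g) ⟨x, hx⟩
      · rw [f.2 x hx, g.2 x hx, dist_self]
        exact dist_nonneg
  have := hρ.isEmbedding.secondCountableTopology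
  exact TopologicalSpace.IsSeparable.of_subtype _

theorem secondCountableTopology_of_isSeparable_pi {G : ℕ → Type*} [∀ i, PseudoMetricSpace (G i)]
    {S : Set (∀ i, G i)} (hS : TopologicalSpace.IsSeparable S) : SecondCountableTopology S :=
  hS.secondCountableTopology

/-- The topology is induced by the sequence of iterated derivatives, so the space sits in a
countable product of separable spaces of bounded continuous functions vanishing off `K`. -/
theorem separableSpace_contDiffMapSupportedIn (K : TopologicalSpace.Compacts (E n)) :
    TopologicalSpace.SeparableSpace (ContDiffMapSupportedIn (E n) ℝ ⊤ K) := by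
  have hemb := (ContDiffMapSupportedIn.isUniformEmbedding_pi_structureMapCLM (E := E n) (F := ℝ)
    (n := ⊤) (K := K) ℝ).isEmbedding
  have hsep : TopologicalSpace.IsSeparable (Set.pi univ fun i : ℕ =>
      {g : BoundedContinuousFunction (E n) (E n [×i]→L[ℝ] ℝ) | ∀ x ∉ (K : Set (E n)), g x = 0}) :=
    TopologicalSpace.IsSeparable.univ_pi fun i => by
      have hfd : FiniteDimensional ℝ (E n [×i]→L[ℝ] ℝ) :=
        Module.Finite.of_injective (ContinuousMultilinearMap.toMultilinearMapLinear
          (R' := ℝ) (A := ℝ) (M₁ := fun _ : Fin i => E n) (M₂ := ℝ))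
          ContinuousMultilinearMap.toMultilinearMap_injective
      have := FiniteDimensional.proper_real (E n [×i]→L[ℝ] ℝ)
      exact isSeparable_bcf_supportedIn _ K.isCompact
  have hmono : TopologicalSpace.IsSeparable (range (ContinuousLinearMap.pi
      (ContDiffMapSupportedIn.structureMapCLM ℝ (⊤ : ℕ∞) (E := E n) (F := ℝ) (K := K)))) := by
    refine hsep.mono ?_
    rintro _ ⟨f, rfl⟩ i _ x hx
    rw [ContinuousLinearMap.pi_apply, ContDiffMapSupportedIn.structureMapCLM_top_apply]
    exact f.iteratedFDeriv_zero_on_compl hx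
  have := secondCountableTopology_of_isSeparable_pi hmono
  have := (hemb.toHomeomorph).isEmbedding.secondCountableTopology
  infer_instance

theorem exists_separating_tests (n : ℕ) : ∃ φ : ℕ → RTest n, ∀ u v : Distr n,
    (∀ k, u (φ k) = v (φ k)) → u = v := by
  have hK : ∀ N : ℕ, ∃ f : ℕ → ContDiffMapSupportedIn (E n) ℝ ⊤
      (⟨Metric.closedBall 0 N, isCompact_closedBall _ _⟩ : TopologicalSpace.Compacts (E n)),
      DenseRange f := fun N => by
    have := separableSpace_contDiffMapSupportedIn
      (⟨Metric.closedBall 0 N, isCompact_closedBall _ _⟩ : TopologicalSpace.Compacts (E n))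
    exact TopologicalSpace.exists_dense_seq _
  choose f hf using hK
  let e := Nat.pairEquiv.symm
  refine ⟨fun k => TestFunction.ofSupportedIn (subset_univ _) (f (e k).1 (e k).2),
    fun u v huv => ContinuousLinearMap.ext fun φ => ?_⟩
  obtain ⟨R, hR⟩ := φ.hasCompactSupport.isBounded.subset_closedBall (0 : E n)
  obtain ⟨N, hN⟩ := exists_nat_ge R
  let K : TopologicalSpace.Compacts (E n) := ⟨Metric.closedBall 0 N, isCompact_closedBall _ _⟩
  let φK : ContDiffMapSupportedIn (E n) ℝ ⊤ K :=
    .of_support_subset φ.contDiff ((subset_tsupport _).trans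
      (hR.trans (Metric.closedBall_subset_closedBall hN)))
  have hφ : φ = TestFunction.ofSupportedIn (subset_univ _) φK := rfl
  have hc := TestFunction.continuous_ofSupportedIn (n := ⊤) (F := ℝ)
    (Ω := (⊤ : TopologicalSpace.Opens (E n))) (K := K) (subset_univ _)
  have h := (hf N).equalizer (u.continuous.comp hc) (v.continuous.comp hc) (funext fun j => by
    obtain ⟨k, hk⟩ := e.surjective (N, j)
    have := huv k
    change u (TestFunction.ofSupportedIn (subset_univ _) (f (N, j).1 (N, j).2)) =
      v (TestFunction.ofSupportedIn (subset_univ _) (f (N, j).1 (N, j).2))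
    rw [← hk]
    exact this)
  rw [hφ]
  exact congrFun h φK

/-- This is what the Lusin–Souslin theorem asks of the target space: injective measurable maps into
it from Polish spaces are then measurable embeddings. -/
instance : MeasurableSpace.CountablySeparated (State n) := by
  obtain ⟨φ, hφ⟩ := exists_separating_tests n
  let T : State n → ℕ → Fin 2 → ℂ := fun Y k i => Y i (φ k)
  have hT : Measurable T := measurable_pi_lambda _ fun k => measurable_pi_lambda _ fun i =>
    measurable_apply i (φ k)
  have hinj : Function.Injective T := fun Y Z h => funext fun i =>
    hφ _ _ fun k => congrFun (congrFun h k) i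
  obtain ⟨S, hSc, hSm, hS⟩ := (inferInstance : HasCountableSeparatingOn (ℕ → Fin 2 → ℂ)
    MeasurableSet univ).exists_countable_separating
  refine ⟨⟨(fun s => T ⁻¹' s) '' S, hSc.image _, ?_, fun Y _ Z _ h => hinj ?_⟩⟩
  · rintro _ ⟨s, hs, rfl⟩
    exact hT (hSm s hs)
  · exact hS _ (mem_univ _) _ (mem_univ _) fun s hs => h _ ⟨s, hs, rfl⟩

/-! ### Realizations on Hilbert spaces -/

section Realization

variable {H : Type*} [NormedAddCommGroup H] [InnerProductSpace ℝ H] [CompleteSpace H]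
  [SecondCountableTopology H] [MeasurableSpace H] [BorelSpace H]

/-- `J` embeds the Hilbert space `H` into the space of pairs of distributions and has the adjoint
map `e`. -/
structure IsRealization (J : H → State n) (e : (Fin 2 → CTest n) →ₗ[ℝ] H) : Prop where
  pairing : ∀ h Ψ, pairing₂ (J h) Ψ = inner ℝ h (e Ψ)
  dense : DenseRange e

variable {J : H → State n} {e : (Fin 2 → CTest n) →ₗ[ℝ] H}

theorem IsRealization.map_sub (hJ : IsRealization J e) (h h' : H) : J (h - h') = J h - J h' :=
  State.ext_pairing fun Ψ => by
    rw [pairing₂_sub_left, hJ.pairing, hJ.pairing, hJ.pairing, inner_sub_left]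

theorem IsRealization.injective (hJ : IsRealization J e) : Function.Injective J := by
  intro h h' hh
  refine sub_eq_zero.1 (hJ.dense.eq_zero_of_inner_left ℝ fun Ψ => ?_)
  rw [← hJ.pairing, hJ.map_sub, hh, pairing₂_sub_left, sub_self]

/-- Lusin–Souslin, as `H` is Polish and states are countably separated. For an embedding the change
of variables holds for arbitrary integrands and sets, so neither the functionals nor the spaces in
`WeaklyConverges` have to be shown measurable. -/
theorem IsRealization.measurableEmbedding (hJ : IsRealization J e) : MeasurableEmbedding J := by
  have hm : Measurable J := measurable_of_pairing fun Ψ => by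
    simp only [hJ.pairing]; fun_prop
  exact hm.measurableEmbedding hJ.injective

theorem IsRealization.charFunctional_map (hJ : IsRealization J e) (ν : Measure H)
    (Ψ : Fin 2 → CTest n) : charFunctional (ν.map J) Ψ = charFun ν (e Ψ) := by
  rw [charFunctional, hJ.measurableEmbedding.integral_map, charFun_apply]
  refine integral_congr_ae (ae_of_all _ fun h => ?_)
  simp only [hJ.pairing, mul_comm]

/-- The bound by the norm and subadditivity make `J` continuous into the seminorm topology, so an
admissible functional becomes a bounded continuous function on `H`. -/
theorem IsRealization.weaklyConverges (hJ : IsRealization J e) {ι A : Type*} {V : Set (State n)}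
    {N : ι → State n → ℝ≥0∞} (hV : ∀ h, J h ∈ V)
    (hN : ∀ i, ∃ C : ℝ≥0, ∀ h, N i (J h) ≤ C * ‖h‖ₑ)
    (hadd : ∀ i Y Z, N i (Y + Z) ≤ N i Y + N i Z) {l : Filter A} {ν : A → ProbabilityMeasure H}
    {ν₀ : ProbabilityMeasure H} (h : Tendsto ν l (𝓝 ν₀)) :
    WeaklyConverges V N l (fun a => (ν a : Measure H).map J) ((ν₀ : Measure H).map J) := by
  have hE := hJ.measurableEmbedding
  refine ⟨Eventually.of_forall fun a => hE.ae_map_iff.2 (ae_of_all _ hV),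
    hE.ae_map_iff.2 (ae_of_all _ hV), fun f ⟨C, hC⟩ hf => ?_⟩
  simp only [hE.integral_map]
  have hJc : @Continuous _ _ _ (seminormTopology N) J := by
    refine continuous_generateFrom_iff.2 ?_
    rintro _ ⟨i, Y, ρ, hρ, rfl⟩
    obtain ⟨C, hC⟩ := hN i
    rw [isOpen_iff_mem_nhds]
    intro h hh
    have hlt : N i (J h - Y) < ρ := hh
    have hcont : Tendsto (fun h' : H => (C : ℝ≥0∞) * ‖h' - h‖ₑ + N i (J h - Y)) (𝓝 h)
        (𝓝 (0 + N i (J h - Y))) := by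
      refine Tendsto.add ?_ tendsto_const_nhds
      have h1 : Tendsto (fun h' : H => ‖h' - h‖ₑ) (𝓝 h) (𝓝 0) := by
        have : Continuous fun h' : H => ‖h' - h‖ₑ := by fun_prop
        simpa using this.tendsto h
      simpa using ENNReal.Tendsto.const_mul h1 (Or.inr ENNReal.coe_ne_top)
    rw [zero_add] at hcont
    filter_upwards [hcont.eventually (gt_mem_nhds hlt)] with h' hh'
    have heq : J h' - Y = J (h' - h) + (J h - Y) := by rw [hJ.map_sub]; abel
    show N i (J h' - Y) < ρ
    rw [heq]
    exact ((hadd i _ _).trans (add_le_add (hC _) le_rfl)).trans_lt hh'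
  have hfJ : Continuous (f ∘ J) := by
    have := @ContinuousOn.comp_continuous H (State n) ℝ _ (seminormTopology N) _ f J V hf hJc hV
    exact this
  let F : BoundedContinuousFunction H ℝ :=
    BoundedContinuousFunction.ofNormedAddCommGroup (f ∘ J) hfJ C fun h => hC _ (hV h)
  exact (ProbabilityMeasure.tendsto_iff_forall_integral_tendsto.1 h) F

end Realization

open FourierTransform SchwartzMap Real

/-! ### The symbols of the dynamics -/

theorem hasTemperateGrowth_const_mul {F : Type*} [NormedAddCommGroup F] [NormedSpace ℝ F]
    {a : F → ℝ} (ha : a.HasTemperateGrowth) (c : ℝ) :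
    Function.HasTemperateGrowth fun ξ => c * a ξ :=
  (Function.HasTemperateGrowth.const c).mul ha

theorem hasTemperateGrowth_symbol_real {c : ℝ} (hc : 0 < c) (p : ℝ) :
    Function.HasTemperateGrowth fun ξ : E n => (c ^ 2 + (2 * π * ‖ξ‖) ^ 2) ^ p := by
  have h1 : Function.HasTemperateGrowth fun ξ : E n => (2 * π / c) • ξ :=
    ((2 * π / c) • ContinuousLinearMap.id ℝ (E n)).hasTemperateGrowth
  have h2 := hasTemperateGrowth_const_mul
    ((Function.hasTemperateGrowth_one_add_norm_sq_rpow (E n) p).comp h1) ((c ^ 2) ^ p)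
  convert h2 using 2 with ξ
  simp only [Function.comp_apply]
  rw [← mul_rpow (by positivity) (by positivity), norm_smul, Real.norm_of_nonneg (by positivity)]
  congr 1
  field_simp

theorem hasTemperateGrowth_cos : Function.HasTemperateGrowth Real.cos :=
  ⟨Real.contDiff_cos, fun k => ⟨0, 1, fun x => by
    rw [norm_iteratedFDeriv_eq_norm_iteratedDeriv]
    simpa using Real.abs_iteratedDeriv_cos_le_one k x⟩⟩

theorem hasTemperateGrowth_sin : Function.HasTemperateGrowth Real.sin :=
  ⟨Real.contDiff_sin, fun k => ⟨0, 1, fun x => by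
    rw [norm_iteratedFDeriv_eq_norm_iteratedDeriv]
    simpa using Real.abs_iteratedDeriv_sin_le_one k x⟩⟩

/-- The dispersion relation `ω(k) = √(m² + |k|²)`, `k = 2πξ`. -/
def disp (m : ℝ) (ξ : E n) : ℝ := √(m ^ 2 + (2 * π * ‖ξ‖) ^ 2)

variable {m : ℝ}

theorem disp_sq (m : ℝ) (ξ : E n) : disp m ξ ^ 2 = m ^ 2 + (2 * π * ‖ξ‖) ^ 2 :=
  Real.sq_sqrt (by positivity)

theorem le_disp (m : ℝ) (ξ : E n) : m ≤ disp m ξ :=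
  Real.le_sqrt_of_sq_le (by nlinarith [sq_nonneg (2 * π * ‖ξ‖)])

theorem disp_pos (hm : 0 < m) (ξ : E n) : 0 < disp m ξ := hm.trans_le (le_disp m ξ)

theorem disp_neg (m : ℝ) (ξ : E n) : disp m (-ξ) = disp m ξ := by simp [disp]

theorem hasTemperateGrowth_disp (hm : 0 < m) :
    Function.HasTemperateGrowth (disp m : E n → ℝ) := by
  have := hasTemperateGrowth_symbol_real (n := n) hm (1 / 2)
  have h : (disp m : E n → ℝ) = fun ξ => (m ^ 2 + (2 * π * ‖ξ‖) ^ 2) ^ (1 / 2 : ℝ) :=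
    funext fun ξ => Real.sqrt_eq_rpow _
  rwa [h]

theorem hasTemperateGrowth_disp_inv (hm : 0 < m) :
    Function.HasTemperateGrowth fun ξ : E n => (disp m ξ)⁻¹ := by
  have := hasTemperateGrowth_symbol_real (n := n) hm (-(1 / 2))
  have h : (fun ξ : E n => (disp m ξ)⁻¹) = fun ξ : E n => (m ^ 2 + (2 * π * ‖ξ‖) ^ 2) ^ (-(1 / 2) : ℝ) := by
    funext ξ
    rw [disp, Real.sqrt_eq_rpow, rpow_neg (by positivity)]
  rwa [h]

theorem continuous_disp (m : ℝ) : Continuous (disp m : E n → ℝ) := by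
  unfold disp; fun_prop

/-- The symbol of `cos (t ω)`. -/
def cosSym (m t : ℝ) (ξ : E n) : ℝ := Real.cos (t * disp m ξ)

/-- The symbol of `sin (t ω) / ω`. -/
def sincSym (m t : ℝ) (ξ : E n) : ℝ := Real.sin (t * disp m ξ) * (disp m ξ)⁻¹

/-- The symbol of `ω sin (t ω)`. -/
def sinSym (m t : ℝ) (ξ : E n) : ℝ := Real.sin (t * disp m ξ) * disp m ξ

theorem hasTemperateGrowth_cosSym (hm : 0 < m) (t : ℝ) :
    Function.HasTemperateGrowth (cosSym m t : E n → ℝ) :=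
  hasTemperateGrowth_cos.comp (hasTemperateGrowth_const_mul (hasTemperateGrowth_disp hm) t)

theorem hasTemperateGrowth_sin_disp (hm : 0 < m) (t : ℝ) :
    Function.HasTemperateGrowth fun ξ : E n => Real.sin (t * disp m ξ) :=
  hasTemperateGrowth_sin.comp (hasTemperateGrowth_const_mul (hasTemperateGrowth_disp hm) t)

theorem hasTemperateGrowth_sincSym (hm : 0 < m) (t : ℝ) :
    Function.HasTemperateGrowth (sincSym m t : E n → ℝ) :=
  (hasTemperateGrowth_sin_disp hm t).mul (hasTemperateGrowth_disp_inv hm)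

theorem hasTemperateGrowth_sinSym (hm : 0 < m) (t : ℝ) :
    Function.HasTemperateGrowth (sinSym m t : E n → ℝ) :=
  (hasTemperateGrowth_sin_disp hm t).mul (hasTemperateGrowth_disp hm)

theorem cosSym_even (m t : ℝ) (ξ : E n) : cosSym m t (-ξ) = cosSym m t ξ := by
  simp [cosSym, disp_neg]

theorem sincSym_even (m t : ℝ) (ξ : E n) : sincSym m t (-ξ) = sincSym m t ξ := by
  simp [sincSym, disp_neg]

theorem sinSym_even (m t : ℝ) (ξ : E n) : sinSym m t (-ξ) = sinSym m t ξ := by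
  simp [sinSym, disp_neg]

theorem abs_cosSym_le (m t : ℝ) (ξ : E n) : |cosSym m t ξ| ≤ 1 := Real.abs_cos_le_one _

theorem abs_sincSym_le (hm : 0 < m) (t : ℝ) (ξ : E n) : |sincSym m t ξ| ≤ (disp m ξ)⁻¹ := by
  have := disp_pos hm ξ
  rw [sincSym, abs_mul, abs_of_pos (inv_pos.2 this)]
  exact mul_le_of_le_one_left (by positivity) (Real.abs_sin_le_one _)

theorem abs_sinSym_le (hm : 0 < m) (t : ℝ) (ξ : E n) : |sinSym m t ξ| ≤ disp m ξ := by
  have := disp_pos hm ξ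
  rw [sinSym, abs_mul, abs_of_pos this]
  exact mul_le_of_le_one_left (by positivity) (Real.abs_sin_le_one _)

/-! ### Real Fourier multipliers -/

theorem fourierMultiplier_apply {a : E n → ℝ} (ha : a.HasTemperateGrowth) (f : 𝓢(E n, ℂ))
    (x : E n) : fourierMultiplierCLM ℂ a f x = ∫ ξ, 𝐞 (inner ℝ ξ x) • ((a ξ : ℂ) * 𝓕 f ξ) := by
  rw [SchwartzMap.fourierMultiplierCLM_apply, fourierInv_coe, Real.fourierInv_eq]
  simp [smulLeftCLM_apply_apply ha]

theorem fourier_fourierMultiplier {a : E n → ℝ} (ha : a.HasTemperateGrowth) (f : 𝓢(E n, ℂ))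
    (ξ : E n) : 𝓕 (fourierMultiplierCLM ℂ a f) ξ = a ξ * 𝓕 f ξ := by
  rw [SchwartzMap.fourierMultiplierCLM_apply, FourierTransform.fourier_fourierInv_eq]
  simp [smulLeftCLM_apply_apply ha]

theorem integrable_symbol_mul {a : E n → ℝ} (ha : a.HasTemperateGrowth) (f : 𝓢(E n, ℂ)) :
    Integrable fun ξ => (a ξ : ℂ) * f ξ := by
  have := (smulLeftCLM ℂ a f).integrable (μ := volume)
  refine this.congr (ae_of_all _ fun ξ => ?_)
  simp [smulLeftCLM_apply_apply ha]

theorem integrable_abs_symbol_mul {a : E n → ℝ} (ha : a.HasTemperateGrowth) (f : 𝓢(E n, ℂ)) :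
    Integrable fun ξ => |a ξ| * ‖f ξ‖ := by
  simpa using (integrable_symbol_mul ha f).norm

theorem norm_fourierMultiplier_le {a : E n → ℝ} (ha : a.HasTemperateGrowth) (f : 𝓢(E n, ℂ))
    (x : E n) {b : E n → ℝ} (hb : b.HasTemperateGrowth) (hab : ∀ ξ, |a ξ| ≤ b ξ) :
    ‖fourierMultiplierCLM ℂ a f x‖ ≤ ∫ ξ, b ξ * ‖𝓕 f ξ‖ := by
  rw [fourierMultiplier_apply ha]
  refine (norm_integral_le_integral_norm _).trans ?_
  have hb0 : ∀ ξ, |b ξ| = b ξ := fun ξ => abs_of_nonneg ((abs_nonneg _).trans (hab ξ))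
  refine integral_mono_of_nonneg (ae_of_all _ fun ξ => norm_nonneg _) ?_ (ae_of_all _ fun ξ => ?_)
  · simpa only [hb0] using integrable_abs_symbol_mul hb (𝓕 f)
  · simp only [Circle.norm_smul, norm_mul, Complex.norm_real, Real.norm_eq_abs]
    exact mul_le_mul_of_nonneg_right (hab ξ) (norm_nonneg _)

theorem conj_fourier_of_real {f : E n → ℂ} (hf : ∀ x, (starRingEnd ℂ) (f x) = f x) (ξ : E n) :
    (starRingEnd ℂ) (𝓕 f ξ) = 𝓕 f (-ξ) := by
  rw [Real.fourier_eq, Real.fourier_eq, ← integral_conj]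
  refine integral_congr_ae (ae_of_all _ fun x => ?_)
  simp [Circle.smul_def, hf, ← Circle.coe_inv_eq_conj, AddChar.map_neg_eq_inv]

theorem conj_fourierMultiplier_of_real {a : E n → ℝ} (ha : a.HasTemperateGrowth)
    (heven : ∀ ξ, a (-ξ) = a ξ) {f : 𝓢(E n, ℂ)} (hf : ∀ x, (starRingEnd ℂ) (f x) = f x)
    (x : E n) : (starRingEnd ℂ) (fourierMultiplierCLM ℂ a f x) = fourierMultiplierCLM ℂ a f x := by
  rw [fourierMultiplier_apply ha, ← integral_conj, ← integral_neg_eq_self]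
  refine integral_congr_ae (ae_of_all _ fun ξ => ?_)
  have h := conj_fourier_of_real hf (-ξ)
  rw [neg_neg] at h
  simp only [Circle.smul_def, smul_eq_mul, map_mul, Complex.conj_ofReal, heven, fourier_coe, h,
    inner_neg_left]
  simp [← Circle.coe_inv_eq_conj, AddChar.map_neg_eq_inv]

theorem taylor_two_bound {f f' f'' : ℝ → ℝ} (hf : ∀ s, HasDerivAt f (f' s) s)
    (hf' : ∀ s, HasDerivAt f' (f'' s) s) {M : ℝ} (hM : ∀ s, |f'' s| ≤ M) (t h : ℝ) :
    |f (t + h) - f t - h * f' t| ≤ M * h ^ 2 := by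
  have hM0 : 0 ≤ M := (abs_nonneg _).trans (hM 0)
  have h1 : ∀ s, |f' s - f' t| ≤ M * |s - t| := fun s => by
    simpa using Convex.norm_image_sub_le_of_norm_hasDerivWithin_le (s := univ)
      (fun x _ => (hf' x).hasDerivWithinAt) (fun x _ => hM x) convex_univ (mem_univ t) (mem_univ s)
  have h2 := Convex.norm_image_sub_le_of_norm_hasDerivWithin_le (s := uIcc t (t + h))
    (f := fun s => f s - s * f' t) (f' := fun s => f' s - f' t) (C := M * |h|) (x := t) (y := t + h)
    (fun x _ => by
      have := ((hf x).fun_sub ((hasDerivAt_id x).mul_const (f' t))).hasDerivWithinAt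
        (s := uIcc t (t + h))
      simpa using this)
    (fun x hx => (h1 x).trans (mul_le_mul_of_nonneg_left (by
      simpa using abs_sub_left_of_mem_uIcc hx) hM0))
    (convex_uIcc _ _) left_mem_uIcc right_mem_uIcc
  simp only [Real.norm_eq_abs, add_sub_cancel_left] at h2
  calc |f (t + h) - f t - h * f' t| = |f (t + h) - (t + h) * f' t - (f t - t * f' t)| := by
        congr 1; ring
    _ ≤ M * |h| * |h| := h2
    _ = M * h ^ 2 := by rw [mul_assoc, ← sq, sq_abs]

/-- The Taylor remainder of the symbol is estimated under the Fourier integral, which makes the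
bound uniform in x. This uniformity is what allows test functions moving with time to be inserted
into distributions. -/
theorem fourierMultiplier_taylor {a a' a'' : ℝ → E n → ℝ} {b : E n → ℝ}
    (ha : ∀ t, (a t).HasTemperateGrowth) (ha' : ∀ t, (a' t).HasTemperateGrowth)
    (hb : b.HasTemperateGrowth) (hd : ∀ t ξ, HasDerivAt (fun s => a s ξ) (a' t ξ) t)
    (hd' : ∀ t ξ, HasDerivAt (fun s => a' s ξ) (a'' t ξ) t) (hab : ∀ t ξ, |a'' t ξ| ≤ b ξ)
    (f : 𝓢(E n, ℂ)) (t h : ℝ) (x : E n) :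
    ‖fourierMultiplierCLM ℂ (a (t + h)) f x - fourierMultiplierCLM ℂ (a t) f x -
      h • fourierMultiplierCLM ℂ (a' t) f x‖ ≤ (∫ ξ, b ξ * ‖𝓕 f ξ‖) * h ^ 2 := by
  have hA : Function.HasTemperateGrowth fun ξ => a (t + h) ξ - a t ξ - h * a' t ξ :=
    ((ha _).sub (ha _)).sub (hasTemperateGrowth_const_mul (ha' t) h)
  have key : fourierMultiplierCLM ℂ (a (t + h)) f x - fourierMultiplierCLM ℂ (a t) f x -
      h • fourierMultiplierCLM ℂ (a' t) f x =
      fourierMultiplierCLM ℂ (fun ξ => a (t + h) ξ - a t ξ - h * a' t ξ) f x := by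
    have hi : ∀ c : E n → ℝ, c.HasTemperateGrowth →
        Integrable fun ξ => 𝐞 (inner ℝ ξ x) • ((c ξ : ℂ) * 𝓕 f ξ) := fun c hc => by
      have := (Real.fourierIntegral_convergent_iff (μ := volume) (-x)).2
        (integrable_symbol_mul hc (𝓕 f))
      simpa using this
    rw [fourierMultiplier_apply (ha _), fourierMultiplier_apply (ha _),
      fourierMultiplier_apply (ha' _), fourierMultiplier_apply hA, ← integral_sub (hi _ (ha _))
      (hi _ (ha _)), ← integral_smul, ← integral_sub (by exact (hi _ (ha _)).sub (hi _ (ha _)))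
      (by exact (hi _ (ha' _)).smul h)]
    refine integral_congr_ae (ae_of_all _ fun ξ => ?_)
    simp only [Circle.smul_def, smul_eq_mul, Complex.real_smul]
    push_cast
    ring
  rw [key]
  refine (norm_fourierMultiplier_le hA f x (b := fun ξ => b ξ * h ^ 2) ?_ fun ξ => ?_).trans_eq ?_
  · exact hb.mul (Function.HasTemperateGrowth.const _)
  · exact taylor_two_bound (fun s => hd s ξ) (fun s => hd' s ξ) (fun s => hab s ξ) t h
  · rw [← integral_mul_const]
    congr 1 with ξ
    ring

theorem hasDerivAt_of_taylor {F : Type*} [NormedAddCommGroup F] [NormedSpace ℝ F] {f : ℝ → F}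
    {f' : F} {t M : ℝ} (h : ∀ᶠ h in 𝓝 (0 : ℝ), ‖f (t + h) - f t - h • f'‖ ≤ M * h ^ 2) :
    HasDerivAt f f' t := by
  rw [hasDerivAt_iff_isLittleO_nhds_zero]
  refine Asymptotics.IsBigO.trans_isLittleO (g := fun h : ℝ => h ^ 2)
    (Asymptotics.IsBigO.of_bound M (h.mono fun s hs => ?_)) ?_
  · simpa using hs
  · exact Asymptotics.isLittleO_pow_id one_lt_two

/-! ### Weighted energy estimate -/

/-- The weight `(1 + |x - x₀|²)⁻ᴺ`. -/
def weight (x₀ : E n) (N : ℕ) (x : E n) : ℝ := ((1 + ‖x - x₀‖ ^ 2) ^ N)⁻¹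

theorem weight_pos (x₀ : E n) (N : ℕ) (x : E n) : 0 < weight x₀ N x := by
  unfold weight; positivity

theorem hasFDerivAt_weight (x₀ : E n) (N : ℕ) (x : E n) :
    HasFDerivAt (weight x₀ N)
      ((-(N * (2 / (1 + ‖x - x₀‖ ^ 2)) * weight x₀ N x)) • innerSL ℝ (x - x₀)) x := by
  have h1 : HasFDerivAt (fun y : E n => 1 + ‖y - x₀‖ ^ 2) (2 • innerSL ℝ (x - x₀)) x := by
    have := ((hasFDerivAt_id x).sub_const x₀).norm_sq.const_add 1
    simpa using this
  have hpos : (0 : ℝ) < 1 + ‖x - x₀‖ ^ 2 := by positivity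
  have h2 := (hasDerivAt_inv (pow_pos hpos N).ne').comp_hasFDerivAt x (h1.pow N)
  refine h2.congr_fderiv ?_
  ext v
  simp only [weight, smul_eq_mul, nsmul_eq_mul, neg_smul, innerSL_apply_apply, smul_apply,
    neg_apply]
  rcases N with _ | N
  · simp
  · rw [Nat.add_sub_cancel]
    field_simp
    push_cast
    ring

theorem continuous_weight (x₀ : E n) (N : ℕ) : Continuous (weight x₀ N) :=
  continuous_iff_continuousAt.2 fun x => (hasFDerivAt_weight x₀ N x).continuousAt

theorem integrable_weight (x₀ : E n) {N : ℕ} (hN : (n : ℝ) < 2 * N) :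
    Integrable (weight x₀ N) := by
  have h := integrable_rpow_neg_one_add_norm_sq (E := E n) (μ := volume) (r := 2 * N)
    (by simpa using hN)
  have h2 := h.comp_sub_right x₀
  refine h2.congr (ae_of_all _ fun x => ?_)
  simp only [weight]
  rw [show (-(2 * (N : ℝ)) / 2) = -(N : ℝ) by ring, rpow_neg (by positivity), rpow_natCast]

/-- The energy density. -/
def density (m : ℝ) (u b : ℝ → E n → ℝ) (a : Fin n → ℝ → E n → ℝ) (t : ℝ) (x : E n) : ℝ :=
  b t x ^ 2 + ∑ k, a k t x ^ 2 + m ^ 2 * u t x ^ 2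

/-- Data of a bounded smooth solution of the Klein–Gordon equation written as a first order
system for `u`, `b = u̇` and `a = ∇u`. -/
structure IsBoundedSystem (m M : ℝ) (u b : ℝ → E n → ℝ) (a : Fin n → ℝ → E n → ℝ) : Prop where
  deriv_u : ∀ t x, HasDerivAt (fun s => u s x) (b t x) t
  deriv_a : ∀ k t x, HasDerivAt (fun s => a k s x)
    (fderiv ℝ (b t) x (EuclideanSpace.single k 1)) t
  deriv_b : ∀ t x, HasDerivAt (fun s => b s x)
    (∑ k, fderiv ℝ (a k t) x (EuclideanSpace.single k 1) - m ^ 2 * u t x) t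
  contDiff_b : ∀ t, ContDiff ℝ 1 (b t)
  contDiff_a : ∀ k t, ContDiff ℝ 1 (a k t)
  continuous_u : ∀ t, Continuous (u t)
  bound_u : ∀ t x, |u t x| ≤ M
  bound_b : ∀ t x, |b t x| ≤ M
  bound_a : ∀ k t x, |a k t x| ≤ M
  bound_db : ∀ k t x, |fderiv ℝ (b t) x (EuclideanSpace.single k 1)| ≤ M
  bound_da : ∀ k t x, |fderiv ℝ (a k t) x (EuclideanSpace.single k 1)| ≤ M

namespace IsBoundedSystem

variable {M : ℝ} {u b : ℝ → E n → ℝ} {a : Fin n → ℝ → E n → ℝ}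

theorem continuous_density (h : IsBoundedSystem m M u b a) (t : ℝ) :
    Continuous (density m u b a t) := by
  have h1 := (h.contDiff_b t).continuous
  have h2 := fun k => (h.contDiff_a k t).continuous
  have h3 := h.continuous_u t
  unfold density
  fun_prop

theorem integrable_weight_mul {x₀ : E n} {N : ℕ} (hN : (n : ℝ) < 2 * N) {f : E n → ℝ}
    (hf : Continuous f) {C : ℝ} (hC : ∀ x, |f x| ≤ C) :
    Integrable fun x => weight x₀ N x * f x :=
  (integrable_weight x₀ hN).mul_bdd (c := C) hf.aestronglyMeasurable (ae_of_all _ hC)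

/-- The local energy law: the mass terms cancel and the density changes by the divergence of the
flux 2 b a. -/
theorem hasDerivAt_density (h : IsBoundedSystem m M u b a) (t : ℝ) (x : E n) :
    HasDerivAt (fun s => density m u b a s x)
      (2 * ∑ k, fderiv ℝ (fun y => b t y * a k t y) x (EuclideanSpace.single k 1)) t := by
  have h1 := ((h.deriv_b t x).fun_pow 2).fun_add
    ((HasDerivAt.fun_sum fun k (_ : k ∈ Finset.univ) => (h.deriv_a k t x).fun_pow 2).fun_add
      (((h.deriv_u t x).fun_pow 2).const_mul (m ^ 2)))
  have h2 : ∀ k, fderiv ℝ (fun y => b t y * a k t y) x (EuclideanSpace.single k 1) =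
      b t x * fderiv ℝ (a k t) x (EuclideanSpace.single k 1) +
        a k t x * fderiv ℝ (b t) x (EuclideanSpace.single k 1) := fun k => by
    rw [fderiv_fun_mul ((h.contDiff_b t).differentiable one_ne_zero x)
      ((h.contDiff_a k t).differentiable one_ne_zero x)]
    simp
  have h3 : (fun s => density m u b a s x) = fun s => b s x ^ 2 +
      (∑ k, a k s x ^ 2 + m ^ 2 * u s x ^ 2) := by
    funext s; simp only [density, add_assoc]
  rw [h3]
  refine h1.congr_deriv ?_
  simp only [h2, Finset.sum_add_distrib, mul_add, mul_sub, Finset.mul_sum]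
  simp only [Nat.cast_ofNat, Nat.reduceSub, pow_one, ← Finset.mul_sum, mul_assoc]
  ring

theorem bound_nonneg (h : IsBoundedSystem m M u b a) : 0 ≤ M :=
  (abs_nonneg _).trans (h.bound_u 0 0)

theorem abs_fderiv_mul_le (h : IsBoundedSystem m M u b a) (k : Fin n) (t : ℝ) (x : E n) :
    |fderiv ℝ (fun y => b t y * a k t y) x (EuclideanSpace.single k 1)| ≤ 2 * M ^ 2 := by
  rw [fderiv_fun_mul ((h.contDiff_b t).differentiable one_ne_zero x)
      ((h.contDiff_a k t).differentiable one_ne_zero x)]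
  simp only [add_apply, smul_apply, smul_eq_mul]
  refine (abs_add_le _ _).trans ?_
  rw [abs_mul, abs_mul, two_mul, sq]
  have := h.bound_nonneg
  exact add_le_add
    (mul_le_mul (h.bound_b t x) (h.bound_da k t x) (abs_nonneg _) this)
    (mul_le_mul (h.bound_a k t x) (h.bound_db k t x) (abs_nonneg _) this)

theorem continuous_fderiv_mul (h : IsBoundedSystem m M u b a) (k : Fin n) (t : ℝ) :
    Continuous fun x => fderiv ℝ (fun y => b t y * a k t y) x (EuclideanSpace.single k 1) :=
  (((h.contDiff_b t).mul (h.contDiff_a k t)).continuous_fderiv one_ne_zero).clm_apply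
    continuous_const

theorem abs_mul_le (h : IsBoundedSystem m M u b a) (k : Fin n) (t : ℝ) (x : E n) :
    |b t x * a k t x| ≤ M ^ 2 := by
  rw [abs_mul, sq]
  exact mul_le_mul (h.bound_b t x) (h.bound_a k t x) (abs_nonneg _) h.bound_nonneg

theorem density_nonneg (t : ℝ) (x : E n) : 0 ≤ density m u b a t x := by
  unfold density; positivity

theorem density_le (h : IsBoundedSystem m M u b a) (t : ℝ) (x : E n) :
    |density m u b a t x| ≤ M ^ 2 + n * M ^ 2 + m ^ 2 * M ^ 2 := by
  rw [abs_of_nonneg (density_nonneg t x), density]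
  have hb : b t x ^ 2 ≤ M ^ 2 := sq_le_sq' (neg_le_of_abs_le (h.bound_b t x))
    (le_of_abs_le (h.bound_b t x))
  have hu : u t x ^ 2 ≤ M ^ 2 := sq_le_sq' (neg_le_of_abs_le (h.bound_u t x))
    (le_of_abs_le (h.bound_u t x))
  have ha : ∑ k, a k t x ^ 2 ≤ n * M ^ 2 := by
    have := Finset.sum_le_card_nsmul (Finset.univ : Finset (Fin n)) (fun k => a k t x ^ 2) (M ^ 2)
      fun k _ => sq_le_sq' (neg_le_of_abs_le (h.bound_a k t x)) (le_of_abs_le (h.bound_a k t x))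
    simpa using this
  gcongr

theorem hasDerivAt_energy (h : IsBoundedSystem m M u b a) {x₀ : E n} {N : ℕ}
    (hN : (n : ℝ) < 2 * N) (t : ℝ) :
    HasDerivAt (fun s => ∫ x, weight x₀ N x * density m u b a s x)
      (∫ x, weight x₀ N x *
        (2 * ∑ k, fderiv ℝ (fun y => b t y * a k t y) x (EuclideanSpace.single k 1))) t := by
  have hcont : ∀ s, Continuous fun x =>
      2 * ∑ k, fderiv ℝ (fun y => b s y * a k s y) x (EuclideanSpace.single k 1) := fun s =>
    continuous_const.mul (continuous_finsetSum _ fun k _ => h.continuous_fderiv_mul k s)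
  have hbd : ∀ s x, |2 * ∑ k, fderiv ℝ (fun y => b s y * a k s y) x (EuclideanSpace.single k 1)| ≤
      2 * (n * (2 * M ^ 2)) := fun s x => by
    rw [abs_mul, abs_two]
    refine mul_le_mul_of_nonneg_left ((Finset.abs_sum_le_sum_abs _ _).trans ?_) zero_le_two
    have := Finset.sum_le_card_nsmul (Finset.univ : Finset (Fin n)) _ (2 * M ^ 2)
      fun k _ => h.abs_fderiv_mul_le k s x
    simpa using this
  refine (hasDerivAt_integral_of_dominated_loc_of_deriv_le (F := fun s x =>
    weight x₀ N x * density m u b a s x) (F' := fun s x => weight x₀ N x *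
        (2 * ∑ k, fderiv ℝ (fun y => b s y * a k s y) x (EuclideanSpace.single k 1)))
    (bound := fun x => weight x₀ N x * (2 * (n * (2 * M ^ 2)))) (s := univ)
    univ_mem (Eventually.of_forall fun s => ?_) ?_ ?_ ?_ ?_ ?_).2
  · exact ((continuous_weight x₀ N).mul (h.continuous_density s)).aestronglyMeasurable
  · exact integrable_weight_mul hN (h.continuous_density t) (h.density_le t)
  · exact ((continuous_weight x₀ N).mul (hcont t)).aestronglyMeasurable
  · refine ae_of_all _ fun x s _ => ?_
    rw [norm_mul, Real.norm_of_nonneg (weight_pos x₀ N x).le]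
    exact mul_le_mul_of_nonneg_left (hbd s x) (weight_pos x₀ N x).le
  · exact (integrable_weight x₀ hN).mul_const _
  · exact ae_of_all _ fun x s _ => (h.hasDerivAt_density s x).const_mul _

/-- The gradient of the weight is at most N times the weight, since 2|y| ≤ 1 + |y|², and 2|b||a| is
at most the energy density. The growth rate N does not depend on x₀. -/
theorem weight_flux_le (x₀ : E n) (N : ℕ) (t : ℝ) (x : E n) :
    |2 * ∑ k, fderiv ℝ (weight x₀ N) x (EuclideanSpace.single k 1) * (b t x * a k t x)| ≤
      N * (weight x₀ N x * density m u b a t x) := by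
  have hw := weight_pos x₀ N x
  set y := x - x₀ with hy
  have h1 : 2 * ∑ k, fderiv ℝ (weight x₀ N) x (EuclideanSpace.single k 1) * (b t x * a k t x) =
      -(N * weight x₀ N x * ((2 / (1 + ‖y‖ ^ 2)) * (2 * (b t x * ∑ k, y k * a k t x)))) := by
    rw [(hasFDerivAt_weight x₀ N x).fderiv]
    simp only [smul_apply, innerSL_apply_apply, smul_eq_mul, ← hy]
    have : ∀ k, inner ℝ y (EuclideanSpace.single k (1 : ℝ)) = y k := fun k => by
      simp [EuclideanSpace.inner_single_right]
    simp only [this, Finset.mul_sum, ← Finset.sum_neg_distrib]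
    exact Finset.sum_congr rfl fun k _ => by ring
  rw [h1, abs_neg, abs_mul, abs_of_nonneg (by positivity : (0 : ℝ) ≤ N * weight x₀ N x),
    mul_assoc (N : ℝ)]
  refine mul_le_mul_of_nonneg_left (mul_le_mul_of_nonneg_left ?_ hw.le) (Nat.cast_nonneg N)
  set A := √(∑ k, a k t x ^ 2) with hA
  have hA2 : A ^ 2 = ∑ k, a k t x ^ 2 := Real.sq_sqrt (Finset.sum_nonneg fun k _ => sq_nonneg _)
  have hcs : |∑ k, y k * a k t x| ≤ ‖y‖ * A := by
    rw [EuclideanSpace.norm_eq, hA]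
    have := abs_real_inner_le_norm (F := E n) y (WithLp.toLp 2 fun k => a k t x)
    simpa [PiLp.inner_apply, EuclideanSpace.norm_eq, mul_comm] using this
  have hpos : (0 : ℝ) < 1 + ‖y‖ ^ 2 := by positivity
  have hyy : 2 / (1 + ‖y‖ ^ 2) * ‖y‖ ≤ 1 := by
    rw [div_mul_eq_mul_div, div_le_one hpos]
    nlinarith [sq_nonneg (‖y‖ - 1)]
  rw [abs_mul, abs_mul, abs_mul, abs_of_pos (by positivity : (0 : ℝ) < 2 / (1 + ‖y‖ ^ 2)), abs_two]
  have hA0 : 0 ≤ A := Real.sqrt_nonneg _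
  calc 2 / (1 + ‖y‖ ^ 2) * (2 * (|b t x| * |∑ k, y k * a k t x|))
      ≤ 2 / (1 + ‖y‖ ^ 2) * (2 * (|b t x| * (‖y‖ * A))) := by gcongr
    _ = (2 / (1 + ‖y‖ ^ 2) * ‖y‖) * (2 * |b t x| * A) := by ring
    _ ≤ 1 * (2 * |b t x| * A) := by gcongr
    _ ≤ |b t x| ^ 2 + A ^ 2 := by nlinarith [sq_nonneg (|b t x| - A)]
    _ ≤ density m u b a t x := by
      rw [density, sq_abs, hA2]
      have : 0 ≤ m ^ 2 * u t x ^ 2 := by positivity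
      linarith

/-- Integration by parts moves the divergence to the weight. No boundary terms occur, because
bounded functions times the weight are integrable for 2N > n. -/
theorem abs_deriv_energy_le (h : IsBoundedSystem m M u b a) {x₀ : E n} {N : ℕ}
    (hN : (n : ℝ) < 2 * N) (t : ℝ) :
    |∫ x, weight x₀ N x *
        (2 * ∑ k, fderiv ℝ (fun y => b t y * a k t y) x (EuclideanSpace.single k 1))| ≤
      N * ∫ x, weight x₀ N x * density m u b a t x := by
  have hfd : ∀ x, fderiv ℝ (weight x₀ N) x =
      (-(N * (2 / (1 + ‖x - x₀‖ ^ 2)) * weight x₀ N x)) • innerSL ℝ (x - x₀) := fun x =>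
    (hasFDerivAt_weight x₀ N x).fderiv
  have hba : ∀ k, Continuous fun x => b t x * a k t x := fun k =>
    (h.contDiff_b t).continuous.mul (h.contDiff_a k t).continuous
  have hint : ∀ k : Fin n, Integrable fun x => fderiv ℝ (weight x₀ N) x
      (EuclideanSpace.single k 1) * (b t x * a k t x) := fun k => by
    have hc : Continuous fun x : E n => (-(N * (2 / (1 + ‖x - x₀‖ ^ 2)) *
        inner ℝ (x - x₀) (EuclideanSpace.single k (1 : ℝ)))) * (b t x * a k t x) := by
      have : ∀ x : E n, (1 + ‖x - x₀‖ ^ 2) ≠ 0 := fun x => by positivity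
      have := hba k
      fun_prop (disch := assumption)
    refine (integrable_weight_mul (x₀ := x₀) hN hc (C := N * M ^ 2) fun x => ?_).congr
      (ae_of_all _ fun x => ?_)
    · rw [abs_mul, abs_neg]
      refine mul_le_mul ?_ (h.abs_mul_le k t x) (abs_nonneg _) (Nat.cast_nonneg N)
      have hpos : (0 : ℝ) < 1 + ‖x - x₀‖ ^ 2 := by positivity
      have hin : |inner ℝ (x - x₀) (EuclideanSpace.single k (1 : ℝ))| ≤ ‖x - x₀‖ := by
        simpa using abs_real_inner_le_norm (x - x₀) (EuclideanSpace.single k (1 : ℝ))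
      rw [abs_mul, abs_of_nonneg (by positivity : (0 : ℝ) ≤ N * (2 / (1 + ‖x - x₀‖ ^ 2))),
        mul_assoc]
      refine mul_le_of_le_one_right (Nat.cast_nonneg N) ?_
      refine (mul_le_mul_of_nonneg_left hin (by positivity)).trans ?_
      rw [div_mul_eq_mul_div, div_le_one hpos]
      nlinarith [sq_nonneg (‖x - x₀‖ - 1)]
    · simp only [hfd, smul_apply, innerSL_apply_apply, smul_eq_mul]
      ring
  have hkey : ∫ x, weight x₀ N x *
        (2 * ∑ k, fderiv ℝ (fun y => b t y * a k t y) x (EuclideanSpace.single k 1)) =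
      -∫ x, 2 * ∑ k, fderiv ℝ (weight x₀ N) x (EuclideanSpace.single k 1) *
        (b t x * a k t x) := by
    have h1 : ∀ k : Fin n, Integrable fun x => weight x₀ N x *
        fderiv ℝ (fun y => b t y * a k t y) x (EuclideanSpace.single k 1) := fun k =>
      integrable_weight_mul hN (h.continuous_fderiv_mul k t) (h.abs_fderiv_mul_le k t)
    calc _ = 2 * ∑ k, ∫ x, weight x₀ N x *
            fderiv ℝ (fun y => b t y * a k t y) x (EuclideanSpace.single k 1) := by
          rw [← integral_finsetSum _ fun k _ => h1 k, ← integral_const_mul]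
          congr 1 with x
          rw [← Finset.mul_sum]
          ring
      _ = 2 * ∑ k, -∫ x, fderiv ℝ (weight x₀ N) x (EuclideanSpace.single k 1) *
            (b t x * a k t x) := by
          congr 1
          refine Finset.sum_congr rfl fun k _ => ?_
          refine integral_mul_fderiv_eq_neg_fderiv_mul_of_integrable (hint k) (h1 k)
            (integrable_weight_mul hN (hba k) (h.abs_mul_le k t))
            (fun x _ => (hasFDerivAt_weight x₀ N x).differentiableAt)
            (fun x _ => ((h.contDiff_b t).mul (h.contDiff_a k t)).differentiable one_ne_zero x)
      _ = _ := by
          rw [Finset.sum_neg_distrib, ← integral_finsetSum _ fun k _ => hint k, mul_neg,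
            ← integral_const_mul]
  rw [hkey, abs_neg]
  have hI := integrable_weight_mul (x₀ := x₀) hN (h.continuous_density t) (h.density_le t)
  refine (abs_integral_le_integral_abs).trans ?_
  rw [← integral_const_mul]
  refine integral_mono_of_nonneg (ae_of_all _ fun x => abs_nonneg _) (hI.const_mul _)
    (ae_of_all _ fun x => weight_flux_le x₀ N t x)

theorem energy_le (h : IsBoundedSystem m M u b a) {x₀ : E n} {N : ℕ} (hN : (n : ℝ) < 2 * N)
    {t : ℝ} (ht : 0 ≤ t) :
    ∫ x, weight x₀ N x * density m u b a t x ≤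
      (∫ x, weight x₀ N x * density m u b a 0 x) * Real.exp (N * t) := by
  have hnn : ∀ s, 0 ≤ ∫ x, weight x₀ N x * density m u b a s x := fun s =>
    integral_nonneg fun x => mul_nonneg (weight_pos x₀ N x).le (density_nonneg s x)
  have hg := norm_le_gronwallBound_of_norm_deriv_right_le (K := N) (ε := 0) (a := 0) (b := t)
    (f := fun s => ∫ x, weight x₀ N x * density m u b a s x)
    (f' := fun t => ∫ x, weight x₀ N x *
        (2 * ∑ k, fderiv ℝ (fun y => b t y * a k t y) x (EuclideanSpace.single k 1)))
    (fun s _ => (h.hasDerivAt_energy hN s).continuousAt.continuousWithinAt)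
    (fun s _ => (h.hasDerivAt_energy hN s).hasDerivWithinAt) le_rfl
    (fun s _ => by
      rw [add_zero, Real.norm_eq_abs, Real.norm_of_nonneg (hnn s)]
      exact h.abs_deriv_energy_le hN s) t ⟨ht, le_rfl⟩
  rw [gronwallBound_ε0, Real.norm_of_nonneg (hnn t), Real.norm_of_nonneg (hnn 0), sub_zero] at hg
  exact hg

/-- Let e = exp t. If x₀ is at distance at least 2e from the initial support, the initial weighted
energy is at most (1 + 4e²)⁻ᴺ times a constant and grows by the factor eᴺ at most. The weight is at
least 2⁻ᴺ within distance 1 of x₀, so the energy near x₀ is bounded by a constant times (2e/(1 +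
4e²))ᴺ, which tends to 0 as N → ∞. The cone obtained is far from sharp, but only compactness of
supports is needed. -/
theorem density_eq_zero (h : IsBoundedSystem m M u b a) {R : ℝ}
    (h0 : ∀ x, R < ‖x‖ → density m u b a 0 x = 0) {t : ℝ} (ht : 0 ≤ t) {x₀ : E n}
    (hx₀ : R + 2 * Real.exp t ≤ ‖x₀‖) : density m u b a t x₀ = 0 := by
  by_contra hne
  have hpos : 0 < density m u b a t x₀ := lt_of_le_of_ne (density_nonneg t x₀) (Ne.symm hne)
  set c := density m u b a t x₀ / 2 with hc
  obtain ⟨δ, hδ, hball⟩ := Metric.continuousAt_iff.1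
    ((h.continuous_density t).continuousAt (x := x₀)) c (by positivity)
  set δ' := min δ 1
  have hδ' : 0 < δ' := lt_min hδ one_pos
  have hlow : ∀ x ∈ Metric.ball x₀ δ', c ≤ density m u b a t x := fun x hx => by
    have := hball (x := x) ((Metric.mem_ball.1 hx).trans_le (min_le_left _ _))
    rw [Real.dist_eq, abs_lt] at this
    linarith
  set e := Real.exp t
  have he : 1 ≤ e := Real.one_le_exp ht
  set D₀ := ∫ x in Metric.closedBall (0 : E n) R, density m u b a 0 x with hD₀
  have hD₀int : IntegrableOn (density m u b a 0) (Metric.closedBall (0 : E n) R) :=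
    (h.continuous_density 0).continuousOn.integrableOn_compact (isCompact_closedBall _ _)
  have hup : ∀ N : ℕ, ∫ x, weight x₀ N x * density m u b a 0 x ≤
      ((1 + (2 * e) ^ 2) ^ N)⁻¹ * D₀ := fun N => by
    rw [hD₀, ← integral_const_mul, ← integral_indicator measurableSet_closedBall]
    refine integral_mono_of_nonneg (ae_of_all _ fun x => mul_nonneg (weight_pos x₀ N x).le
      (density_nonneg 0 x)) ((integrable_indicator_iff measurableSet_closedBall).2 (hD₀int.const_mul _))
      (ae_of_all _ fun x => ?_)
    by_cases hx : x ∈ Metric.closedBall (0 : E n) R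
    · rw [indicator_of_mem hx]
      refine mul_le_mul_of_nonneg_right ?_ (density_nonneg 0 x)
      unfold weight
      have hxR : ‖x‖ ≤ R := by simpa using hx
      have h1 : 2 * e ≤ ‖x - x₀‖ := by
        have := norm_sub_norm_le x₀ x
        rw [norm_sub_rev]
        linarith
      gcongr
    · rw [indicator_of_notMem hx]
      have : R < ‖x‖ := by simpa using hx
      simp [h0 x this]
  have hbelow : ∀ N : ℕ, (n : ℝ) < 2 * N → ((2 : ℝ) ^ N)⁻¹ * c * volume.real (Metric.ball x₀ δ') ≤
      ∫ x, weight x₀ N x * density m u b a t x := fun N hN => by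
    have hI := integrable_weight_mul (x₀ := x₀) hN (h.continuous_density t) (h.density_le t)
    calc ((2 : ℝ) ^ N)⁻¹ * c * volume.real (Metric.ball x₀ δ')
        = ∫ x in Metric.ball x₀ δ', ((2 : ℝ) ^ N)⁻¹ * c := by
          rw [setIntegral_const, smul_eq_mul, mul_comm]
      _ ≤ ∫ x in Metric.ball x₀ δ', weight x₀ N x * density m u b a t x := by
          refine setIntegral_mono_on (integrableOn_const measure_ball_lt_top.ne)
            hI.integrableOn measurableSet_ball fun x hx => ?_
          refine mul_le_mul ?_ (hlow x hx) (by positivity) (weight_pos x₀ N x).le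
          unfold weight
          have : ‖x - x₀‖ ≤ 1 := by
            rw [← dist_eq_norm]
            exact ((Metric.mem_ball.1 hx).trans_le (min_le_right _ _)).le
          have h2 : 1 + ‖x - x₀‖ ^ 2 ≤ 2 := by nlinarith [norm_nonneg (x - x₀)]
          gcongr
      _ ≤ _ := setIntegral_le_integral hI (ae_of_all _ fun x => mul_nonneg (weight_pos x₀ N x).le
          (density_nonneg t x))
  set V := volume.real (Metric.ball x₀ δ')
  have hV : 0 < V := ENNReal.toReal_pos (Metric.measure_ball_pos _ _ hδ').ne' measure_ball_lt_top.ne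
  have hlim : Tendsto (fun N : ℕ => (2 * e / (1 + (2 * e) ^ 2)) ^ N * D₀) atTop (𝓝 (0 * D₀)) := by
    refine Tendsto.mul_const _ (tendsto_pow_atTop_nhds_zero_of_lt_one (by positivity) ?_)
    rw [div_lt_one (by positivity)]
    nlinarith
  rw [zero_mul] at hlim
  have hcV : c * V ≤ 0 := by
    refine ge_of_tendsto hlim ?_
    obtain ⟨N₀, hN₀⟩ := exists_nat_gt (n : ℝ)
    filter_upwards [eventually_ge_atTop N₀] with N hNN
    have hN : (n : ℝ) < 2 * N := by
      have : (N₀ : ℝ) ≤ N := by exact_mod_cast hNN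
      have : (0 : ℝ) ≤ N := Nat.cast_nonneg N
      linarith
    have h1 := (hbelow N hN).trans ((h.energy_le hN ht).trans
      (mul_le_mul_of_nonneg_right (hup N) (Real.exp_pos _).le))
    have h2 : Real.exp (N * t) = e ^ N := by rw [← Real.exp_nat_mul]
    rw [h2, mul_assoc, inv_mul_le_iff₀ (by positivity)] at h1
    refine h1.trans_eq ?_
    rw [div_pow, mul_pow, div_eq_mul_inv]
    ring
  have : 0 < c * V := by positivity
  linarith

end IsBoundedSystem

/-! ### Finite speed of propagation -/

theorem hasDerivAt_sincSym (hm : 0 < m) (t : ℝ) (ξ : E n) :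
    HasDerivAt (fun s => sincSym m s ξ) (cosSym m t ξ) t := by
  have h := (((hasDerivAt_id t).mul_const (disp m ξ)).sin).mul_const (disp m ξ)⁻¹
  refine h.congr_deriv ?_
  have := (disp_pos hm ξ).ne'
  simp only [cosSym, id]
  field_simp

theorem hasDerivAt_cosSym (t : ℝ) (ξ : E n) :
    HasDerivAt (fun s => cosSym m s ξ) (-sinSym m t ξ) t := by
  have h := ((hasDerivAt_id t).mul_const (disp m ξ)).cos
  refine h.congr_deriv ?_
  simp only [sinSym, id]
  ring

theorem hasDerivAt_neg_sinSym (t : ℝ) (ξ : E n) :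
    HasDerivAt (fun s => -sinSym m s ξ) (-(disp m ξ ^ 2 * cosSym m t ξ)) t := by
  have h := (((hasDerivAt_id t).mul_const (disp m ξ)).sin).mul_const (disp m ξ)
  refine h.neg.congr_deriv ?_
  simp only [cosSym, id]
  ring

theorem sincSym_taylor (hm : 0 < m) (f : 𝓢(E n, ℂ)) (t h : ℝ) (x : E n) :
    ‖fourierMultiplierCLM ℂ (sincSym m (t + h)) f x - fourierMultiplierCLM ℂ (sincSym m t) f x -
      h • fourierMultiplierCLM ℂ (cosSym m t) f x‖ ≤ (∫ ξ, disp m ξ * ‖𝓕 f ξ‖) * h ^ 2 :=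
  fourierMultiplier_taylor (hasTemperateGrowth_sincSym hm) (hasTemperateGrowth_cosSym hm)
    (hasTemperateGrowth_disp hm) (hasDerivAt_sincSym hm) hasDerivAt_cosSym
    (fun t ξ => by rw [abs_neg]; exact abs_sinSym_le hm t ξ) f t h x

theorem cosSym_taylor (hm : 0 < m) (f : 𝓢(E n, ℂ)) (t h : ℝ) (x : E n) :
    ‖fourierMultiplierCLM ℂ (cosSym m (t + h)) f x - fourierMultiplierCLM ℂ (cosSym m t) f x -
      h • fourierMultiplierCLM ℂ (fun ξ => -sinSym m t ξ) f x‖ ≤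
      (∫ ξ, disp m ξ ^ 2 * ‖𝓕 f ξ‖) * h ^ 2 :=
  fourierMultiplier_taylor (a' := fun t ξ => -sinSym m t ξ) (hasTemperateGrowth_cosSym hm)
    (fun t => (hasTemperateGrowth_sinSym hm t).neg)
    ((hasTemperateGrowth_disp hm).pow 2) hasDerivAt_cosSym hasDerivAt_neg_sinSym
    (fun t ξ => by
      rw [abs_neg, abs_mul, abs_of_nonneg (sq_nonneg _)]
      exact mul_le_of_le_one_right (sq_nonneg _) (abs_cosSym_le m t ξ)) f t h x

theorem schwartz_ext_fourier {f g : 𝓢(E n, ℂ)} (h : ∀ ξ, 𝓕 f ξ = 𝓕 g ξ) : f = g := by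
  have : 𝓕 f = 𝓕 g := SchwartzMap.ext h
  rw [← FourierTransform.fourierInv_fourier_eq (F := 𝓢(E n, ℂ)) f, this,
    FourierTransform.fourierInv_fourier_eq]

theorem fourier_sub_schwartz (f g : 𝓢(E n, ℂ)) : 𝓕 (f - g) = 𝓕 f - 𝓕 g :=
  map_sub (fourierCLM ℂ 𝓢(E n, ℂ)) f g

theorem fourier_lineDeriv (f : 𝓢(E n, ℂ)) (v ξ : E n) :
    𝓕 (∂_{v} f) ξ = (2 * π * Complex.I) * (inner ℝ ξ v : ℝ) * 𝓕 f ξ := by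
  rw [fourier_lineDerivOp_eq]
  simp only [smul_apply, smul_eq_mul]
  rw [smulLeftCLM_apply_apply (by fun_prop)]
  simp [mul_assoc]

theorem lineDeriv_fourierMultiplier {a : E n → ℝ} (ha : a.HasTemperateGrowth) (f : 𝓢(E n, ℂ))
    (v : E n) : ∂_{v} (fourierMultiplierCLM ℂ a f) = fourierMultiplierCLM ℂ a (∂_{v} f) := by
  refine schwartz_ext_fourier fun ξ => ?_
  rw [fourier_lineDeriv, fourier_fourierMultiplier ha, fourier_fourierMultiplier ha,
    fourier_lineDeriv]
  ring

theorem inner_single (ξ : E n) (k : Fin n) : inner ℝ ξ (EuclideanSpace.single k (1 : ℝ)) = ξ k := by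
  simp [EuclideanSpace.inner_single_right]

theorem fourier_sum_lineDeriv (f : 𝓢(E n, ℂ)) (ξ : E n) :
    ∑ k : Fin n, 𝓕 (∂_{(EuclideanSpace.single k (1 : ℝ) : E n)}
      (∂_{(EuclideanSpace.single k (1 : ℝ) : E n)} f)) ξ =
      -((2 * π * ‖ξ‖) ^ 2 : ℝ) * 𝓕 f ξ := by
  simp only [fourier_lineDeriv, inner_single]
  rw [mul_pow, EuclideanSpace.real_norm_sq_eq]
  push_cast
  rw [Finset.mul_sum, ← Finset.sum_neg_distrib, Finset.sum_mul]
  refine Finset.sum_congr rfl fun k _ => ?_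
  ring_nf
  rw [Complex.I_sq]
  ring

/-- Since ω² = m² + |k|², this is the Klein–Gordon equation for the solution sin(tω)/ω f, in the
divergence form that `IsBoundedSystem.deriv_b` asks for. -/
theorem neg_sinSym_eq (hm : 0 < m) (f : 𝓢(E n, ℂ)) (t : ℝ) :
    fourierMultiplierCLM ℂ (fun ξ => -sinSym m t ξ) f =
      ∑ k : Fin n, ∂_{(EuclideanSpace.single k (1 : ℝ) : E n)} (fourierMultiplierCLM ℂ (sincSym m t)
        (∂_{(EuclideanSpace.single k (1 : ℝ) : E n)} f)) -
      (m ^ 2) • fourierMultiplierCLM ℂ (sincSym m t) f := by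
  refine schwartz_ext_fourier fun ξ => ?_
  rw [fourier_fourierMultiplier (hasTemperateGrowth_sinSym hm t).fun_neg, fourier_sub_schwartz,
    FourierTransform.fourier_smul, FourierTransform.fourier_sum]
  simp only [sub_apply, smul_apply, sum_apply, lineDeriv_fourierMultiplier
    (hasTemperateGrowth_sincSym hm t), fourier_fourierMultiplier (hasTemperateGrowth_sincSym hm t)]
  rw [← Finset.mul_sum, fourier_sum_lineDeriv]
  have h1 : sinSym m t ξ = (m ^ 2 + (2 * π * ‖ξ‖) ^ 2) * sincSym m t ξ := by
    rw [← disp_sq]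
    have := (disp_pos hm ξ).ne'
    simp only [sinSym, sincSym]
    field_simp
  rw [h1, Complex.real_smul]
  push_cast
  ring

theorem fderiv_re_schwartz (f : 𝓢(E n, ℂ)) (x v : E n) :
    fderiv ℝ (fun y => (f y).re) x v = (∂_{v} f x).re := by
  have h := (Complex.reCLM.hasFDerivAt.comp x (f.differentiableAt (x := x)).hasFDerivAt).fderiv
  rw [lineDerivOp_apply_eq_fderiv]
  change fderiv ℝ (Complex.reCLM ∘ f) x v = _
  rw [h]
  rfl

theorem contDiff_re_schwartz (f : 𝓢(E n, ℂ)) (k : ℕ∞) : ContDiff ℝ k fun y => (f y).re :=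
  Complex.reCLM.contDiff.comp (f.smooth k)

theorem hasDerivAt_re {g : ℝ → ℂ} {g' : ℂ} {t : ℝ} (h : HasDerivAt g g' t) :
    HasDerivAt (fun s => (g s).re) g'.re t :=
  Complex.reCLM.hasFDerivAt.comp_hasDerivAt t h

theorem hasDerivAt_sincSym_apply (hm : 0 < m) (f : 𝓢(E n, ℂ)) (t : ℝ) (x : E n) :
    HasDerivAt (fun s => fourierMultiplierCLM ℂ (sincSym m s) f x)
      (fourierMultiplierCLM ℂ (cosSym m t) f x) t :=
  hasDerivAt_of_taylor (f := fun s => fourierMultiplierCLM ℂ (sincSym m s) f x)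
    (Eventually.of_forall fun h => sincSym_taylor hm f t h x)

theorem hasDerivAt_cosSym_apply (hm : 0 < m) (f : 𝓢(E n, ℂ)) (t : ℝ) (x : E n) :
    HasDerivAt (fun s => fourierMultiplierCLM ℂ (cosSym m s) f x)
      (fourierMultiplierCLM ℂ (fun ξ => -sinSym m t ξ) f x) t :=
  hasDerivAt_of_taylor (f := fun s => fourierMultiplierCLM ℂ (cosSym m s) f x)
    (Eventually.of_forall fun h => cosSym_taylor hm f t h x)

/-- The solution with initial data (0, f). All bounds are uniform in time because the symbols are
dominated by 1 and ω⁻¹; finitely many derivatives of f enter, so one `M` serves all of them. -/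
theorem isBoundedSystem_of_schwartz (hm : 0 < m) (f : 𝓢(E n, ℂ)) :
    ∃ M, IsBoundedSystem m M (fun t x => (fourierMultiplierCLM ℂ (sincSym m t) f x).re)
      (fun t x => (fourierMultiplierCLM ℂ (cosSym m t) f x).re)
      (fun k t x => (fourierMultiplierCLM ℂ (sincSym m t)
        (∂_{(EuclideanSpace.single k (1 : ℝ) : E n)} f) x).re) := by
  have hre : ∀ {z : ℂ} {c : ℝ}, ‖z‖ ≤ c → |z.re| ≤ c := fun h => (Complex.abs_re_le_norm _).trans h
  have hC : ∀ g : 𝓢(E n, ℂ), ∃ M, ∀ t x, |(fourierMultiplierCLM ℂ (cosSym m t) g x).re| ≤ M :=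
    fun g => ⟨_, fun t x => hre (norm_fourierMultiplier_le (hasTemperateGrowth_cosSym hm t) g x
      (b := fun _ => 1) (Function.HasTemperateGrowth.const _) (abs_cosSym_le m t))⟩
  have hS : ∀ g : 𝓢(E n, ℂ), ∃ M, ∀ t x, |(fourierMultiplierCLM ℂ (sincSym m t) g x).re| ≤ M :=
    fun g => ⟨_, fun t x => hre (norm_fourierMultiplier_le (hasTemperateGrowth_sincSym hm t) g x
      (hasTemperateGrowth_disp_inv hm) (abs_sincSym_le hm t))⟩
  choose MC hMC using hC
  choose MS hMS using hS
  let e : Fin n → E n := fun k => EuclideanSpace.single k (1 : ℝ)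
  obtain ⟨M₁, h₁⟩ := Finite.exists_le fun k => MS (∂_{e k} f)
  obtain ⟨M₂, h₂⟩ := Finite.exists_le fun k => MC (∂_{e k} f)
  obtain ⟨M₃, h₃⟩ := Finite.exists_le fun k => MS (∂_{e k} (∂_{e k} f))
  obtain ⟨M, hM⟩ := Finite.exists_le ![MS f, MC f, M₁, M₂, M₃]
  refine ⟨M, ?_, ?_, ?_, ?_, ?_, ?_, ?_, ?_, ?_, ?_, ?_⟩
  · exact fun t x => hasDerivAt_re (hasDerivAt_sincSym_apply hm f t x)
  · intro k t x
    rw [fderiv_re_schwartz, lineDeriv_fourierMultiplier (hasTemperateGrowth_cosSym hm t)]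
    exact hasDerivAt_re (hasDerivAt_sincSym_apply hm _ t x)
  · intro t x
    have h := hasDerivAt_re (hasDerivAt_cosSym_apply hm f t x)
    refine h.congr_deriv ?_
    rw [neg_sinSym_eq hm]
    simp [fderiv_re_schwartz, -Complex.ofReal_pow]
  · exact fun t => contDiff_re_schwartz _ 1
  · exact fun k t => contDiff_re_schwartz _ 1
  · exact fun t => (contDiff_re_schwartz _ 0).continuous
  · exact fun t x => (hMS f t x).trans (hM 0)
  · exact fun t x => (hMC f t x).trans (hM 1)
  · intro k t x
    exact (hMS _ t x).trans ((h₁ k).trans (hM 2))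
  · intro k t x
    rw [fderiv_re_schwartz, lineDeriv_fourierMultiplier (hasTemperateGrowth_cosSym hm t)]
    exact (hMC _ t x).trans ((h₂ k).trans (hM 3))
  · intro k t x
    rw [fderiv_re_schwartz, lineDeriv_fourierMultiplier (hasTemperateGrowth_sincSym hm t)]
    exact (hMS _ t x).trans ((h₃ k).trans (hM 4))

theorem fourierMultiplier_const_one (f : 𝓢(E n, ℂ)) {a : E n → ℝ} (ha : ∀ ξ, a ξ = 1) :
    fourierMultiplierCLM ℂ a f = f := by
  have : a = fun _ => 1 := funext ha
  rw [this, SchwartzMap.fourierMultiplierCLM_const]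
  simp

theorem fourierMultiplier_zero (f : 𝓢(E n, ℂ)) {a : E n → ℝ} (ha : ∀ ξ, a ξ = 0) :
    fourierMultiplierCLM ℂ a f = 0 := by
  have : a = fun _ => 0 := funext ha
  rw [this, SchwartzMap.fourierMultiplierCLM_const]
  simp

/-- At time 0 the density is (Re f)². Vanishing of the density gives vanishing of both the velocity
and, as m > 0, the solution itself. -/
theorem re_propagation (hm : 0 < m) (f : 𝓢(E n, ℂ)) {R : ℝ} (hf : ∀ x, R < ‖x‖ → f x = 0)
    (t : ℝ) {x : E n} (hx : R + 2 * Real.exp |t| ≤ ‖x‖) :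
    (fourierMultiplierCLM ℂ (sincSym m t) f x).re = 0 ∧
      (fourierMultiplierCLM ℂ (cosSym m t) f x).re = 0 := by
  obtain ⟨M, hM⟩ := isBoundedSystem_of_schwartz hm f
  have h0 := hM.density_eq_zero (R := R) (fun y hy => by
    simp only [density]
    rw [fourierMultiplier_const_one f (a := cosSym m 0) (by simp [cosSym]), hf y hy]
    simp [fourierMultiplier_zero _ (a := sincSym m 0) (by simp [sincSym])]) (abs_nonneg t) hx
  simp only [density] at h0
  have h1 : 0 ≤ ∑ k : Fin n, (fourierMultiplierCLM ℂ (sincSym m |t|)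
      (∂_{(EuclideanSpace.single k (1 : ℝ) : E n)} f) x).re ^ 2 :=
    Finset.sum_nonneg fun _ _ => sq_nonneg _
  have h2 := sq_nonneg (fourierMultiplierCLM ℂ (cosSym m |t|) f x).re
  have h3 : 0 ≤ m ^ 2 * (fourierMultiplierCLM ℂ (sincSym m |t|) f x).re ^ 2 := by positivity
  have hb : (fourierMultiplierCLM ℂ (cosSym m |t|) f x).re = 0 :=
    pow_eq_zero_iff two_ne_zero |>.1 (by linarith)
  have hu : (fourierMultiplierCLM ℂ (sincSym m |t|) f x).re = 0 := by
    have : m ^ 2 * (fourierMultiplierCLM ℂ (sincSym m |t|) f x).re ^ 2 = 0 := by linarith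
    simpa [hm.ne'] using this
  rcases abs_cases t with ⟨ht, _⟩ | ⟨ht, _⟩
  · rw [ht] at hb hu
    exact ⟨hu, hb⟩
  -- Negative times: one symbol is even in t, the other odd.
  · have hc : (cosSym m |t| : E n → ℝ) = cosSym m t := by
      funext ξ; simp [cosSym, ht]
    have hs : (sincSym m |t| : E n → ℝ) = fun ξ => -sincSym m t ξ := by
      funext ξ; simp [sincSym, ht]
    rw [hc] at hb
    rw [hs, fourierMultiplier_apply (hasTemperateGrowth_sincSym hm t).fun_neg] at hu
    rw [fourierMultiplier_apply (hasTemperateGrowth_sincSym hm t)]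
    refine ⟨?_, hb⟩
    simpa [integral_neg, smul_neg] using hu

/-! ### The flow on real test functions -/

theorem RTest.toSchwartz_apply (φ : RTest n) (x : E n) : φ.toSchwartz x = (φ x : ℂ) := rfl

theorem CTest.toSchwartz_apply (ψ : CTest n) (x : E n) : ψ.toSchwartz x = ψ x := rfl

theorem RTest.conj_toSchwartz (φ : RTest n) (x : E n) :
    (starRingEnd ℂ) (φ.toSchwartz x) = φ.toSchwartz x := by
  rw [RTest.toSchwartz_apply, Complex.conj_ofReal]

theorem RTest.toSchwartz_add (φ ψ : RTest n) :
    (φ + ψ).toSchwartz = φ.toSchwartz + ψ.toSchwartz := by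
  ext x; simp [RTest.toSchwartz_apply]

theorem RTest.toSchwartz_sub (φ ψ : RTest n) :
    (φ - ψ).toSchwartz = φ.toSchwartz - ψ.toSchwartz := by
  ext x; simp [RTest.toSchwartz_apply]

theorem RTest.toSchwartz_smul (c : ℝ) (φ : RTest n) :
    (c • φ).toSchwartz = c • φ.toSchwartz := by
  ext x; simp [RTest.toSchwartz_apply]

theorem RTest.toSchwartz_sum {ι : Type*} (s : Finset ι) (φ : ι → RTest n) :
    (∑ i ∈ s, φ i).toSchwartz = ∑ i ∈ s, (φ i).toSchwartz := by
  ext x; simp [RTest.toSchwartz_apply]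

theorem RTest.toSchwartz_lineDeriv (φ : RTest n) (v : E n) :
    RTest.toSchwartz (∂_{v} φ) = ∂_{v} φ.toSchwartz := by
  ext x
  rw [RTest.toSchwartz_apply, lineDerivOp_apply_eq_fderiv]
  have hd : DifferentiableAt ℝ φ x := (φ.contDiff.differentiable (by simp)) x
  have h1 : (∂_{v} φ) x = fderiv ℝ φ x v := by
    rw [TestFunction.lineDerivOp_eq_lineDerivCLM ℝ, TestFunction.lineDerivCLM_apply_of_le (by simp),
      hd.lineDeriv_eq_fderiv]
  have h2 := (Complex.ofRealCLM.hasFDerivAt.comp x hd.hasFDerivAt).fderiv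
  rw [h1]
  change _ = fderiv ℝ (Complex.ofRealCLM ∘ φ) x v
  rw [h2]
  rfl

open Classical in
/-- The operator with a real even symbol on real test functions (zero where it does not preserve
the compactness of the support). -/
def evol (a : E n → ℝ) (φ : RTest n) : RTest n :=
  if h : HasCompactSupport fun x => (fourierMultiplierCLM ℂ a φ.toSchwartz x).re then
    ⟨fun x => (fourierMultiplierCLM ℂ a φ.toSchwartz x).re, contDiff_re_schwartz _ ⊤, h,
      subset_univ _⟩
  else 0

/-- The symbol `a` is real even of temperate growth and its operator preserves compactness of
supports. -/
structure IsLocalSymbol (a : E n → ℝ) : Prop where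
  growth : a.HasTemperateGrowth
  even : ∀ ξ, a (-ξ) = a ξ
  compact : ∀ φ : RTest n, HasCompactSupport fun x => (fourierMultiplierCLM ℂ a φ.toSchwartz x).re

theorem IsLocalSymbol.evol_apply {a : E n → ℝ} (ha : IsLocalSymbol a) (φ : RTest n) (x : E n) :
    evol a φ x = (fourierMultiplierCLM ℂ a φ.toSchwartz x).re := by
  rw [evol, dif_pos (ha.compact φ)]; rfl

theorem IsLocalSymbol.toSchwartz_evol {a : E n → ℝ} (ha : IsLocalSymbol a) (φ : RTest n) :
    (evol a φ).toSchwartz = fourierMultiplierCLM ℂ a φ.toSchwartz := by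
  ext x
  rw [RTest.toSchwartz_apply, ha.evol_apply]
  exact Complex.conj_eq_iff_re.1
    (conj_fourierMultiplier_of_real ha.growth ha.even φ.conj_toSchwartz x)

theorem IsLocalSymbol.fourier_evol {a : E n → ℝ} (ha : IsLocalSymbol a) (φ : RTest n) (ξ : E n) :
    𝓕 (evol a φ).toSchwartz ξ = a ξ * 𝓕 φ.toSchwartz ξ := by
  rw [ha.toSchwartz_evol, fourier_fourierMultiplier ha.growth]

theorem hasCompactSupport_of_zero_outside {F : Type*} [Zero F] {f : E n → F} {R : ℝ}
    (h : ∀ x, R < ‖x‖ → f x = 0) : HasCompactSupport f :=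
  HasCompactSupport.intro (isCompact_closedBall (0 : E n) R) fun x hx => h x (by simpa using hx)

theorem RTest.exists_radius (φ : RTest n) : ∃ R, ∀ x, R < ‖x‖ → φ x = 0 := by
  obtain ⟨R, hR⟩ := φ.hasCompactSupport.isBounded.subset_closedBall (0 : E n)
  refine ⟨R, fun x hx => image_eq_zero_of_notMem_tsupport fun h => ?_⟩
  have := hR h
  simp only [Metric.mem_closedBall, dist_zero_right] at this
  linarith

theorem RTest.toSchwartz_eq_zero {φ : RTest n} {x : E n} (h : φ x = 0) : φ.toSchwartz x = 0 := by
  rw [RTest.toSchwartz_apply, h, Complex.ofReal_zero]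

theorem isLocalSymbol_cos (hm : 0 < m) (t : ℝ) : IsLocalSymbol (cosSym m t : E n → ℝ) where
  growth := hasTemperateGrowth_cosSym hm t
  even := cosSym_even m t
  compact φ := by
    obtain ⟨R, hR⟩ := φ.exists_radius
    exact hasCompactSupport_of_zero_outside fun x hx => (re_propagation hm φ.toSchwartz
      (fun y hy => RTest.toSchwartz_eq_zero (hR y hy)) t (le_of_lt hx)).2

theorem isLocalSymbol_sinc (hm : 0 < m) (t : ℝ) : IsLocalSymbol (sincSym m t : E n → ℝ) where
  growth := hasTemperateGrowth_sincSym hm t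
  even := sincSym_even m t
  compact φ := by
    obtain ⟨R, hR⟩ := φ.exists_radius
    exact hasCompactSupport_of_zero_outside fun x hx => (re_propagation hm φ.toSchwartz
      (fun y hy => RTest.toSchwartz_eq_zero (hR y hy)) t (le_of_lt hx)).1

/-- The operator `Δ - m²` on real test functions. -/
def kgOp (m : ℝ) (φ : RTest n) : RTest n :=
  ∑ k : Fin n, ∂_{(EuclideanSpace.single k (1 : ℝ) : E n)}
    (∂_{(EuclideanSpace.single k (1 : ℝ) : E n)} φ) - m ^ 2 • φ

theorem fourier_kgOp (φ : RTest n) (ξ : E n) :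
    𝓕 (kgOp m φ).toSchwartz ξ = -(disp m ξ ^ 2 : ℝ) * 𝓕 φ.toSchwartz ξ := by
  rw [kgOp, RTest.toSchwartz_sub, RTest.toSchwartz_sum, RTest.toSchwartz_smul,
    fourier_sub_schwartz, FourierTransform.fourier_smul, FourierTransform.fourier_sum]
  simp only [RTest.toSchwartz_lineDeriv, sub_apply, smul_apply, sum_apply]
  rw [fourier_sum_lineDeriv, disp_sq, Complex.real_smul]
  push_cast
  ring

/-- The symbol ω sin(tω) is ω² times sin(tω)/ω, and ω² is the symbol of the local operator m² - Δ.
Propagation of supports for the third symbol thus follows from that for the second. -/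
theorem sinSym_eq (hm : 0 < m) (t : ℝ) (φ : RTest n) :
    fourierMultiplierCLM ℂ (sinSym m t) φ.toSchwartz =
      fourierMultiplierCLM ℂ (sincSym m t) (-kgOp m φ).toSchwartz := by
  refine schwartz_ext_fourier fun ξ => ?_
  have hneg : (-kgOp m φ).toSchwartz = -(kgOp m φ).toSchwartz := by
    ext x; simp [RTest.toSchwartz_apply]
  have h1 : sinSym m t ξ = disp m ξ ^ 2 * sincSym m t ξ := by
    have := (disp_pos hm ξ).ne'
    simp only [sinSym, sincSym]
    field_simp
  rw [fourier_fourierMultiplier (hasTemperateGrowth_sinSym hm t),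
    fourier_fourierMultiplier (hasTemperateGrowth_sincSym hm t), hneg,
    FourierTransform.fourier_neg, neg_apply, fourier_kgOp, h1]
  push_cast
  ring

theorem isLocalSymbol_sin (hm : 0 < m) (t : ℝ) : IsLocalSymbol (sinSym m t : E n → ℝ) where
  growth := hasTemperateGrowth_sinSym hm t
  even := sinSym_even m t
  compact φ := by
    rw [sinSym_eq hm]
    exact (isLocalSymbol_sinc hm t).compact _

/-! ### Duality: solutions expressed through the initial state -/

theorem enorm_integral_smul_sq_le {u : E n → ℂ} {R B : ℝ} (ψ : RTest n)
    (hu : AEStronglyMeasurable u (volume.restrict (Metric.ball 0 R)))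
    (hψ : ∀ x, ψ x ≠ 0 → ‖x‖ < R) (hB : ∀ x, |ψ x| ≤ B) :
    ‖∫ x, ψ x • u x‖ₑ ^ 2 ≤ ENNReal.ofReal B ^ 2 * volume (Metric.ball (0 : E n) R) *
      ∫⁻ x in Metric.ball 0 R, ‖u x‖ₑ ^ 2 := by
  have h1 : ∫ x, ψ x • u x = ∫ x in Metric.ball 0 R, ψ x • u x := by
    refine (setIntegral_eq_integral_of_forall_compl_eq_zero fun x hx => ?_).symm
    have : ψ x = 0 := by
      by_contra h
      exact hx (by simpa using hψ x h)
    rw [this, zero_smul]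
  have h2 : ‖∫ x, ψ x • u x‖ₑ ≤ ENNReal.ofReal B * ∫⁻ x in Metric.ball 0 R, ‖u x‖ₑ := by
    rw [h1, ← lintegral_const_mul' _ _ ENNReal.ofReal_ne_top]
    refine (enorm_integral_le_lintegral_enorm _).trans (lintegral_mono fun x => ?_)
    rw [enorm_smul]
    gcongr
    rw [Real.enorm_eq_ofReal_abs]
    exact ENNReal.ofReal_le_ofReal (hB x)
  have h3 : (∫⁻ x in Metric.ball 0 R, ‖u x‖ₑ) ^ 2 ≤
      volume (Metric.ball (0 : E n) R) * ∫⁻ x in Metric.ball 0 R, ‖u x‖ₑ ^ 2 := by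
    have := ENNReal.lintegral_mul_le_Lp_mul_Lq (volume.restrict (Metric.ball (0 : E n) R))
      (Real.HolderConjugate.two_two) (f := fun _ => 1) (g := fun x => ‖u x‖ₑ)
      aemeasurable_const hu.enorm
    simp only [Pi.mul_apply, one_mul, lintegral_const, Measure.restrict_apply_univ,
      ENNReal.rpow_two, one_pow] at this
    calc _ ≤ (volume (Metric.ball (0 : E n) R) ^ (1 / 2 : ℝ) *
          (∫⁻ x in Metric.ball 0 R, ‖u x‖ₑ ^ 2) ^ (1 / 2 : ℝ)) ^ 2 := by gcongr
      _ = _ := by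
        rw [mul_pow, ← ENNReal.rpow_two, ← ENNReal.rpow_two, ← ENNReal.rpow_mul, ← ENNReal.rpow_mul]
        norm_num
  calc ‖∫ x, ψ x • u x‖ₑ ^ 2 ≤ (ENNReal.ofReal B * ∫⁻ x in Metric.ball 0 R, ‖u x‖ₑ) ^ 2 := by
        gcongr
    _ ≤ ENNReal.ofReal B ^ 2 * (volume (Metric.ball (0 : E n) R) *
        ∫⁻ x in Metric.ball 0 R, ‖u x‖ₑ ^ 2) := by rw [mul_pow]; gcongr
    _ = _ := by ring

/-- Cauchy–Schwarz on the ball. The summand m⁻² accounts for the factor m² with which u enters the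
energy. -/
theorem enorm_apply_sq_le (hm : 0 < m) (Z : State n) (i : Fin 2) {R B : ℝ} (hR : 0 < R)
    (hB0 : 0 < B) (ψ : RTest n) (hψ : ∀ x, ψ x ≠ 0 → ‖x‖ < R) (hB : ∀ x, |ψ x| ≤ B) :
    ‖Z i ψ‖ₑ ^ 2 ≤ ENNReal.ofReal B ^ 2 * volume (Metric.ball (0 : E n) R) *
      (1 + ENNReal.ofReal (m ^ 2)⁻¹) * localEnergy m R Z := by
  have hV := (measure_ball_lt_top (μ := volume) (x := (0 : E n)) (r := R)).ne
  have hV0 := (Metric.measure_ball_pos volume (0 : E n) hR).ne'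
  set K := ENNReal.ofReal B ^ 2 * volume (Metric.ball (0 : E n) R) with hK
  have hKt : K ≠ ⊤ := ENNReal.mul_ne_top (by finiteness) hV
  have hK0 : K ≠ 0 := mul_ne_zero (by simpa using hB0) hV0
  have hc : K * (1 + ENNReal.ofReal (m ^ 2)⁻¹) ≠ ⊤ := by finiteness
  have hc0 : K * (1 + ENNReal.ofReal (m ^ 2)⁻¹) ≠ 0 := mul_ne_zero hK0 (by simp)
  -- The constant, positive and finite, is divided out so that the infimum over representations
  -- stands alone on the right.
  rw [localEnergy, mul_comm, ← ENNReal.div_le_iff_le_mul (Or.inl hc0) (Or.inl hc)]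
  refine le_iInf fun u => le_iInf fun v => le_iInf fun g => le_iInf fun hrep => ?_
  rw [ENNReal.div_le_iff_le_mul (Or.inl hc0) (Or.inl hc), mul_comm, mul_assoc]
  have hu := enorm_integral_smul_sq_le ψ (hrep.memLp_u R).1 hψ hB
  have hv := enorm_integral_smul_sq_le ψ (hrep.memLp_v R).1 hψ hB
  set I := ∫⁻ x in Metric.ball 0 R,
      (‖v x‖ₑ ^ 2 + ∑ k, ‖g k x‖ₑ ^ 2 + ENNReal.ofReal (m ^ 2) * ‖u x‖ₑ ^ 2) with hI
  fin_cases i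
  · change ‖Z 0 ψ‖ₑ ^ 2 ≤ _
    rw [hrep.rep_u]
    refine hu.trans (mul_le_mul_right ?_ K)
    have hmm : ENNReal.ofReal (m ^ 2)⁻¹ * ENNReal.ofReal (m ^ 2) = 1 := by
      rw [← ENNReal.ofReal_mul (by positivity), inv_mul_cancel₀ (by positivity), ENNReal.ofReal_one]
    calc ∫⁻ x in Metric.ball 0 R, ‖u x‖ₑ ^ 2
        = ENNReal.ofReal (m ^ 2)⁻¹ *
          ∫⁻ x in Metric.ball 0 R, ENNReal.ofReal (m ^ 2) * ‖u x‖ₑ ^ 2 := by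
          rw [lintegral_const_mul' _ _ ENNReal.ofReal_ne_top, ← mul_assoc, hmm, one_mul]
      _ ≤ ENNReal.ofReal (m ^ 2)⁻¹ * I :=
          mul_le_mul_right (lintegral_mono fun x => le_add_self) _
      _ ≤ _ := mul_le_mul_left le_add_self I
  · change ‖Z 1 ψ‖ₑ ^ 2 ≤ _
    rw [hrep.rep_v]
    refine hv.trans (mul_le_mul_right ?_ K)
    calc ∫⁻ x in Metric.ball 0 R, ‖v x‖ₑ ^ 2 ≤ I := by
          refine lintegral_mono fun x => ?_
          rw [add_assoc]
          exact le_self_add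
      _ ≤ _ := le_mul_of_one_le_left' le_self_add

theorem lintegral_enorm_sq_lt_top {u : E n → ℂ} {μ : Measure (E n)} (hu : MemLp u 2 μ) :
    ∫⁻ x, ‖u x‖ₑ ^ 2 ∂μ < ⊤ := by
  have := lintegral_rpow_enorm_lt_top_of_eLpNorm_lt_top two_ne_zero ENNReal.ofNat_ne_top hu.2
  simpa using this

theorem localEnergy_lt_top {Y : State n} (hY : Y ∈ phaseSpace n) (R : ℝ) :
    localEnergy m R Y < ⊤ := by
  obtain ⟨u, v, g, h⟩ := hY
  unfold localEnergy
  refine (iInf₂_le_of_le u v (iInf₂_le_of_le g h le_rfl)).trans_lt ?_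
  have hg : ∀ k ∈ Finset.univ, AEMeasurable (fun x => ‖g k x‖ₑ ^ 2)
      (volume.restrict (Metric.ball 0 R)) := fun k _ => (h.memLp_g k R).1.enorm.pow_const 2
  have hv : AEMeasurable (fun x => ‖v x‖ₑ ^ 2) (volume.restrict (Metric.ball 0 R)) :=
    (h.memLp_v R).1.enorm.pow_const 2
  rw [lintegral_add_left' (by exact hv.add (Finset.aemeasurable_fun_sum _ hg)), lintegral_add_left' hv,
    lintegral_finsetSum' _ hg, lintegral_const_mul' _ _ ENNReal.ofReal_ne_top]
  refine ENNReal.add_lt_top.2 ⟨ENNReal.add_lt_top.2 ⟨lintegral_enorm_sq_lt_top (h.memLp_v R),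
    ENNReal.sum_lt_top.2 fun k _ => lintegral_enorm_sq_lt_top (h.memLp_g k R)⟩,
    ENNReal.mul_lt_top ENNReal.ofReal_lt_top (lintegral_enorm_sq_lt_top (h.memLp_u R))⟩

/-- The constant of the estimate of `Z i ψ` by the local energy. -/
def energyConst (n : ℕ) (m R : ℝ) : ℝ :=
  √((volume (Metric.ball (0 : E n) R) * (1 + ENNReal.ofReal (m ^ 2)⁻¹)).toReal)

theorem norm_apply_le (hm : 0 < m) {Z : State n} (i : Fin 2) {R B : ℝ} (hR : 0 < R)
    (hB0 : 0 < B) {ψ : RTest n} (hψ : ∀ x, ψ x ≠ 0 → ‖x‖ < R) (hB : ∀ x, |ψ x| ≤ B)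
    (hZ : localEnergy m R Z < ⊤) :
    ‖Z i ψ‖ ≤ energyConst n m R * √((localEnergy m R Z).toReal) * B := by
  have h := enorm_apply_sq_le hm Z i hR hB0 ψ hψ hB
  have hV := (measure_ball_lt_top (μ := volume) (x := (0 : E n)) (r := R)).ne
  rw [mul_assoc (ENNReal.ofReal B ^ 2)] at h
  have hfin : ENNReal.ofReal B ^ 2 * (volume (Metric.ball (0 : E n) R) *
      (1 + ENNReal.ofReal (m ^ 2)⁻¹)) * localEnergy m R Z ≠ ⊤ := by
    refine ENNReal.mul_ne_top (ENNReal.mul_ne_top (by finiteness) (ENNReal.mul_ne_top hV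
      (by finiteness))) hZ.ne
  have h2 := ENNReal.toReal_mono hfin h
  rw [ENNReal.toReal_mul, ENNReal.toReal_mul, ENNReal.toReal_pow, ENNReal.toReal_pow,
    toReal_enorm, ENNReal.toReal_ofReal hB0.le] at h2
  refine le_of_sq_le_sq ?_ (by unfold energyConst; positivity)
  rw [mul_pow, mul_pow, energyConst, Real.sq_sqrt ENNReal.toReal_nonneg,
    Real.sq_sqrt ENNReal.toReal_nonneg]
  linarith

/-- A state of finite local energy is continuous in the sup norm of test functions supported in a
fixed ball, so a sup-norm Taylor estimate for the test functions suffices. -/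
theorem hasDerivAt_apply_moving (hm : 0 < m) {Z : State n} (i : Fin 2) {R M s : ℝ} (hR : 0 < R)
    (hZ : localEnergy m R Z < ⊤) {p : ℝ → RTest n} {p' : RTest n}
    (hp : ∀ h x, |h| ≤ 1 → p (s + h) x ≠ 0 → ‖x‖ < R) (hp' : ∀ x, p' x ≠ 0 → ‖x‖ < R)
    (htay : ∀ h x, |p (s + h) x - p s x - h * p' x| ≤ M * h ^ 2) :
    HasDerivAt (fun τ => Z i (p τ)) (Z i p') s := by
  have hM0 : 0 ≤ M := by simpa using (abs_nonneg _).trans (htay 1 0)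
  refine hasDerivAt_of_taylor (M := energyConst n m R * √((localEnergy m R Z).toReal) * (M + 1)) ?_
  filter_upwards [Metric.ball_mem_nhds (0 : ℝ) one_pos] with h hh
  have hh1 : |h| ≤ 1 := by simpa using (le_of_lt (Metric.mem_ball.1 hh))
  by_cases h0 : h = 0
  · simp [h0]
  have key : Z i (p (s + h)) - Z i (p s) - h • Z i p' = Z i (p (s + h) - p s - h • p') := by
    rw [map_sub, map_sub, map_smul]
  rw [key, mul_assoc]
  have hh2 : 0 < h ^ 2 := by positivity
  refine norm_apply_le hm i hR (by positivity) (fun x hx => ?_) (fun x => ?_) hZ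
  · by_contra hlt
    have e1 : p (s + h) x = 0 := by_contra fun hne => hlt (hp h x hh1 hne)
    have e2 : p s x = 0 := by
      have := by_contra fun hne => hlt (hp 0 x (by simp) hne)
      simpa using this
    have e3 : p' x = 0 := by_contra fun hne => hlt (hp' x hne)
    exact hx (by simp [e1, e2, e3])
  · refine le_trans ?_ ((htay h x).trans (by nlinarith))
    simp

/-- A product rule. Besides the two one-sided variations there is the term (Z(τ) - Z(s)) applied to
p(τ) - p(s); it is o(τ - s), because the test function is O(τ - s) and the local energy of the
difference of states tends to 0. -/
theorem hasDerivAt_moving (hm : 0 < m) {Z : ℝ → State n} (i : Fin 2) {R M s : ℝ} (hR : 0 < R)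
    (hZ : localEnergy m R (Z s) < ⊤)
    (hcont : Tendsto (fun t => localEnergy m R (Z t - Z s)) (𝓝 s) (𝓝 0))
    {p : ℝ → RTest n} {p' : RTest n} {D : ℂ} (hD : HasDerivAt (fun τ => Z τ i (p s)) D s)
    (hp : ∀ h x, |h| ≤ 1 → p (s + h) x ≠ 0 → ‖x‖ < R) (hp' : ∀ x, p' x ≠ 0 → ‖x‖ < R)
    (htay : ∀ h x, |p (s + h) x - p s x - h * p' x| ≤ M * h ^ 2) :
    HasDerivAt (fun τ => Z τ i (p τ)) (D + Z s i p') s := by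
  have hM0 : 0 ≤ M := by simpa using (abs_nonneg _).trans (htay 1 0)
  obtain ⟨B, hB⟩ := p'.hasCompactSupport.exists_bound_of_continuous p'.continuous
  have hB0 : 0 ≤ B := (norm_nonneg _).trans (hB 0)
  have h2 := hasDerivAt_apply_moving hm (Z := Z s) i hR hZ hp hp' htay
  have h3 : HasDerivAt (fun τ => (Z τ - Z s) i (p τ - p s)) 0 s := by
    rw [hasDerivAt_iff_isLittleO_nhds_zero]
    simp only [sub_self, map_zero, sub_zero, smul_zero]
    rw [Asymptotics.isLittleO_iff]
    intro c hc
    have hlim : Tendsto (fun h => energyConst n m R *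
        √((localEnergy m R (Z (s + h) - Z s)).toReal) * (M + B + 1)) (𝓝 0) (𝓝 0) := by
      have h1 : Tendsto (fun h : ℝ => s + h) (𝓝 0) (𝓝 s) := by
        have : Continuous fun h : ℝ => s + h := by fun_prop
        simpa using this.tendsto 0
      have h2 := (ENNReal.tendsto_toReal ENNReal.zero_ne_top).comp (hcont.comp h1)
      have h3 := ((Real.continuous_sqrt.tendsto _).comp h2).const_mul (energyConst n m R)
      simpa using h3.mul_const (M + B + 1)
    have hfin : ∀ᶠ h in 𝓝 (0 : ℝ), localEnergy m R (Z (s + h) - Z s) < ⊤ := by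
      have h1 : Tendsto (fun h : ℝ => s + h) (𝓝 0) (𝓝 s) := by
        have : Continuous fun h : ℝ => s + h := by fun_prop
        simpa using this.tendsto 0
      exact (hcont.comp h1).eventually (gt_mem_nhds ENNReal.zero_lt_top)
    filter_upwards [Metric.ball_mem_nhds (0 : ℝ) one_pos, hfin, hlim.eventually (gt_mem_nhds hc)]
      with h hh hf hlt
    have hh1 : |h| ≤ 1 := by simpa using (le_of_lt (Metric.mem_ball.1 hh))
    by_cases h0 : h = 0
    · simp [h0]
    have hpos : 0 < |h| := abs_pos.2 h0
    refine (norm_apply_le hm i hR (B := (M + B + 1) * |h|) (by positivity) (fun x hx => ?_)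
      (fun x => ?_) hf).trans ?_
    · by_contra hlt
      have e1 : p (s + h) x = 0 := by_contra fun hne => hlt (hp h x hh1 hne)
      have e2 : p s x = 0 := by
        have := by_contra fun hne => hlt (hp 0 x (by simp) hne)
        simpa using this
      exact hx (by simp [e1, e2])
    · have e : (p (s + h) - p s) x = (p (s + h) x - p s x - h * p' x) + h * p' x := by simp
      rw [e]
      refine (abs_add_le _ _).trans ?_
      have e1 := htay h x
      have e2 : |h * p' x| ≤ |h| * B := by
        rw [abs_mul]; exact mul_le_mul_of_nonneg_left (hB x) (abs_nonneg _)
      have e3 : M * h ^ 2 ≤ M * |h| := by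
        refine mul_le_mul_of_nonneg_left ?_ hM0
        rw [← sq_abs]; nlinarith
      nlinarith
    · rw [← mul_assoc]
      exact mul_le_mul_of_nonneg_right hlt.le (norm_nonneg h)
  have h4 := (hD.add h2).add h3
  have h5 := h4.sub (hasDerivAt_const s (Z s i (p s)))
  rw [sub_zero, add_zero] at h5
  refine h5.congr_of_eventuallyEq (Eventually.of_forall fun τ => ?_)
  change Z τ i (p τ) = Z τ i (p s) + Z s i (p τ) + (Z τ - Z s) i (p τ - p s) - Z s i (p s)
  rw [State.apply_sub, sub_apply, map_sub, map_sub]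
  ring

theorem distrLaplacian_apply (u : Distr n) (φ : RTest n) :
    distrLaplacian u φ - (m : ℂ) ^ 2 * u φ = u (kgOp m φ) := by
  have h1 : ∀ k : Fin n, (∂_{(EuclideanSpace.single k (1 : ℝ) : E n)}
      (∂_{(EuclideanSpace.single k (1 : ℝ) : E n)} u)) φ =
      u (∂_{(EuclideanSpace.single k (1 : ℝ) : E n)}
        (∂_{(EuclideanSpace.single k (1 : ℝ) : E n)} φ)) := fun k => by
    rw [Distribution.lineDerivOp_apply_apply, Distribution.lineDerivOp_apply_apply,
      LineDeriv.lineDerivOp_neg, neg_neg]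
  rw [distrLaplacian, sum_apply, kgOp, map_sub, map_sum, map_smul]
  simp only [h1]
  rw [Complex.real_smul]
  push_cast
  rfl

/-! ### Solutions as functionals of their initial states -/

section Formula

variable (hm : 0 < m) {Y : ℝ → State n} (hY : IsKGSolution m Y)

theorem evol_ne_zero_norm_lt (hm : 0 < m) {φ : RTest n} {R₀ T t : ℝ}
    (hR₀ : ∀ x, R₀ < ‖x‖ → φ x = 0) (ht : |t| ≤ T) (x : E n)
    (hx : evol (cosSym m t) φ x ≠ 0 ∨ evol (sincSym m t) φ x ≠ 0) :
    ‖x‖ < R₀ + 2 * Real.exp T := by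
  by_contra! hlt
  have h := re_propagation hm φ.toSchwartz (fun y hy => RTest.toSchwartz_eq_zero (hR₀ y hy)) t
    (x := x) ((add_le_add_right (mul_le_mul_of_nonneg_left (Real.exp_le_exp.2 ht) zero_le_two)
      R₀).trans hlt)
  rw [← (isLocalSymbol_cos hm t).evol_apply, ← (isLocalSymbol_sinc hm t).evol_apply] at h
  tauto

theorem evol_sin_ne_zero_norm_lt (hm : 0 < m) {φ : RTest n} {R₀ T t : ℝ}
    (hR₀ : ∀ x, R₀ < ‖x‖ → kgOp m φ x = 0) (ht : |t| ≤ T) (x : E n)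
    (hx : evol (sinSym m t) φ x ≠ 0) : ‖x‖ < R₀ + 2 * Real.exp T := by
  rw [(isLocalSymbol_sin hm t).evol_apply, sinSym_eq hm,
    ← (isLocalSymbol_sinc hm t).evol_apply] at hx
  exact evol_ne_zero_norm_lt hm (φ := -kgOp m φ) (fun x hx => by simp [hR₀ x hx]) ht x (Or.inr hx)

theorem evol_taylor_sinc (hm : 0 < m) (φ : RTest n) (t h : ℝ) (x : E n) :
    |evol (sincSym m (t + h)) φ x - evol (sincSym m t) φ x - h * evol (cosSym m t) φ x| ≤
      (∫ ξ, disp m ξ * ‖𝓕 φ.toSchwartz ξ‖) * h ^ 2 := by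
  simp only [(isLocalSymbol_cos hm _).evol_apply, (isLocalSymbol_sinc hm _).evol_apply]
  refine le_trans ?_ (sincSym_taylor hm φ.toSchwartz t h x)
  refine le_trans (le_of_eq ?_) (Complex.abs_re_le_norm _)
  simp

theorem evol_taylor_cos (hm : 0 < m) (φ : RTest n) (t h : ℝ) (x : E n) :
    |evol (cosSym m (t + h)) φ x - evol (cosSym m t) φ x - h * -evol (sinSym m t) φ x| ≤
      (∫ ξ, disp m ξ ^ 2 * ‖𝓕 φ.toSchwartz ξ‖) * h ^ 2 := by
  simp only [(isLocalSymbol_cos hm _).evol_apply, (isLocalSymbol_sin hm _).evol_apply]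
  refine le_trans ?_ (cosSym_taylor hm φ.toSchwartz t h x)
  refine le_trans (le_of_eq ?_) (Complex.abs_re_le_norm _)
  have : fourierMultiplierCLM ℂ (fun ξ => -sinSym m t ξ) φ.toSchwartz x =
      -fourierMultiplierCLM ℂ (sinSym m t) φ.toSchwartz x := by
    rw [fourierMultiplier_apply (hasTemperateGrowth_sinSym hm t).fun_neg,
      fourierMultiplier_apply (hasTemperateGrowth_sinSym hm t), ← integral_neg]
    congr 1 with ξ
    simp
  rw [this]
  simp

theorem kgOp_evol_sinc (hm : 0 < m) (φ : RTest n) (t : ℝ) :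
    kgOp m (evol (sincSym m t) φ) = -evol (sinSym m t) φ := by
  have h : (kgOp m (evol (sincSym m t) φ)).toSchwartz = (-evol (sinSym m t) φ).toSchwartz := by
    refine schwartz_ext_fourier fun ξ => ?_
    have hneg : (-evol (sinSym m t) φ).toSchwartz = -(evol (sinSym m t) φ).toSchwartz := by
      ext x; simp [RTest.toSchwartz_apply]
    rw [fourier_kgOp, (isLocalSymbol_sinc hm t).fourier_evol, hneg, FourierTransform.fourier_neg,
      neg_apply, (isLocalSymbol_sin hm t).fourier_evol]
    have h1 : sinSym m t ξ = disp m ξ ^ 2 * sincSym m t ξ := by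
      have := (disp_pos hm ξ).ne'
      simp only [sinSym, sincSym]
      field_simp
    rw [h1]
    push_cast
    ring
  ext x
  have := congrArg (fun f : 𝓢(E n, ℂ) => (f x).re) h
  simpa [RTest.toSchwartz_apply] using this

include hm in
theorem exists_radius_flow (φ : RTest n) (T : ℝ) : ∃ R, 0 < R ∧ ∀ t, |t| ≤ T → ∀ x,
    (evol (cosSym m t) φ x ≠ 0 ∨ evol (sincSym m t) φ x ≠ 0 ∨ evol (sinSym m t) φ x ≠ 0) →
      ‖x‖ < R := by
  obtain ⟨R₁, hR₁⟩ := φ.exists_radius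
  obtain ⟨R₂, hR₂⟩ := (kgOp m φ).exists_radius
  refine ⟨max 1 (max (R₁ + 2 * Real.exp T) (R₂ + 2 * Real.exp T)), by simp, fun t ht x hx => ?_⟩
  rcases hx with hx | hx | hx
  · exact lt_max_of_lt_right (lt_max_of_lt_left (evol_ne_zero_norm_lt hm hR₁ ht x (Or.inl hx)))
  · exact lt_max_of_lt_right (lt_max_of_lt_left (evol_ne_zero_norm_lt hm hR₁ ht x (Or.inr hx)))
  · exact lt_max_of_lt_right (lt_max_of_lt_right (evol_sin_ne_zero_norm_lt hm hR₂ ht x hx))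

theorem evol_cos_zero (hm : 0 < m) (φ : RTest n) : evol (cosSym m 0) φ = φ := by
  ext x
  rw [(isLocalSymbol_cos hm 0).evol_apply, fourierMultiplier_const_one _ (by simp [cosSym])]
  simp [RTest.toSchwartz_apply]

theorem evol_sinc_zero (hm : 0 < m) (φ : RTest n) : evol (sincSym m 0) φ = 0 := by
  ext x
  rw [(isLocalSymbol_sinc hm 0).evol_apply, fourierMultiplier_zero _ (by simp [sincSym])]
  simp

-- Holmgren's duality: the solution at time τ, paired with the adjoint flow for the remaining time t
-- - τ, does not depend on τ. The values τ = t and τ = 0 give the two sides.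
include hm hY in
theorem solution_apply_zero (φ : RTest n) (t : ℝ) :
    Y t 0 φ = Y 0 0 (evol (cosSym m t) φ) + Y 0 1 (evol (sincSym m t) φ) := by
  have hderiv : ∀ s, HasDerivAt (fun τ => Y τ 0 (evol (cosSym m (t - τ)) φ) +
      Y τ 1 (evol (sincSym m (t - τ)) φ)) 0 s := by
    intro s
    obtain ⟨R, hR, hsupp⟩ := exists_radius_flow hm φ (|t - s| + 1)
    have habs : ∀ h : ℝ, |h| ≤ 1 → |t - (s + h)| ≤ |t - s| + 1 := fun h hh => by
      rw [← sub_sub]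
      exact (abs_sub _ _).trans (by linarith)
    have hts : |t - s| ≤ |t - s| + 1 := by linarith
    have h1 := hasDerivAt_moving hm (Z := Y) 0 hR (localEnergy_lt_top (hY.mem s) R)
      (hY.continuous R s) (p := fun τ => evol (cosSym m (t - τ)) φ)
      (p' := evol (sinSym m (t - s)) φ) (M := ∫ ξ, disp m ξ ^ 2 * ‖𝓕 φ.toSchwartz ξ‖)
      (hY.deriv_zero _ s)
      (fun h x hh hx => hsupp _ (habs h hh) x (Or.inl hx))
      (fun x hx => hsupp _ hts x (Or.inr (Or.inr hx)))
      (fun h x => by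
        have := evol_taylor_cos hm φ (t - s) (-h) x
        rw [show t - s + -h = t - (s + h) by ring, neg_mul_neg, neg_sq] at this
        exact this)
    have h2 := hasDerivAt_moving hm (Z := Y) 1 hR (localEnergy_lt_top (hY.mem s) R)
      (hY.continuous R s) (p := fun τ => evol (sincSym m (t - τ)) φ)
      (p' := -evol (cosSym m (t - s)) φ) (M := ∫ ξ, disp m ξ * ‖𝓕 φ.toSchwartz ξ‖)
      (hY.deriv_one _ s)
      (fun h x hh hx => hsupp _ (habs h hh) x (Or.inr (Or.inl hx)))
      (fun x hx => hsupp _ hts x (Or.inl (by simpa using hx)))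
      (fun h x => by
        have := evol_taylor_sinc hm φ (t - s) (-h) x
        rw [show t - s + -h = t - (s + h) by ring, neg_sq] at this
        simpa using this)
    refine (h1.add h2).congr_deriv ?_
    rw [distrLaplacian_apply, kgOp_evol_sinc hm, map_neg, map_neg]
    ring
  have hconst := is_const_of_deriv_eq_zero (fun s => (hderiv s).differentiableAt)
    (fun s => (hderiv s).deriv) t 0
  simp only [sub_self, sub_zero] at hconst
  rw [evol_cos_zero hm, evol_sinc_zero hm, map_zero, add_zero] at hconst
  exact hconst

-- The first formula is differentiated in t, now with the fixed initial state and moving test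
-- functions, and compared with the equation u̇ = v.
include hm hY in
theorem solution_apply_one (φ : RTest n) (t : ℝ) :
    Y t 1 φ = -Y 0 0 (evol (sinSym m t) φ) + Y 0 1 (evol (cosSym m t) φ) := by
  obtain ⟨R, hR, hsupp⟩ := exists_radius_flow hm φ (|t| + 1)
  have habs : ∀ h : ℝ, |h| ≤ 1 → |t + h| ≤ |t| + 1 := fun h hh =>
    (abs_add_le _ _).trans (by linarith)
  have hts : |t| ≤ |t| + 1 := by linarith
  have h1 := hasDerivAt_apply_moving hm (Z := Y 0) 0 hR (localEnergy_lt_top (hY.mem 0) R) (s := t)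
      (p := fun τ => evol (cosSym m τ) φ)
      (p' := -evol (sinSym m t) φ) (M := ∫ ξ, disp m ξ ^ 2 * ‖𝓕 φ.toSchwartz ξ‖)
      (fun h x hh hx => hsupp _ (habs h hh) x (Or.inl hx))
      (fun x hx => hsupp _ hts x (Or.inr (Or.inr (by simpa using hx))))
      (fun h x => by simpa using evol_taylor_cos hm φ t h x)
  have h2 := hasDerivAt_apply_moving hm (Z := Y 0) 1 hR (localEnergy_lt_top (hY.mem 0) R) (s := t)
      (p := fun τ => evol (sincSym m τ) φ)
      (p' := evol (cosSym m t) φ) (M := ∫ ξ, disp m ξ * ‖𝓕 φ.toSchwartz ξ‖)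
      (fun h x hh hx => hsupp _ (habs h hh) x (Or.inr (Or.inl hx)))
      (fun x hx => hsupp _ hts x (Or.inl hx))
      (fun h x => evol_taylor_sinc hm φ t h x)
  have h3 := hY.deriv_zero φ t
  have h4 : (fun τ => Y τ 0 φ) = fun τ => Y 0 0 (evol (cosSym m τ) φ) +
      Y 0 1 (evol (sincSym m τ) φ) := funext fun τ => solution_apply_zero hm hY φ τ
  rw [h4] at h3
  rw [h3.unique (h1.add h2), map_neg]

end Formula

open FourierTransform SchwartzMap Real ComplexConjugate

/-! ### Translation-invariant forms and the Fourier transform of their kernels -/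

/-- The Fourier transform of a real function. -/
def four (p : E n → ℝ) (ξ : E n) : ℂ := 𝓕 (fun z => (p z : ℂ)) ξ

/-- The bilinear form with the kernel `p(x - y)`. -/
def kform (p : E n → ℝ) (φ ψ : RTest n) : ℝ := ∫ x, ∫ y, φ x * p (x - y) * ψ y

theorem continuous_four {p : E n → ℝ} (hp : Integrable p) : Continuous (four p) :=
  VectorFourier.fourierIntegral_continuous Real.continuous_fourierChar
    (by exact continuous_inner) hp.ofReal

theorem norm_four_le (p : E n → ℝ) (ξ : E n) : ‖four p ξ‖ ≤ ∫ z, |p z| := by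
  rw [four, Real.fourier_eq]
  refine (norm_integral_le_integral_norm _).trans_eq ?_
  simp [Circle.norm_smul]

theorem integral_fourier_mul_flip {f g : E n → ℂ} (hf : Integrable f) (hg : Integrable g) :
    ∫ ξ, 𝓕 f ξ * g ξ = ∫ x, f x * 𝓕 g x := by
  simpa using! VectorFourier.integral_bilin_fourierIntegral_eq_flip (ContinuousLinearMap.mul ℂ ℂ)
    (L := innerₗ (E n)) continuous_fourierChar continuous_inner hf hg

theorem integral_mul_eq_fourier (φ : RTest n) {g : E n → ℂ} (hg : Integrable g) :
    ∫ x, (φ x : ℂ) * g x = ∫ ξ, conj (𝓕 φ.toSchwartz ξ) * 𝓕 g ξ := by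
  have h := integral_fourier_mul_flip (𝓕⁻ φ.toSchwartz).integrable hg
  have h1 : 𝓕 (⇑(𝓕⁻ φ.toSchwartz : 𝓢(E n, ℂ))) = φ.toSchwartz := by
    rw [← fourier_coe, FourierTransform.fourier_fourierInv_eq]
  rw [h1] at h
  refine (integral_congr_ae (ae_of_all _ fun x => rfl)).trans
    (h.trans (integral_congr_ae (ae_of_all _ fun ξ => ?_)))
  beta_reduce
  rw [fourier_coe, conj_fourier_of_real φ.conj_toSchwartz, fourierInv_coe,
    Real.fourierInv_eq_fourier_neg]

theorem fourier_convolution_test {p : E n → ℝ} (hp : Integrable p) (ψ : RTest n) :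
    Integrable (fun x => ((∫ y, p (x - y) * ψ y : ℝ) : ℂ)) ∧
      ∀ ξ, 𝓕 (fun x => ((∫ y, p (x - y) * ψ y : ℝ) : ℂ)) ξ =
        four p ξ * 𝓕 ψ.toSchwartz ξ := by
  have h1 : (fun x => ((∫ y, p (x - y) * ψ y : ℝ) : ℂ)) =
      convolution (fun z => (p z : ℂ)) ψ.toSchwartz (ContinuousLinearMap.mul ℂ ℂ) volume := by
    funext x
    rw [convolution_def, ← integral_complex_ofReal, ← integral_sub_left_eq_self _ _ x]
    refine integral_congr_ae (ae_of_all _ fun y => ?_)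
    simp [RTest.toSchwartz_apply]
  rw [h1]
  refine ⟨hp.ofReal.integrable_convolution _ ψ.toSchwartz.integrable, fun ξ => ?_⟩
  exact Real.fourier_mul_convolution_eq (f₁ := fun z => (p z : ℂ)) hp.ofReal
    ψ.toSchwartz.integrable ξ

/-- The inner integral is a convolution, whose transform is a product; Parseval's identity does the
rest. -/
theorem kform_eq_fourier {p : E n → ℝ} (hp : Integrable p) (φ ψ : RTest n) :
    (kform p φ ψ : ℂ) = ∫ ξ, four p ξ * (conj (𝓕 φ.toSchwartz ξ) * 𝓕 ψ.toSchwartz ξ) := by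
  obtain ⟨hi, hf⟩ := fourier_convolution_test hp ψ
  have h1 : (kform p φ ψ : ℂ) = ∫ x, (φ x : ℂ) * ((∫ y, p (x - y) * ψ y : ℝ) : ℂ) := by
    rw [kform, ← integral_complex_ofReal]
    refine integral_congr_ae (ae_of_all _ fun x => ?_)
    beta_reduce
    rw [← Complex.ofReal_mul, ← integral_const_mul]
    congr 2 with y
    ring
  rw [h1, integral_mul_eq_fourier φ hi]
  refine integral_congr_ae (ae_of_all _ fun ξ => ?_)
  beta_reduce
  rw [hf]
  ring

/-- Otherwise the character with frequency ξ would annihilate all test functions and vanish almost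
everywhere. This permits division by the transform of a test function at a given point. -/
theorem exists_test_fourier_ne_zero (ξ : E n) : ∃ ψ : RTest n, 𝓕 ψ.toSchwartz ξ ≠ 0 := by
  by_contra! h
  have hc : Continuous fun x : E n => (𝐞 (-inner ℝ x ξ) : ℂ) := by
    have := Real.continuous_fourierChar
    fun_prop
  have h0 := ae_eq_zero_of_integral_contDiff_smul_eq_zero (μ := (volume : Measure (E n)))
    (f := fun x => (𝐞 (-inner ℝ x ξ) : ℂ)) hc.locallyIntegrable fun g hg hg' => by
      have := h ⟨g, hg, hg', subset_univ _⟩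
      rw [fourier_coe, Real.fourier_eq] at this
      rw [← this]
      refine integral_congr_ae (ae_of_all _ fun x => ?_)
      change g x • (𝐞 (-inner ℝ x ξ) : ℂ) = 𝐞 (-inner ℝ x ξ) • (g x : ℂ)
      rw [Circle.smul_def, Complex.real_smul, smul_eq_mul, mul_comm]
  have h1 : (volume : Measure (E n)) univ = 0 := by
    have : ∀ᵐ x : E n, False := h0.mono fun x hx => Circle.coe_ne_zero _ hx
    simpa [ae_iff] using this
  exact (isOpen_univ.measure_pos volume univ_nonempty).ne' h1

/-! ### The Fourier transform of the Laplacian -/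

theorem laplacian_eq_sum_fderiv {q : E n → ℝ} (hq : ContDiff ℝ 2 q) (x : E n) :
    Δ q x = ∑ k : Fin n, fderiv ℝ (fun y => fderiv ℝ q y (EuclideanSpace.single k 1)) x
      (EuclideanSpace.single k 1) := by
  rw [InnerProductSpace.laplacian_eq_iteratedFDeriv_orthonormalBasis q
    (EuclideanSpace.basisFun (Fin n) ℝ)]
  refine Finset.sum_congr rfl fun k _ => ?_
  rw [iteratedFDeriv_two_apply]
  have hd : DifferentiableAt ℝ (fderiv ℝ q) x :=
    (hq.fderiv_right (m := 1) le_rfl).differentiable one_ne_zero x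
  have h : HasFDerivAt (fun y => fderiv ℝ q y (EuclideanSpace.single k 1))
      ((fderiv ℝ (fderiv ℝ q) x).flip (EuclideanSpace.single k 1)) x := by
    have := hd.hasFDerivAt.clm_apply (hasFDerivAt_const (EuclideanSpace.single k (1 : ℝ)) x)
    simpa using this
  rw [h.fderiv]
  simp

theorem continuous_laplacian {q : E n → ℝ} (hq : ContDiff ℝ 2 q) : Continuous (Δ q) := by
  have h : Δ q = fun x => ∑ k : Fin n, fderiv ℝ (fun y => fderiv ℝ q y
      (EuclideanSpace.single k 1)) x (EuclideanSpace.single k 1) :=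
    funext fun x => laplacian_eq_sum_fderiv hq x
  rw [h]
  refine continuous_finsetSum _ fun k _ => ?_
  have h1 : ContDiff ℝ 1 fun y => fderiv ℝ q y (EuclideanSpace.single k 1) :=
    (hq.fderiv_right (m := 1) le_rfl).clm_apply contDiff_const
  exact (h1.continuous_fderiv one_ne_zero).clm_apply continuous_const

theorem integral_fderiv_sub_mul {q : E n → ℝ} (hq : ContDiff ℝ 1 q) (ψ : RTest n) (x v : E n) :
    ∫ y, fderiv ℝ q (x - y) v * ψ y = ∫ y, q (x - y) * (∂_{v} ψ) y := by
  have hd : ∀ y, HasFDerivAt (fun y => q (x - y)) (-(fderiv ℝ q (x - y))) y := fun y => by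
    have h := (hq.differentiable one_ne_zero (x - y)).hasFDerivAt.comp y
      ((hasFDerivAt_id y).const_sub x)
    refine h.congr_fderiv ?_
    ext v
    simp
  have hψd : Differentiable ℝ ψ := ψ.contDiff.differentiable (by simp)
  have hψ : ∀ y, fderiv ℝ ψ y v = (∂_{v} ψ) y := fun y => by
    rw [TestFunction.lineDerivOp_eq_lineDerivCLM ℝ, TestFunction.lineDerivCLM_apply_of_le (by simp),
      (hψd y).lineDeriv_eq_fderiv]
  have hqc : Continuous fun y => q (x - y) := hq.continuous.comp (continuous_const.sub continuous_id)
  have hqd : Continuous fun y => fderiv ℝ q (x - y) v :=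
    ((hq.continuous_fderiv one_ne_zero).comp (continuous_const.sub continuous_id)).clm_apply
      continuous_const
  have h := integral_mul_fderiv_eq_neg_fderiv_mul_of_integrable (μ := volume) (v := v)
    (f := fun y => q (x - y)) (g := ψ)
    (by
      simp only [(hd _).fderiv]
      exact ((hqd.neg.mul ψ.continuous).integrable_of_hasCompactSupport
        ψ.hasCompactSupport.mul_left))
    (by
      simp only [hψ]
      exact (hqc.mul (∂_{v} ψ).continuous).integrable_of_hasCompactSupport
        (∂_{v} ψ).hasCompactSupport.mul_left)
    ((hqc.mul ψ.continuous).integrable_of_hasCompactSupport ψ.hasCompactSupport.mul_left)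
    (fun y _ => (hd y).differentiableAt) (fun y _ => hψd y)
  simp only [hψ, (hd _).fderiv, neg_apply, neg_mul, integral_neg, neg_neg] at h
  exact h.symm

theorem integral_laplacian_sub_mul {q : E n → ℝ} (hq : ContDiff ℝ 2 q) (ψ : RTest n) (x : E n) :
    (∫ y, Δ q (x - y) * ψ y) - m ^ 2 * ∫ y, q (x - y) * ψ y = ∫ y, q (x - y) * kgOp m ψ y := by
  have h1 : ∀ k : Fin n, ContDiff ℝ 1 fun y => fderiv ℝ q y (EuclideanSpace.single k 1) :=
    fun k => (hq.fderiv_right (m := 1) le_rfl).clm_apply contDiff_const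
  have hqc : Continuous fun y => q (x - y) := hq.continuous.comp (continuous_const.sub continuous_id)
  have hint : ∀ η : RTest n, Integrable fun y => q (x - y) * η y := fun η =>
    (hqc.mul η.continuous).integrable_of_hasCompactSupport η.hasCompactSupport.mul_left
  have h2 : ∫ y, Δ q (x - y) * ψ y = ∑ k : Fin n, ∫ y, q (x - y) *
      (∂_{(EuclideanSpace.single k (1 : ℝ) : E n)}
        (∂_{(EuclideanSpace.single k (1 : ℝ) : E n)} ψ)) y := by
    simp only [laplacian_eq_sum_fderiv hq, Finset.sum_mul]
    rw [integral_finsetSum]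
    · refine Finset.sum_congr rfl fun k _ => ?_
      rw [integral_fderiv_sub_mul (h1 k), integral_fderiv_sub_mul (hq.of_le one_le_two)]
    · intro k _
      refine Continuous.integrable_of_hasCompactSupport ?_ ψ.hasCompactSupport.mul_left
      exact ((((h1 k).continuous_fderiv one_ne_zero).comp
        (continuous_const.sub continuous_id)).clm_apply continuous_const).mul ψ.continuous
  rw [h2, ← integral_finsetSum _ fun k _ => hint _, ← integral_const_mul, ← integral_sub
    (integrable_finsetSum _ fun k _ => hint _) ((hint ψ).const_mul _)]
  refine integral_congr_ae (ae_of_all _ fun y => ?_)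
  simp only [kgOp, sub_apply, sum_apply, smul_apply, smul_eq_mul, mul_sub, Finset.mul_sum]
  ring

theorem four_add {p q : E n → ℝ} (hp : Integrable p) (hq : Integrable q) (ξ : E n) :
    four (fun z => p z + q z) ξ = four p ξ + four q ξ := by
  have h : ∀ {p : E n → ℝ}, Integrable p → Integrable fun z => 𝐞 (-inner ℝ z ξ) • (p z : ℂ) :=
    fun hp => (Real.fourierIntegral_convergent_iff ξ).2 hp.ofReal
  simp only [four, Real.fourier_eq]
  rw [← integral_add (h hp) (h hq)]
  congr 1 with z
  rw [← smul_add, Complex.ofReal_add]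

/-- Nothing is known about the decay of the gradient of q, so q cannot be integrated by parts
directly. The Laplacian is moved to a test function inside a convolution, and the transform of that
test function is then cancelled. -/
theorem four_laplacian {q : E n → ℝ} (hq : ContDiff ℝ 2 q) (hqi : Integrable q)
    (hΔ : Integrable (Δ q)) (ξ : E n) :
    four (fun z => m ^ 2 * q z - Δ q z) ξ = (disp m ξ ^ 2 : ℝ) * four q ξ := by
  obtain ⟨ψ, hψ⟩ := exists_test_fourier_ne_zero ξ
  have hp : Integrable fun z => m ^ 2 * q z - Δ q z := (hqi.const_mul _).sub hΔ
  have hint : ∀ {g : E n → ℝ} (x : E n), Continuous g → Integrable fun y => g (x - y) * ψ y :=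
    fun {g} x hg => ((hg.comp (continuous_const.sub continuous_id)).mul
      ψ.continuous).integrable_of_hasCompactSupport ψ.hasCompactSupport.mul_left
  have hfun : (fun x => ((∫ y, (m ^ 2 * q (x - y) - Δ q (x - y)) * ψ y : ℝ) : ℂ)) =
      fun x => -((∫ y, q (x - y) * kgOp m ψ y : ℝ) : ℂ) := by
    funext x
    rw [← integral_laplacian_sub_mul hq, ← Complex.ofReal_neg]
    congr 1
    rw [neg_sub, ← integral_const_mul, ← integral_sub ((hint x hq.continuous).const_mul _)
      (hint x (continuous_laplacian hq))]
    congr 1 with y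
    ring
  have h1 := (fourier_convolution_test hp ψ).2 ξ
  have h2 := (fourier_convolution_test hqi (kgOp m ψ)).2 ξ
  rw [hfun] at h1
  have h3 : 𝓕 (fun x => -((∫ y, q (x - y) * kgOp m ψ y : ℝ) : ℂ)) ξ =
      -𝓕 (fun x => ((∫ y, q (x - y) * kgOp m ψ y : ℝ) : ℂ)) ξ := by
    simp only [Real.fourier_eq, smul_neg, integral_neg]
  rw [h3, h2, fourier_kgOp] at h1
  refine mul_right_cancel₀ hψ ?_
  rw [← h1]
  push_cast
  ring

/-! ### Positive definite kernels -/

theorem integrable_mul_norm_sq {w : E n → ℝ} (hw : Continuous w) {M : ℝ} (hM : ∀ ξ, |w ξ| ≤ M)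
    (f : 𝓢(E n, ℂ)) : Integrable fun ξ => w ξ * ‖f ξ‖ ^ 2 :=
  (by simpa using (f.memLp 2 volume).integrable_norm_pow two_ne_zero :
    Integrable fun ξ => ‖f ξ‖ ^ 2).bdd_mul (c := M) hw.aestronglyMeasurable (ae_of_all _ hM)

theorem integrable_norm_sq (f : 𝓢(E n, ℂ)) : Integrable fun ξ => ‖f ξ‖ ^ 2 := by
  simpa using (f.memLp 2 volume).integrable_norm_pow two_ne_zero

/-- Positivity extends from test functions to Schwartz functions by density in L², since w is
bounded and the Fourier transform preserves the L² norm. -/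
theorem integral_mul_norm_sq_nonneg {w : E n → ℝ} (hw : Continuous w) {M : ℝ}
    (hM : ∀ ξ, |w ξ| ≤ M) (h : ∀ ψ : CTest n, 0 ≤ ∫ ξ, w ξ * ‖𝓕 ψ.toSchwartz ξ‖ ^ 2)
    (f : 𝓢(E n, ℂ)) : 0 ≤ ∫ ξ, w ξ * ‖𝓕 f ξ‖ ^ 2 := by
  have hM0 : 0 ≤ M := (abs_nonneg _).trans (hM 0)
  set A := ∫ ξ, ‖𝓕 f ξ‖ ^ 2 with hA
  have hA0 : 0 ≤ A := integral_nonneg fun _ => by positivity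
  have key : ∀ η : ℝ, 0 < η → -(M * (A + 1)) * η ≤ ∫ ξ, w ξ * ‖𝓕 f ξ‖ ^ 2 := by
    intro η hη
    -- With this precision the error term (1 + η⁻¹)‖d‖² from Young's inequality is at most η.
    set ε := √(η / (1 + η⁻¹)) with hε
    have hε0 : 0 < ε := Real.sqrt_pos.2 (by positivity)
    obtain ⟨g, hg1, hg2, hg3⟩ := MemLp.exist_eLpNorm_sub_le ENNReal.ofNat_ne_top one_le_two
      (f.memLp 2 volume) hε0
    let ψ : CTest n := ⟨g, hg2, hg1, subset_univ _⟩
    set d := 𝓕 (f - ψ.toSchwartz) with hd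
    have hd1 : ∫ ξ, ‖d ξ‖ ^ 2 ≤ η / (1 + η⁻¹) := by
      rw [hd, integral_norm_sq_fourier]
      have h1 := (f - ψ.toSchwartz).memLp 2 volume
      have h2 : eLpNorm (f - ψ.toSchwartz) 2 volume ≤ ENNReal.ofReal ε := hg3
      have h3 := ENNReal.toReal_mono ENNReal.ofReal_ne_top h2
      rw [ENNReal.toReal_ofReal hε0.le, h1.eLpNorm_eq_integral_rpow_norm two_ne_zero
        ENNReal.ofNat_ne_top, ENNReal.toReal_ofReal (by positivity)] at h3
      simp only [ENNReal.toReal_ofNat, rpow_two] at h3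
      have h4 := Real.rpow_le_rpow (by positivity) h3 (zero_le_two)
      rw [← Real.rpow_mul (by positivity)] at h4
      norm_num at h4
      rw [hε, Real.sq_sqrt (by positivity)] at h4
      exact h4
    have hfd : ∀ ξ, 𝓕 ψ.toSchwartz ξ = 𝓕 f ξ - d ξ := fun ξ => by
      rw [hd, fourier_sub_schwartz]; simp
    have hpt : ∀ ξ, w ξ * ‖𝓕 ψ.toSchwartz ξ‖ ^ 2 ≤ w ξ * ‖𝓕 f ξ‖ ^ 2 +
        M * (η * ‖𝓕 f ξ‖ ^ 2 + (1 + η⁻¹) * ‖d ξ‖ ^ 2) := by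
      intro ξ
      have h1 : |‖𝓕 ψ.toSchwartz ξ‖ ^ 2 - ‖𝓕 f ξ‖ ^ 2| ≤
          η * ‖𝓕 f ξ‖ ^ 2 + (1 + η⁻¹) * ‖d ξ‖ ^ 2 := by
        rw [hfd]
        set z := 𝓕 f ξ
        set e := d ξ
        have e1 : |‖z - e‖ - ‖z‖| ≤ ‖e‖ := by
          simpa [norm_neg] using abs_norm_sub_norm_le (z - e) z
        have e2 : 2 * (‖z‖ * ‖e‖) ≤ η * ‖z‖ ^ 2 + η⁻¹ * ‖e‖ ^ 2 := by
          have : 0 ≤ η⁻¹ * (η * ‖z‖ - ‖e‖) ^ 2 := by positivity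
          have e3 : η⁻¹ * (η * ‖z‖ - ‖e‖) ^ 2 =
              η * ‖z‖ ^ 2 - 2 * (‖z‖ * ‖e‖) + η⁻¹ * ‖e‖ ^ 2 := by
            field_simp
            ring
          linarith
        set δ := ‖z - e‖ - ‖z‖ with hδ
        have e4 : ‖z - e‖ ^ 2 - ‖z‖ ^ 2 = 2 * ‖z‖ * δ + δ ^ 2 := by rw [hδ]; ring
        rw [e4]
        refine (abs_add_le _ _).trans ?_
        rw [abs_mul, abs_of_nonneg (by positivity : 0 ≤ 2 * ‖z‖), abs_of_nonneg (sq_nonneg δ),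
          ← sq_abs]
        have e5 : |δ| ^ 2 ≤ ‖e‖ ^ 2 := by gcongr
        have e6 : 2 * ‖z‖ * |δ| ≤ 2 * ‖z‖ * ‖e‖ := by gcongr
        linarith
      have h2 : w ξ * (‖𝓕 ψ.toSchwartz ξ‖ ^ 2 - ‖𝓕 f ξ‖ ^ 2) ≤
          M * (η * ‖𝓕 f ξ‖ ^ 2 + (1 + η⁻¹) * ‖d ξ‖ ^ 2) := by
        refine (le_abs_self _).trans ?_
        rw [abs_mul]
        exact mul_le_mul (hM ξ) h1 (abs_nonneg _) hM0
      linarith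
    have hI1 := integrable_mul_norm_sq hw hM (𝓕 f)
    have hI2 := (integrable_norm_sq (𝓕 f)).const_mul η
    have hI3 := (integrable_norm_sq d).const_mul (1 + η⁻¹)
    have h1 := (h ψ).trans (integral_mono (integrable_mul_norm_sq hw hM (𝓕 ψ.toSchwartz))
      (hI1.add ((hI2.add hI3).const_mul M)) hpt)
    simp only [Pi.add_apply] at h1
    rw [integral_add hI1 (by exact (hI2.add hI3).const_mul M)] at h1
    have h2 : ∫ ξ, M * (η * ‖𝓕 f ξ‖ ^ 2 + (1 + η⁻¹) * ‖d ξ‖ ^ 2) ≤ M * ((A + 1) * η) := by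
      rw [integral_const_mul, integral_add hI2 hI3, integral_const_mul, integral_const_mul, ← hA]
      refine mul_le_mul_of_nonneg_left ?_ hM0
      have : (1 + η⁻¹) * ∫ ξ, ‖d ξ‖ ^ 2 ≤ η := by
        calc _ ≤ (1 + η⁻¹) * (η / (1 + η⁻¹)) := by gcongr
          _ = η := mul_div_cancel₀ _ (by positivity)
      linarith
    linarith
  have hlim : Tendsto (fun η : ℝ => -(M * (A + 1)) * η) (𝓝[>] 0) (𝓝 (-(M * (A + 1)) * 0)) :=
    ((continuous_const.mul continuous_id).tendsto 0).mono_left nhdsWithin_le_nhds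
  rw [mul_zero] at hlim
  exact le_of_tendsto hlim (eventually_nhdsWithin_of_forall fun η hη => key η hη)

/-- If w were negative near a point, a Schwartz function whose transform is a bump there would give
a negative integral. Such a function is not a test function, whence the preceding extension. -/
theorem nonneg_of_forall_test {w : E n → ℝ} (hw : Continuous w) {M : ℝ}
    (hM : ∀ ξ, |w ξ| ≤ M) (h : ∀ ψ : CTest n, 0 ≤ ∫ ξ, w ξ * ‖𝓕 ψ.toSchwartz ξ‖ ^ 2)
    (ξ : E n) : 0 ≤ w ξ := by
  by_contra! hneg
  obtain ⟨δ, hδ, hball⟩ := Metric.isOpen_iff.1 (isOpen_lt hw continuous_const) ξ hneg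
  let b : ContDiffBump ξ := ⟨δ / 2, δ, by positivity, by linarith⟩
  have hbc : HasCompactSupport fun x => ((b x : ℝ) : ℂ) :=
    b.hasCompactSupport.comp_left (g := fun t : ℝ => (t : ℂ)) Complex.ofReal_zero
  let g : 𝓢(E n, ℂ) := hbc.toSchwartzMap (Complex.ofRealCLM.contDiff.comp b.contDiff)
  have hg : ∀ x, g x = (b x : ℂ) := fun x => rfl
  have h1 := integral_mul_norm_sq_nonneg hw hM h (𝓕⁻ g)
  rw [FourierTransform.fourier_fourierInv_eq] at h1
  have h2 : 0 < ∫ x, -(w x * ‖g x‖ ^ 2) := by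
    refine Continuous.integral_pos_of_hasCompactSupport_nonneg_nonzero (x := ξ)
      (by fun_prop) ?_ (fun x => ?_) ?_
    · refine HasCompactSupport.intro b.hasCompactSupport fun x hx => ?_
      rw [hg, image_eq_zero_of_notMem_tsupport hx]
      simp
    · rw [Pi.zero_apply]
      by_cases hx : x ∈ Metric.ball ξ δ
      · have : w x < 0 := hball hx
        have := mul_nonneg (neg_nonneg.2 this.le) (sq_nonneg ‖g x‖)
        linarith
      · have : b x = 0 := b.zero_of_le_dist (by simpa using hx)
        simp [hg, this]
    · have : b ξ = 1 := b.one_of_mem_closedBall (by simp [b.rIn_pos.le])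
      rw [hg, this]
      simp [hneg.ne]
  rw [integral_neg] at h2
  linarith

theorem CTest.fourier_toSchwartz (ψ : CTest n) (ξ : E n) : 𝓕 ψ.toSchwartz ξ =
    𝓕 (CTest.comp 0 ψ).toSchwartz ξ + Complex.I * 𝓕 (CTest.comp 1 ψ).toSchwartz ξ := by
  have h : ψ.toSchwartz = (CTest.comp 0 ψ).toSchwartz +
      Complex.I • (CTest.comp 1 ψ).toSchwartz := by
    ext x
    simp only [add_apply, smul_apply, smul_eq_mul, RTest.toSchwartz_apply, CTest.comp_apply]
    change ψ x = ((ψ x).re : ℂ) + Complex.I * ((ψ x).im : ℂ)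
    rw [mul_comm, Complex.re_add_im]
  rw [h, FourierTransform.fourier_add, FourierTransform.fourier_smul]
  rfl

theorem integrable_four_mul {p : E n → ℝ} (hp : Integrable p) (f g : 𝓢(E n, ℂ)) :
    Integrable fun ξ => four p ξ * (conj (f ξ) * g ξ) := by
  have h1 : Integrable fun ξ => conj (f ξ) * g ξ :=
    (g.integrable (μ := volume)).bdd_mul (c := ‖f.toBoundedContinuousFunction‖)
      (Complex.continuous_conj.comp f.continuous).aestronglyMeasurable (ae_of_all _ fun ξ => by
        rw [RCLike.norm_conj]; exact f.toBoundedContinuousFunction.norm_coe_le_norm ξ)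
  exact h1.bdd_mul (c := ∫ z, |p z|) (continuous_four hp).aestronglyMeasurable
    (ae_of_all _ fun ξ => norm_four_le p ξ)

/-- Expanding the square of the modulus produces cross terms between the real components, which
cancel by symmetry of the form. -/
theorem integral_four_mul_norm_sq {p : E n → ℝ} (hp : Integrable p)
    (hsymm : ∀ φ ψ, kform p φ ψ = kform p ψ φ) (ψ : CTest n) :
    ∫ ξ, four p ξ * (‖𝓕 ψ.toSchwartz ξ‖ ^ 2 : ℝ) =
      ((kform p (CTest.comp 0 ψ) (CTest.comp 0 ψ) + kform p (CTest.comp 1 ψ) (CTest.comp 1 ψ) : ℝ) :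
        ℂ) := by
  set f := 𝓕 (CTest.comp 0 ψ).toSchwartz with hf
  set g := 𝓕 (CTest.comp 1 ψ).toSchwartz with hg
  have h1 : ∀ ξ, four p ξ * (‖𝓕 ψ.toSchwartz ξ‖ ^ 2 : ℝ) =
      (four p ξ * (conj (f ξ) * f ξ) + four p ξ * (conj (g ξ) * g ξ)) +
      Complex.I * (four p ξ * (conj (f ξ) * g ξ) - four p ξ * (conj (g ξ) * f ξ)) := fun ξ => by
    rw [Complex.ofReal_pow, ← Complex.conj_mul', CTest.fourier_toSchwartz]
    simp only [map_add, map_mul, Complex.conj_I]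
    ring_nf
    rw [Complex.I_sq]
    ring
  have i1 := integrable_four_mul hp f f
  have i2 := integrable_four_mul hp g g
  have i3 := integrable_four_mul hp f g
  have i4 := integrable_four_mul hp g f
  simp only [h1]
  rw [integral_add (by exact i1.add i2) (by exact (i3.sub i4).const_mul _), integral_add i1 i2,
    integral_const_mul, integral_sub i3 i4, hf, hg, ← kform_eq_fourier hp, ← kform_eq_fourier hp,
    ← kform_eq_fourier hp, ← kform_eq_fourier hp, hsymm (CTest.comp 1 ψ) (CTest.comp 0 ψ)]
  push_cast
  ring

/-- The elementary half of Bochner's theorem. The integrals of the imaginary part against |ψ̂|²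
vanish, so both it and its negative are nonnegative. -/
theorem four_nonneg {p : E n → ℝ} (hp : Integrable p)
    (hsymm : ∀ φ ψ, kform p φ ψ = kform p ψ φ) (hpos : ∀ φ, 0 ≤ kform p φ φ) (ξ : E n) :
    0 ≤ (four p ξ).re ∧ (four p ξ).im = 0 := by
  have hc := continuous_four hp
  have hI : ∀ ψ : CTest n, Integrable fun ξ => four p ξ * (‖𝓕 ψ.toSchwartz ξ‖ ^ 2 : ℝ) := fun ψ => by
    refine (integrable_four_mul hp (𝓕 ψ.toSchwartz) (𝓕 ψ.toSchwartz)).congr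
      (ae_of_all _ fun ξ => ?_)
    beta_reduce
    rw [Complex.conj_mul', Complex.ofReal_pow]
  have hre : ∀ ψ : CTest n, ∫ ξ, (four p ξ).re * ‖𝓕 ψ.toSchwartz ξ‖ ^ 2 =
      kform p (CTest.comp 0 ψ) (CTest.comp 0 ψ) + kform p (CTest.comp 1 ψ) (CTest.comp 1 ψ) :=
    fun ψ => by
    have h1 := integral_re (hI ψ)
    simp only [RCLike.re_to_complex, Complex.re_mul_ofReal] at h1
    rw [h1, integral_four_mul_norm_sq hp hsymm, Complex.ofReal_re]
  have him : ∀ ψ : CTest n, ∫ ξ, (four p ξ).im * ‖𝓕 ψ.toSchwartz ξ‖ ^ 2 = 0 := fun ψ => by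
    have h1 := integral_im (hI ψ)
    simp only [RCLike.im_to_complex, Complex.im_mul_ofReal] at h1
    rw [h1, integral_four_mul_norm_sq hp hsymm, Complex.ofReal_im]
  have hb := norm_four_le p
  refine ⟨nonneg_of_forall_test (w := fun ξ => (four p ξ).re) (Complex.continuous_re.comp hc)
    (fun ξ => (Complex.abs_re_le_norm _).trans (hb ξ)) (fun ψ => ?_) ξ, le_antisymm ?_ ?_⟩
  · rw [hre]
    exact add_nonneg (hpos _) (hpos _)
  · refine neg_nonneg.1 (nonneg_of_forall_test (w := fun ξ => -(four p ξ).im)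
      (Complex.continuous_im.comp hc).neg (M := ∫ z, |p z|)
      (fun ξ => by rw [abs_neg]; exact (Complex.abs_im_le_norm _).trans (hb ξ)) (fun ψ => ?_) ξ)
    simp only [neg_mul, integral_neg, him, neg_zero, le_refl]
  · exact nonneg_of_forall_test (w := fun ξ => (four p ξ).im) (Complex.continuous_im.comp hc)
      (fun ξ => (Complex.abs_im_le_norm _).trans (hb ξ)) (fun ψ => (him ψ).ge) ξ

/-- Integrated against widening Gaussians, the transform gives Gaussian averages of p around 0,
which tend to p(0) by continuity; Fatou's lemma then bounds the integral of the nonnegative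
transform. For the energy covariance this expresses finite mean energy density. -/
theorem integrable_four_of_nonneg {p : E n → ℝ} (hp : Integrable p) (hc : Continuous p)
    (h : ∀ ξ, 0 ≤ (four p ξ).re ∧ (four p ξ).im = 0) : Integrable (four p) := by
  have hre : ∀ ξ, four p ξ = ((four p ξ).re : ℂ) := fun ξ =>
    Complex.ext (by simp) (by simp [(h ξ).2])
  have hlim := (Real.tendsto_integral_gaussian_smul' (f := fun z => (p z : ℂ)) hp.ofReal (v := 0)
    (Complex.continuous_ofReal.comp hc).continuousAt)
  have hg : ∀ c : ℝ, 0 < c → Integrable fun ξ : E n => Complex.exp (-(c⁻¹ : ℂ) * ‖ξ‖ ^ 2) :=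
    fun c hc => by
      have := GaussianFourier.integrable_cexp_neg_mul_sq_norm_add (V := E n) (b := (c⁻¹ : ℂ))
        (by rw [← Complex.ofReal_inv, Complex.ofReal_re]; positivity) 0 0
      simpa using this
  have hflip : ∀ c : ℝ, 0 < c → ∫ w : E n, ((π * c : ℂ) ^ (Module.finrank ℝ (E n) / 2 : ℂ) *
      Complex.exp (-π ^ 2 * c * ‖0 - w‖ ^ 2)) • (p w : ℂ) =
      ((∫ ξ, (four p ξ).re * rexp (-c⁻¹ * ‖ξ‖ ^ 2) : ℝ) : ℂ) := fun c hc => by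
    have h1 := integral_fourier_mul_flip (f := fun z => (p z : ℂ)) hp.ofReal (hg c hc)
    rw [← integral_complex_ofReal]
    refine Eq.trans ?_ (h1.symm.trans ?_)
    · refine integral_congr_ae (ae_of_all _ fun w => ?_)
      beta_reduce
      rw [fourier_gaussian_innerProductSpace
        (by rw [← Complex.ofReal_inv, Complex.ofReal_re]; positivity), smul_eq_mul, mul_comm]
      simp only [zero_sub, norm_neg, div_inv_eq_mul]
      ring_nf
    · refine integral_congr_ae (ae_of_all _ fun ξ => ?_)
      change four p ξ * _ = _
      rw [hre]
      simp
  have hlim2 : Tendsto (fun k : ℕ => ∫ ξ, (four p ξ).re * rexp (-((k : ℝ) + 1)⁻¹ * ‖ξ‖ ^ 2)) atTop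
      (𝓝 (p 0)) := by
    have h1 := hlim.comp (tendsto_atTop_add_const_right atTop (1 : ℝ) tendsto_natCast_atTop_atTop)
    have h2 := (Complex.continuous_re.tendsto _).comp h1
    refine h2.congr fun k => ?_
    simp only [Function.comp_apply]
    rw [hflip _ (by positivity), Complex.ofReal_re]
  have hmeas : ∀ k : ℕ, Measurable fun ξ =>
      ENNReal.ofReal ((four p ξ).re * rexp (-((k : ℝ) + 1)⁻¹ * ‖ξ‖ ^ 2)) := fun k => by
    have := Complex.continuous_re.comp (continuous_four hp)
    exact (ENNReal.continuous_ofReal.comp (this.mul (by fun_prop))).measurable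
  refine ⟨(continuous_four hp).aestronglyMeasurable, ?_⟩
  have hfatou := lintegral_liminf_le (μ := (volume : Measure (E n))) (u := atTop) hmeas
  have hpt : ∀ ξ, liminf (fun k : ℕ =>
      ENNReal.ofReal ((four p ξ).re * rexp (-((k : ℝ) + 1)⁻¹ * ‖ξ‖ ^ 2))) atTop = ‖four p ξ‖ₑ :=
    fun ξ => by
    refine Tendsto.liminf_eq ?_
    have h1 : Tendsto (fun k : ℕ => ((k : ℝ) + 1)⁻¹) atTop (𝓝 0) := by
      simpa using tendsto_one_div_add_atTop_nhds_zero_nat (𝕜 := ℝ)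
    have h2 : Tendsto (fun k : ℕ => (four p ξ).re * rexp (-((k : ℝ) + 1)⁻¹ * ‖ξ‖ ^ 2)) atTop
        (𝓝 ((four p ξ).re * rexp (-0 * ‖ξ‖ ^ 2))) :=
      ((Real.continuous_exp.tendsto _).comp (h1.neg.mul_const _)).const_mul _
    have h3 := ENNReal.tendsto_ofReal h2
    rw [neg_zero, zero_mul, Real.exp_zero, mul_one] at h3
    rwa [hre, ← ofReal_norm, Complex.norm_real, Real.norm_of_nonneg (h ξ).1]
  simp only [hpt] at hfatou
  refine lt_of_le_of_lt hfatou ?_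
  have hI : ∀ k : ℕ, ∫⁻ ξ, ENNReal.ofReal ((four p ξ).re * rexp (-((k : ℝ) + 1)⁻¹ * ‖ξ‖ ^ 2)) =
      ENNReal.ofReal (∫ ξ, (four p ξ).re * rexp (-((k : ℝ) + 1)⁻¹ * ‖ξ‖ ^ 2)) := fun k => by
    rw [ofReal_integral_eq_lintegral_ofReal]
    · have h1 := (hg ((k : ℝ) + 1) (by positivity)).norm.bdd_mul (c := ∫ z, |p z|)
        (Complex.continuous_re.comp (continuous_four hp)).aestronglyMeasurable
        (ae_of_all _ fun ξ => (Complex.abs_re_le_norm _).trans (norm_four_le p ξ))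
      refine h1.congr (ae_of_all _ fun ξ => ?_)
      simp only [Function.comp_apply, Complex.norm_exp]
      norm_cast
    · exact ae_of_all _ fun ξ => mul_nonneg (h ξ).1 (Real.exp_pos _).le
  simp only [hI]
  rw [(ENNReal.tendsto_ofReal hlim2).liminf_eq]
  exact ENNReal.ofReal_lt_top

/-! ### Oscillatory integrals with the phase `disp m` -/

/-- For y > 0 the frequency exceeds m, where the inverse of the dispersion relation is
differentiable and hence maps null sets to null sets. -/
theorem volume_radial_null {N : Set ℝ} (hm : 0 < m) (h0 : volume N = 0) :
    ∀ᵐ y : ℝ, 0 < y → √(m ^ 2 + (2 * π * y) ^ 2) ∉ N := by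
  let g : ℝ → ℝ := fun x => √(x ^ 2 - m ^ 2) / (2 * π)
  have hg : DifferentiableOn ℝ g (N ∩ Ioi m) := fun x hx => by
    have hx' : x ^ 2 - m ^ 2 ≠ 0 := by
      have : m < x := hx.2
      nlinarith
    have h1 : DifferentiableAt ℝ (fun x : ℝ => x ^ 2 - m ^ 2) x := by fun_prop
    exact ((h1.sqrt hx').div_const _).differentiableWithinAt
  have h1 : volume (g '' (N ∩ Ioi m)) = 0 :=
    addHaar_image_eq_zero_of_differentiableOn_of_addHaar_eq_zero volume hg
      (measure_mono_null inter_subset_left h0)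
  refine (measure_eq_zero_iff_ae_notMem.1 h1).mono fun y hy hy0 hyN => hy
    ⟨_, ⟨hyN, ?_⟩, ?_⟩
  · exact Real.lt_sqrt_of_sq_lt (by have : 0 < (2 * π * y) ^ 2 := by positivity
                                    linarith)
  · simp only [g]
    rw [Real.sq_sqrt (by positivity), add_sub_cancel_left, Real.sqrt_sq (by positivity)]
    field_simp

theorem map_disp_absolutelyContinuous (hn : 0 < n) (hm : 0 < m) :
    (volume : Measure (E n)).map (disp m) ≪ volume := by
  refine Measure.AbsolutelyContinuous.mk fun N hN h0 => ?_
  have hnt : Nontrivial (E n) := by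
    have : Nonempty (Fin n) := ⟨⟨0, hn⟩⟩
    infer_instance
  rw [Measure.map_apply (continuous_disp m).measurable hN]
  have hmeas : MeasurableSet (disp m ⁻¹' N : Set (E n)) := (continuous_disp m).measurable hN
  -- Polar coordinates are used for a real-valued integral, from which the measure of a set can be
  -- read off only if it is finite; hence the exhaustion by balls.
  have key : ∀ k : ℕ, volume (disp m ⁻¹' N ∩ Metric.ball (0 : E n) k) = 0 := fun k => by
    let f : ℝ → ℝ := ({y | √(m ^ 2 + (2 * π * y) ^ 2) ∈ N} ∩ Iio (k : ℝ)).indicator fun _ => 1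
    have h1 := integral_fun_norm_addHaar (volume : Measure (E n)) f
    have h2 : ∫ y in Ioi (0 : ℝ), y ^ (Module.finrank ℝ (E n) - 1) • f y = 0 := by
      rw [setIntegral_eq_zero_of_ae_eq_zero]
      filter_upwards [volume_radial_null hm h0] with y hy hy0
      have : y ∉ {y | √(m ^ 2 + (2 * π * y) ^ 2) ∈ N} ∩ Iio (k : ℝ) := fun h => hy hy0 h.1
      simp [f, indicator_of_notMem this]
    rw [h2, smul_zero, smul_zero] at h1
    have h3 : (fun x : E n => f ‖x‖) =
        (disp m ⁻¹' N ∩ Metric.ball (0 : E n) k).indicator fun _ => 1 := by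
      funext x
      have hx : ‖x‖ ∈ {y | √(m ^ 2 + (2 * π * y) ^ 2) ∈ N} ∩ Iio (k : ℝ) ↔
          x ∈ disp m ⁻¹' N ∩ Metric.ball (0 : E n) k := by
        rw [mem_inter_iff, mem_inter_iff, mem_ball_zero_iff]
        rfl
      by_cases h : x ∈ disp m ⁻¹' N ∩ Metric.ball (0 : E n) k
      · rw [indicator_of_mem h]
        exact indicator_of_mem (hx.2 h) _
      · rw [indicator_of_notMem h]
        exact indicator_of_notMem (fun h' => h (hx.1 h')) _
    rw [h3, integral_indicator_const _ (hmeas.inter measurableSet_ball), smul_eq_mul, mul_one] at h1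
    rwa [measureReal_eq_zero_iff
      (measure_inter_lt_top_of_right_ne_top measure_ball_lt_top.ne).ne] at h1
  refine measure_mono_null (fun x hx => ?_) (measure_iUnion_null key)
  obtain ⟨k, hk⟩ := exists_nat_gt ‖x‖
  exact mem_iUnion.2 ⟨k, hx, by simpa using hk⟩

theorem tendsto_integral_exp_mul_real (f : ℝ → ℂ) :
    Tendsto (fun t : ℝ => ∫ x : ℝ, Complex.exp (Complex.I * (t * x : ℝ)) * f x) atTop (𝓝 0) := by
  have h1 : Tendsto (fun t : ℝ => -(t / (2 * π))) atTop (cocompact ℝ) := by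
    have := tendsto_neg_atTop_atBot.comp (tendsto_id.atTop_div_const (r := 2 * π) (by positivity))
    exact this.mono_right atBot_le_cocompact
  refine ((Real.tendsto_integral_exp_smul_cocompact f).comp h1).congr fun t => ?_
  simp only [Function.comp_apply, Circle.smul_def, Real.fourierChar_apply, smul_eq_mul]
  congr 1 with x
  congr 2
  push_cast
  field_simp

/-- The measure g dξ, pushed forward by ω, has a density on the line, and the one-dimensional
Riemann–Lebesgue lemma applies to it. No stationary phase analysis is needed. -/
theorem tendsto_integral_exp_disp_of_nonneg (hn : 0 < n) (hm : 0 < m) {g : E n → ℝ}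
    (hg : Integrable g) (h0 : ∀ ξ, 0 ≤ g ξ) :
    Tendsto (fun t : ℝ => ∫ ξ, Complex.exp (Complex.I * (t * disp m ξ : ℝ)) * g ξ) atTop
      (𝓝 0) := by
  have hac : ((volume : Measure (E n)).withDensity fun ξ => ENNReal.ofReal (g ξ)).map (disp m) ≪
      volume :=
    ((withDensity_absolutelyContinuous _ _).map (continuous_disp m).measurable).trans
      (map_disp_absolutelyContinuous hn hm)
  have hfin : IsFiniteMeasure ((volume : Measure (E n)).withDensity fun ξ =>
      ENNReal.ofReal (g ξ)) := isFiniteMeasure_withDensity_ofReal hg.2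
  set ν := ((volume : Measure (E n)).withDensity fun ξ => ENNReal.ofReal (g ξ)).map (disp m)
    with hν
  refine (tendsto_integral_exp_mul_real fun x => ((ν.rnDeriv volume x).toReal : ℂ)).congr
    fun t => ?_
  have h1 := integral_rnDeriv_smul (f := fun x => Complex.exp (Complex.I * (t * x : ℝ))) hac
  have h2 : ∫ x, Complex.exp (Complex.I * (t * x : ℝ)) ∂ν =
      ∫ ξ, Complex.exp (Complex.I * (t * disp m ξ : ℝ)) * g ξ := by
    rw [hν, integral_map (continuous_disp m).aemeasurable
      (by fun_prop : Continuous fun x : ℝ =>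
        Complex.exp (Complex.I * (t * x : ℝ))).aestronglyMeasurable,
      integral_withDensity_eq_integral_toReal_smul₀ hg.1.aemeasurable.ennreal_ofReal
        (ae_of_all _ fun _ => ENNReal.ofReal_lt_top)]
    refine integral_congr_ae (ae_of_all _ fun ξ => ?_)
    beta_reduce
    rw [ENNReal.toReal_ofReal (h0 ξ), Complex.real_smul, mul_comm]
  rw [← h2, ← h1]
  congr 1 with x
  rw [Complex.real_smul, mul_comm]

theorem tendsto_integral_exp_disp (hn : 0 < n) (hm : 0 < m) {G : E n → ℂ} (hG : Integrable G) :
    Tendsto (fun t : ℝ => ∫ ξ, Complex.exp (Complex.I * (t * disp m ξ : ℝ)) * G ξ) atTop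
      (𝓝 0) := by
  have hb : ∀ (t : ℝ) {F : E n → ℂ}, Integrable F →
      Integrable fun ξ => Complex.exp (Complex.I * (t * disp m ξ : ℝ)) * F ξ := fun t F hF => by
    refine hF.bdd_mul (c := 1) ?_ (ae_of_all _ fun ξ => ?_)
    · have := continuous_disp (n := n) m
      fun_prop
    · rw [mul_comm, Complex.norm_exp_ofReal_mul_I]
  have hre := hG.re
  have him := hG.im
  have a1 := tendsto_integral_exp_disp_of_nonneg hn hm hre.pos_part fun ξ => le_max_right _ _
  have a2 := tendsto_integral_exp_disp_of_nonneg hn hm hre.neg_part fun ξ => le_max_right _ _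
  have a3 := tendsto_integral_exp_disp_of_nonneg hn hm him.pos_part fun ξ => le_max_right _ _
  have a4 := tendsto_integral_exp_disp_of_nonneg hn hm him.neg_part fun ξ => le_max_right _ _
  have h := (a1.sub a2).add ((a3.sub a4).const_mul Complex.I)
  rw [sub_zero, mul_zero, add_zero] at h
  refine h.congr fun t => ?_
  have i1 := hb t hre.pos_part.ofReal
  have i2 := hb t hre.neg_part.ofReal
  have i3 := hb t him.pos_part.ofReal
  have i4 := hb t him.neg_part.ofReal
  rw [← integral_sub (by exact i1) (by exact i2), ← integral_sub (by exact i3) (by exact i4),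
    ← integral_const_mul, ← integral_add (by exact i1.sub i2) (by exact (i3.sub i4).const_mul _)]
  congr 1 with ξ
  have e1 : ∀ x : ℝ, max x 0 - max (-x) 0 = x := fun x => by
    rcases le_total 0 x with hx | hx
    · rw [max_eq_left hx, max_eq_right (by linarith), sub_zero]
    · rw [max_eq_right hx, max_eq_left (by linarith), zero_sub, neg_neg]
  have e2 : G ξ = ((max (G ξ).re 0 - max (-(G ξ).re) 0 : ℝ) : ℂ) +
      Complex.I * ((max (G ξ).im 0 - max (-(G ξ).im) 0 : ℝ) : ℂ) := by
    rw [e1, e1, mul_comm, Complex.re_add_im]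
  conv_rhs => rw [e2]
  simp only [RCLike.re_to_complex, RCLike.im_to_complex]
  push_cast
  ring

theorem tendsto_integral_cos_sin_disp (hn : 0 < n) (hm : 0 < m) {G : E n → ℂ}
    (hG : Integrable G) :
    Tendsto (fun t : ℝ => ∫ ξ, (Real.cos (t * disp m ξ) : ℂ) * G ξ) atTop (𝓝 0) ∧
    Tendsto (fun t : ℝ => ∫ ξ, (Real.sin (t * disp m ξ) : ℂ) * G ξ) atTop (𝓝 0) := by
  have hb : ∀ (t : ℝ) {F : E n → ℂ}, Integrable F →
      Integrable fun ξ => Complex.exp (Complex.I * (t * disp m ξ : ℝ)) * F ξ := fun t F hF => by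
    refine hF.bdd_mul (c := 1) ?_ (ae_of_all _ fun ξ => ?_)
    · have := continuous_disp (n := n) m
      fun_prop
    · rw [mul_comm, Complex.norm_exp_ofReal_mul_I]
  have hG' : Integrable fun ξ => conj (G ξ) :=
    hG.mono (Complex.continuous_conj.comp_aestronglyMeasurable hG.1)
      (ae_of_all _ fun ξ => by rw [RCLike.norm_conj])
  have h1 := tendsto_integral_exp_disp hn hm hG
  have h2 := (Complex.continuous_conj.tendsto _).comp (tendsto_integral_exp_disp hn hm hG')
  rw [map_zero] at h2
  have h3 : ∀ t : ℝ, (conj ∘ fun t : ℝ => ∫ ξ, Complex.exp (Complex.I * (t * disp m ξ : ℝ)) *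
      conj (G ξ)) t = ∫ ξ, Complex.exp (-(Complex.I * (t * disp m ξ : ℝ))) * G ξ := fun t => by
    rw [Function.comp_apply, ← integral_conj]
    congr 1 with ξ
    rw [map_mul, Complex.conj_conj, ← Complex.exp_conj, map_mul, Complex.conj_I,
      Complex.conj_ofReal, neg_mul]
  have h2 := h2.congr h3
  have hb' : ∀ t : ℝ, Integrable fun ξ => Complex.exp (-(Complex.I * (t * disp m ξ : ℝ))) * G ξ :=
    fun t => by simpa using hb (-t) hG
  constructor
  · have h := (h1.add h2).const_mul (1 / 2)
    rw [add_zero, mul_zero] at h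
    refine h.congr fun t => ?_
    rw [← integral_add (hb t hG) (hb' t), ← integral_const_mul]
    congr 1 with ξ
    rw [Complex.ofReal_cos, Complex.cos]
    ring_nf
  · have h := (h1.sub h2).const_mul (-Complex.I / 2)
    rw [sub_zero, mul_zero] at h
    refine h.congr fun t => ?_
    rw [← integral_sub (hb t hG) (hb' t), ← integral_const_mul]
    congr 1 with ξ
    rw [Complex.ofReal_sin, Complex.sin]
    ring_nf

/-- By the double angle formulas cos² and sin² oscillate about 1/2 and sin cos about 0, at the
doubled time. -/
theorem tendsto_integral_quadratic_disp (hn : 0 < n) (hm : 0 < m) {G₀ G₁ G₂ : E n → ℂ}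
    (h₀ : Integrable G₀) (h₁ : Integrable G₁) (h₂ : Integrable G₂) :
    Tendsto (fun t : ℝ => ∫ ξ, ((Real.cos (t * disp m ξ) : ℂ) ^ 2 * G₀ ξ +
      (Real.sin (t * disp m ξ) : ℂ) ^ 2 * G₁ ξ +
      (Real.sin (t * disp m ξ) : ℂ) * (Real.cos (t * disp m ξ) : ℂ) * G₂ ξ)) atTop
      (𝓝 (1 / 2 * ∫ ξ, (G₀ ξ + G₁ ξ))) := by
  have ht : Tendsto (fun t : ℝ => 2 * t) atTop atTop := tendsto_id.const_mul_atTop two_pos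
  have a := (tendsto_integral_cos_sin_disp hn hm (h₀.sub h₁)).1.comp ht
  have b := (tendsto_integral_cos_sin_disp hn hm h₂).2.comp ht
  have h := ((a.add b).const_add (∫ ξ, (G₀ ξ + G₁ ξ))).const_mul (1 / 2)
  rw [add_zero, add_zero] at h
  refine h.congr fun t => ?_
  have hc := continuous_disp (n := n) m
  have i1 : Integrable fun ξ => (Real.cos (2 * t * disp m ξ) : ℂ) * (G₀ - G₁) ξ :=
    (h₀.sub h₁).bdd_mul (c := 1) (by fun_prop) (ae_of_all _ fun ξ => by
      rw [Complex.norm_real]; exact Real.abs_cos_le_one _)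
  have i2 : Integrable fun ξ => (Real.sin (2 * t * disp m ξ) : ℂ) * G₂ ξ :=
    h₂.bdd_mul (c := 1) (by fun_prop) (ae_of_all _ fun ξ => by
      rw [Complex.norm_real]; exact Real.abs_sin_le_one _)
  simp only [Function.comp_apply]
  rw [← integral_add i1 i2, ← integral_add (by exact h₀.add h₁) (by exact i1.add i2),
    ← integral_const_mul]
  congr 1 with ξ
  rw [mul_assoc, Real.cos_two_mul', Real.sin_two_mul, Pi.sub_apply]
  have := congrArg (fun x : ℝ => (x : ℂ)) (Real.sin_sq_add_cos_sq (t * disp m ξ))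
  push_cast at this ⊢
  linear_combination (-(G₀ ξ + G₁ ξ) / 2) * this

/-! ### The covariance of the initial state -/

theorem comp_add (z w : ℂ) (a : Fin 2) : comp (z + w) a = comp z a + comp w a := by
  fin_cases a <;> simp [comp]

theorem comp_sub (z w : ℂ) (a : Fin 2) : comp (z - w) a = comp z a - comp w a := by
  fin_cases a <;> simp [comp]

theorem comp_neg (z : ℂ) (a : Fin 2) : comp (-z) a = -comp z a := by
  fin_cases a <;> simp [comp]

/-- The real random variables `Yⁱ(φ)_a`. -/
def coord (i a : Fin 2) (φ : RTest n) (Y : State n) : ℝ := comp (Y i φ) a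

theorem coord_add (i a : Fin 2) (φ ψ : RTest n) (Y : State n) :
    coord i a (φ + ψ) Y = coord i a φ Y + coord i a ψ Y := by
  rw [coord, map_add, comp_add]; rfl

theorem coord_sub (i a : Fin 2) (φ ψ : RTest n) (Y : State n) :
    coord i a (φ - ψ) Y = coord i a φ Y - coord i a ψ Y := by
  rw [coord, map_sub, comp_sub]; rfl

theorem measurable_coord (i a : Fin 2) (φ : RTest n) : Measurable (coord i a φ) := by
  simpa only [pairing_toCTest] using! measurable_pairing i (φ.toCTest a)

theorem pairing₂_eq_sum_coord (Y : State n) (Ψ : Fin 2 → CTest n) :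
    pairing₂ Y Ψ = ∑ i, ∑ a, coord i a (CTest.comp a (Ψ i)) Y := by
  simp only [pairing₂, pairing_eq_sum, coord]

variable {μ : Measure (State n)} {q : CovFun n}

theorem HasCovFun.coord_mul (h : HasCovFun μ q) (i j a b : Fin 2) (φ ψ : RTest n) :
    Integrable (fun Y => coord i a φ Y * coord j b ψ Y) μ ∧
      ∫ Y, coord i a φ Y * coord j b ψ Y ∂μ = kform (fun z => q i j z a b) φ ψ := by
  have h1 := h i j (φ.toCTest a) (ψ.toCTest b)
  simp only [pairing_toCTest, ← CTest.comp_apply, CTest.comp_toCTest] at h1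
  refine ⟨h1.1, h1.2.trans ?_⟩
  have e : ∀ (c d : Fin 2) (η : RTest n) (x : E n), (if c = d then η else 0) x =
      if c = d then η x else 0 := fun c d η x => by split_ifs <;> rfl
  simp only [e, kform, ite_mul, mul_ite, zero_mul, mul_zero, Finset.sum_ite_eq',
    Finset.mem_univ, if_true]

theorem HasCovFun.memLp_coord (h : HasCovFun μ q) (i a : Fin 2) (φ : RTest n) :
    MemLp (coord i a φ) 2 μ := by
  refine (memLp_two_iff_integrable_sq (measurable_coord i a φ).aestronglyMeasurable).2 ?_
  simpa only [sq] using (h.coord_mul i i a a φ φ).1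

theorem HasCovFun.kform_comm (h : HasCovFun μ q) (i j a b : Fin 2) (φ ψ : RTest n) :
    kform (fun z => q i j z a b) φ ψ = kform (fun z => q j i z b a) ψ φ := by
  rw [← (h.coord_mul i j a b φ ψ).2, ← (h.coord_mul j i b a ψ φ).2]
  simp only [mul_comm]

theorem HasCovFun.kform_self_nonneg (h : HasCovFun μ q) (i a : Fin 2) (φ : RTest n) :
    0 ≤ kform (fun z => q i i z a a) φ φ := by
  rw [← (h.coord_mul i i a a φ φ).2]
  exact integral_nonneg fun Y => mul_self_nonneg _

theorem HasCovFun.kform_sub_add (h : HasCovFun μ q) (i j a b : Fin 2) (φ φ' ψ ψ' : RTest n) :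
    kform (fun z => q i j z a b) (φ - φ') (ψ + ψ') =
      kform (fun z => q i j z a b) φ ψ + kform (fun z => q i j z a b) φ ψ' -
      (kform (fun z => q i j z a b) φ' ψ + kform (fun z => q i j z a b) φ' ψ') := by
  simp only [← (h.coord_mul i j a b _ _).2]
  have I := fun f g => (h.coord_mul i j a b f g).1
  rw [← integral_add (I _ _) (I _ _), ← integral_add (I _ _) (I _ _),
    ← integral_sub (by exact (I _ _).add (I _ _)) (by exact (I _ _).add (I _ _))]
  congr 1 with Y
  rw [coord_sub, coord_add]
  ring

theorem HasCovFun.integral_pairing₂_sq (h : HasCovFun μ q) (Ψ : Fin 2 → CTest n) :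
    ∫ Y, pairing₂ Y Ψ ^ 2 ∂μ = ∑ a, ∑ b,
      (kform (fun z => q 0 0 z a b) (CTest.comp a (Ψ 0)) (CTest.comp b (Ψ 0)) +
        kform (fun z => q 1 1 z a b) (CTest.comp a (Ψ 1)) (CTest.comp b (Ψ 1)) +
        2 * kform (fun z => q 0 1 z a b) (CTest.comp a (Ψ 0)) (CTest.comp b (Ψ 1))) := by
  simp only [← (h.coord_mul _ _ _ _ _ _).2]
  have I := fun i j a b f g => (h.coord_mul i j a b f g).1
  have hs : ∀ a b : Fin 2, Integrable (fun Y =>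
      coord 0 a (CTest.comp a (Ψ 0)) Y * coord 0 b (CTest.comp b (Ψ 0)) Y +
      coord 1 a (CTest.comp a (Ψ 1)) Y * coord 1 b (CTest.comp b (Ψ 1)) Y +
      2 * (coord 0 a (CTest.comp a (Ψ 0)) Y * coord 1 b (CTest.comp b (Ψ 1)) Y)) μ := fun a b =>
    ((I _ _ _ _ _ _).add (I _ _ _ _ _ _)).add ((I _ _ _ _ _ _).const_mul 2)
  have h1 : ∀ a b : Fin 2, (∫ Y, coord 0 a (CTest.comp a (Ψ 0)) Y *
      coord 0 b (CTest.comp b (Ψ 0)) Y ∂μ) + (∫ Y, coord 1 a (CTest.comp a (Ψ 1)) Y *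
      coord 1 b (CTest.comp b (Ψ 1)) Y ∂μ) + 2 * (∫ Y, coord 0 a (CTest.comp a (Ψ 0)) Y *
      coord 1 b (CTest.comp b (Ψ 1)) Y ∂μ) = ∫ Y,
      (coord 0 a (CTest.comp a (Ψ 0)) Y * coord 0 b (CTest.comp b (Ψ 0)) Y +
      coord 1 a (CTest.comp a (Ψ 1)) Y * coord 1 b (CTest.comp b (Ψ 1)) Y +
      2 * (coord 0 a (CTest.comp a (Ψ 0)) Y * coord 1 b (CTest.comp b (Ψ 1)) Y)) ∂μ :=
    fun a b => by
    rw [integral_add (by exact (I _ _ _ _ _ _).add (I _ _ _ _ _ _))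
      (by exact (I _ _ _ _ _ _).const_mul 2), integral_add (I _ _ _ _ _ _) (I _ _ _ _ _ _),
      integral_const_mul]
  simp only [h1]
  rw [Finset.sum_congr rfl fun a _ => (integral_finsetSum _ fun b _ => hs a b).symm,
    ← integral_finsetSum _ fun a _ => integrable_finsetSum _ fun b _ => hs a b]
  congr 1 with Y
  rw [pairing₂_eq_sum_coord]
  simp only [Fin.sum_univ_two]
  ring

theorem HasCovFun.memLp_pairing₂ (h : HasCovFun μ q) (Ψ : Fin 2 → CTest n) :
    MemLp (fun Y => pairing₂ Y Ψ) 2 μ := by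
  simp only [pairing₂_eq_sum_coord]
  exact memLp_finsetSum _ fun i _ => memLp_finsetSum _ fun a _ => h.memLp_coord i a _

/-- Each pairing is a real Gaussian variable, so the form in the exponent is its variance. This
links the definition of a Gaussian measure with the covariance functions. -/
theorem quadratic_eq_integral_sq [IsProbabilityMeasure μ] {Q : QuadraticForm ℝ (Fin 2 → CTest n)}
    (h0 : ∀ Ψ, 0 ≤ Q Ψ) (hQ : ∀ Ψ, charFunctional μ Ψ = Complex.exp (-(Q Ψ : ℂ) / 2))
    (Ψ : Fin 2 → CTest n) : Q Ψ = ∫ Y, pairing₂ Y Ψ ^ 2 ∂μ := by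
  refine (integral_sq_of_gaussian (measurable_pairing₂ Ψ).aemeasurable (h0 Ψ) fun t => ?_).symm
  have h1 := hQ (t • Ψ)
  rw [charFunctional, QuadraticMap.map_smul] at h1
  simp only [← pairingₗ_apply, map_smul] at h1 ⊢
  rw [smul_eq_mul, ← sq] at h1
  rw [← h1]
  congr 1 with Y
  rw [smul_eq_mul, Complex.ofReal_mul, mul_comm]

/-- A Gaussian initial measure whose covariance has finite mean energy density, satisfies the
symmetry condition, and is integrable. -/
structure IsInitial (μ : Measure (State n)) (q : CovFun n) : Prop where
  gpm : IsGPM μ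
  cov : HasCovFun μ q
  reg : IsRegularCovFun q
  symm : ∀ z, q 0 1 z = q 1 0 z
  int₁ : ∀ a b, Integrable fun z => q 1 1 z a b
  int₀ : ∀ a b, Integrable fun z => q 0 0 z a b
  intΔ : ∀ a b, Integrable (Δ fun z => q 0 0 z a b)

theorem continuous_energyCovFun (h : IsRegularCovFun q) (a b : Fin 2) :
    Continuous (energyCovFun m q a b) := by
  unfold energyCovFun
  exact ((h.2 1 1 a b).sub (continuous_laplacian (h.1 a b))).add
    (continuous_const.mul (h.2 0 0 a b))

namespace IsInitial

theorem integrable_energyCovFun (h : IsInitial μ q) (a b : Fin 2) :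
    Integrable (energyCovFun m q a b) :=
  ((h.int₁ a b).sub (h.intΔ a b)).add ((h.int₀ a b).const_mul _)

theorem four_energyCovFun (h : IsInitial μ q) (a b : Fin 2) (ξ : E n) :
    four (energyCovFun m q a b) ξ =
      four (fun z => q 1 1 z a b) ξ + (disp m ξ ^ 2 : ℝ) * four (fun z => q 0 0 z a b) ξ := by
  rw [← four_laplacian (h.reg.1 a b) (h.int₀ a b) (h.intΔ a b)]
  refine Eq.trans ?_ (four_add (h.int₁ a b)
    (((h.int₀ a b).const_mul (m ^ 2)).sub (h.intΔ a b)) ξ)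
  refine congrArg (fun p => four p ξ) (funext fun z => ?_)
  simp only [energyCovFun, Pi.sub_apply]
  ring

theorem four_nonneg₀ (h : IsInitial μ q) (a : Fin 2) (ξ : E n) :
    0 ≤ (four (fun z => q 0 0 z a a) ξ).re ∧ (four (fun z => q 0 0 z a a) ξ).im = 0 :=
  four_nonneg (h.int₀ a a) (h.cov.kform_comm 0 0 a a) (h.cov.kform_self_nonneg 0 a) ξ

theorem four_nonneg₁ (h : IsInitial μ q) (a : Fin 2) (ξ : E n) :
    0 ≤ (four (fun z => q 1 1 z a a) ξ).re ∧ (four (fun z => q 1 1 z a a) ξ).im = 0 :=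
  four_nonneg (h.int₁ a a) (h.cov.kform_comm 1 1 a a) (h.cov.kform_self_nonneg 1 a) ξ

theorem four_energy_nonneg (h : IsInitial μ q) (a : Fin 2) (ξ : E n) :
    0 ≤ (four (energyCovFun m q a a) ξ).re ∧ (four (energyCovFun m q a a) ξ).im = 0 := by
  have h0 := h.four_nonneg₀ a ξ
  have h1 := h.four_nonneg₁ a ξ
  rw [h.four_energyCovFun, Complex.add_re, Complex.add_im, Complex.re_ofReal_mul,
    Complex.im_ofReal_mul, h0.2, h1.2, mul_zero, add_zero]
  exact ⟨add_nonneg h1.1 (mul_nonneg (sq_nonneg _) h0.1), rfl⟩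

end IsInitial

/-- The spectral energy density, a weight for the majorant of the covariances. -/
def spectralDensity (m : ℝ) (q : CovFun n) (ξ : E n) : ℝ :=
  ∑ a, (four (energyCovFun m q a a) ξ).re

theorem IsInitial.spectralDensity_nonneg (h : IsInitial μ q) (ξ : E n) :
    0 ≤ spectralDensity m q ξ :=
  Finset.sum_nonneg fun a _ => (h.four_energy_nonneg a ξ).1

theorem IsInitial.integrable_spectralDensity (h : IsInitial μ q) :
    Integrable (spectralDensity m q) :=
  integrable_finsetSum _ fun a _ => (integrable_four_of_nonneg (h.integrable_energyCovFun a a)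
    (continuous_energyCovFun h.reg a a) (h.four_energy_nonneg a)).re

theorem IsInitial.continuous_spectralDensity (h : IsInitial μ q) :
    Continuous (spectralDensity m q) :=
  continuous_finsetSum _ fun a _ =>
    Complex.continuous_re.comp (continuous_four (h.integrable_energyCovFun a a))

theorem spectralDensity_le (ξ : E n) :
    spectralDensity m q ξ ≤ ∑ a, ∫ z, |energyCovFun m q a a z| :=
  Finset.sum_le_sum fun _ _ => (Complex.re_le_norm _).trans (norm_four_le _ ξ)

/-! ### The flow on test functions -/

/-- A local Fourier multiplier as a linear operator on test functions. -/
def evolₗ {a : E n → ℝ} (ha : IsLocalSymbol a) : RTest n →ₗ[ℝ] RTest n where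
  toFun := evol a
  map_add' φ ψ := by
    ext x
    simp only [ha.evol_apply, RTest.toSchwartz_add, map_add, add_apply, Complex.add_re]
  map_smul' c φ := by
    ext x
    simp only [ha.evol_apply, RTest.toSchwartz_smul, map_smul, smul_apply, RingHom.id_apply,
      smul_eq_mul, Complex.smul_re]

/-- The adjoint of the Klein–Gordon flow, acting on pairs of test functions. -/
def flow (hm : 0 < m) (t : ℝ) : (Fin 2 → CTest n) →ₗ[ℝ] (Fin 2 → CTest n) where
  toFun Ψ := ![∑ a, RTest.toCTest a (evolₗ (isLocalSymbol_cos hm t) (CTest.comp a (Ψ 0)) -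
      evolₗ (isLocalSymbol_sin hm t) (CTest.comp a (Ψ 1))),
    ∑ a, RTest.toCTest a (evolₗ (isLocalSymbol_sinc hm t) (CTest.comp a (Ψ 0)) +
      evolₗ (isLocalSymbol_cos hm t) (CTest.comp a (Ψ 1)))]
  map_add' Ψ Φ := by
    funext i
    fin_cases i <;> simp only [Pi.add_apply, map_add, map_sub, Fin.sum_univ_two, Fin.zero_eta,
      Fin.mk_one, Matrix.cons_val_zero, Matrix.cons_val_one] <;> abel
  map_smul' c Ψ := by
    funext i
    fin_cases i <;> simp only [Pi.smul_apply, map_smul, map_sub, map_add, Fin.sum_univ_two,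
      Fin.zero_eta, Fin.mk_one, Matrix.cons_val_zero, Matrix.cons_val_one, RingHom.id_apply,
      smul_sub, smul_add]

theorem comp_sum_toCTest (φ : Fin 2 → RTest n) (a : Fin 2) :
    CTest.comp a (∑ b, (φ b).toCTest b) = φ a := by
  rw [map_sum]
  simp [CTest.comp_toCTest]

theorem comp_flow_zero (hm : 0 < m) (t : ℝ) (Ψ : Fin 2 → CTest n) (a : Fin 2) :
    CTest.comp a (flow hm t Ψ 0) =
      evol (cosSym m t) (CTest.comp a (Ψ 0)) - evol (sinSym m t) (CTest.comp a (Ψ 1)) :=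
  comp_sum_toCTest (fun a => evolₗ (isLocalSymbol_cos hm t) (CTest.comp a (Ψ 0)) -
      evolₗ (isLocalSymbol_sin hm t) (CTest.comp a (Ψ 1))) a

theorem comp_flow_one (hm : 0 < m) (t : ℝ) (Ψ : Fin 2 → CTest n) (a : Fin 2) :
    CTest.comp a (flow hm t Ψ 1) =
      evol (sincSym m t) (CTest.comp a (Ψ 0)) + evol (cosSym m t) (CTest.comp a (Ψ 1)) :=
  comp_sum_toCTest (fun a => evolₗ (isLocalSymbol_sinc hm t) (CTest.comp a (Ψ 0)) +
      evolₗ (isLocalSymbol_cos hm t) (CTest.comp a (Ψ 1))) a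

theorem IsKGSolution.pairing₂_flow (hm : 0 < m) {Y : ℝ → State n} (hY : IsKGSolution m Y) (t : ℝ)
    (Ψ : Fin 2 → CTest n) : pairing₂ (Y t) Ψ = pairing₂ (Y 0) (flow hm t Ψ) := by
  rw [pairing₂_eq_sum_coord, pairing₂_eq_sum_coord, Fin.sum_univ_two (M := ℝ)
    (fun i => ∑ a, coord i a (CTest.comp a (Ψ i)) (Y t)), Fin.sum_univ_two (M := ℝ)
    (fun i => ∑ a, coord i a (CTest.comp a (flow hm t Ψ i)) (Y 0)), ← Finset.sum_add_distrib, ← Finset.sum_add_distrib]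
  refine Finset.sum_congr rfl fun a _ => ?_
  rw [comp_flow_zero, comp_flow_one, coord_sub, coord_add]
  simp only [coord]
  rw [solution_apply_zero hm hY _ t, solution_apply_one hm hY _ t, comp_add, comp_add, comp_neg]
  ring

theorem IsRandomSolution.charFunctional_map (hm : 0 < m) {Ω : Type*} [MeasurableSpace Ω]
    {P : Measure Ω} {Y : ℝ → Ω → State n} (hY : IsRandomSolution m P Y μ) (t : ℝ)
    (Ψ : Fin 2 → CTest n) :
    charFunctional (P.map (Y t)) Ψ = charFunctional μ (flow hm t Ψ) := by
  have hc : ∀ Ψ : Fin 2 → CTest n, Measurable fun Y : State n =>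
      Complex.exp (Complex.I * (pairing₂ Y Ψ : ℂ)) := fun Ψ => by
    have := measurable_pairing₂ Ψ
    fun_prop
  rw [← hY.initial, charFunctional, charFunctional,
    integral_map (hY.measurable t).aemeasurable (hc _).aestronglyMeasurable,
    integral_map (hY.measurable 0).aemeasurable (hc _).aestronglyMeasurable]
  refine integral_congr_ae (hY.solution.mono fun ω hω => ?_)
  beta_reduce
  rw [hω.pairing₂_flow hm]

/-! ### Convergence of the covariances -/

theorem integrable_four_symbol_mul {p : E n → ℝ} (hp : Integrable p) {w : E n → ℝ}
    (hw : w.HasTemperateGrowth) (f g : 𝓢(E n, ℂ)) :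
    Integrable fun ξ => four p ξ * ((w ξ : ℂ) * (conj (f ξ) * g ξ)) := by
  have h1 : Integrable fun ξ => conj (f ξ) * ((w ξ : ℂ) * g ξ) :=
    (integrable_symbol_mul hw g).bdd_mul (c := ‖f.toBoundedContinuousFunction‖)
      (Complex.continuous_conj.comp f.continuous).aestronglyMeasurable (ae_of_all _ fun ξ => by
        rw [RCLike.norm_conj]; exact f.toBoundedContinuousFunction.norm_coe_le_norm ξ)
  refine (h1.bdd_mul (c := ∫ z, |p z|) (continuous_four hp).aestronglyMeasurable
    (ae_of_all _ fun ξ => norm_four_le p ξ)).congr (ae_of_all _ fun ξ => ?_)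
  beta_reduce
  ring

theorem hasTemperateGrowth_disp_sq (hm : 0 < m) :
    Function.HasTemperateGrowth fun ξ : E n => disp m ξ ^ 2 := by
  simpa only [sq] using! (hasTemperateGrowth_disp hm).mul (hasTemperateGrowth_disp hm)

theorem hasTemperateGrowth_disp_inv_sq (hm : 0 < m) :
    Function.HasTemperateGrowth fun ξ : E n => (disp m ξ)⁻¹ ^ 2 := by
  simpa only [sq] using! (hasTemperateGrowth_disp_inv hm).mul (hasTemperateGrowth_disp_inv hm)

theorem tendsto_kform_flow_zero (hn : 0 < n) (hm : 0 < m) {p : E n → ℝ} (hp : Integrable p)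
    (φ φ' ψ ψ' : RTest n) :
    Tendsto (fun t => kform p (evol (cosSym m t) φ - evol (sinSym m t) φ')
      (evol (cosSym m t) ψ - evol (sinSym m t) ψ')) atTop
      (𝓝 (1 / 2 * ∫ ξ, (four p ξ * (conj (𝓕 φ.toSchwartz ξ) * 𝓕 ψ.toSchwartz ξ) +
        four p ξ * ((disp m ξ ^ 2 : ℝ) *
          (conj (𝓕 φ'.toSchwartz ξ) * 𝓕 ψ'.toSchwartz ξ)))).re) := by
  have h := tendsto_integral_quadratic_disp hn hm (integrable_four_mul hp (𝓕 φ.toSchwartz)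
    (𝓕 ψ.toSchwartz)) (integrable_four_symbol_mul hp (hasTemperateGrowth_disp_sq hm)
    (𝓕 φ'.toSchwartz) (𝓕 ψ'.toSchwartz))
    ((integrable_four_symbol_mul hp (hasTemperateGrowth_disp hm) (𝓕 φ.toSchwartz)
      (𝓕 ψ'.toSchwartz)).add (integrable_four_symbol_mul hp (hasTemperateGrowth_disp hm)
      (𝓕 φ'.toSchwartz) (𝓕 ψ.toSchwartz))).neg
  refine ((Complex.continuous_re.tendsto _).comp h).congr fun t => ?_
  rw [Function.comp_apply, ← Complex.ofReal_re (kform _ _ _), kform_eq_fourier hp]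
  congr 2 with ξ
  simp only [RTest.toSchwartz_sub, fourier_sub_schwartz, sub_apply,
    (isLocalSymbol_cos hm t).fourier_evol, (isLocalSymbol_sin hm t).fourier_evol, cosSym, sinSym,
    map_sub, map_mul, Complex.conj_ofReal, Pi.neg_apply, Pi.add_apply]
  push_cast
  ring

theorem tendsto_kform_flow_one (hn : 0 < n) (hm : 0 < m) {p : E n → ℝ} (hp : Integrable p)
    (φ φ' ψ ψ' : RTest n) :
    Tendsto (fun t => kform p (evol (sincSym m t) φ + evol (cosSym m t) φ')
      (evol (sincSym m t) ψ + evol (cosSym m t) ψ')) atTop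
      (𝓝 (1 / 2 * ∫ ξ, (four p ξ * (conj (𝓕 φ'.toSchwartz ξ) * 𝓕 ψ'.toSchwartz ξ) +
        four p ξ * (((disp m ξ)⁻¹ ^ 2 : ℝ) *
          (conj (𝓕 φ.toSchwartz ξ) * 𝓕 ψ.toSchwartz ξ)))).re) := by
  have h := tendsto_integral_quadratic_disp hn hm (integrable_four_mul hp (𝓕 φ'.toSchwartz)
    (𝓕 ψ'.toSchwartz)) (integrable_four_symbol_mul hp (hasTemperateGrowth_disp_inv_sq hm)
    (𝓕 φ.toSchwartz) (𝓕 ψ.toSchwartz))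
    ((integrable_four_symbol_mul hp (hasTemperateGrowth_disp_inv hm) (𝓕 φ.toSchwartz)
      (𝓕 ψ'.toSchwartz)).add (integrable_four_symbol_mul hp (hasTemperateGrowth_disp_inv hm)
      (𝓕 φ'.toSchwartz) (𝓕 ψ.toSchwartz)))
  refine ((Complex.continuous_re.tendsto _).comp h).congr fun t => ?_
  rw [Function.comp_apply, ← Complex.ofReal_re (kform _ _ _), kform_eq_fourier hp]
  congr 2 with ξ
  simp only [RTest.toSchwartz_add, FourierTransform.fourier_add, add_apply,
    (isLocalSymbol_cos hm t).fourier_evol, (isLocalSymbol_sinc hm t).fourier_evol, cosSym, sincSym,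
    map_add, map_mul, Complex.conj_ofReal, Pi.add_apply]
  push_cast
  ring

theorem kform_congr_of_radius {p p' : E n → ℝ} {φ ψ : RTest n} {R : ℝ}
    (hφ : ∀ x, R < ‖x‖ → φ x = 0) (hψ : ∀ x, R < ‖x‖ → ψ x = 0)
    (hp : ∀ z, ‖z‖ ≤ 2 * R → p z = p' z) : kform p φ ψ = kform p' φ ψ := by
  unfold kform
  congr 1 with x
  congr 1 with y
  by_cases hx : R < ‖x‖
  · simp [hφ x hx]
  by_cases hy : R < ‖y‖
  · simp [hψ y hy]
  rw [hp]
  have := norm_sub_le x y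
  linarith

/-- Local Fourier multipliers may be moved from one argument of a translation-invariant form to
the other one. -/
theorem kform_evol_evol {p : E n → ℝ} (hp : Continuous p) {a b c : E n → ℝ} (ha : IsLocalSymbol a)
    (hb : IsLocalSymbol b) (hc : IsLocalSymbol c) {u v : ℝ} (h : ∀ ξ, a ξ * b ξ = u + v * c ξ)
    (φ ψ : RTest n) :
    kform p (evol a φ) (evol b ψ) = u * kform p φ ψ + v * kform p φ (evol c ψ) := by
  obtain ⟨R₁, h₁⟩ := φ.exists_radius
  obtain ⟨R₂, h₂⟩ := ψ.exists_radius
  obtain ⟨R₃, h₃⟩ := (evol a φ).exists_radius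
  obtain ⟨R₄, h₄⟩ := (evol b ψ).exists_radius
  obtain ⟨R₅, h₅⟩ := (evol c ψ).exists_radius
  obtain ⟨R, k₁, k₂, k₃, k₄, k₅⟩ : ∃ R, R₁ ≤ R ∧ R₂ ≤ R ∧ R₃ ≤ R ∧ R₄ ≤ R ∧ R₅ ≤ R :=
    ⟨max R₁ (max R₂ (max R₃ (max R₄ R₅))), by simp⟩
  -- The kernel is only continuous, so it need not have a Fourier transform. As all the test
  -- functions are supported in the ball of radius R, only its values in the ball of radius 2R
  -- matter, and it may be truncated.
  let p' : E n → ℝ := (Metric.closedBall 0 (2 * R)).indicator p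
  have hp' : Integrable p' := (hp.continuousOn.integrableOn_compact
    (isCompact_closedBall _ _)).integrable_indicator Metric.isClosed_closedBall.measurableSet
  have e : ∀ z : E n, ‖z‖ ≤ 2 * R → p z = p' z := fun z hz =>
    (indicator_of_mem (by simpa using hz) _).symm
  rw [kform_congr_of_radius (fun x hx => h₃ x (k₃.trans_lt hx)) (fun x hx => h₄ x (k₄.trans_lt hx)) e,
    kform_congr_of_radius (fun x hx => h₁ x (k₁.trans_lt hx)) (fun x hx => h₂ x (k₂.trans_lt hx)) e,
    kform_congr_of_radius (fun x hx => h₁ x (k₁.trans_lt hx)) (fun x hx => h₅ x (k₅.trans_lt hx)) e]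
  have h6 : (kform p' (evol a φ) (evol b ψ) : ℂ) =
      (u : ℂ) * (kform p' φ ψ : ℂ) + (v : ℂ) * (kform p' φ (evol c ψ) : ℂ) := by
    rw [kform_eq_fourier hp', kform_eq_fourier hp', kform_eq_fourier hp', ← integral_const_mul,
      ← integral_const_mul, ← integral_add ((integrable_four_mul hp' _ _).const_mul _)
        ((integrable_four_mul hp' _ _).const_mul _)]
    congr 1 with ξ
    rw [ha.fourier_evol, hb.fourier_evol, hc.fourier_evol, map_mul, Complex.conj_ofReal]
    have := congrArg (fun x : ℝ => (x : ℂ)) (h ξ)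
    push_cast at this
    linear_combination (four p' ξ * (conj (𝓕 φ.toSchwartz ξ) * 𝓕 ψ.toSchwartz ξ)) * this
  exact_mod_cast h6

/-- A bounded family in a subspace which is weakly null on the subspace is weakly null. -/
theorem tendsto_inner_zero_of_mem {H A : Type*} [NormedAddCommGroup H] [InnerProductSpace ℝ H]
    [CompleteSpace H] {l : Filter A} (S : Submodule ℝ H) {v : A → H} (hv : ∀ a, v a ∈ S) {C : ℝ}
    (hC : ∀ a, ‖v a‖ ≤ C) (h0 : ∀ s ∈ S, Tendsto (fun a => inner ℝ s (v a)) l (𝓝 0)) (h : H) :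
    Tendsto (fun a => inner ℝ h (v a)) l (𝓝 0) := by
  rcases isEmpty_or_nonempty A with hA | ⟨⟨a₀⟩⟩
  · rw [filter_eq_bot_of_isEmpty l]; exact tendsto_bot
  have hC0 : 0 ≤ C := (norm_nonneg _).trans (hC a₀)
  have hcl : IsClosed (S.topologicalClosure : Set H) := S.isClosed_topologicalClosure
  have : CompleteSpace S.topologicalClosure := hcl.completeSpace_coe
  -- Only the projection of h to the closure of `S` matters, and it is approximated by elements of
  -- `S`.
  set p := S.topologicalClosure.starProjection h with hp
  have h1 : ∀ a, inner ℝ h (v a) = inner ℝ p (v a) := fun a => by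
    have h2 : inner ℝ (v a) (h - p) = 0 :=
      (S.topologicalClosure.sub_starProjection_mem_orthogonal h) _
        (S.le_topologicalClosure (hv a))
    rw [inner_sub_right] at h2
    rw [real_inner_comm, real_inner_comm _ p]
    linarith
  simp only [h1]
  have hpS : p ∈ closure (S : Set H) :=
    Submodule.starProjection_apply_mem S.topologicalClosure h
  rw [Metric.tendsto_nhds]
  intro ε hε
  obtain ⟨s, hs, hps⟩ := Metric.mem_closure_iff.1 hpS (ε / (2 * (C + 1))) (by positivity)
  filter_upwards [Metric.tendsto_nhds.1 (h0 s hs) (ε / 2) (by positivity)] with a ha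
  rw [dist_zero_right] at ha ⊢
  have h3 : inner ℝ p (v a) = inner ℝ (p - s) (v a) + inner ℝ s (v a) := by
    rw [inner_sub_left]; ring
  have h4 : ‖(inner ℝ (p - s) (v a) : ℝ)‖ ≤ ε / 2 := by
    rw [dist_eq_norm] at hps
    calc _ ≤ ‖p - s‖ * ‖v a‖ := norm_inner_le_norm _ _
      _ ≤ ε / (2 * (C + 1)) * (C + 1) := by
        gcongr
        exact (hC a).trans (by linarith)
      _ = ε / 2 := by field_simp
  rw [h3]
  linarith [norm_add_le (inner ℝ (p - s) (v a)) (inner ℝ s (v a))]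

/-- The random variables Yⁱ(φ) are vectors of L²(μ) whose inner products are the covariances. If the
j-th variables along η are bounded and weakly null in their own span, they are weakly null in all of
L²(μ). Decay of the mixed covariance thus follows without any integrability of its kernel. -/
theorem HasCovFun.tendsto_kform_cross (h : HasCovFun μ q) (i j a b : Fin 2) {η : ℝ → RTest n}
    {C : ℝ} (hC : ∀ t, kform (fun z => q j j z b b) (η t) (η t) ≤ C)
    (h0 : ∀ ψ, Tendsto (fun t => kform (fun z => q j j z b b) ψ (η t)) atTop (𝓝 0))
    (φ : RTest n) : Tendsto (fun t => kform (fun z => q i j z a b) φ (η t)) atTop (𝓝 0) := by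
  let X : Fin 2 → Fin 2 → RTest n → Lp ℝ 2 μ := fun i a φ => (h.memLp_coord i a φ).toLp _
  have hX : ∀ i j a b φ ψ, inner ℝ (X i a φ) (X j b ψ) = kform (fun z => q i j z a b) φ ψ :=
    fun i j a b φ ψ => by
    rw [← (h.coord_mul i j a b φ ψ).2, L2.inner_def]
    refine integral_congr_ae ?_
    filter_upwards [(h.memLp_coord i a φ).coeFn_toLp, (h.memLp_coord j b ψ).coeFn_toLp]
      with Y h1 h2
    rw [h1, h2, real_inner_eq_re_inner, RCLike.inner_apply, conj_trivial, mul_comm]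
    rfl
  simp only [← hX]
  refine tendsto_inner_zero_of_mem (Submodule.span ℝ (range (X j b))) (C := √C)
    (fun t => Submodule.subset_span (mem_range_self _)) (fun t => ?_) (fun s hs => ?_) _
  · refine Real.le_sqrt_of_sq_le ?_
    rw [← real_inner_self_eq_norm_sq, hX]
    exact hC t
  · induction hs using Submodule.span_induction with
    | mem x hx => obtain ⟨ψ, rfl⟩ := hx; simp only [hX]; exact h0 ψ
    | zero => simp only [inner_zero_left]; exact tendsto_const_nhds
    | add x y _ _ hx hy => simp only [inner_add_left]; simpa using hx.add hy
    | smul c x _ hx => simp only [real_inner_smul_left]; simpa using hx.const_mul c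

theorem kform_evol_self_le {p : E n → ℝ} (hp : Integrable p) {a b : E n → ℝ} (ha : IsLocalSymbol a)
    (hb : b.HasTemperateGrowth) (hab : ∀ ξ, |a ξ| ≤ b ξ) (ψ : RTest n) :
    kform p (evol a ψ) (evol a ψ) ≤
      ∫ ξ, ‖four p ξ * (((b ξ * b ξ : ℝ) : ℂ) *
        (conj (𝓕 ψ.toSchwartz ξ) * 𝓕 ψ.toSchwartz ξ))‖ := by
  have h1 := kform_eq_fourier hp (evol a ψ) (evol a ψ)
  have h2 : ‖(kform p (evol a ψ) (evol a ψ) : ℂ)‖ ≤ _ := h1 ▸ norm_integral_le_integral_norm _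
  rw [Complex.norm_real] at h2
  refine (le_abs_self _).trans (h2.trans (integral_mono (integrable_four_mul hp _ _).norm
    (integrable_four_symbol_mul hp (hb.mul hb) _ _).norm fun ξ => ?_))
  simp only [norm_mul, ha.fourier_evol, RCLike.norm_conj, Complex.norm_real, Real.norm_eq_abs]
  have h3 : |b ξ| = b ξ := abs_of_nonneg ((abs_nonneg _).trans (hab ξ))
  rw [h3]
  calc _ = ‖four p ξ‖ * (|a ξ| * |a ξ| * (‖𝓕 ψ.toSchwartz ξ‖ * ‖𝓕 ψ.toSchwartz ξ‖)) := by ring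
    _ ≤ _ := by
      have := mul_le_mul (hab ξ) (hab ξ) (abs_nonneg _) ((abs_nonneg _).trans (hab ξ))
      gcongr

theorem tendsto_kform_evol (hn : 0 < n) (hm : 0 < m) {p : E n → ℝ} (hp : Integrable p)
    (φ ψ : RTest n) :
    Tendsto (fun t => kform p φ (evol (cosSym m t) ψ)) atTop (𝓝 0) ∧
    Tendsto (fun t => kform p φ (evol (sincSym m t) ψ)) atTop (𝓝 0) ∧
    Tendsto (fun t => kform p φ (evol (sinSym m t) ψ)) atTop (𝓝 0) := by
  have key : ∀ {a : ℝ → E n → ℝ}, (∀ t, IsLocalSymbol (a t)) → ∀ w : ℝ → E n → ℂ,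
      (∀ t ξ, w t ξ = four p ξ * (a t ξ * (conj (𝓕 φ.toSchwartz ξ) * 𝓕 ψ.toSchwartz ξ))) →
      Tendsto (fun t => ∫ ξ, w t ξ) atTop (𝓝 0) →
      Tendsto (fun t => kform p φ (evol (a t) ψ)) atTop (𝓝 0) := fun {a} ha w hw h => by
    have h1 := (Complex.continuous_re.tendsto _).comp h
    rw [Complex.zero_re] at h1
    refine h1.congr fun t => ?_
    rw [Function.comp_apply, ← Complex.ofReal_re (kform _ _ _), kform_eq_fourier hp]
    congr 2 with ξ
    rw [hw, (ha t).fourier_evol]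
    ring
  refine ⟨key (isLocalSymbol_cos hm) _ (fun t ξ => ?_) (tendsto_integral_cos_sin_disp hn hm
      (integrable_four_mul hp (𝓕 φ.toSchwartz) (𝓕 ψ.toSchwartz))).1,
    key (isLocalSymbol_sinc hm) _ (fun t ξ => ?_) (tendsto_integral_cos_sin_disp hn hm
      (integrable_four_symbol_mul hp (hasTemperateGrowth_disp_inv hm) (𝓕 φ.toSchwartz)
        (𝓕 ψ.toSchwartz))).2,
    key (isLocalSymbol_sin hm) _ (fun t ξ => ?_) (tendsto_integral_cos_sin_disp hn hm
      (integrable_four_symbol_mul hp (hasTemperateGrowth_disp hm) (𝓕 φ.toSchwartz)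
        (𝓕 ψ.toSchwartz))).2⟩
  · rw [cosSym]; ring
  · rw [sincSym]; push_cast; ring
  · rw [sinSym]; push_cast; ring

/-- Only the integrable kernel q¹¹ is Fourier transformed: it supplies boundedness along the flow
and, by Riemann–Lebesgue, decay against fixed test functions. -/
theorem IsInitial.tendsto_cross (hn : 0 < n) (hm : 0 < m) (h : IsInitial μ q) (a b : Fin 2)
    (φ ψ : RTest n) :
    Tendsto (fun t => kform (fun z => q 0 1 z a b) φ (evol (cosSym m t) ψ)) atTop (𝓝 0) ∧
    Tendsto (fun t => kform (fun z => q 0 1 z a b) φ (evol (sincSym m t) ψ)) atTop (𝓝 0) ∧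
    Tendsto (fun t => kform (fun z => q 0 1 z a b) φ (evol (sinSym m t) ψ)) atTop (𝓝 0) := by
  have hp := h.int₁ b b
  refine ⟨h.cov.tendsto_kform_cross 0 1 a b (fun t => kform_evol_self_le hp
      (isLocalSymbol_cos hm t) (b := fun _ => 1) (.const 1) (abs_cosSym_le m t) ψ)
      (fun η => (tendsto_kform_evol hn hm hp η ψ).1) φ,
    h.cov.tendsto_kform_cross 0 1 a b (fun t => kform_evol_self_le hp
      (isLocalSymbol_sinc hm t) (hasTemperateGrowth_disp_inv hm) (abs_sincSym_le hm t) ψ)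
      (fun η => (tendsto_kform_evol hn hm hp η ψ).2.1) φ,
    h.cov.tendsto_kform_cross 0 1 a b (fun t => kform_evol_self_le hp
      (isLocalSymbol_sin hm t) (hasTemperateGrowth_disp hm) (abs_sinSym_le hm t) ψ)
      (fun η => (tendsto_kform_evol hn hm hp η ψ).2.2) φ⟩

/-- The double angle formulas leave the constant 1/2 in both cos² and sin². The two constant terms
enter with opposite signs and cancel after summation, because G0 makes the mixed form symmetric
under exchange of its arguments and matrix indices. Only oscillating terms remain. -/
theorem IsInitial.sum_cross (hm : 0 < m) (h : IsInitial μ q) (t : ℝ) (Ψ : Fin 2 → CTest n) :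
    ∑ a, ∑ b, kform (fun z => q 0 1 z a b) (CTest.comp a (flow hm t Ψ 0))
      (CTest.comp b (flow hm t Ψ 1)) = ∑ a, ∑ b,
      (1 / 2 * kform (fun z => q 0 1 z a b) (CTest.comp a (Ψ 0))
          (evol (sincSym m (2 * t)) (CTest.comp b (Ψ 0))) +
        kform (fun z => q 0 1 z a b) (CTest.comp a (Ψ 0))
          (evol (cosSym m (2 * t)) (CTest.comp b (Ψ 1))) -
        1 / 2 * kform (fun z => q 0 1 z a b) (CTest.comp a (Ψ 1))
          (evol (sinSym m (2 * t)) (CTest.comp b (Ψ 1)))) := by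
  have hs : ∀ (a b : Fin 2) (φ ψ : RTest n), kform (fun z => q 0 1 z a b) φ ψ =
      kform (fun z => q 0 1 z b a) ψ φ := fun a b φ ψ => by
    rw [h.cov.kform_comm 0 1 a b]
    simp only [h.symm]
  have hc := fun a b => h.reg.2 0 1 a b
  have hC := isLocalSymbol_cos (n := n) hm t
  have hS := isLocalSymbol_sinc (n := n) hm t
  have hA := isLocalSymbol_sin (n := n) hm t
  have hC2 := isLocalSymbol_cos (n := n) hm (2 * t)
  have hS2 := isLocalSymbol_sinc (n := n) hm (2 * t)
  have hA2 := isLocalSymbol_sin (n := n) hm (2 * t)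
  have hd := fun ξ : E n => (disp_pos hm ξ).ne'
  have e1 : ∀ a b φ ψ, kform (fun z => q 0 1 z a b) (evol (cosSym m t) φ) (evol (sincSym m t) ψ) =
      1 / 2 * kform (fun z => q 0 1 z a b) φ (evol (sincSym m (2 * t)) ψ) := fun a b φ ψ => by
    rw [kform_evol_evol (hc a b) hC hS hS2 (u := 0) (v := 1 / 2), zero_mul, zero_add]
    intro ξ
    rw [cosSym, sincSym, sincSym, mul_assoc 2, Real.sin_two_mul]
    ring
  have e2 : ∀ a b φ ψ, kform (fun z => q 0 1 z a b) (evol (cosSym m t) φ) (evol (cosSym m t) ψ) =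
      1 / 2 * kform (fun z => q 0 1 z a b) φ ψ +
      1 / 2 * kform (fun z => q 0 1 z a b) φ (evol (cosSym m (2 * t)) ψ) := fun a b φ ψ => by
    rw [kform_evol_evol (hc a b) hC hC hC2]
    intro ξ
    rw [cosSym, cosSym, mul_assoc 2, Real.cos_two_mul]
    ring
  have e3 : ∀ a b φ ψ, kform (fun z => q 0 1 z a b) (evol (sincSym m t) φ) (evol (sinSym m t) ψ) =
      1 / 2 * kform (fun z => q 0 1 z a b) φ ψ +
      -(1 / 2) * kform (fun z => q 0 1 z a b) φ (evol (cosSym m (2 * t)) ψ) := fun a b φ ψ => by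
    rw [kform_evol_evol (hc a b) hS hA hC2]
    intro ξ
    rw [cosSym, sincSym, sinSym, mul_assoc 2, Real.cos_two_mul']
    have h1 := Real.sin_sq_add_cos_sq (t * disp m ξ)
    have h2 := inv_mul_cancel₀ (hd ξ)
    linear_combination Real.sin (t * disp m ξ) ^ 2 * h2 + (1 / 2) * h1
  have e4 : ∀ a b φ ψ, kform (fun z => q 0 1 z a b) (evol (sinSym m t) φ) (evol (cosSym m t) ψ) =
      1 / 2 * kform (fun z => q 0 1 z a b) φ (evol (sinSym m (2 * t)) ψ) := fun a b φ ψ => by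
    rw [kform_evol_evol (hc a b) hA hC hA2 (u := 0) (v := 1 / 2), zero_mul, zero_add]
    intro ξ
    rw [cosSym, sinSym, sinSym, mul_assoc 2, Real.sin_two_mul]
    ring
  have h1 : ∀ a b, kform (fun z => q 0 1 z a b) (CTest.comp a (flow hm t Ψ 0))
      (CTest.comp b (flow hm t Ψ 1)) =
      (1 / 2 * kform (fun z => q 0 1 z a b) (CTest.comp a (Ψ 0))
          (evol (sincSym m (2 * t)) (CTest.comp b (Ψ 0))) +
        (1 / 2 * kform (fun z => q 0 1 z a b) (CTest.comp a (Ψ 0)) (CTest.comp b (Ψ 1)) +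
          1 / 2 * kform (fun z => q 0 1 z a b) (CTest.comp a (Ψ 0))
          (evol (cosSym m (2 * t)) (CTest.comp b (Ψ 1)))) -
        1 / 2 * kform (fun z => q 0 1 z a b) (CTest.comp a (Ψ 1))
          (evol (sinSym m (2 * t)) (CTest.comp b (Ψ 1)))) -
      (1 / 2 * kform (fun z => q 0 1 z b a) (CTest.comp b (Ψ 0)) (CTest.comp a (Ψ 1)) +
          -(1 / 2) * kform (fun z => q 0 1 z b a) (CTest.comp b (Ψ 0))
          (evol (cosSym m (2 * t)) (CTest.comp a (Ψ 1)))) := fun a b => by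
    rw [comp_flow_zero, comp_flow_one, h.cov.kform_sub_add, e1, e2,
      hs a b (evol (sinSym m t) _) (evol (sincSym m t) _), e3, e4]
    ring
  simp only [h1, Fin.sum_univ_two]
  ring

/-- The covariance form of the limiting measure. -/
def limitForm (m : ℝ) (q : CovFun n) (Ψ : Fin 2 → CTest n) : ℝ :=
  ∑ a, ∑ b, (1 / 2 * ∫ ξ, four (energyCovFun m q a b) ξ *
    (((disp m ξ)⁻¹ ^ 2 : ℝ) * (conj (𝓕 (CTest.comp a (Ψ 0)).toSchwartz ξ) *
      𝓕 (CTest.comp b (Ψ 0)).toSchwartz ξ) +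
      conj (𝓕 (CTest.comp a (Ψ 1)).toSchwartz ξ) * 𝓕 (CTest.comp b (Ψ 1)).toSchwartz ξ)).re

/-- Averaging turns the diagonal terms into half of q̂⁰⁰ + ω⁻²q̂¹¹ on the first component and half
of ω²q̂⁰⁰ + q̂¹¹ on the second. Both are multiples of the transformed energy covariance. -/
theorem IsInitial.tendsto_flow (hn : 0 < n) (hm : 0 < m) (h : IsInitial μ q)
    (Ψ : Fin 2 → CTest n) :
    Tendsto (fun t => ∫ Y, pairing₂ Y (flow hm t Ψ) ^ 2 ∂μ) atTop (𝓝 (limitForm m q Ψ)) := by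
  have ht : Tendsto (fun t : ℝ => 2 * t) atTop atTop := tendsto_id.const_mul_atTop two_pos
  have hcross : Tendsto (fun t => 2 * ∑ a, ∑ b, kform (fun z => q 0 1 z a b)
      (CTest.comp a (flow hm t Ψ 0)) (CTest.comp b (flow hm t Ψ 1))) atTop (𝓝 0) := by
    simp only [h.sum_cross hm]
    have h1 : ∀ a b : Fin 2, Tendsto (fun t => (1 / 2 * kform (fun z => q 0 1 z a b)
          (CTest.comp a (Ψ 0)) (evol (sincSym m (2 * t)) (CTest.comp b (Ψ 0))) +
        kform (fun z => q 0 1 z a b) (CTest.comp a (Ψ 0))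
          (evol (cosSym m (2 * t)) (CTest.comp b (Ψ 1))) -
        1 / 2 * kform (fun z => q 0 1 z a b) (CTest.comp a (Ψ 1))
          (evol (sinSym m (2 * t)) (CTest.comp b (Ψ 1))))) atTop (𝓝 0) := fun a b => by
      have a1 := ((h.tendsto_cross hn hm a b (CTest.comp a (Ψ 0)) (CTest.comp b (Ψ 0))).2.1.comp
        ht).const_mul (1 / 2)
      have a2 := (h.tendsto_cross hn hm a b (CTest.comp a (Ψ 0)) (CTest.comp b (Ψ 1))).1.comp ht
      have a3 := ((h.tendsto_cross hn hm a b (CTest.comp a (Ψ 1)) (CTest.comp b (Ψ 1))).2.2.comp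
        ht).const_mul (1 / 2)
      simpa using! (a1.add a2).sub a3
    simpa using! (tendsto_finsetSum Finset.univ fun a _ =>
      tendsto_finsetSum Finset.univ fun b _ => h1 a b).const_mul 2
  have hdiag : Tendsto (fun t => ∑ a, ∑ b,
      (kform (fun z => q 0 0 z a b) (CTest.comp a (flow hm t Ψ 0)) (CTest.comp b (flow hm t Ψ 0)) +
        kform (fun z => q 1 1 z a b) (CTest.comp a (flow hm t Ψ 1))
          (CTest.comp b (flow hm t Ψ 1)))) atTop (𝓝 (limitForm m q Ψ)) := by
    refine tendsto_finsetSum _ fun a _ => tendsto_finsetSum _ fun b _ => ?_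
    simp only [comp_flow_zero, comp_flow_one]
    have hlim := (tendsto_kform_flow_zero hn hm (h.int₀ a b) (CTest.comp a (Ψ 0))
      (CTest.comp a (Ψ 1)) (CTest.comp b (Ψ 0)) (CTest.comp b (Ψ 1))).add
      (tendsto_kform_flow_one hn hm (h.int₁ a b) (CTest.comp a (Ψ 0))
      (CTest.comp a (Ψ 1)) (CTest.comp b (Ψ 0)) (CTest.comp b (Ψ 1)))
    refine hlim.trans_eq (congrArg 𝓝 ?_)
    have i0 := fun f g : 𝓢(E n, ℂ) => integrable_four_mul (h.int₀ a b) f g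
    have i1 := fun f g : 𝓢(E n, ℂ) => integrable_four_mul (h.int₁ a b) f g
    have j0 := fun f g : 𝓢(E n, ℂ) => integrable_four_symbol_mul (h.int₀ a b)
      (hasTemperateGrowth_disp_sq hm) f g
    have j1 := fun f g : 𝓢(E n, ℂ) => integrable_four_symbol_mul (h.int₁ a b)
      (hasTemperateGrowth_disp_inv_sq hm) f g
    rw [← Complex.add_re, ← mul_add, ← integral_add (by exact (i0 _ _).add (j0 _ _))
      (by exact (i1 _ _).add (j1 _ _))]
    congr 3 with ξ
    rw [h.four_energyCovFun]
    have h2 : ((disp m ξ : ℂ))⁻¹ * disp m ξ = 1 :=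
      inv_mul_cancel₀ (by exact_mod_cast (disp_pos hm ξ).ne')
    push_cast
    linear_combination (-four (fun z => q 0 0 z a b) ξ *
      (conj (𝓕 (CTest.comp a (Ψ 0)).toSchwartz ξ) * 𝓕 (CTest.comp b (Ψ 0)).toSchwartz ξ) *
      (((disp m ξ : ℂ))⁻¹ * disp m ξ + 1)) * h2
  have h3 := hdiag.add hcross
  rw [add_zero] at h3
  refine h3.congr fun t => ?_
  rw [h.cov.integral_pairing₂_sq]
  simp only [Finset.sum_add_distrib, Finset.mul_sum]

/-! ### A common majorant of the covariances -/

/-- The form `∫ F (|ψ̂⁰|² / ω² + |ψ̂¹|²)`. -/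
def majorant (m : ℝ) (F : E n → ℝ) (Ψ : Fin 2 → CTest n) : ℝ :=
  ∑ a, ((∫ ξ, F ξ * ‖((disp m ξ)⁻¹ : ℝ) * 𝓕 (CTest.comp a (Ψ 0)).toSchwartz ξ‖ ^ 2) +
    ∫ ξ, F ξ * ‖𝓕 (CTest.comp a (Ψ 1)).toSchwartz ξ‖ ^ 2)

theorem integrable_majorant_zero (hm : 0 < m) {F : E n → ℝ} (hF : Continuous F) {M : ℝ}
    (hM : ∀ ξ, |F ξ| ≤ M) (f : 𝓢(E n, ℂ)) :
    Integrable fun ξ => F ξ * ‖((disp m ξ)⁻¹ : ℝ) * 𝓕 f ξ‖ ^ 2 := by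
  have h := integrable_mul_norm_sq hF hM
    (𝓕 (fourierMultiplierCLM ℂ (fun ξ : E n => (disp m ξ)⁻¹) f))
  simpa only [fourier_fourierMultiplier (hasTemperateGrowth_disp_inv hm)] using h

theorem majorant_le (hm : 0 < m) {F : E n → ℝ} (hF : Continuous F) (h0 : ∀ ξ, 0 ≤ F ξ) {M : ℝ}
    (hM : ∀ ξ, F ξ ≤ M) (Ψ : Fin 2 → CTest n) :
    majorant m F Ψ ≤ M * majorant m (fun _ => 1) Ψ := by
  have hM' : ∀ ξ, |F ξ| ≤ M := fun ξ => by rw [abs_of_nonneg (h0 ξ)]; exact hM ξ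
  have h1 : ∀ _ : E n, |(1 : ℝ)| ≤ 1 := fun _ => by simp
  simp only [majorant, Finset.mul_sum, mul_add, ← integral_const_mul]
  refine Finset.sum_le_sum fun a _ => add_le_add ?_ ?_
  · refine integral_mono (integrable_majorant_zero hm hF hM' _)
      ((integrable_majorant_zero hm continuous_const h1 _).const_mul M) fun ξ => ?_
    rw [one_mul]
    exact mul_le_mul_of_nonneg_right (hM ξ) (sq_nonneg _)
  · refine integral_mono (integrable_mul_norm_sq hF hM' _)
      ((integrable_mul_norm_sq continuous_const h1 _).const_mul M) fun ξ => ?_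
    rw [one_mul]
    exact mul_le_mul_of_nonneg_right (hM ξ) (sq_nonneg _)

theorem kform_self_eq {p : E n → ℝ} (hp : Integrable p) (h : ∀ ξ, (four p ξ).im = 0)
    (φ : RTest n) : kform p φ φ = ∫ ξ, (four p ξ).re * ‖𝓕 φ.toSchwartz ξ‖ ^ 2 := by
  have h1 := kform_eq_fourier hp φ φ
  have h2 : ∀ ξ, four p ξ * (conj (𝓕 φ.toSchwartz ξ) * 𝓕 φ.toSchwartz ξ) =
      (((four p ξ).re * ‖𝓕 φ.toSchwartz ξ‖ ^ 2 : ℝ) : ℂ) := fun ξ => by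
    rw [Complex.conj_mul', Complex.ofReal_mul, Complex.ofReal_pow]
    congr 1
    exact Complex.ext (by simp) (by simp [h])
  simp only [h2] at h1
  rw [integral_complex_ofReal] at h1
  exact_mod_cast h1

theorem IsInitial.abs_spectralDensity_le (h : IsInitial μ q) (ξ : E n) :
    |spectralDensity m q ξ| ≤ ∑ a, ∫ z, |energyCovFun m q a a z| := by
  rw [abs_of_nonneg (h.spectralDensity_nonneg ξ)]
  exact spectralDensity_le ξ

theorem norm_sq_add_le (z w : ℂ) : ‖z + w‖ ^ 2 ≤ 2 * (‖z‖ ^ 2 + ‖w‖ ^ 2) := by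
  have h1 := norm_add_le z w
  have h2 : ‖z + w‖ ^ 2 ≤ (‖z‖ + ‖w‖) ^ 2 := by gcongr
  nlinarith [sq_nonneg (‖z‖ - ‖w‖)]

theorem norm_sq_flow_zero_le {c s w : ℝ} (hc : |c| ≤ 1) (hs : |s| ≤ 1) (hw : 0 < w) (z z' : ℂ) :
    ‖(c : ℂ) * z - ((s * w : ℝ) : ℂ) * z'‖ ^ 2 ≤
      2 * w ^ 2 * (‖((w⁻¹ : ℝ) : ℂ) * z‖ ^ 2 + ‖z'‖ ^ 2) := by
  have h := norm_sq_add_le ((c : ℂ) * z) (-(((s * w : ℝ) : ℂ) * z'))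
  rw [← sub_eq_add_neg, norm_neg] at h
  refine h.trans ?_
  simp only [norm_mul, Complex.norm_real, Real.norm_eq_abs, abs_of_pos hw, mul_pow,
    abs_inv, inv_pow]
  have h1 : |c| ^ 2 ≤ 1 := pow_le_one₀ (abs_nonneg _) hc
  have h2 : |s| ^ 2 ≤ 1 := pow_le_one₀ (abs_nonneg _) hs
  have h3 : |c| ^ 2 * ‖z‖ ^ 2 ≤ 1 * ‖z‖ ^ 2 := by gcongr
  have h4 : |s| ^ 2 * w ^ 2 * ‖z'‖ ^ 2 ≤ 1 * w ^ 2 * ‖z'‖ ^ 2 := by gcongr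
  have h5 : w ^ 2 * (w ^ 2)⁻¹ = 1 := mul_inv_cancel₀ (by positivity)
  have h6 : 2 * w ^ 2 * ((w ^ 2)⁻¹ * ‖z‖ ^ 2 + ‖z'‖ ^ 2) =
      2 * (1 * ‖z‖ ^ 2 + 1 * w ^ 2 * ‖z'‖ ^ 2) := by
    linear_combination (2 * ‖z‖ ^ 2) * h5
  rw [h6]
  linarith

theorem norm_sq_flow_one_le {c s w : ℝ} (hc : |c| ≤ 1) (hs : |s| ≤ 1) (z z' : ℂ) :
    ‖((s * w⁻¹ : ℝ) : ℂ) * z + (c : ℂ) * z'‖ ^ 2 ≤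
      2 * (‖((w⁻¹ : ℝ) : ℂ) * z‖ ^ 2 + ‖z'‖ ^ 2) := by
  refine (norm_sq_add_le _ _).trans ?_
  simp only [norm_mul, Complex.norm_real, Real.norm_eq_abs, mul_pow]
  have h1 : |c| ^ 2 ≤ 1 := pow_le_one₀ (abs_nonneg _) hc
  have h2 : |s| ^ 2 ≤ 1 := pow_le_one₀ (abs_nonneg _) hs
  have h3 : |c| ^ 2 * ‖z'‖ ^ 2 ≤ 1 * ‖z'‖ ^ 2 := by gcongr
  have h4 : |s| ^ 2 * |w⁻¹| ^ 2 * ‖z‖ ^ 2 ≤ 1 * |w⁻¹| ^ 2 * ‖z‖ ^ 2 := by gcongr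
  linarith

/-- The evolved test functions are bounded pointwise in frequency, uniformly in t, and the
combination q̂¹¹ + ω²q̂⁰⁰ that results is one summand of the spectral density. -/
theorem IsInitial.kform_flow_le (hm : 0 < m) (h : IsInitial μ q) (t : ℝ) (Ψ : Fin 2 → CTest n)
    (a : Fin 2) :
    kform (fun z => q 0 0 z a a) (CTest.comp a (flow hm t Ψ 0)) (CTest.comp a (flow hm t Ψ 0)) +
      kform (fun z => q 1 1 z a a) (CTest.comp a (flow hm t Ψ 1)) (CTest.comp a (flow hm t Ψ 1)) ≤
      2 * ((∫ ξ, spectralDensity m q ξ *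
          ‖((disp m ξ)⁻¹ : ℝ) * 𝓕 (CTest.comp a (Ψ 0)).toSchwartz ξ‖ ^ 2) +
        ∫ ξ, spectralDensity m q ξ * ‖𝓕 (CTest.comp a (Ψ 1)).toSchwartz ξ‖ ^ 2) := by
  have hb : ∀ {p : E n → ℝ}, Integrable p → ∀ f : 𝓢(E n, ℂ),
      Integrable fun ξ => (four p ξ).re * ‖f ξ‖ ^ 2 := fun {p} hp f =>
    integrable_mul_norm_sq (Complex.continuous_re.comp (continuous_four hp))
      (fun ξ => (Complex.abs_re_le_norm _).trans (norm_four_le p ξ)) f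
  have hF := h.continuous_spectralDensity (m := m)
  have hM := h.abs_spectralDensity_le (m := m)
  have i0 := integrable_majorant_zero hm hF hM (CTest.comp a (Ψ 0)).toSchwartz
  have i1 := integrable_mul_norm_sq hF hM (𝓕 (CTest.comp a (Ψ 1)).toSchwartz)
  rw [kform_self_eq (h.int₀ a a) fun ξ => (h.four_nonneg₀ a ξ).2,
    kform_self_eq (h.int₁ a a) fun ξ => (h.four_nonneg₁ a ξ).2,
    ← integral_add (hb (h.int₀ a a) _) (hb (h.int₁ a a) _), ← integral_add i0 i1,
    ← integral_const_mul]
  refine integral_mono ((hb (h.int₀ a a) _).add (hb (h.int₁ a a) _)) ((i0.add i1).const_mul 2)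
    fun ξ => ?_
  beta_reduce
  set z := 𝓕 (CTest.comp a (Ψ 0)).toSchwartz ξ
  set z' := 𝓕 (CTest.comp a (Ψ 1)).toSchwartz ξ
  have e0 : 𝓕 (CTest.comp a (flow hm t Ψ 0)).toSchwartz ξ =
      (Real.cos (t * disp m ξ) : ℂ) * z - ((Real.sin (t * disp m ξ) * disp m ξ : ℝ) : ℂ) * z' := by
    rw [comp_flow_zero, RTest.toSchwartz_sub, fourier_sub_schwartz, sub_apply,
      (isLocalSymbol_cos hm t).fourier_evol, (isLocalSymbol_sin hm t).fourier_evol]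
    rfl
  have e1 : 𝓕 (CTest.comp a (flow hm t Ψ 1)).toSchwartz ξ =
      ((Real.sin (t * disp m ξ) * (disp m ξ)⁻¹ : ℝ) : ℂ) * z + (Real.cos (t * disp m ξ) : ℂ) * z' := by
    rw [comp_flow_one, RTest.toSchwartz_add, FourierTransform.fourier_add, add_apply,
      (isLocalSymbol_cos hm t).fourier_evol, (isLocalSymbol_sinc hm t).fourier_evol]
    rfl
  have b0 := norm_sq_flow_zero_le (Real.abs_cos_le_one (t * disp m ξ))
    (Real.abs_sin_le_one (t * disp m ξ)) (disp_pos hm ξ) z z'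
  have b1 := norm_sq_flow_one_le (w := disp m ξ) (Real.abs_cos_le_one (t * disp m ξ))
    (Real.abs_sin_le_one (t * disp m ξ)) z z'
  rw [← e0] at b0
  rw [← e1] at b1
  set B := ‖((disp m ξ)⁻¹ : ℝ) * z‖ ^ 2 + ‖z'‖ ^ 2 with hB
  have hB0 : 0 ≤ B := by positivity
  have hE : (four (fun z => q 1 1 z a a) ξ).re + disp m ξ ^ 2 *
      (four (fun z => q 0 0 z a a) ξ).re ≤ spectralDensity m q ξ := by
    have := Finset.single_le_sum (f := fun a => (four (energyCovFun m q a a) ξ).re)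
      (fun a _ => (h.four_energy_nonneg a ξ).1) (Finset.mem_univ a)
    rwa [h.four_energyCovFun, Complex.add_re, Complex.re_ofReal_mul] at this
  calc _ ≤ (four (fun z => q 0 0 z a a) ξ).re * (2 * disp m ξ ^ 2 * B) +
        (four (fun z => q 1 1 z a a) ξ).re * (2 * B) :=
        add_le_add (mul_le_mul_of_nonneg_left b0 (h.four_nonneg₀ a ξ).1)
          (mul_le_mul_of_nonneg_left b1 (h.four_nonneg₁ a ξ).1)
    _ = 2 * (((four (fun z => q 1 1 z a a) ξ).re + disp m ξ ^ 2 *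
      (four (fun z => q 0 0 z a a) ξ).re) * B) := by ring
    _ ≤ 2 * (spectralDensity m q ξ * B) := by gcongr
    _ = _ := by simp only [hB, mul_add]

/-- The constant is 4 · 2: the square of a sum of four real variables, and the square of the sum of
two terms in the flow. The mixed covariances never appear. -/
theorem IsInitial.integral_sq_flow_le (hm : 0 < m) (h : IsInitial μ q) (t : ℝ)
    (Ψ : Fin 2 → CTest n) :
    ∫ Y, pairing₂ Y (flow hm t Ψ) ^ 2 ∂μ ≤ 8 * majorant m (spectralDensity m q) Ψ := by
  have I := fun i a φ => (h.cov.coord_mul i i a a φ φ).1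
  have E := fun i a φ => (h.cov.coord_mul i i a a φ φ).2
  set Φ := flow hm t Ψ with hΦ
  have h1 : ∀ Y, pairing₂ Y Φ ^ 2 ≤ 4 * ∑ a,
      (coord 0 a (CTest.comp a (Φ 0)) Y * coord 0 a (CTest.comp a (Φ 0)) Y +
      coord 1 a (CTest.comp a (Φ 1)) Y * coord 1 a (CTest.comp a (Φ 1)) Y) := fun Y => by
    rw [pairing₂_eq_sum_coord]
    simp only [Fin.sum_univ_two]
    have k : ∀ x y z w : ℝ, (x + y + (z + w)) ^ 2 ≤ 4 * (x * x + z * z + (y * y + w * w)) :=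
      fun x y z w => by
        nlinarith [sq_nonneg (x - y), sq_nonneg (x - z), sq_nonneg (x - w), sq_nonneg (y - z),
          sq_nonneg (y - w), sq_nonneg (z - w)]
    exact k _ _ _ _
  have h2 := integral_mono (h.cov.memLp_pairing₂ Φ).integrable_sq
    ((integrable_finsetSum Finset.univ fun a _ =>
      (I 0 a (CTest.comp a (Φ 0))).add (I 1 a (CTest.comp a (Φ 1)))).const_mul 4) h1
  refine h2.trans ?_
  rw [integral_const_mul, integral_finsetSum _ fun a _ => by
    exact (I 0 a (CTest.comp a (Φ 0))).add (I 1 a (CTest.comp a (Φ 1)))]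
  simp only [Pi.add_apply]
  have h3 : ∀ a : Fin 2, ∫ Y, (coord 0 a (CTest.comp a (Φ 0)) Y * coord 0 a (CTest.comp a (Φ 0)) Y +
      coord 1 a (CTest.comp a (Φ 1)) Y * coord 1 a (CTest.comp a (Φ 1)) Y) ∂μ ≤
      2 * ((∫ ξ, spectralDensity m q ξ *
          ‖((disp m ξ)⁻¹ : ℝ) * 𝓕 (CTest.comp a (Ψ 0)).toSchwartz ξ‖ ^ 2) +
        ∫ ξ, spectralDensity m q ξ * ‖𝓕 (CTest.comp a (Ψ 1)).toSchwartz ξ‖ ^ 2) := fun a => by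
    rw [integral_add (I 0 a _) (I 1 a _), E, E]
    exact h.kform_flow_le hm t Ψ a
  have h4 := Finset.sum_le_sum fun a (_ : a ∈ Finset.univ) => h3 a
  rw [← Finset.mul_sum] at h4
  change _ ≤ 8 * ∑ a, _
  linarith

/-! ### Limits of quadratic forms -/

/-- Homogeneity and bilinearity of the polar form pass to pointwise limits, which spares a direct
verification for the explicit limit and Gibbs forms. -/
theorem exists_quadraticForm_of_tendsto {V A : Type*} [AddCommGroup V] [Module ℝ V]
    {l : Filter A} [l.NeBot] {Q : A → QuadraticForm ℝ V} {Q₀ : V → ℝ}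
    (h : ∀ v, Tendsto (fun a => Q a v) l (𝓝 (Q₀ v))) :
    ∃ Q' : QuadraticForm ℝ V, ∀ v, Q' v = Q₀ v := by
  have hp : ∀ x y, Tendsto (fun a => QuadraticMap.polar (Q a) x y) l
      (𝓝 (QuadraticMap.polar Q₀ x y)) := fun x y => ((h (x + y)).sub (h x)).sub (h y)
  refine ⟨QuadraticMap.ofPolar Q₀ (fun c v => ?_) (fun x x' y => ?_) (fun c x y => ?_),
    fun v => rfl⟩
  · refine tendsto_nhds_unique (h (c • v)) ?_
    simp only [QuadraticMap.map_smul]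
    exact (h v).const_mul _
  · refine tendsto_nhds_unique (hp (x + x') y) ?_
    simp only [QuadraticMap.polar_add_left]
    exact (hp x y).add (hp x' y)
  · refine tendsto_nhds_unique (hp (c • x) y) ?_
    simp only [QuadraticMap.polar_smul_left]
    exact (hp x y).const_mul _

/-! ### The Gibbs form -/

theorem integral_potential (hm : 0 < m) (φ : RTest n) :
    ∫ x, φ x * (fourierMultiplierCLM ℂ (fun ξ : E n => (disp m ξ)⁻¹ ^ 2) φ.toSchwartz x).re =
      ∫ ξ, ‖((disp m ξ)⁻¹ : ℝ) * 𝓕 φ.toSchwartz ξ‖ ^ 2 := by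
  have hw := hasTemperateGrowth_disp_inv_sq (n := n) hm
  set g := fourierMultiplierCLM ℂ (fun ξ : E n => (disp m ξ)⁻¹ ^ 2) φ.toSchwartz with hg
  have hreal : ∀ x, ((g x).re : ℂ) = g x := fun x =>
    Complex.conj_eq_iff_re.1 (conj_fourierMultiplier_of_real hw
      (fun ξ => by simp only [disp_neg]) φ.conj_toSchwartz x)
  have h1 := integral_mul_eq_fourier φ g.integrable
  have h2 : ∫ x, (φ x : ℂ) * g x = ((∫ x, φ x * (g x).re : ℝ) : ℂ) := by
    rw [← integral_complex_ofReal]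
    congr 1 with x
    rw [Complex.ofReal_mul, hreal]
  have h3 : ∫ ξ, conj (𝓕 φ.toSchwartz ξ) * 𝓕 (g : E n → ℂ) ξ =
      ((∫ ξ, ‖((disp m ξ)⁻¹ : ℝ) * 𝓕 φ.toSchwartz ξ‖ ^ 2 : ℝ) : ℂ) := by
    rw [← integral_complex_ofReal]
    congr 1 with ξ
    rw [← fourier_coe, hg, fourier_fourierMultiplier hw,
      Complex.ofReal_pow ‖((disp m ξ)⁻¹ : ℝ) * 𝓕 φ.toSchwartz ξ‖, ← Complex.conj_mul',
      map_mul, Complex.conj_ofReal]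
    push_cast
    ring
  rw [h2, h3] at h1
  exact_mod_cast h1

theorem symbol_neg_one (m : ℝ) : (symbol m (-1) : E n → ℂ) =
    fun ξ => (((disp m ξ)⁻¹ ^ 2 : ℝ) : ℂ) := by
  funext ξ
  rw [symbol, inv_pow, disp_sq, Real.rpow_neg_one]

theorem CTest.toSchwartz_eq (ψ : CTest n) :
    ψ.toSchwartz = (CTest.comp 0 ψ).toSchwartz + Complex.I • (CTest.comp 1 ψ).toSchwartz := by
  ext x
  rw [add_apply, smul_apply, RTest.toSchwartz_apply,
    RTest.toSchwartz_apply, CTest.comp_apply, CTest.comp_apply, CTest.toSchwartz_apply, smul_eq_mul,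
    mul_comm]
  exact (Complex.re_add_im _).symm

/-- Parseval's identity. The Gibbs form is T times the majorant with weight 1, so the estimate that
makes the latter trace class also yields the Gibbs measure. -/
theorem gibbsForm_eq (hm : 0 < m) (T : ℝ) (Ψ : Fin 2 → CTest n) :
    gibbsForm m T Ψ = T * majorant m (fun _ => 1) Ψ := by
  have hw := hasTemperateGrowth_disp_inv_sq (n := n) hm
  let g : Fin 2 → 𝓢(E n, ℂ) := fun a =>
    fourierMultiplierCLM ℂ (fun ξ : E n => (disp m ξ)⁻¹ ^ 2) (CTest.comp a (Ψ 0)).toSchwartz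
  have hg : ∀ a x, (g a x).im = 0 := fun a x =>
    Complex.conj_eq_iff_im.1 (conj_fourierMultiplier_of_real hw
      (fun ξ => by simp only [disp_neg]) (CTest.comp a (Ψ 0)).conj_toSchwartz x)
  have hpot : ∀ x, (star (Ψ 0 x) * potential m (Ψ 0) x).re =
      ∑ a, CTest.comp a (Ψ 0) x * (g a x).re := fun x => by
    have h1 : potential m (Ψ 0) = g 0 + Complex.I • g 1 := by
      rw [potential, CTest.toSchwartz_eq, symbol_neg_one, map_add, map_smul]
      have h2 := SchwartzMap.fourierMultiplierCLM_ofReal ℂ (F := ℂ) hw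
      exact congrArg₂ (fun f f' => f + Complex.I • f') (h2 _) (h2 _)
    rw [h1, add_apply, smul_apply, smul_eq_mul, Fin.sum_univ_two, CTest.comp_apply,
      CTest.comp_apply]
    simp [comp, hg, Complex.mul_re, Complex.add_re, Complex.add_im]
  have hsq : ∀ x, ‖Ψ 1 x‖ ^ 2 = ∑ a, ‖(CTest.comp a (Ψ 1)).toSchwartz x‖ ^ 2 := fun x => by
    simp only [RTest.toSchwartz_apply, CTest.comp_apply, Fin.sum_univ_two, Complex.norm_real,
      Real.norm_eq_abs, sq_abs]
    rw [Complex.sq_norm, Complex.normSq_apply]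
    simp [comp, sq]
  have i0 : ∀ a, Integrable fun x => CTest.comp a (Ψ 0) x * (g a x).re := fun a =>
    ((CTest.comp a (Ψ 0)).continuous.mul (Complex.continuous_re.comp
      (g a).continuous)).integrable_of_hasCompactSupport
      (CTest.comp a (Ψ 0)).hasCompactSupport.mul_right
  simp only [gibbsForm, hpot, hsq]
  rw [integral_finsetSum _ fun a _ => i0 a,
    integral_finsetSum _ fun a _ => integrable_norm_sq _, ← mul_add, ← Finset.sum_add_distrib]
  congr 1
  refine Finset.sum_congr rfl fun a _ => ?_
  simp only [one_mul]
  rw [integral_potential hm, integral_norm_sq_fourier]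

/-! ### The limit of short correlation length -/

/-- On the support |z| < r the character differs from 1 by at most 2πr|ξ|. -/
theorem norm_four_sub_integral_le {p : E n → ℝ} (hp : Integrable p) {r : ℝ}
    (h : ∀ z, r ≤ ‖z‖ → p z = 0) (ξ : E n) :
    ‖four p ξ - ((∫ z, p z : ℝ) : ℂ)‖ ≤ 2 * π * r * ‖ξ‖ * ∫ z, |p z| := by
  have i1 : Integrable fun z => 𝐞 (-inner ℝ z ξ) • (p z : ℂ) :=
    (Real.fourierIntegral_convergent_iff ξ).2 hp.ofReal
  rw [four, Real.fourier_eq, ← integral_complex_ofReal, ← integral_sub i1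
    (by exact hp.ofReal), ← integral_const_mul]
  refine norm_integral_le_of_norm_le (hp.abs.const_mul _) (ae_of_all _ fun z => ?_)
  by_cases hz : r ≤ ‖z‖
  · simp [h z hz]
  have h1 : 𝐞 (-inner ℝ z ξ) • (p z : ℂ) - (p z : ℂ) =
      (Complex.exp (Complex.I * (2 * π * -inner ℝ z ξ : ℝ)) - 1) * (p z : ℂ) := by
    rw [Circle.smul_def, Real.fourierChar_apply, smul_eq_mul, mul_comm Complex.I]
    ring
  rw [h1, norm_mul, Complex.norm_real, Real.norm_eq_abs]
  refine mul_le_mul_of_nonneg_right ((Real.norm_exp_I_mul_ofReal_sub_one_le).trans ?_)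
    (abs_nonneg _)
  rw [norm_mul, norm_neg, Real.norm_of_nonneg (by positivity), mul_assoc (2 * π)]
  refine mul_le_mul_of_nonneg_left ?_ (by positivity)
  exact (norm_inner_le_norm z ξ).trans (by gcongr; linarith)

/-- By G1 the kernel concentrates at the origin, so with the bound from G3 its transform approaches
its integral pointwise in ξ, and G2 gives the limit 2T times the unit matrix. The bound C also
dominates, so the limit may be taken under the integral. -/
theorem tendsto_limitForm (hm : 0 < m) {T C : ℝ} {q : ℝ → CovFun n}
    (hi : ∀ r ∈ Ioc (0 : ℝ) 1, ∀ a b, Integrable (energyCovFun m (q r) a b))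
    (G1 : ∀ r ∈ Ioc (0 : ℝ) 1, ∀ z, r ≤ ‖z‖ → ∀ a b, energyCovFun m (q r) a b z = 0)
    (G2 : ∀ a b, Tendsto (fun r => (1 / 2 : ℝ) * ∫ z, energyCovFun m (q r) a b z) (𝓝[>] 0)
      (𝓝 (T * (1 : Matrix (Fin 2) (Fin 2) ℝ) a b)))
    (G3 : ∀ r ∈ Ioc (0 : ℝ) 1, ∀ a b, ∫ z, |energyCovFun m (q r) a b z| ≤ C)
    (Ψ : Fin 2 → CTest n) :
    Tendsto (fun r => limitForm m (q r) Ψ) (𝓝[>] 0) (𝓝 (gibbsForm m T Ψ)) := by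
  have hev : ∀ᶠ r in 𝓝[>] (0 : ℝ), r ∈ Ioc (0 : ℝ) 1 := Ioc_mem_nhdsGT one_pos
  have hfour : ∀ a b ξ, Tendsto (fun r => four (energyCovFun m (q r) a b) ξ) (𝓝[>] 0)
      (𝓝 ((2 * (T * (1 : Matrix (Fin 2) (Fin 2) ℝ) a b) : ℝ) : ℂ)) := fun a b ξ => by
    have h1 : Tendsto (fun r => ((∫ z, energyCovFun m (q r) a b z : ℝ) : ℂ)) (𝓝[>] 0)
        (𝓝 ((2 * (T * (1 : Matrix (Fin 2) (Fin 2) ℝ) a b) : ℝ) : ℂ)) := by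
      refine ((Complex.continuous_ofReal.tendsto _).comp ((G2 a b).const_mul 2)).congr fun r => ?_
      simp only [Function.comp_apply]
      congr 1
      ring
    have h2 : Tendsto (fun r => four (energyCovFun m (q r) a b) ξ -
        ((∫ z, energyCovFun m (q r) a b z : ℝ) : ℂ)) (𝓝[>] 0) (𝓝 0) := by
      refine squeeze_zero_norm' (a := fun r => 2 * π * r * ‖ξ‖ * C) ?_ ?_
      · filter_upwards [hev] with r hr
        refine (norm_four_sub_integral_le (hi r hr a b)
          (fun z hz => G1 r hr z hz a b) ξ).trans ?_
        have := hr.1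
        gcongr
        exact G3 r hr a b
      · have : Continuous fun r : ℝ => 2 * π * r * ‖ξ‖ * C := by fun_prop
        simpa using (this.tendsto 0).mono_left nhdsWithin_le_nhds
    simpa using h2.add h1
  have hval : gibbsForm m T Ψ = ∑ a, ∑ b, (1 / 2 * ∫ ξ,
      ((2 * (T * (1 : Matrix (Fin 2) (Fin 2) ℝ) a b) : ℝ) : ℂ) *
      (((disp m ξ)⁻¹ ^ 2 : ℝ) * (conj (𝓕 (CTest.comp a (Ψ 0)).toSchwartz ξ) *
      𝓕 (CTest.comp b (Ψ 0)).toSchwartz ξ) +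
      conj (𝓕 (CTest.comp a (Ψ 1)).toSchwartz ξ) * 𝓕 (CTest.comp b (Ψ 1)).toSchwartz ξ)).re := by
    have h1 : ∀ _ : E n, |(1 : ℝ)| ≤ 1 := fun _ => by simp
    have hd : ∀ a, ∫ ξ, (((disp m ξ)⁻¹ ^ 2 : ℝ) * (conj (𝓕 (CTest.comp a (Ψ 0)).toSchwartz ξ) *
        𝓕 (CTest.comp a (Ψ 0)).toSchwartz ξ) + conj (𝓕 (CTest.comp a (Ψ 1)).toSchwartz ξ) *
        𝓕 (CTest.comp a (Ψ 1)).toSchwartz ξ) =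
        (((∫ ξ, 1 * ‖((disp m ξ)⁻¹ : ℝ) * 𝓕 (CTest.comp a (Ψ 0)).toSchwartz ξ‖ ^ 2) +
          ∫ ξ, 1 * ‖𝓕 (CTest.comp a (Ψ 1)).toSchwartz ξ‖ ^ 2 : ℝ) : ℂ) := fun a => by
      rw [← integral_add (integrable_majorant_zero hm continuous_const h1 _)
        (integrable_mul_norm_sq continuous_const h1 _), ← integral_complex_ofReal]
      congr 1 with ξ
      rw [Complex.conj_mul', Complex.conj_mul', one_mul, one_mul, norm_mul, Complex.norm_real,
        mul_pow, Real.norm_eq_abs, sq_abs]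
      push_cast
      rfl
    rw [gibbsForm_eq hm, majorant, Finset.mul_sum]
    refine Finset.sum_congr rfl fun a _ => ?_
    rw [Finset.sum_eq_single a]
    · rw [Matrix.one_apply_eq, integral_const_mul (μ := volume)
        ((2 * (T * 1) : ℝ) : ℂ), hd, ← Complex.ofReal_mul]
      have : (1 / 2 : ℂ) = ((1 / 2 : ℝ) : ℂ) := by push_cast; rfl
      rw [this, ← Complex.ofReal_mul, Complex.ofReal_re]
      ring
    · intro b _ hb
      rw [Matrix.one_apply_ne hb.symm]
      simp
    · simp
  rw [hval]
  refine tendsto_finsetSum _ fun a _ => tendsto_finsetSum _ fun b _ => ?_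
  refine (Complex.continuous_re.tendsto _).comp (Tendsto.const_mul _ ?_)
  have hb : ∀ f g : 𝓢(E n, ℂ), Integrable fun ξ => conj (f ξ) * g ξ := fun f g =>
    (g.integrable (μ := volume)).bdd_mul (c := ‖f.toBoundedContinuousFunction‖)
      (Complex.continuous_conj.comp f.continuous).aestronglyMeasurable (ae_of_all _ fun ξ => by
        rw [RCLike.norm_conj]; exact f.toBoundedContinuousFunction.norm_coe_le_norm ξ)
  have hb2 : ∀ f g : 𝓢(E n, ℂ), Integrable fun ξ => (((disp m ξ)⁻¹ ^ 2 : ℝ) : ℂ) *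
      (conj (f ξ) * g ξ) := fun f g => by
    refine ((integrable_symbol_mul (hasTemperateGrowth_disp_inv_sq hm) g).bdd_mul
      (f := fun ξ => conj (f ξ)) (c := ‖f.toBoundedContinuousFunction‖)
      (Complex.continuous_conj.comp f.continuous).aestronglyMeasurable (ae_of_all _ fun ξ => by
        rw [RCLike.norm_conj]; exact f.toBoundedContinuousFunction.norm_coe_le_norm ξ)).congr
      (ae_of_all _ fun ξ => ?_)
    beta_reduce
    ring
  have hI := (hb2 (𝓕 (CTest.comp a (Ψ 0)).toSchwartz) (𝓕 (CTest.comp b (Ψ 0)).toSchwartz)).add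
    (hb (𝓕 (CTest.comp a (Ψ 1)).toSchwartz) (𝓕 (CTest.comp b (Ψ 1)).toSchwartz))
  refine tendsto_integral_filter_of_dominated_convergence _ ?_ ?_ (hI.norm.const_mul C)
    (ae_of_all _ fun ξ => (hfour a b ξ).mul_const _)
  · filter_upwards [hev] with r hr
    exact (continuous_four (hi r hr a b)).aestronglyMeasurable.mul hI.1
  · filter_upwards [hev] with r hr
    refine ae_of_all _ fun ξ => ?_
    rw [norm_mul]
    exact mul_le_mul_of_nonneg_right ((norm_four_le _ ξ).trans (G3 r hr a b)) (norm_nonneg _)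

/-! ### Test functions as Schwartz functions -/

/-- On functions supported in a ball of radius R the polynomial weight of order k in a Schwartz
seminorm costs only the factor |R|ᵏ. -/
theorem continuous_toSchwartz_ofSupportedIn (K : TopologicalSpace.Compacts (E n))
    (hK : (K : Set (E n)) ⊆ (⊤ : TopologicalSpace.Opens (E n))) :
    Continuous (RTest.toSchwartz ∘ (TestFunction.ofSupportedIn hK : 𝓓_{K}(E n, ℝ) → RTest n)) := by
  let L : 𝓓_{K}(E n, ℝ) →ₗ[ℝ] 𝓢(E n, ℂ) :=
    { toFun := fun f => RTest.toSchwartz (TestFunction.ofSupportedIn hK f)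
      map_add' := fun f g => by ext x; simp [RTest.toSchwartz_apply]
      map_smul' := fun c f => by ext x; simp [RTest.toSchwartz_apply] }
  refine (show Continuous L from ?_)
  refine WithSeminorms.continuous_of_isBounded (ContDiffMapSupportedIn.withSeminorms ℝ (E n) ℝ ⊤ K)
    (schwartz_withSeminorms ℝ (E n) ℂ) L ?_
  obtain ⟨R, hR⟩ := K.isCompact.isBounded.exists_norm_le
  rintro ⟨k, l⟩
  refine ⟨{l}, NNReal.mk (|R| ^ k) (by positivity), fun f => ?_⟩
  have h0 : 0 ≤ |R| ^ k * ContDiffMapSupportedIn.seminorm ℝ (E n) ℝ ⊤ K l f := by positivity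
  have hs : (NNReal.mk (|R| ^ k) (by positivity) •
      (({l} : Finset ℕ).sup (ContDiffMapSupportedIn.seminorm ℝ (E n) ℝ ⊤ K))) f =
      |R| ^ k * ContDiffMapSupportedIn.seminorm ℝ (E n) ℝ ⊤ K l f := by
    rw [Finset.sup_singleton]; rfl
  refine (SchwartzMap.seminorm_le_bound ℝ k l _ h0 fun x => ?_).trans_eq hs.symm
  have hd : ‖iteratedFDeriv ℝ l (L f) x‖ = ‖iteratedFDeriv ℝ l f x‖ :=
    Complex.ofRealLI.norm_iteratedFDeriv_comp_left (f := f) f.contDiff.contDiffAt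
      (by exact_mod_cast le_top)
  rw [hd]
  by_cases hx : x ∈ K
  · refine mul_le_mul (pow_le_pow_left₀ (norm_nonneg x) ((hR x hx).trans (le_abs_self R)) k)
      (ContDiffMapSupportedIn.norm_iteratedFDeriv_apply_le_seminorm_top ℝ) (norm_nonneg _)
      (by positivity)
  · rw [f.iteratedFDeriv_zero_on_compl hx]
    simpa using h0

/-- The continuous inclusion of the real test functions in the Schwartz space. -/
def RTest.toSchwartzCLM : RTest n →L[ℝ] 𝓢(E n, ℂ) :=
  TestFunction.mkCLM ℝ RTest.toSchwartz RTest.toSchwartz_add RTest.toSchwartz_smul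
    continuous_toSchwartz_ofSupportedIn

/-- The distribution `φ ↦ w (A φ)`, where `w` is tempered and `A` acts in the Schwartz space. -/
def pullback (w : 𝓢'(E n, ℂ)) (A : 𝓢(E n, ℂ) →L[ℂ] 𝓢(E n, ℂ)) : Distr n :=
  (w : 𝓢(E n, ℂ) →L[ℂ] ℂ).restrictScalars ℝ ∘L A.restrictScalars ℝ ∘L RTest.toSchwartzCLM

/-- A complex test function as an element of the Schwartz space, real linearly. -/
def CTest.toSchwartzₗ : CTest n →ₗ[ℝ] 𝓢(E n, ℂ) where
  toFun := CTest.toSchwartz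
  map_add' _ _ := rfl
  map_smul' _ _ := rfl

/-! ### Realizations in `L² ⊕ L²` -/

instance : Fact ((2 : ℝ≥0∞) ≠ ∞) := ⟨by simp⟩

/-- The Hilbert space `L² ⊕ L²`. -/
abbrev L2Pair (n : ℕ) : Type := PiLp 2 fun _ : Fin 2 => Lp ℂ 2 (volume : Measure (E n))

/-- Operators in the Schwartz space mapping real test functions to real functions. -/
def IsRealOp (A : 𝓢(E n, ℂ) →L[ℂ] 𝓢(E n, ℂ)) : Prop :=
  ∀ f : 𝓢(E n, ℂ), (∀ x, conj (f x) = f x) → ∀ x, conj (A f x) = A f x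

theorem IsRealOp.comp {A B : 𝓢(E n, ℂ) →L[ℂ] 𝓢(E n, ℂ)} (hA : IsRealOp A) (hB : IsRealOp B) :
    IsRealOp (A ∘L B) := fun f hf => hA _ (hB f hf)

/-- The map `Ψ ↦ (A⁰Ψ⁰, A¹Ψ¹)` to `L² ⊕ L²`. -/
def testMap (A : Fin 2 → 𝓢(E n, ℂ) →L[ℂ] 𝓢(E n, ℂ)) : (Fin 2 → CTest n) →ₗ[ℝ] L2Pair n where
  toFun Ψ := WithLp.toLp 2 fun i => SchwartzMap.toLpCLM ℂ ℂ 2 volume (A i (Ψ i).toSchwartz)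
  map_add' Ψ Φ := by
    ext1 i
    change SchwartzMap.toLpCLM ℂ ℂ 2 volume (A i (CTest.toSchwartzₗ (Ψ i + Φ i))) = _
    rw [map_add, map_add, map_add]; rfl
  map_smul' c Ψ := by
    ext1 i
    change SchwartzMap.toLpCLM ℂ ℂ 2 volume (A i (CTest.toSchwartzₗ (c • Ψ i))) = _
    rw [map_smul]
    change SchwartzMap.toLpCLM ℂ ℂ 2 volume ((A i).restrictScalars ℝ (c • CTest.toSchwartzₗ (Ψ i))) = _
    rw [map_smul]
    change (SchwartzMap.toLpCLM ℂ ℂ 2 volume).restrictScalars ℝ (c • _) = _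
    rw [map_smul]; rfl

/-- The closure of the image of the test functions in `L² ⊕ L²`. -/
abbrev RealSpace (A : Fin 2 → 𝓢(E n, ℂ) →L[ℂ] 𝓢(E n, ℂ)) : Type :=
  (testMap A).range.topologicalClosure

instance (A : Fin 2 → 𝓢(E n, ℂ) →L[ℂ] 𝓢(E n, ℂ)) : MeasurableSpace (RealSpace A) := borel _

instance (A : Fin 2 → 𝓢(E n, ℂ) →L[ℂ] 𝓢(E n, ℂ)) : BorelSpace (RealSpace A) := ⟨rfl⟩

instance (A : Fin 2 → 𝓢(E n, ℂ) →L[ℂ] 𝓢(E n, ℂ)) : CompleteSpace (RealSpace A) :=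
  (Submodule.isClosed_topologicalClosure _).completeSpace_coe

/-- The pair of distributions given by the functionals `φ ↦ ∫ hⁱ Aⁱφ`. -/
def realize (A : Fin 2 → 𝓢(E n, ℂ) →L[ℂ] 𝓢(E n, ℂ)) (h : RealSpace A) : State n := fun i =>
  pullback (Lp.toTemperedDistribution ((h : L2Pair n) i)) (A i)

/-- The map of the test functions to their closure in `L² ⊕ L²`. -/
def testMap' (A : Fin 2 → 𝓢(E n, ℂ) →L[ℂ] 𝓢(E n, ℂ)) : (Fin 2 → CTest n) →ₗ[ℝ] RealSpace A :=
  (testMap A).codRestrict _ fun Ψ =>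
    Submodule.le_topologicalClosure _ (LinearMap.mem_range_self (testMap A) Ψ)

theorem denseRange_testMap' (A : Fin 2 → 𝓢(E n, ℂ) →L[ℂ] 𝓢(E n, ℂ)) :
    DenseRange (testMap' A) := by
  intro h
  have h1 : (h : L2Pair n) ∈ closure (range (testMap A)) := by
    have := h.2
    rwa [← SetLike.mem_coe, Submodule.topologicalClosure_coe, LinearMap.coe_range] at this
  rw [closure_subtype]
  convert h1 using 2
  ext y
  constructor
  · rintro ⟨_, ⟨Ψ, rfl⟩, rfl⟩; exact ⟨Ψ, rfl⟩
  · rintro ⟨Ψ, rfl⟩; exact ⟨_, ⟨Ψ, rfl⟩, rfl⟩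

/-- Because `A` preserves real functions it acts separately on the two real components of ψ, as the
real pairing does; hence the pairing becomes the real part of the L² inner product. -/
theorem pairing_toTemperedDistribution {A : 𝓢(E n, ℂ) →L[ℂ] 𝓢(E n, ℂ)} (hA : IsRealOp A)
    (h : Lp ℂ 2 (volume : Measure (E n))) (ψ : CTest n) :
    pairing (pullback (Lp.toTemperedDistribution h) A) ψ =
      inner ℝ h ((A ψ.toSchwartz).toLp 2) := by
  have key : ∀ f : 𝓢(E n, ℂ), Integrable fun x => f x • h x := fun f =>
    MemLp.integrable_mul (f.memLp 2 volume) (Lp.memLp h)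
  have e1 : ∀ φ : RTest n, ∀ x, (((A φ.toSchwartz x).re : ℝ) : ℂ) = A φ.toSchwartz x := fun φ x =>
    Complex.conj_eq_iff_re.mp (hA _ φ.conj_toSchwartz x)
  change (Lp.toTemperedDistribution h (A (CTest.comp 0 ψ).toSchwartz)).re +
    (Lp.toTemperedDistribution h (A (CTest.comp 1 ψ).toSchwartz)).im = _
  rw [L2.inner_def, Lp.toTemperedDistribution_apply, Lp.toTemperedDistribution_apply]
  have hre : (∫ x, A (CTest.comp 0 ψ).toSchwartz x • h x).re =
      ∫ x, (A (CTest.comp 0 ψ).toSchwartz x • h x).re :=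
    (integral_re (key _)).symm
  have him : (∫ x, A (CTest.comp 1 ψ).toSchwartz x • h x).im =
      ∫ x, (A (CTest.comp 1 ψ).toSchwartz x • h x).im :=
    (integral_im (key _)).symm
  rw [hre, him]
  refine (integral_add (key _).re (key _).im).symm.trans ?_
  refine integral_congr_ae ?_
  filter_upwards [(A ψ.toSchwartz).coeFn_toLp 2] with x hx
  have h2 : A ψ.toSchwartz x = A (CTest.comp 0 ψ).toSchwartz x +
      Complex.I * A (CTest.comp 1 ψ).toSchwartz x := by
    rw [CTest.toSchwartz_eq, map_add, map_smul, add_apply, smul_apply, smul_eq_mul]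
  rw [hx, h2]
  have i0 := Complex.ext_iff.1 (e1 (CTest.comp 0 ψ) x)
  have i1 := Complex.ext_iff.1 (e1 (CTest.comp 1 ψ) x)
  simp only [Complex.ofReal_im] at i0 i1
  simp [Complex.inner, ← i0.2, ← i1.2]

theorem isRealization_realize {A : Fin 2 → 𝓢(E n, ℂ) →L[ℂ] 𝓢(E n, ℂ)}
    (hA : ∀ i, IsRealOp (A i)) : IsRealization (realize A) (testMap' A) where
  pairing h Ψ := by
    change ∑ i, pairing _ _ = inner ℝ (h : L2Pair n) (testMap A Ψ)
    rw [PiLp.inner_apply]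
    exact Finset.sum_congr rfl fun i _ => pairing_toTemperedDistribution (hA i) _ _
  dense := denseRange_testMap' A

theorem norm_apply_le_norm {A : Fin 2 → 𝓢(E n, ℂ) →L[ℂ] 𝓢(E n, ℂ)} (h : RealSpace A) (i : Fin 2) :
    ‖(h : L2Pair n) i‖ ≤ ‖h‖ := PiLp.norm_apply_le (h : L2Pair n) i

theorem norm_comp_toLp_le {A : 𝓢(E n, ℂ) →L[ℂ] 𝓢(E n, ℂ)} (hA : IsRealOp A) (a : Fin 2)
    (ψ : CTest n) :
    ‖(A (CTest.comp a ψ).toSchwartz).toLp 2‖ ≤ ‖(A ψ.toSchwartz).toLp 2‖ := by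
  refine Lp.norm_le_norm_of_ae_le ?_
  filter_upwards [(A ψ.toSchwartz).coeFn_toLp 2, (A (CTest.comp a ψ).toSchwartz).coeFn_toLp 2]
    with x hx hx'
  have e1 : ∀ φ : RTest n, (((A φ.toSchwartz x).re : ℝ) : ℂ) = A φ.toSchwartz x := fun φ =>
    Complex.conj_eq_iff_re.mp (hA _ φ.conj_toSchwartz x)
  rw [hx, hx', CTest.toSchwartz_eq, map_add, map_smul, add_apply,
    smul_apply, smul_eq_mul, mul_comm, ← e1, ← e1 (CTest.comp 0 ψ),
    ← e1 (CTest.comp 1 ψ), Complex.norm_real]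
  fin_cases a
  · refine le_of_eq_of_le ?_ (Complex.abs_re_le_norm _)
    simp
  · refine le_of_eq_of_le ?_ (Complex.abs_im_le_norm _)
    simp

theorem norm_comp_le_testMap' {A : Fin 2 → 𝓢(E n, ℂ) →L[ℂ] 𝓢(E n, ℂ)} (hA : ∀ i, IsRealOp (A i))
    (a i : Fin 2) (Ψ : Fin 2 → CTest n) :
    ‖(A i (CTest.comp a (Ψ i)).toSchwartz).toLp 2‖ ≤ ‖testMap' A Ψ‖ :=
  (norm_comp_toLp_le (hA i) a (Ψ i)).trans (norm_apply_le_norm (testMap' A Ψ) i)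

/-- A fixed real test function as a linear functional of `Ψ`, via the Fourier transform. -/
def fourierFunctional (i a : Fin 2) (c : ℝ) (ξ : E n) : (Fin 2 → CTest n) →ₗ[ℝ] ℂ where
  toFun Ψ := (c : ℂ) * 𝓕 (CTest.comp a (Ψ i)).toSchwartz ξ
  map_add' Ψ Φ := by
    rw [Pi.add_apply, map_add, RTest.toSchwartz_add, FourierTransform.fourier_add,
      add_apply, mul_add]
  map_smul' t Ψ := by
    rw [Pi.smul_apply, map_smul, RTest.toSchwartz_smul, RingHom.id_apply]
    have : 𝓕 (t • (CTest.comp a (Ψ i)).toSchwartz) = t • 𝓕 (CTest.comp a (Ψ i)).toSchwartz :=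
      FourierTransform.fourier_smul t _
    rw [this, smul_apply, mul_smul_comm]

/-- The transforms at a frequency ξ are linear functionals of Ψ with norm at most c(ξ) relative to
`e`, so the majorant is a sum of four integrals of squares of such functionals. -/
theorem traceBound_majorant (hm : 0 < m) {H : Type*} [NormedAddCommGroup H] [InnerProductSpace ℝ H]
    [CompleteSpace H] {e : (Fin 2 → CTest n) →ₗ[ℝ] H} {F c : E n → ℝ} (hF : ∀ ξ, 0 ≤ F ξ) (hFc : Continuous F)
    (h0 : ∀ a Ψ ξ, ‖((disp m ξ)⁻¹ : ℝ) * 𝓕 (CTest.comp a (Ψ 0)).toSchwartz ξ‖ ≤ c ξ * ‖e Ψ‖)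
    (h1 : ∀ a Ψ ξ, ‖𝓕 (CTest.comp a (Ψ 1)).toSchwartz ξ‖ ≤ c ξ * ‖e Ψ‖)
    (hint : Integrable fun ξ => F ξ * c ξ ^ 2) :
    ∃ K, TraceBound e (majorant m F) K := by
  have t0 : ∀ a, TraceBound e (fun Ψ =>
      ∫ ξ, F ξ * ‖((disp m ξ)⁻¹ : ℝ) * 𝓕 (CTest.comp a (Ψ 0)).toSchwartz ξ‖ ^ 2)
      (2 * ∫ ξ, F ξ * c ξ ^ 2) := fun a =>
    (traceBound_integral e volume (fun ξ => fourierFunctional 0 a (disp m ξ)⁻¹ ξ) F c hF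
      hFc.aestronglyMeasurable (fun Ψ => by
        refine Continuous.aestronglyMeasurable ?_
        change Continuous fun ξ => (((disp m ξ)⁻¹ : ℝ) : ℂ) * 𝓕 (CTest.comp a (Ψ 0)).toSchwartz ξ
        exact (Complex.continuous_ofReal.comp ((continuous_disp m).inv₀ fun ξ =>
          (disp_pos hm ξ).ne')).mul (SchwartzMap.continuous _)) (fun ξ Ψ => h0 a Ψ ξ) hint).2
  have t1 : ∀ a, TraceBound e (fun Ψ =>
      ∫ ξ, F ξ * ‖𝓕 (CTest.comp a (Ψ 1)).toSchwartz ξ‖ ^ 2)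
      (2 * ∫ ξ, F ξ * c ξ ^ 2) := fun a => by
    have := (traceBound_integral e volume (fun ξ => fourierFunctional 1 a 1 ξ) F c hF
      hFc.aestronglyMeasurable (fun Ψ => by
        refine Continuous.aestronglyMeasurable ?_
        change Continuous fun ξ => ((1 : ℝ) : ℂ) * 𝓕 (CTest.comp a (Ψ 1)).toSchwartz ξ
        exact continuous_const.mul (SchwartzMap.continuous _)) (fun ξ Ψ => by
          change ‖((1 : ℝ) : ℂ) * _‖ ≤ _
          rw [Complex.ofReal_one, one_mul]; exact h1 a Ψ ξ) hint).2
    convert this using 6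
    change _ = ‖((1 : ℝ) : ℂ) * _‖
    rw [Complex.ofReal_one, one_mul]
  have := ((t0 0).add (t1 0)).add ((t0 1).add (t1 1))
  have hD : majorant m F = _ := funext fun Ψ => Fin.sum_univ_two _
  exact ⟨_, hD ▸ this⟩

/-! ### Bessel potentials and weights on the Schwartz space -/

/-- The operator `Λˢ` on the Schwartz space. -/
def lamS (s : ℝ) : 𝓢(E n, ℂ) →L[ℂ] 𝓢(E n, ℂ) :=
  SchwartzMap.fourierMultiplierCLM ℂ (symbol 1 (s / 2))

/-- Multiplication by `⟨x⟩^α` on the Schwartz space. -/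
def weightS (α : ℝ) : 𝓢(E n, ℂ) →L[ℂ] 𝓢(E n, ℂ) :=
  SchwartzMap.smulLeftCLM ℂ fun x : E n => (((1 + ‖x‖ ^ 2) ^ (α / 2) : ℝ) : ℂ)

theorem hasTemperateGrowth_symbol (p : ℝ) :
    (symbol 1 p : E n → ℂ).HasTemperateGrowth :=
  Function.HasTemperateGrowth.comp Complex.ofRealCLM.hasTemperateGrowth (hasTemperateGrowth_symbol_real one_pos p)

theorem hasTemperateGrowth_weight (α : ℝ) : Function.HasTemperateGrowth
    fun x : E n => (((1 + ‖x‖ ^ 2) ^ (α / 2) : ℝ) : ℂ) :=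
  Function.HasTemperateGrowth.comp Complex.ofRealCLM.hasTemperateGrowth
    (Function.hasTemperateGrowth_one_add_norm_sq_rpow (E n) (α / 2))

theorem fourier_multiplier_complex {a : E n → ℂ} (ha : a.HasTemperateGrowth) (f : 𝓢(E n, ℂ))
    (ξ : E n) : 𝓕 (SchwartzMap.fourierMultiplierCLM ℂ a f) ξ = a ξ * 𝓕 f ξ := by
  rw [SchwartzMap.fourierMultiplierCLM_apply, FourierTransform.fourier_fourierInv_eq]
  simp [smulLeftCLM_apply_apply ha]

theorem fourier_lamS (s : ℝ) (f : 𝓢(E n, ℂ)) (ξ : E n) :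
    𝓕 (lamS s f) ξ = symbol 1 (s / 2) ξ * 𝓕 f ξ :=
  fourier_multiplier_complex (hasTemperateGrowth_symbol _) f ξ

theorem symbol_mul_symbol (s t : ℝ) (ξ : E n) :
    symbol 1 (s / 2) ξ * symbol 1 (t / 2) ξ = symbol 1 ((s + t) / 2) ξ := by
  rw [symbol, symbol, symbol, ← Complex.ofReal_mul, ← Real.rpow_add (by positivity), add_div]

theorem lamS_lamS (s t : ℝ) (f : 𝓢(E n, ℂ)) : lamS s (lamS t f) = lamS (s + t) f := by
  refine schwartz_ext_fourier fun ξ => ?_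
  rw [fourier_lamS, fourier_lamS, fourier_lamS, ← mul_assoc, symbol_mul_symbol]

theorem lamS_zero (f : 𝓢(E n, ℂ)) : lamS 0 f = f := by
  refine schwartz_ext_fourier fun ξ => ?_
  rw [fourier_lamS, symbol]
  simp

theorem weightS_apply (α : ℝ) (f : 𝓢(E n, ℂ)) (x : E n) :
    weightS α f x = (((1 + ‖x‖ ^ 2) ^ (α / 2) : ℝ) : ℂ) * f x :=
  smulLeftCLM_apply_apply (hasTemperateGrowth_weight α) f x

theorem weightS_weightS (α β : ℝ) (f : 𝓢(E n, ℂ)) :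
    weightS α (weightS β f) = weightS (α + β) f := by
  ext x
  rw [weightS_apply, weightS_apply, weightS_apply, ← mul_assoc, ← Complex.ofReal_mul,
    ← Real.rpow_add (by positivity), add_div]

theorem weightS_zero (f : 𝓢(E n, ℂ)) : weightS 0 f = f := by
  ext x
  simp [weightS_apply]

theorem isRealOp_lamS (s : ℝ) : IsRealOp (lamS s : 𝓢(E n, ℂ) →L[ℂ] 𝓢(E n, ℂ)) := by
  intro f hf x
  have h := conj_fourierMultiplier_of_real (n := n)
    (hasTemperateGrowth_symbol_real one_pos (s / 2)) (fun ξ => by simp) hf x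
  have h2 : lamS s f = fourierMultiplierCLM ℂ
      (fun ξ : E n => ((1 : ℝ) ^ 2 + (2 * π * ‖ξ‖) ^ 2) ^ (s / 2)) f :=
    SchwartzMap.fourierMultiplierCLM_ofReal ℂ (F := ℂ)
      (hasTemperateGrowth_symbol_real one_pos (s / 2)) f
  rw [h2]
  exact h

theorem isRealOp_weightS (α : ℝ) : IsRealOp (weightS α : 𝓢(E n, ℂ) →L[ℂ] 𝓢(E n, ℂ)) := by
  intro f hf x
  rw [weightS_apply, map_mul, Complex.conj_ofReal, hf]

/-- The symbol is even, so Λˢ is its own transpose. -/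
theorem lam_apply (s : ℝ) (w : 𝓢'(E n, ℂ)) (f : 𝓢(E n, ℂ)) : Lam s w f = w (lamS s f) := by
  rw [Lam, TemperedDistribution.fourierMultiplierCLM_apply_apply]
  congr 1
  ext x
  rw [lamS, SchwartzMap.fourierMultiplierCLM_apply, fourierInv_coe, fourier_coe,
    Real.fourierInv_eq_fourier_comp_neg]
  refine congrFun (congrArg _ (funext fun ξ => ?_)) x
  rw [smulLeftCLM_apply_apply (hasTemperateGrowth_symbol _),
    smulLeftCLM_apply_apply (hasTemperateGrowth_symbol _), fourierInv_coe, fourier_coe,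
    Real.fourierInv_eq_fourier_neg]
  simp [symbol]

/-! ### Estimates of Fourier transforms by weighted norms -/

theorem norm_toLp_two_fourier (f : 𝓢(E n, ℂ)) : ‖(𝓕 f).toLp 2‖ = ‖f.toLp 2‖ := by
  rw [← SchwartzMap.toLp_fourier_eq, Lp.norm_fourier_eq]

theorem exists_norm_fourier_smul_le {g : E n → ℂ} (hg : g.HasTemperateGrowth)
    (hg2 : MemLp g 2 volume) :
    ∃ κ : ℝ, 0 ≤ κ ∧ ∀ (f : 𝓢(E n, ℂ)) ξ, ‖𝓕 (smulLeftCLM ℂ g f) ξ‖ ≤ κ * ‖f.toLp 2‖ := by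
  refine ⟨(eLpNorm g 2 volume).toReal, ENNReal.toReal_nonneg, fun f ξ => ?_⟩
  have h1 : ‖𝓕 (smulLeftCLM ℂ g f) ξ‖ ≤ ∫ x, ‖smulLeftCLM ℂ g f x‖ := by
    rw [fourier_coe, Real.fourier_eq]
    refine (norm_integral_le_integral_norm _).trans_eq ?_
    simp only [Circle.norm_smul]
  refine h1.trans ?_
  have h2 : ∫ x, ‖smulLeftCLM ℂ g f x‖ = (eLpNorm (g • (f : E n → ℂ)) 1 volume).toReal := by
    rw [eLpNorm_one_eq_lintegral_enorm, integral_norm_eq_lintegral_enorm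
      (SchwartzMap.continuous _).aestronglyMeasurable]
    congr 2
    funext x
    rw [smulLeftCLM_apply_apply hg]; rfl
  rw [h2, SchwartzMap.norm_toLp, ← ENNReal.toReal_mul]
  have h3 : eLpNorm (g • (f : E n → ℂ)) 1 volume ≤ eLpNorm g 2 volume * eLpNorm f 2 volume :=
    eLpNorm_smul_le_mul_eLpNorm (f.memLp 2 volume).1 hg2.1
  exact ENNReal.toReal_mono (ENNReal.mul_ne_top hg2.2.ne (f.memLp 2 volume).2.ne) h3

theorem integrable_one_add_norm_sq_rpow {p : ℝ} (hp : p < -(n : ℝ) / 2) :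
    Integrable fun x : E n => (1 + ‖x‖ ^ 2) ^ p := by
  have h := integrable_rpow_neg_one_add_norm_sq (E := E n) (μ := volume) (r := -(2 * p))
    (by rw [finrank_euclideanSpace, Fintype.card_fin]; linarith)
  refine h.congr (ae_of_all _ fun x => ?_)
  simp only
  congr 1; ring

theorem memLp_two_weight {α : ℝ} (hα : α < -(n : ℝ) / 2) :
    MemLp (fun x : E n => (((1 + ‖x‖ ^ 2) ^ (α / 2) : ℝ) : ℂ)) 2 volume := by
  rw [memLp_two_iff_integrable_sq_norm]
  · refine (integrable_one_add_norm_sq_rpow hα).congr (ae_of_all _ fun x => ?_)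
    simp only [Complex.norm_real]
    rw [Real.norm_of_nonneg (by positivity), ← Real.rpow_natCast ((1 + ‖x‖ ^ 2) ^ (α / 2)),
      ← Real.rpow_mul (by positivity)]
    congr 1; push_cast; ring
  · refine Continuous.aestronglyMeasurable (Complex.continuous_ofReal.comp ?_)
    exact Continuous.rpow_const (by fun_prop) fun x => Or.inl (by positivity)

theorem norm_symbol (s : ℝ) (ξ : E n) :
    ‖symbol 1 (s / 2) ξ‖ = (1 + (2 * π * ‖ξ‖) ^ 2) ^ (s / 2) := by
  rw [symbol, Complex.norm_real, Real.norm_of_nonneg (by positivity), one_pow]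

/-- Undoing the weight and then Λ^(-σ): the weight ⟨x⟩^α is square integrable, so multiplication by
it turns an L² function into an integrable one, whose transform is bounded; Λ^σ contributes the
growing factor. -/
theorem exists_norm_fourier_le_weighted {α : ℝ} (hα : α < -(n : ℝ) / 2) :
    ∃ κ : ℝ, 0 ≤ κ ∧ ∀ (σ : ℝ) (f : 𝓢(E n, ℂ)) ξ, ‖𝓕 f ξ‖ ≤
      (1 + (2 * π * ‖ξ‖) ^ 2) ^ (σ / 2) * κ * ‖(weightS (-α) (lamS (-σ) f)).toLp 2‖ := by
  obtain ⟨κ, hκ, h⟩ := exists_norm_fourier_smul_le (hasTemperateGrowth_weight α)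
    (memLp_two_weight hα)
  refine ⟨κ, hκ, fun σ f ξ => ?_⟩
  have hf : f = lamS σ (weightS α (weightS (-α) (lamS (-σ) f))) := by
    rw [weightS_weightS, add_neg_cancel, weightS_zero, lamS_lamS, add_neg_cancel, lamS_zero]
  conv_lhs => rw [hf]
  rw [fourier_lamS, norm_mul, mul_assoc]
  rw [norm_symbol]
  exact mul_le_mul_of_nonneg_left (h _ ξ) (by positivity)

theorem rpow_half_le_disp (hm : 0 < m) (ξ : E n) :
    (1 + (2 * π * ‖ξ‖) ^ 2) ^ (1 / 2 : ℝ) ≤ max 1 m⁻¹ * disp m ξ := by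
  have hC : 0 < max 1 m⁻¹ := lt_max_of_lt_left one_pos
  rw [← Real.sqrt_eq_rpow]
  refine Real.sqrt_le_iff.2 ⟨mul_nonneg hC.le (disp_pos hm ξ).le, ?_⟩
  rw [mul_pow (max 1 m⁻¹), disp_sq, mul_add, ← mul_pow (max 1 m⁻¹) m]
  have h1 : 1 ≤ max 1 m⁻¹ * m := by
    calc (1 : ℝ) = m⁻¹ * m := (inv_mul_cancel₀ hm.ne').symm
      _ ≤ _ := mul_le_mul_of_nonneg_right (le_max_right _ _) hm.le
  have h2 : (1 : ℝ) ≤ max 1 m⁻¹ := le_max_left _ _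
  have h3 : (1 : ℝ) ≤ (max 1 m⁻¹ * m) ^ 2 := one_le_pow₀ h1
  have h4 : (1 : ℝ) ≤ (max 1 m⁻¹) ^ 2 := one_le_pow₀ h2
  have h5 : (2 * π * ‖ξ‖) ^ 2 ≤ (max 1 m⁻¹) ^ 2 * (2 * π * ‖ξ‖) ^ 2 :=
    le_mul_of_one_le_left (sq_nonneg _) h4
  linarith

theorem norm_disp_inv_mul_le (hm : 0 < m) {z : ℂ} {ξ : E n} {s D : ℝ}
    (h : ‖z‖ ≤ (1 + (2 * π * ‖ξ‖) ^ 2) ^ ((1 + s) / 2) * D) (hD : 0 ≤ D) :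
    ‖((disp m ξ)⁻¹ : ℝ) * z‖ ≤ max 1 m⁻¹ * (1 + (2 * π * ‖ξ‖) ^ 2) ^ (s / 2) * D := by
  have hω := disp_pos hm ξ
  rw [norm_mul, Complex.norm_real, Real.norm_of_nonneg (inv_nonneg.2 hω.le), inv_mul_le_iff₀ hω]
  refine h.trans ?_
  rw [add_div, Real.rpow_add (by positivity)]
  have := mul_le_mul_of_nonneg_right (rpow_half_le_disp hm ξ)
    (mul_nonneg (Real.rpow_nonneg (by positivity : 0 ≤ 1 + (2 * π * ‖ξ‖) ^ 2) (s / 2)) hD)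
  linarith

/-! ### The weighted Sobolev spaces -/

/-- The orders `1 + s` and `s` of the two components of `𝓗^{s,α}`. -/
def sobOrder (s : ℝ) (i : Fin 2) : ℝ := ![1 + s, s] i

/-- The operators adjoint to the embedding of `L² ⊕ L²` onto `𝓗^{s,α}`. -/
def weightedOp (s α : ℝ) (i : Fin 2) : 𝓢(E n, ℂ) →L[ℂ] 𝓢(E n, ℂ) :=
  weightS (-α) ∘L lamS (-sobOrder s i)

theorem isRealOp_weightedOp (s α : ℝ) (i : Fin 2) :
    IsRealOp (weightedOp s α i : 𝓢(E n, ℂ) →L[ℂ] 𝓢(E n, ℂ)) :=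
  (isRealOp_weightS _).comp (isRealOp_lamS _)

/-- The condition on α makes point values of the transform continuous functionals, of size ⟨k⟩ˢ
after division by ω in the first component. The condition on s makes ⟨k⟩²ˢ integrable, which is the
trace. -/
theorem exists_traceBound_weighted (hm : 0 < m) {s α : ℝ} (hs : s < -(n : ℝ) / 2)
    (hα : α < -(n : ℝ) / 2) :
    ∃ K, TraceBound (testMap' (weightedOp (n := n) s α)) (majorant m fun _ => 1) K := by
  obtain ⟨κ, hκ, h⟩ := exists_norm_fourier_le_weighted (n := n) hα
  have hC : 1 ≤ max 1 m⁻¹ := le_max_left _ _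
  have hA := isRealOp_weightedOp (n := n) s α
  refine traceBound_majorant hm (c := fun ξ => max 1 m⁻¹ * κ * (1 + (2 * π * ‖ξ‖) ^ 2) ^ (s / 2))
    (fun _ => zero_le_one) continuous_const (fun a Ψ ξ => ?_) (fun a Ψ ξ => ?_) ?_
  · refine (norm_disp_inv_mul_le hm (s := s) (D := κ * ‖testMap' (weightedOp s α) Ψ‖) ?_
      (by positivity)).trans_eq (by ring)
    refine (h (1 + s) _ ξ).trans ?_
    rw [mul_assoc]
    exact mul_le_mul_of_nonneg_left (mul_le_mul_of_nonneg_left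
      (norm_comp_le_testMap' hA a 0 Ψ) hκ) (by positivity)
  · refine (h s _ ξ).trans ?_
    refine (mul_le_mul_of_nonneg_left (norm_comp_le_testMap' hA a 1 Ψ) (by positivity)).trans ?_
    rw [mul_comm _ κ]
    refine mul_le_mul_of_nonneg_right (mul_le_mul_of_nonneg_right ?_ (by positivity)) ?_
    · exact le_mul_of_one_le_left hκ hC
    · exact norm_nonneg _
  · have hn : 0 ≤ (n : ℝ) := Nat.cast_nonneg n
    have hi : Integrable fun ξ : E n => (1 + (2 * π * ‖ξ‖) ^ 2) ^ s := by
      refine (integrable_one_add_norm_sq_rpow hs).mono' ?_ (ae_of_all _ fun ξ => ?_)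
      · refine Continuous.aestronglyMeasurable ?_
        exact Continuous.rpow_const (by fun_prop) fun x => Or.inl (by positivity)
      · rw [Real.norm_of_nonneg (by positivity)]
        refine Real.rpow_le_rpow_of_nonpos (by positivity) ?_ (by linarith)
        have : ‖ξ‖ ≤ 2 * π * ‖ξ‖ :=
          le_mul_of_one_le_left (norm_nonneg ξ) (by linarith [Real.pi_gt_three])
        gcongr
    refine (hi.const_mul ((max 1 m⁻¹ * κ) ^ 2)).congr (ae_of_all _ fun ξ => ?_)
    simp only [one_mul]
    rw [mul_pow (max 1 m⁻¹ * κ), ← Real.rpow_natCast ((1 + (2 * π * ‖ξ‖) ^ 2) ^ (s / 2)), ← Real.rpow_mul (by positivity)]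
    congr 2; push_cast; ring

theorem toTemperedDistribution_add (g g' : Lp ℂ 2 (volume : Measure (E n))) :
    Lp.toTemperedDistribution (g + g') =
      Lp.toTemperedDistribution g + Lp.toTemperedDistribution g' :=
  map_add (Lp.toTemperedDistributionCLM ℂ volume 2) g g'

theorem isWeightedRep_realize (s α : ℝ) (h : RealSpace (weightedOp (n := n) s α)) (i : Fin 2) :
    IsWeightedRep (sobOrder s i) α (realize _ h i) ((h : L2Pair n) i) := by
  refine ⟨PointwiseConvergenceCLM.precomp ℂ (weightedOp s α i)
    (Lp.toTemperedDistribution ((h : L2Pair n) i)), fun φ => rfl, ?_⟩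
  ext f
  rw [TemperedDistribution.smulLeftCLM_apply_apply, lam_apply]
  change Lp.toTemperedDistribution ((h : L2Pair n) i)
    (weightS (-α) (lamS (-sobOrder s i) (lamS (sobOrder s i) (weightS α f)))) = _
  rw [lamS_lamS, neg_add_cancel, lamS_zero, weightS_weightS, neg_add_cancel, weightS_zero]

theorem realize_mem_weightedSpace (s α : ℝ) (h : RealSpace (weightedOp (n := n) s α)) :
    realize _ h ∈ weightedSpace n s α :=
  ⟨⟨_, isWeightedRep_realize s α h 0⟩, ⟨_, isWeightedRep_realize s α h 1⟩⟩

theorem weightedNorm₂_realize_le (s α : ℝ) (h : RealSpace (weightedOp (n := n) s α)) :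
    weightedNorm₂ s α (realize _ h) ≤ (2 : ℝ≥0) * ‖h‖ₑ := by
  have h1 : ∀ i, weightedNorm (sobOrder s i) α (realize _ h i) ≤ ‖h‖ₑ := fun i =>
    (iInf₂_le _ (isWeightedRep_realize s α h i)).trans
      (enorm_le_iff_norm_le.2 (norm_apply_le_norm h i))
  calc _ ≤ ‖h‖ₑ + ‖h‖ₑ := add_le_add (h1 0) (h1 1)
    _ = _ := by rw [← two_mul]; rfl

theorem IsWeightedRep.add {s α : ℝ} {u v : Distr n} {g g' : Lp ℂ 2 (volume : Measure (E n))}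
    (hu : IsWeightedRep s α u g) (hv : IsWeightedRep s α v g') :
    IsWeightedRep s α (u + v) (g + g') := by
  obtain ⟨w, hw, hg⟩ := hu
  obtain ⟨w', hw', hg'⟩ := hv
  refine ⟨w + w', fun φ => ?_, ?_⟩
  · change u φ + v φ = w φ.toSchwartz + w' φ.toSchwartz
    rw [hw, hw']
  · rw [map_add, map_add, hg, hg', toTemperedDistribution_add]

theorem weightedNorm_add_le (s α : ℝ) (u v : Distr n) :
    weightedNorm s α (u + v) ≤ weightedNorm s α u + weightedNorm s α v := by
  simp only [weightedNorm, ENNReal.iInf_add, ENNReal.add_iInf]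
  refine le_iInf fun g' => le_iInf fun hg' => le_iInf fun g => le_iInf fun hg => ?_
  refine le_trans ?_ (enorm_add_le g g')
  exact iInf₂_le (g + g') (hg.add hg')

theorem weightedNorm₂_add_le (s α : ℝ) (Y Z : State n) :
    weightedNorm₂ s α (Y + Z) ≤ weightedNorm₂ s α Y + weightedNorm₂ s α Z := by
  refine (add_le_add (weightedNorm_add_le (1 + s) α (Y 0) (Z 0))
    (weightedNorm_add_le s α (Y 1) (Z 1))).trans_eq ?_
  rw [weightedNorm₂, weightedNorm₂]
  ring

/-! ### Operators bounded in `L²` -/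

/-- The operator `B` in the Schwartz space is bounded with respect to the `L²` norm. -/
def IsL2Bounded (B : 𝓢(E n, ℂ) →L[ℂ] 𝓢(E n, ℂ)) : Prop :=
  ∃ C : ℝ, 0 ≤ C ∧ ∀ f, ‖(B f).toLp 2‖ ≤ C * ‖f.toLp 2‖

theorem toLp_add (f g : 𝓢(E n, ℂ)) :
    (f + g).toLp 2 volume = f.toLp 2 volume + g.toLp 2 volume :=
  map_add (SchwartzMap.toLpCLM ℂ ℂ 2 volume) f g

theorem toLp_sub (f g : 𝓢(E n, ℂ)) :
    (f - g).toLp 2 volume = f.toLp 2 volume - g.toLp 2 volume :=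
  map_sub (SchwartzMap.toLpCLM ℂ ℂ 2 volume) f g

theorem IsL2Bounded.comp {A B : 𝓢(E n, ℂ) →L[ℂ] 𝓢(E n, ℂ)} (hA : IsL2Bounded A)
    (hB : IsL2Bounded B) : IsL2Bounded (A ∘L B) := by
  obtain ⟨C, hC, h⟩ := hA
  obtain ⟨C', hC', h'⟩ := hB
  refine ⟨C * C', mul_nonneg hC hC', fun f => (h (B f)).trans ?_⟩
  rw [mul_assoc]
  exact mul_le_mul_of_nonneg_left (h' f) hC

theorem IsL2Bounded.sub {A B : 𝓢(E n, ℂ) →L[ℂ] 𝓢(E n, ℂ)} (hA : IsL2Bounded A)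
    (hB : IsL2Bounded B) : IsL2Bounded (A - B) := by
  obtain ⟨C, hC, h⟩ := hA
  obtain ⟨C', hC', h'⟩ := hB
  refine ⟨C + C', add_nonneg hC hC', fun f => ?_⟩
  have : (A - B) f = A f - B f := rfl
  rw [this, toLp_sub, add_mul]
  exact (norm_sub_le _ _).trans (add_le_add (h f) (h' f))

theorem IsL2Bounded.add {A B : 𝓢(E n, ℂ) →L[ℂ] 𝓢(E n, ℂ)} (hA : IsL2Bounded A)
    (hB : IsL2Bounded B) : IsL2Bounded (A + B) := by
  obtain ⟨C, hC, h⟩ := hA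
  obtain ⟨C', hC', h'⟩ := hB
  refine ⟨C + C', add_nonneg hC hC', fun f => ?_⟩
  have : (A + B) f = A f + B f := rfl
  rw [this, toLp_add, add_mul]
  exact (norm_add_le _ _).trans (add_le_add (h f) (h' f))

theorem isL2Bounded_zero : IsL2Bounded (0 : 𝓢(E n, ℂ) →L[ℂ] 𝓢(E n, ℂ)) := by
  refine ⟨0, le_rfl, fun f => ?_⟩
  have : ((0 : 𝓢(E n, ℂ) →L[ℂ] 𝓢(E n, ℂ)) f).toLp 2 = 0 :=
    map_zero (SchwartzMap.toLpCLM ℂ ℂ 2 volume)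
  rw [this, norm_zero, zero_mul]

theorem isL2Bounded_sum {ι : Type*} (s : Finset ι) {A : ι → 𝓢(E n, ℂ) →L[ℂ] 𝓢(E n, ℂ)}
    (hA : ∀ i, IsL2Bounded (A i)) : IsL2Bounded (∑ i ∈ s, A i) := by
  classical
  induction s using Finset.induction_on with
  | empty => simpa using isL2Bounded_zero
  | insert i s hi ih => rw [Finset.sum_insert hi]; exact (hA i).add ih

theorem norm_toLp_le_of_le {f g : 𝓢(E n, ℂ)} {C : ℝ} (h : ∀ x, ‖f x‖ ≤ C * ‖g x‖) :
    ‖f.toLp 2‖ ≤ C * ‖g.toLp 2‖ := by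
  refine Lp.norm_le_mul_norm_of_ae_le_mul ?_
  filter_upwards [f.coeFn_toLp 2, g.coeFn_toLp 2] with x hf hg
  rw [hf, hg]
  exact h x

theorem isL2Bounded_smulLeft {g : E n → ℂ} (hg : g.HasTemperateGrowth) {C : ℝ}
    (hC : ∀ x, ‖g x‖ ≤ C) : IsL2Bounded (smulLeftCLM ℂ g : 𝓢(E n, ℂ) →L[ℂ] 𝓢(E n, ℂ)) := by
  refine ⟨C, (norm_nonneg _).trans (hC 0), fun f => norm_toLp_le_of_le fun x => ?_⟩
  rw [smulLeftCLM_apply_apply hg, smul_eq_mul, norm_mul]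
  exact mul_le_mul_of_nonneg_right (hC x) (norm_nonneg _)

theorem isL2Bounded_of_fourier {B : 𝓢(E n, ℂ) →L[ℂ] 𝓢(E n, ℂ)} {a : E n → ℂ} {C : ℝ}
    (hB : ∀ f ξ, 𝓕 (B f) ξ = a ξ * 𝓕 f ξ) (hC : ∀ ξ, ‖a ξ‖ ≤ C) : IsL2Bounded B := by
  refine ⟨C, (norm_nonneg _).trans (hC 0), fun f => ?_⟩
  rw [← norm_toLp_two_fourier (B f), ← norm_toLp_two_fourier f]
  refine norm_toLp_le_of_le fun ξ => ?_
  rw [hB, norm_mul]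
  exact mul_le_mul_of_nonneg_right (hC ξ) (norm_nonneg _)

/-- The partial derivatives on the Schwartz space. -/
def partialS (k : Fin n) : 𝓢(E n, ℂ) →L[ℂ] 𝓢(E n, ℂ) :=
  LineDeriv.lineDerivOpCLM ℂ 𝓢(E n, ℂ) (EuclideanSpace.single k (1 : ℝ) : E n)

theorem partialS_apply (k : Fin n) (f : 𝓢(E n, ℂ)) :
    partialS k f = ∂_{(EuclideanSpace.single k (1 : ℝ) : E n)} f := rfl

theorem fourier_partialS (k : Fin n) (f : 𝓢(E n, ℂ)) (ξ : E n) :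
    𝓕 (partialS k f) ξ = (2 * π * Complex.I) * (ξ k : ℝ) * 𝓕 f ξ := by
  rw [partialS_apply, fourier_lineDeriv, inner_single]

theorem isL2Bounded_lamS {s : ℝ} (hs : s ≤ 0) :
    IsL2Bounded (lamS s : 𝓢(E n, ℂ) →L[ℂ] 𝓢(E n, ℂ)) := by
  refine isL2Bounded_of_fourier (fourier_lamS s) (C := 1) fun ξ => ?_
  rw [norm_symbol]
  exact Real.rpow_le_one_of_one_le_of_nonpos (by nlinarith [sq_nonneg (2 * π * ‖ξ‖)]) (by linarith)

theorem norm_partial_symbol_le (k : Fin n) (ξ : E n) :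
    ‖(2 * π * Complex.I) * ((ξ k : ℝ) : ℂ)‖ ≤ (1 + (2 * π * ‖ξ‖) ^ 2) ^ (1 / 2 : ℝ) := by
  rw [← Real.sqrt_eq_rpow]
  refine Real.le_sqrt_of_sq_le ?_
  have h1 : ‖(2 * π * Complex.I) * ((ξ k : ℝ) : ℂ)‖ = 2 * π * |ξ k| := by
    simp [abs_of_pos Real.pi_pos]
  have h2 : |ξ k| ≤ ‖ξ‖ := PiLp.norm_apply_le ξ k
  rw [h1]
  have : 2 * π * |ξ k| ≤ 2 * π * ‖ξ‖ := mul_le_mul_of_nonneg_left h2 (by positivity)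
  nlinarith [abs_nonneg (ξ k), Real.pi_pos, mul_nonneg Real.pi_pos.le (abs_nonneg (ξ k))]

theorem isL2Bounded_partialS_lamS (k : Fin n) {s : ℝ} (hs : s ≤ -1) :
    IsL2Bounded (partialS k ∘L lamS s : 𝓢(E n, ℂ) →L[ℂ] 𝓢(E n, ℂ)) := by
  refine isL2Bounded_of_fourier (a := fun ξ => (2 * π * Complex.I) * ((ξ k : ℝ) : ℂ) *
    symbol 1 (s / 2) ξ) (fun f ξ => ?_) (C := 1) fun ξ => ?_
  · rw [ContinuousLinearMap.comp_apply, fourier_partialS, fourier_lamS, mul_assoc _ (symbol _ _ _)]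
  · rw [norm_mul, norm_symbol]
    refine (mul_le_mul_of_nonneg_right (norm_partial_symbol_le k ξ) (by positivity)).trans ?_
    rw [← Real.rpow_add (by positivity)]
    exact Real.rpow_le_one_of_one_le_of_nonpos (by nlinarith [sq_nonneg (2 * π * ‖ξ‖)])
      (by linarith)

theorem partialS_lamS (k : Fin n) (s : ℝ) (f : 𝓢(E n, ℂ)) :
    partialS k (lamS s f) = lamS s (partialS k f) := by
  refine schwartz_ext_fourier fun ξ => ?_
  rw [fourier_partialS, fourier_lamS, fourier_lamS, fourier_partialS]
  ring

theorem isL2Bounded_lamS_partialS (k : Fin n) {s : ℝ} (hs : s ≤ -1) :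
    IsL2Bounded (lamS s ∘L partialS k : 𝓢(E n, ℂ) →L[ℂ] 𝓢(E n, ℂ)) := by
  obtain ⟨C, hC, h⟩ := isL2Bounded_partialS_lamS k hs
  refine ⟨C, hC, fun f => ?_⟩
  rw [ContinuousLinearMap.comp_apply, ← partialS_lamS]
  exact h f

/-- This is Λˢ = (1 - Δ)Λ^(s-2). It trades a Bessel potential, which does not commute simply with
multiplications, for derivatives, which obey the product rule. -/
theorem lamS_eq_sub_sum (s : ℝ) (f : 𝓢(E n, ℂ)) :
    lamS s f = lamS (s - 2) f - ∑ k : Fin n, partialS k (partialS k (lamS (s - 2) f)) := by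
  refine schwartz_ext_fourier fun ξ => ?_
  rw [fourier_sub_schwartz, sub_apply]
  have h1 : 𝓕 (∑ k : Fin n, partialS k (partialS k (lamS (s - 2) f))) ξ =
      ∑ k : Fin n, 𝓕 (partialS k (partialS k (lamS (s - 2) f))) ξ := by
    rw [show 𝓕 (∑ k : Fin n, partialS k (partialS k (lamS (s - 2) f))) =
      ∑ k : Fin n, 𝓕 (partialS k (partialS k (lamS (s - 2) f))) from
        map_sum (fourierCLM ℂ 𝓢(E n, ℂ)) _ _, sum_apply]
  rw [h1]
  simp only [partialS_apply]
  rw [fourier_sum_lineDeriv, fourier_lamS, fourier_lamS, ← mul_assoc, ← sub_mul, neg_mul,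
    sub_neg_eq_add]
  congr 1
  have h2 : (1 : ℝ) ^ 2 + (2 * π * ‖ξ‖) ^ 2 ≠ 0 := by positivity
  have h3 : s / 2 = (s - 2) / 2 + 1 := by ring
  rw [symbol, symbol, h3, Real.rpow_add_one h2]
  push_cast
  ring

/-! ### The product rule -/

theorem hasTemperateGrowth_fderiv_apply {g : E n → ℂ} (hg : g.HasTemperateGrowth) (v : E n) :
    Function.HasTemperateGrowth fun x => fderiv ℝ g x v := by
  have h : Function.HasTemperateGrowth (fderiv ℝ g) := by
    refine ⟨(contDiff_infty_iff_fderiv.1 hg.1).2, fun l => ?_⟩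
    obtain ⟨k, C, hC⟩ := hg.2 (l + 1)
    exact ⟨k, C, fun x => by simpa only [norm_iteratedFDeriv_fderiv] using hC x⟩
  exact (ContinuousLinearMap.apply ℝ ℂ v).hasTemperateGrowth.comp h

/-- The partial derivatives of a function. -/
def partialF (k : Fin n) (g : E n → ℂ) (x : E n) : ℂ :=
  fderiv ℝ g x (EuclideanSpace.single k (1 : ℝ))

theorem smulLeft_partialS {g : E n → ℂ} (hg : g.HasTemperateGrowth) (k : Fin n)
    (f : 𝓢(E n, ℂ)) : smulLeftCLM ℂ g (partialS k f) =
      partialS k (smulLeftCLM ℂ g f) - smulLeftCLM ℂ (partialF k g) f := by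
  have hg' : (partialF k g).HasTemperateGrowth := hasTemperateGrowth_fderiv_apply hg _
  ext x
  rw [sub_apply, smulLeftCLM_apply_apply hg, smulLeftCLM_apply_apply hg', partialS_apply,
    partialS_apply, lineDerivOp_apply_eq_fderiv, lineDerivOp_apply_eq_fderiv]
  have h1 : (smulLeftCLM ℂ g f : E n → ℂ) = fun y => g y * f y := by
    funext y; rw [smulLeftCLM_apply_apply hg]; rfl
  have hd : DifferentiableAt ℝ g x := hg.1.contDiffAt.differentiableAt (by simp)
  rw [h1, fderiv_fun_mul hd f.differentiableAt]
  simp [partialF]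
  ring

/-- After writing Λˢ as (1 - Δ)Λ^(s-2), one of the two derivatives is moved to the left of g. What
remains is composed of Λ⁻¹∂, ∂Λ^(s-2) and multiplications by g and its derivatives, all bounded in
L² when s ≤ 1. -/
theorem isL2Bounded_sobolev_product {g : E n → ℂ} (hg : g.HasTemperateGrowth) {C : ℝ}
    (hC : ∀ x, ‖g x‖ ≤ C) {C' : ℝ} (hC' : ∀ k x, ‖partialF k g x‖ ≤ C') {s : ℝ} (hs : s ≤ 1) :
    IsL2Bounded (lamS (-1) ∘L smulLeftCLM ℂ g ∘L lamS s : 𝓢(E n, ℂ) →L[ℂ] 𝓢(E n, ℂ)) := by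
  have hg' : ∀ k, (partialF k g).HasTemperateGrowth := fun k => hasTemperateGrowth_fderiv_apply hg _
  have hb := isL2Bounded_smulLeft hg hC
  have hl := isL2Bounded_lamS (n := n) (s := -1) (by norm_num)
  have h1 := (hl.comp hb).comp (isL2Bounded_lamS (n := n) (s := s - 2) (by linarith))
  have h2 : ∀ k : Fin n, IsL2Bounded (((lamS (-1) ∘L partialS k) ∘L smulLeftCLM ℂ g -
      lamS (-1) ∘L smulLeftCLM ℂ (partialF k g)) ∘L (partialS k ∘L lamS (s - 2))) := fun k =>
    (((isL2Bounded_lamS_partialS k le_rfl).comp hb).sub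
      (hl.comp (isL2Bounded_smulLeft (hg' k) (hC' k)))).comp
        (isL2Bounded_partialS_lamS k (by linarith))
  have h3 := h1.sub (isL2Bounded_sum Finset.univ h2)
  convert h3 using 1
  ext1 f
  simp only [ContinuousLinearMap.comp_apply, sub_apply, sum_apply]
  rw [lamS_eq_sub_sum s f, map_sub, map_sub, map_sum, map_sum]
  congr 1
  refine Finset.sum_congr rfl fun k _ => ?_
  rw [smulLeft_partialS hg, map_sub]

/-! ### Transposes of bounded operators -/

theorem norm_star_Lp (g : Lp ℂ 2 (volume : Measure (E n))) : ‖star g‖ = ‖g‖ := by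
  have h : ∀ f : Lp ℂ 2 (volume : Measure (E n)), ‖star f‖ ≤ ‖f‖ := fun f => by
    refine Lp.norm_le_norm_of_ae_le ?_
    filter_upwards [Lp.coeFn_star f] with x hx
    rw [hx, Pi.star_apply, norm_star]
  refine le_antisymm (h g) ?_
  simpa using h (star g)

theorem toTemperedDistribution_eq_inner (g : Lp ℂ 2 (volume : Measure (E n))) (f : 𝓢(E n, ℂ)) :
    Lp.toTemperedDistribution g f = inner ℂ (star g) (f.toLp 2) := by
  rw [Lp.toTemperedDistribution_apply, L2.inner_def]
  refine integral_congr_ae ?_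
  filter_upwards [Lp.coeFn_star g, f.coeFn_toLp 2] with x h1 h2
  rw [h1, h2, Pi.star_apply, RCLike.inner_apply]
  simp

theorem norm_toTemperedDistribution_le (g : Lp ℂ 2 (volume : Measure (E n))) (f : 𝓢(E n, ℂ)) :
    ‖Lp.toTemperedDistribution g f‖ ≤ ‖g‖ * ‖f.toLp 2‖ := by
  rw [toTemperedDistribution_eq_inner, ← norm_star_Lp g]
  exact norm_inner_le_norm _ _

/-- `B` extends to L² by density, and its adjoint is conjugated on both sides because the pairing of
distributions is bilinear rather than sesquilinear. -/
theorem IsL2Bounded.exists_transpose {B : 𝓢(E n, ℂ) →L[ℂ] 𝓢(E n, ℂ)} (hB : IsL2Bounded B) :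
    ∃ C : ℝ, 0 ≤ C ∧ ∀ g : Lp ℂ 2 (volume : Measure (E n)),
      ∃ g' : Lp ℂ 2 (volume : Measure (E n)), ‖g'‖ ≤ C * ‖g‖ ∧
        ∀ f, Lp.toTemperedDistribution g' f = Lp.toTemperedDistribution g (B f) := by
  obtain ⟨C, hC, hB⟩ := hB
  let e : 𝓢(E n, ℂ) →ₗ[ℂ] Lp ℂ 2 (volume : Measure (E n)) :=
    (SchwartzMap.toLpCLM ℂ ℂ 2 volume : 𝓢(E n, ℂ) →L[ℂ] Lp ℂ 2 (volume : Measure (E n)))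
  let T : Lp ℂ 2 (volume : Measure (E n)) →L[ℂ] Lp ℂ 2 (volume : Measure (E n)) :=
    (e ∘ₗ (B : 𝓢(E n, ℂ) →ₗ[ℂ] 𝓢(E n, ℂ))).extendOfNorm e
  have hd : DenseRange e := SchwartzMap.denseRange_toLpCLM (by simp)
  have hT : ∀ f : 𝓢(E n, ℂ), T (f.toLp 2) = (B f).toLp 2 := fun f =>
    LinearMap.extendOfNorm_eq (f := e ∘ₗ (B : 𝓢(E n, ℂ) →ₗ[ℂ] 𝓢(E n, ℂ))) hd ⟨C, hB⟩ f
  have hTn : ‖T‖ ≤ C :=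
    LinearMap.opNorm_extendOfNorm_le (f := e ∘ₗ (B : 𝓢(E n, ℂ) →ₗ[ℂ] 𝓢(E n, ℂ))) hd hC hB
  refine ⟨C, hC, fun g => ⟨star (T.adjoint (star g)), ?_, fun f => ?_⟩⟩
  · rw [norm_star_Lp]
    refine (ContinuousLinearMap.le_opNorm _ _).trans ?_
    rw [norm_star_Lp, LinearIsometryEquiv.norm_map]
    exact mul_le_mul_of_nonneg_right hTn (norm_nonneg _)
  · rw [toTemperedDistribution_eq_inner, toTemperedDistribution_eq_inner, star_star,
      ContinuousLinearMap.adjoint_inner_left, hT]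

/-! ### A weighted space of states of finite local energy -/

/-- The weight `⟨x⟩^α`. -/
def weightF (α : ℝ) (x : E n) : ℂ := (((1 + ‖x‖ ^ 2) ^ (α / 2) : ℝ) : ℂ)

theorem continuous_weightF (α : ℝ) : Continuous (weightF α : E n → ℂ) :=
  (hasTemperateGrowth_weight α).1.continuous

theorem norm_partialF_weightF_le (α : ℝ) (k : Fin n) (x : E n) :
    ‖partialF k (weightF α) x‖ ≤ |α| * ‖weightF α x‖ := by
  have hpos : 0 < 1 + ‖x‖ ^ 2 := by positivity
  have h1 : HasFDerivAt (fun y : E n => 1 + ‖y‖ ^ 2) (2 • innerSL ℝ x) x :=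
    (hasStrictFDerivAt_norm_sq x).hasFDerivAt.const_add 1
  have h2 := h1.rpow_const (p := α / 2) (Or.inl hpos.ne')
  have h3 : HasFDerivAt (weightF α : E n → ℂ) (Complex.ofRealCLM ∘L
      ((α / 2 * (1 + ‖x‖ ^ 2) ^ (α / 2 - 1)) • (2 • innerSL ℝ x))) x :=
    Complex.ofRealCLM.hasFDerivAt.comp x h2
  have h4 : partialF k (weightF α) x =
      ((α / 2 * (1 + ‖x‖ ^ 2) ^ (α / 2 - 1) * (2 * x k) : ℝ) : ℂ) := by
    rw [partialF, h3.fderiv]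
    simp [EuclideanSpace.inner_single_right]
  have h5 : |x k| ≤ ‖x‖ := PiLp.norm_apply_le x k
  have h6 : |x k| ≤ 1 + ‖x‖ ^ 2 := h5.trans (by nlinarith [sq_nonneg (‖x‖ - 1), norm_nonneg x])
  rw [h4, weightF, Complex.norm_real, Complex.norm_real,
    Real.norm_of_nonneg (by positivity : (0 : ℝ) ≤ (1 + ‖x‖ ^ 2) ^ (α / 2)), Real.norm_eq_abs]
  have h7 : (1 + ‖x‖ ^ 2) ^ (α / 2) = (1 + ‖x‖ ^ 2) ^ (α / 2 - 1) * (1 + ‖x‖ ^ 2) := by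
    rw [← Real.rpow_add_one hpos.ne']; congr 1; ring
  have h8 : (0 : ℝ) ≤ (1 + ‖x‖ ^ 2) ^ (α / 2 - 1) := by positivity
  calc |α / 2 * (1 + ‖x‖ ^ 2) ^ (α / 2 - 1) * (2 * x k)|
      = |α| * ((1 + ‖x‖ ^ 2) ^ (α / 2 - 1) * |x k|) := by
        rw [show α / 2 * (1 + ‖x‖ ^ 2) ^ (α / 2 - 1) * (2 * x k) =
          α * ((1 + ‖x‖ ^ 2) ^ (α / 2 - 1) * x k) by ring, abs_mul, abs_mul, abs_of_nonneg h8]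
    _ ≤ _ := by
        rw [h7]
        exact mul_le_mul_of_nonneg_left (mul_le_mul_of_nonneg_left h6 h8) (abs_nonneg α)

theorem continuous_partialF {g : E n → ℂ} (hg : g.HasTemperateGrowth) (k : Fin n) :
    Continuous (partialF k g) :=
  (hasTemperateGrowth_fderiv_apply hg _).1.continuous

theorem norm_fourier_weight_partialS_le {α : ℝ} (hα : α < -(n : ℝ) / 2) (k : Fin n) :
    ∃ κ : ℝ, 0 ≤ κ ∧ ∀ (f : 𝓢(E n, ℂ)) ξ, ‖𝓕 (weightS α (partialS k f)) ξ‖ ≤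
      (1 + (2 * π * ‖ξ‖) ^ 2) ^ (1 / 2 : ℝ) * (κ * ‖f.toLp 2‖) := by
  have hw := hasTemperateGrowth_weight (n := n) α
  have hw2 := memLp_two_weight hα
  have hp : (partialF k (weightF α) : E n → ℂ).HasTemperateGrowth :=
    hasTemperateGrowth_fderiv_apply hw _
  have hp2 : MemLp (partialF k (weightF α)) 2 (volume : Measure (E n)) :=
    MemLp.of_le_mul hw2 (continuous_partialF hw k).aestronglyMeasurable
      (ae_of_all _ fun x => norm_partialF_weightF_le α k x)
  obtain ⟨κ, hκ, h⟩ := exists_norm_fourier_smul_le hw hw2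
  obtain ⟨κ', hκ', h'⟩ := exists_norm_fourier_smul_le hp hp2
  refine ⟨κ + κ', by positivity, fun f ξ => ?_⟩
  have h1 : weightS α (partialS k f) = partialS k (weightS α f) -
    smulLeftCLM ℂ (partialF k (weightF α)) f := smulLeft_partialS hw k f
  rw [h1, fourier_sub_schwartz, sub_apply, fourier_partialS]
  refine (norm_sub_le _ _).trans ?_
  rw [norm_mul]
  have hW : 1 ≤ (1 + (2 * π * ‖ξ‖) ^ 2) ^ (1 / 2 : ℝ) :=
    Real.one_le_rpow (by nlinarith [sq_nonneg (2 * π * ‖ξ‖)]) (by norm_num)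
  rw [add_mul, mul_add]
  refine add_le_add (mul_le_mul (norm_partial_symbol_le k ξ) (h f ξ) (norm_nonneg _)
    (by positivity)) ((h' f ξ).trans (le_mul_of_one_le_left (by positivity) hW))

/-- Here the weight stands outside Λ, so f = ⟨x⟩^α Λ b. Writing Λ = Λ⁻¹ - Σ ∂∂Λ⁻¹ and commuting one
derivative with the weight leaves a single power of ⟨k⟩; the derivative of the weight is dominated
by the weight and does no harm. -/
theorem exists_norm_fourier_le_energy {α : ℝ} (hα : α < -(n : ℝ) / 2) :
    ∃ κ : ℝ, 0 ≤ κ ∧ ∀ (f : 𝓢(E n, ℂ)) ξ, ‖𝓕 f ξ‖ ≤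
      (1 + (2 * π * ‖ξ‖) ^ 2) ^ (1 / 2 : ℝ) *
        (κ * ‖(lamS (-1) (weightS (-α) f)).toLp 2‖) := by
  obtain ⟨κ, hκ, h⟩ := exists_norm_fourier_smul_le (hasTemperateGrowth_weight α)
    (memLp_two_weight hα)
  choose κ' hκ' h' using fun k => norm_fourier_weight_partialS_le hα k
  obtain ⟨C, hC, hb⟩ := isL2Bounded_lamS (n := n) (s := 1 - 2) (by norm_num)
  choose C' hC' hb' using fun k : Fin n =>
    isL2Bounded_partialS_lamS (n := n) k (s := 1 - 2) (by norm_num)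
  refine ⟨κ * C + ∑ k, κ' k * C' k, add_nonneg (by positivity)
    (Finset.sum_nonneg fun k _ => mul_nonneg (hκ' k) (hC' k)), fun f ξ => ?_⟩
  set b := lamS (-1) (weightS (-α) f) with hbdef
  have hf : f = weightS α (lamS 1 b) := by
    rw [hbdef, lamS_lamS, add_neg_cancel, lamS_zero, weightS_weightS, add_neg_cancel,
      weightS_zero]
  have hsum : 𝓕 f ξ = 𝓕 (weightS α (lamS (1 - 2) b)) ξ -
      ∑ k : Fin n, 𝓕 (weightS α (partialS k (partialS k (lamS (1 - 2) b)))) ξ := by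
    conv_lhs => rw [hf, lamS_eq_sub_sum, map_sub, map_sum, fourier_sub_schwartz, sub_apply]
    rw [show 𝓕 (∑ k : Fin n, weightS α (partialS k (partialS k (lamS (1 - 2) b)))) =
      ∑ k : Fin n, 𝓕 (weightS α (partialS k (partialS k (lamS (1 - 2) b)))) from
        map_sum (fourierCLM ℂ 𝓢(E n, ℂ)) _ _, sum_apply]
  have hW : 1 ≤ (1 + (2 * π * ‖ξ‖) ^ 2) ^ (1 / 2 : ℝ) :=
    Real.one_le_rpow (by nlinarith [sq_nonneg (2 * π * ‖ξ‖)]) (by norm_num)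
  set W := (1 + (2 * π * ‖ξ‖) ^ 2) ^ (1 / 2 : ℝ)
  rw [hsum]
  refine (norm_sub_le _ _).trans ((add_le_add (?_ : _ ≤ W * (κ * C * ‖b.toLp 2‖))
    ((norm_sum_le _ _).trans (Finset.sum_le_sum fun k _ =>
      (?_ : _ ≤ W * (κ' k * C' k * ‖b.toLp 2‖))))).trans_eq ?_)
  · refine (h _ ξ).trans ?_
    rw [mul_assoc κ]
    exact (mul_le_mul_of_nonneg_left (hb b) hκ).trans (le_mul_of_one_le_left (by positivity) hW)
  · refine (h' k _ ξ).trans (mul_le_mul_of_nonneg_left ?_ (by positivity))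
    rw [mul_assoc]
    exact mul_le_mul_of_nonneg_left (hb' k b) (hκ' k)
  · rw [← Finset.mul_sum, ← Finset.sum_mul]; ring

/-- The operators adjoint to the embedding of `L² ⊕ L²` onto the space of all pairs `(u, v)` with
`Λ(⟨x⟩^α u)` and `⟨x⟩^α v` in `L²`. -/
def energyOp (α : ℝ) : Fin 2 → 𝓢(E n, ℂ) →L[ℂ] 𝓢(E n, ℂ) :=
  ![lamS (-1) ∘L weightS (-α), weightS (-α)]

theorem isRealOp_energyOp (α : ℝ) (i : Fin 2) : IsRealOp (energyOp (n := n) α i) := by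
  fin_cases i
  · exact (isRealOp_lamS _).comp (isRealOp_weightS _)
  · exact isRealOp_weightS _

/-- The power of ⟨k⟩ lost in the first component is compensated by ω⁻¹, so the functionals are
bounded uniformly in ξ and integrability of F alone gives a finite trace. With F the spectral
density this is finiteness of the mean energy. -/
theorem exists_traceBound_energy (hm : 0 < m) {α : ℝ} (hα : α < -(n : ℝ) / 2) {F : E n → ℝ}
    (hF : ∀ ξ, 0 ≤ F ξ) (hFc : Continuous F) (hFi : Integrable F) :
    ∃ K, TraceBound (testMap' (energyOp (n := n) α)) (majorant m F) K := by
  obtain ⟨κ, hκ, h⟩ := exists_norm_fourier_le_energy (n := n) hα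
  obtain ⟨κ', hκ', h'⟩ := exists_norm_fourier_le_weighted (n := n) hα
  have hA := isRealOp_energyOp (n := n) α
  refine traceBound_majorant hm (c := fun _ => max 1 m⁻¹ * κ + κ') hF hFc (fun a Ψ ξ => ?_)
    (fun a Ψ ξ => ?_) (hFi.mul_const _)
  · have h1 : ‖𝓕 (CTest.comp a (Ψ 0)).toSchwartz ξ‖ ≤
        (1 + (2 * π * ‖ξ‖) ^ 2) ^ ((1 + 0 : ℝ) / 2) * (κ * ‖testMap' (energyOp α) Ψ‖) := by
      rw [add_zero]
      exact (h _ ξ).trans (mul_le_mul_of_nonneg_left (mul_le_mul_of_nonneg_left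
        (norm_comp_le_testMap' hA a 0 Ψ) hκ) (by positivity))
    refine (norm_disp_inv_mul_le hm h1 (by positivity)).trans ?_
    rw [zero_div, Real.rpow_zero, mul_one, ← mul_assoc]
    exact mul_le_mul_of_nonneg_right (le_add_of_nonneg_right hκ') (norm_nonneg _)
  · refine (h' 0 _ ξ).trans ?_
    rw [zero_div, Real.rpow_zero, one_mul, neg_zero, lamS_zero]
    refine (mul_le_mul_of_nonneg_left (norm_comp_le_testMap' hA a 1 Ψ) hκ').trans ?_
    exact mul_le_mul_of_nonneg_right (le_add_of_nonneg_left (by positivity)) (norm_nonneg _)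

/-! ### Realizations have finite local energy -/

theorem memLp_ball_mul {g : E n → ℂ} (hg : Continuous g) (G : Lp ℂ 2 (volume : Measure (E n)))
    (R : ℝ) : MemLp (fun x => g x * G x) 2 (volume.restrict (Metric.ball 0 R)) := by
  obtain ⟨C, hC⟩ := (isCompact_closedBall (0 : E n) R).exists_bound_of_continuousOn hg.continuousOn
  have hG : MemLp G 2 (volume.restrict (Metric.ball (0 : E n) R)) := (Lp.memLp G).restrict _
  refine MemLp.of_le_mul (c := C) hG (hg.aestronglyMeasurable.mul hG.1) ?_
  filter_upwards [ae_restrict_mem Metric.isOpen_ball.measurableSet] with x hx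
  rw [norm_mul]
  exact mul_le_mul_of_nonneg_right (hC x (Metric.ball_subset_closedBall hx)) (norm_nonneg _)

theorem integrable_schwartz_smul (G : Lp ℂ 2 (volume : Measure (E n))) (f : 𝓢(E n, ℂ)) :
    Integrable fun x => f x • G x :=
  MemLp.integrable_mul (f.memLp 2 volume) (Lp.memLp G)

theorem toTemperedDistribution_smulLeft {g : E n → ℂ} (hg : g.HasTemperateGrowth)
    (G : Lp ℂ 2 (volume : Measure (E n))) (φ : RTest n) :
    (Integrable fun x => φ x • (g x * G x)) ∧
      Lp.toTemperedDistribution G (smulLeftCLM ℂ g φ.toSchwartz) = ∫ x, φ x • (g x * G x) := by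
  have h : ∀ x, smulLeftCLM ℂ g φ.toSchwartz x • G x = φ x • (g x * G x) := fun x => by
    rw [smulLeftCLM_apply_apply hg, RTest.toSchwartz_apply, smul_eq_mul, smul_eq_mul,
      Complex.real_smul]
    ring
  refine ⟨(integrable_schwartz_smul G _).congr (ae_of_all _ h), ?_⟩
  rw [Lp.toTemperedDistribution_apply]
  exact integral_congr_ae (ae_of_all _ h)

theorem realize_energyOp_zero (α : ℝ) (h : RealSpace (energyOp (n := n) α)) (φ : RTest n) :
    realize _ h 0 φ = Lp.toTemperedDistribution ((h : L2Pair n) 0)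
      (lamS (-1) (smulLeftCLM ℂ (weightF (-α)) φ.toSchwartz)) := rfl

theorem realize_energyOp_one (α : ℝ) (h : RealSpace (energyOp (n := n) α)) (φ : RTest n) :
    realize _ h 1 φ = Lp.toTemperedDistribution ((h : L2Pair n) 1)
      (smulLeftCLM ℂ (weightF (-α)) φ.toSchwartz) := rfl

/-- The position field is a smooth weight times Λ⁻¹h⁰. Both Λ⁻¹ and Λ⁻¹∂ are bounded in L², so it
and its gradient, computed by the product rule, are locally square integrable. -/
theorem realize_energyOp_mem_phaseSpace (α : ℝ) (h : RealSpace (energyOp (n := n) α)) :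
    realize _ h ∈ phaseSpace n := by
  have hw : (weightF (-α) : E n → ℂ).HasTemperateGrowth := hasTemperateGrowth_weight (-α)
  obtain ⟨C, -, hG⟩ := (isL2Bounded_lamS (n := n) (s := -1) (by norm_num)).exists_transpose
  obtain ⟨G, -, hG⟩ := hG ((h : L2Pair n) 0)
  have hD : ∀ k : Fin n, ∃ D : Lp ℂ 2 (volume : Measure (E n)), ∀ f,
      Lp.toTemperedDistribution D f =
        Lp.toTemperedDistribution ((h : L2Pair n) 0) (lamS (-1) (partialS k f)) := fun k => by
    obtain ⟨C, -, hD⟩ := (isL2Bounded_lamS_partialS (n := n) k le_rfl).exists_transpose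
    obtain ⟨D, -, hD⟩ := hD ((h : L2Pair n) 0)
    exact ⟨D, hD⟩
  choose D hD using hD
  have hp : ∀ k, (partialF k (weightF (-α)) : E n → ℂ).HasTemperateGrowth := fun k =>
    hasTemperateGrowth_fderiv_apply hw _
  refine ⟨fun x => weightF (-α) x * G x, fun x => weightF (-α) x * (h : L2Pair n) 1 x,
    fun k x => -(weightF (-α) x * D k x) + partialF k (weightF (-α)) x * G x, ?_⟩
  refine ⟨fun R => memLp_ball_mul (continuous_weightF _) _ R,
    fun R => memLp_ball_mul (continuous_weightF _) _ R,
    fun k R => (memLp_ball_mul (continuous_weightF _) _ R).neg.add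
      (memLp_ball_mul (continuous_partialF hw k) _ R), fun φ => ?_, fun φ => ?_, fun k φ => ?_⟩
  · exact (realize_energyOp_zero α h φ).trans
      ((hG _).symm.trans (toTemperedDistribution_smulLeft hw G φ).2)
  · exact (realize_energyOp_one α h φ).trans (toTemperedDistribution_smulLeft hw _ φ).2
  · have h1 : smulLeftCLM ℂ (weightF (-α))
        (RTest.toSchwartz (∂_{(EuclideanSpace.single k (1 : ℝ) : E n)} φ)) =
        partialS k (smulLeftCLM ℂ (weightF (-α)) φ.toSchwartz) -
          smulLeftCLM ℂ (partialF k (weightF (-α))) φ.toSchwartz := by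
      rw [RTest.toSchwartz_lineDeriv, ← partialS_apply, smulLeft_partialS hw]
    have h2 : realize _ h 0 (∂_{(EuclideanSpace.single k (1 : ℝ) : E n)} φ) =
        Lp.toTemperedDistribution (D k) (smulLeftCLM ℂ (weightF (-α)) φ.toSchwartz) -
        Lp.toTemperedDistribution G
          (smulLeftCLM ℂ (partialF k (weightF (-α))) φ.toSchwartz) := by
      refine (realize_energyOp_zero α h _).trans ?_
      rw [h1, map_sub, map_sub, hD, hG]
    have h3 : (∂_{(EuclideanSpace.single k (1 : ℝ) : E n)} (realize _ h 0)) φ =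
        -(realize _ h 0 (∂_{(EuclideanSpace.single k (1 : ℝ) : E n)} φ)) :=
      (Distribution.lineDerivOp_apply_apply ..).trans (map_neg _ _)
    refine h3.trans ((congrArg _ h2).trans ?_)
    rw [(toTemperedDistribution_smulLeft hw (D k) φ).2,
      (toTemperedDistribution_smulLeft (hp k) G φ).2, neg_sub, sub_eq_neg_add, ← integral_neg]
    refine (integral_add (toTemperedDistribution_smulLeft hw (D k) φ).1.neg
        (toTemperedDistribution_smulLeft (hp k) G φ).1).symm.trans ?_
    refine integral_congr_ae (ae_of_all _ fun x => ?_)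
    simp only [smul_add, smul_neg, Pi.neg_apply]

theorem exists_bound_schwartz (f : 𝓢(E n, ℂ)) : ∃ C, ∀ x, ‖f x‖ ≤ C := by
  obtain ⟨C, -, hC⟩ := f.decay 0 0
  exact ⟨C, fun x => by simpa using hC x⟩

/-- The cut-off and the weight merge into one Schwartz function θ with bounded derivatives. The
position component then needs the product estimate at order 1 + s ≤ 1, the velocity component only
boundedness of Λˢ for s ≤ 0. -/
theorem exists_localRep_energyOp (α : ℝ) {s : ℝ} (hs : s ≤ 0) (χ : RTest n) (i : Fin 2) :
    ∃ C : ℝ, 0 ≤ C ∧ ∀ h : RealSpace (energyOp (n := n) α), ∃ g,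
      IsLocalRep (sobOrder s i) χ (realize _ h i) g ∧ ‖g‖ ≤ C * ‖h‖ := by
  let θ : 𝓢(E n, ℂ) := weightS (-α) χ.toSchwartz
  have hθ : (θ : E n → ℂ).HasTemperateGrowth := θ.hasTemperateGrowth
  obtain ⟨C, hC⟩ := exists_bound_schwartz θ
  choose C' hC' using fun k : Fin n => exists_bound_schwartz (partialS k θ)
  have hC'0 : ∀ k, 0 ≤ C' k := fun k => (norm_nonneg _).trans (hC' k 0)
  have hp : ∀ k x, ‖partialF k θ x‖ ≤ ∑ k, C' k := fun k x => by
    refine le_trans ?_ (Finset.single_le_sum (fun k _ => hC'0 k) (Finset.mem_univ k))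
    have := hC' k x
    rwa [partialS_apply, lineDerivOp_apply_eq_fderiv] at this
  have hmul : ∀ φ : RTest n, weightS (-α) (RTest.mul χ φ).toSchwartz =
      smulLeftCLM ℂ θ φ.toSchwartz := fun φ => by
    ext x
    rw [weightS_apply, smulLeftCLM_apply_apply hθ]
    change _ * ((χ x * φ x : ℝ) : ℂ) = weightS (-α) χ.toSchwartz x * (φ x : ℂ)
    rw [weightS_apply, RTest.toSchwartz_apply]
    push_cast
    ring
  have key : ∀ A : 𝓢(E n, ℂ) →L[ℂ] 𝓢(E n, ℂ), energyOp α i = A ∘L weightS (-α) →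
      IsL2Bounded (A ∘L smulLeftCLM ℂ θ ∘L lamS (sobOrder s i)) →
      ∃ C : ℝ, 0 ≤ C ∧ ∀ h : RealSpace (energyOp (n := n) α), ∃ g,
        IsLocalRep (sobOrder s i) χ (realize _ h i) g ∧ ‖g‖ ≤ C * ‖h‖ := by
    intro A hA hB
    obtain ⟨C, hC, hT⟩ := hB.exists_transpose
    refine ⟨C, hC, fun h => ?_⟩
    obtain ⟨g, hg, hgf⟩ := hT ((h : L2Pair n) i)
    refine ⟨g, ⟨PointwiseConvergenceCLM.precomp ℂ (A ∘L smulLeftCLM ℂ θ)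
      (Lp.toTemperedDistribution ((h : L2Pair n) i)), fun φ => ?_, ?_⟩,
      hg.trans (mul_le_mul_of_nonneg_left (norm_apply_le_norm h i) hC)⟩
    · change Lp.toTemperedDistribution ((h : L2Pair n) i)
        (energyOp α i (RTest.mul χ φ).toSchwartz) = _
      rw [hA, ContinuousLinearMap.comp_apply, hmul]
      rfl
    · ext f
      rw [lam_apply, hgf]
      rfl
  fin_cases i
  · exact key (lamS (-1)) rfl (isL2Bounded_sobolev_product hθ hC hp (by
      change 1 + s ≤ 1; linarith))
  · refine key (ContinuousLinearMap.id ℂ _) rfl ?_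
    exact (isL2Bounded_smulLeft hθ hC).comp (isL2Bounded_lamS hs)

theorem realize_energyOp_mem_localSpace (α : ℝ) {s : ℝ} (hs : s ≤ 0)
    (h : RealSpace (energyOp (n := n) α)) : realize _ h ∈ localSpace n s := by
  intro χ
  obtain ⟨C, -, h0⟩ := exists_localRep_energyOp α hs χ 0
  obtain ⟨C', -, h1⟩ := exists_localRep_energyOp α hs χ 1
  exact ⟨(h0 h).imp fun g hg => hg.1, (h1 h).imp fun g hg => hg.1⟩

theorem localSeminorm₂_realize_le (α : ℝ) {s : ℝ} (hs : s ≤ 0) (χ : RTest n) :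
    ∃ C : ℝ≥0, ∀ h : RealSpace (energyOp (n := n) α),
      localSeminorm₂ s χ (realize _ h) ≤ C * ‖h‖ₑ := by
  have key : ∀ i, ∃ C : ℝ≥0, ∀ h : RealSpace (energyOp (n := n) α),
      localSeminorm (sobOrder s i) χ (realize _ h i) ≤ C * ‖h‖ₑ := fun i => by
    obtain ⟨C, hC, H⟩ := exists_localRep_energyOp α hs χ i
    refine ⟨C.toNNReal, fun h => ?_⟩
    obtain ⟨g, hg, hgC⟩ := H h
    refine (iInf₂_le g hg).trans ?_
    rw [← ofReal_norm, ← ofReal_norm, ENNReal.ofNNReal_toNNReal, ← ENNReal.ofReal_mul hC]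
    exact ENNReal.ofReal_le_ofReal hgC
  obtain ⟨C, h0⟩ := key 0
  obtain ⟨C', h1⟩ := key 1
  refine ⟨C + C', fun h => ?_⟩
  rw [ENNReal.coe_add, add_mul]
  exact add_le_add (h0 h) (h1 h)

theorem IsLocalRep.add {s : ℝ} {χ : RTest n} {u v : Distr n}
    {g g' : Lp ℂ 2 (volume : Measure (E n))} (hu : IsLocalRep s χ u g)
    (hv : IsLocalRep s χ v g') : IsLocalRep s χ (u + v) (g + g') := by
  obtain ⟨w, hw, hg⟩ := hu
  obtain ⟨w', hw', hg'⟩ := hv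
  refine ⟨w + w', fun φ => ?_, ?_⟩
  · change u (RTest.mul χ φ) + v (RTest.mul χ φ) = w φ.toSchwartz + w' φ.toSchwartz
    rw [hw, hw']
  · rw [map_add, hg, hg', toTemperedDistribution_add]

theorem localSeminorm_add_le (s : ℝ) (χ : RTest n) (u v : Distr n) :
    localSeminorm s χ (u + v) ≤ localSeminorm s χ u + localSeminorm s χ v := by
  simp only [localSeminorm, ENNReal.iInf_add, ENNReal.add_iInf]
  refine le_iInf fun g' => le_iInf fun hg' => le_iInf fun g => le_iInf fun hg => ?_
  refine le_trans ?_ (enorm_add_le g g')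
  exact iInf₂_le (g + g') (hg.add hg')

theorem localSeminorm₂_add_le (s : ℝ) (χ : RTest n) (Y Z : State n) :
    localSeminorm₂ s χ (Y + Z) ≤ localSeminorm₂ s χ Y + localSeminorm₂ s χ Z := by
  refine (add_le_add (localSeminorm_add_le (1 + s) χ (Y 0) (Z 0))
    (localSeminorm_add_le s χ (Y 1) (Z 1))).trans_eq ?_
  rw [localSeminorm₂, localSeminorm₂]
  ring

/-! ### Uniqueness of the limiting measure -/

theorem RTest.exists_cutoff (φ : RTest n) : ∃ χ : RTest n, RTest.mul χ φ = φ := by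
  obtain ⟨R, hR⟩ := φ.exists_radius
  let b : ContDiffBump (0 : E n) := ⟨|R| + 1, |R| + 2, by positivity, by linarith⟩
  refine ⟨⟨b, b.contDiff, b.hasCompactSupport, subset_univ _⟩, ?_⟩
  ext x
  change b x * φ x = φ x
  rcases le_or_gt ‖x‖ (|R| + 1) with hx | hx
  · rw [b.one_of_mem_closedBall (by simpa using hx), one_mul]
  · rw [hR x (by linarith [le_abs_self R]), mul_zero]

/-- With a cut-off equal to 1 on the support of φ, the value u(φ) is read off from χu as the pairing
of g with Λ^(-s)φ. -/
theorem exists_norm_apply_le_localRep (s : ℝ) (φ : RTest n) :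
    ∃ (χ : RTest n) (C : ℝ), 0 ≤ C ∧ ∀ (u : Distr n) g, IsLocalRep s χ u g → ‖u φ‖ ≤ C * ‖g‖ := by
  obtain ⟨χ, hχ⟩ := φ.exists_cutoff
  refine ⟨χ, ‖(lamS (-s) φ.toSchwartz).toLp 2‖, norm_nonneg _, fun u g ⟨w, hw, hg⟩ => ?_⟩
  have h1 : u φ = Lp.toTemperedDistribution g (lamS (-s) φ.toSchwartz) := by
    rw [← hg, lam_apply, lamS_lamS, add_neg_cancel, lamS_zero, ← hw, hχ]
  rw [h1, mul_comm]
  exact norm_toTemperedDistribution_le _ _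

theorem isLocalRep_zero (s : ℝ) (χ : RTest n) : IsLocalRep s χ (0 : Distr n) 0 :=
  ⟨0, fun _ => rfl, by
    rw [map_zero]; exact (map_zero (Lp.toTemperedDistributionCLM ℂ volume 2)).symm⟩

theorem localSeminorm₂_zero (s : ℝ) (χ : RTest n) : localSeminorm₂ s χ (0 : State n) = 0 := by
  have h : ∀ s, localSeminorm s χ (0 : Distr n) = 0 := fun s =>
    le_antisymm ((iInf₂_le 0 (isLocalRep_zero s χ)).trans_eq enorm_zero) bot_le
  change localSeminorm (1 + s) χ (0 : Distr n) + localSeminorm s χ (0 : Distr n) = 0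
  rw [h, h, add_zero]

theorem localSeminorm_le (s : ℝ) (χ : RTest n) (Y : State n) (i : Fin 2) :
    localSeminorm (sobOrder s i) χ (Y i) ≤ localSeminorm₂ s χ Y := by
  fin_cases i
  · exact le_self_add
  · exact le_add_self

theorem continuous_apply_local (s : ℝ) (i : Fin 2) (φ : RTest n) :
    @Continuous _ _ (seminormTopology (localSeminorm₂ (n := n) s)) _ fun Y : State n => Y i φ := by
  let _ : TopologicalSpace (State n) := seminormTopology (localSeminorm₂ (n := n) s)
  obtain ⟨χ, C, hC, h⟩ := exists_norm_apply_le_localRep (sobOrder s i) φ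
  refine Metric.continuous_iff'.2 fun Y ε hε => ?_
  have hρ : 0 < ε / (C + 1) := by positivity
  have hopen : IsOpen {Z : State n | localSeminorm₂ s χ (Z - Y) < ENNReal.ofReal (ε / (C + 1))} :=
    TopologicalSpace.isOpen_generateFrom_of_mem ⟨χ, Y, _, ENNReal.ofReal_pos.2 hρ, rfl⟩
  have hmem : Y ∈ {Z : State n | localSeminorm₂ s χ (Z - Y) < ENNReal.ofReal (ε / (C + 1))} := by
    rw [mem_ofPred_eq, sub_self, localSeminorm₂_zero]
    exact ENNReal.ofReal_pos.2 hρ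
  filter_upwards [hopen.mem_nhds hmem] with Z hZ
  have h1 := (localSeminorm_le s χ (Z - Y) i).trans_lt hZ
  rw [localSeminorm] at h1
  simp only [iInf_lt_iff] at h1
  obtain ⟨g, hg, hlt⟩ := h1
  rw [← ofReal_norm, ENNReal.ofReal_lt_ofReal_iff hρ] at hlt
  have h2 : Z i φ - Y i φ = (Z - Y) i φ := by rw [State.apply_sub, sub_apply]
  rw [dist_eq_norm]
  refine lt_of_eq_of_lt (congrArg norm h2) ((h _ g hg).trans_lt ?_)
  rw [lt_div_iff₀ (by positivity)] at hlt
  nlinarith [norm_nonneg g]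

theorem continuous_pairing₂_local (s : ℝ) (Ψ : Fin 2 → CTest n) :
    @Continuous _ _ (seminormTopology (localSeminorm₂ (n := n) s)) _
      fun Y : State n => pairing₂ Y Ψ := by
  let _ : TopologicalSpace (State n) := seminormTopology (localSeminorm₂ (n := n) s)
  refine continuous_finsetSum _ fun i _ => ?_
  exact (Complex.continuous_re.comp (continuous_apply_local s i _)).add
    (Complex.continuous_im.comp (continuous_apply_local s i _))

theorem charFunctional_eq_cos_sin [IsProbabilityMeasure μ] (Ψ : Fin 2 → CTest n) :
    charFunctional μ Ψ = ((∫ Y, Real.cos (pairing₂ Y Ψ) ∂μ : ℝ) : ℂ) +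
      ((∫ Y, Real.sin (pairing₂ Y Ψ) ∂μ : ℝ) : ℂ) * Complex.I := by
  have hc : Integrable (fun Y : State n => Real.cos (pairing₂ Y Ψ)) μ :=
    Integrable.of_bound (Real.measurable_cos.comp (measurable_pairing₂ Ψ)).aestronglyMeasurable 1
      (ae_of_all _ fun Y => Real.abs_cos_le_one _)
  have hs : Integrable (fun Y : State n => Real.sin (pairing₂ Y Ψ)) μ :=
    Integrable.of_bound (Real.measurable_sin.comp (measurable_pairing₂ Ψ)).aestronglyMeasurable 1
      (ae_of_all _ fun Y => Real.abs_sin_le_one _)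
  rw [charFunctional, ← integral_complex_ofReal, ← integral_complex_ofReal, ← integral_mul_const]
  refine Eq.trans ?_ (integral_add hc.ofReal (hs.ofReal.mul_const Complex.I))
  refine integral_congr_ae (ae_of_all _ fun Y => ?_)
  simp only [Complex.ofReal_cos, Complex.ofReal_sin]
  rw [mul_comm, Complex.exp_mul_I]

/-- Cosines and sines of pairings are bounded and continuous for the local Sobolev topology, so
convergence for one value of ε already fixes the characteristic functional. -/
theorem IsLimitingMeasure.unique {μ : ℝ → Measure (State n)} {ν ν' : Measure (State n)}
    (h : IsLimitingMeasure μ ν) (h' : IsLimitingMeasure μ ν') : ν' = ν := by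
  have := h.prob
  have := h'.prob
  refine measure_ext_of_charFunctional fun Ψ => ?_
  have key : ∀ f : ℝ → ℝ, Continuous f → (∀ x, |f x| ≤ 1) →
      ∫ Y, f (pairing₂ Y Ψ) ∂ν' = ∫ Y, f (pairing₂ Y Ψ) ∂ν := fun f hf hb => by
    have hc : @ContinuousOn _ _ (seminormTopology (localSeminorm₂ (n := n) (-1))) _
        (fun Y : State n => f (pairing₂ Y Ψ)) (localSpace n (-1)) := by
      let _ : TopologicalSpace (State n) := seminormTopology (localSeminorm₂ (n := n) (-1))
      exact (hf.comp (continuous_pairing₂_local (-1) Ψ)).continuousOn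
    exact tendsto_nhds_unique
      ((h'.tendsto 1 one_pos).2.2 _ ⟨1, fun Y _ => hb _⟩ hc)
      ((h.tendsto 1 one_pos).2.2 _ ⟨1, fun Y _ => hb _⟩ hc)
  rw [charFunctional_eq_cos_sin, charFunctional_eq_cos_sin,
    key _ Real.continuous_cos Real.abs_cos_le_one, key _ Real.continuous_sin Real.abs_sin_le_one]

/-! ### Gaussian measures in a realization -/

theorem TraceBound.const_mul {V H : Type*} [AddCommGroup V] [Module ℝ V] [NormedAddCommGroup H]
    [InnerProductSpace ℝ H] [CompleteSpace H] {e : V →ₗ[ℝ] H} {D : V → ℝ} {K : ℝ}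
    (h : TraceBound e D K) {c : ℝ} (hc : 0 ≤ c) : TraceBound e (fun v => c * D v) (c * K) := by
  refine ⟨fun v => ?_, fun ι s w hw => ?_⟩
  · rw [mul_assoc]; exact mul_le_mul_of_nonneg_left (h.1 v) hc
  · rw [← Finset.mul_sum]; exact mul_le_mul_of_nonneg_left (h.2 ι s w hw) hc

section Gaussian

variable {H : Type*} [NormedAddCommGroup H] [InnerProductSpace ℝ H] [CompleteSpace H]
  [SecondCountableTopology H] [MeasurableSpace H] [BorelSpace H]
  {J : H → State n} {e : (Fin 2 → CTest n) →ₗ[ℝ] H} {D : (Fin 2 → CTest n) → ℝ} {K : ℝ}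

theorem IsRealization.exists_gaussian (hJ : IsRealization J e) (hD : TraceBound e D K)
    {Q : QuadraticForm ℝ (Fin 2 → CTest n)} (h0 : ∀ Ψ, 0 ≤ Q Ψ) (hQ : ∀ Ψ, Q Ψ ≤ D Ψ) :
    ∃ ν : ProbabilityMeasure H, (∀ Ψ, charFun (ν : Measure H) (e Ψ) =
      Complex.exp (-(Q Ψ : ℝ) / 2)) ∧ ∀ Ψ, charFunctional ((ν : Measure H).map J) Ψ =
        Complex.exp (-(Q Ψ : ℂ) / 2) := by
  have hβ : ∀ Ψ, QuadraticMap.associated (R := ℝ) Q Ψ Ψ = Q Ψ := fun Ψ =>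
    QuadraticMap.associated_eq_self_apply ℝ Q Ψ
  obtain ⟨ν, hν⟩ := KleinGordon.exists_gaussian e hJ.dense hD (QuadraticMap.associated (R := ℝ) Q)
    ⟨fun x y => QuadraticMap.associated_isSymm ℝ Q x y⟩ (fun Ψ => (h0 Ψ).trans_eq (hβ Ψ).symm)
    (fun Ψ => (hβ Ψ).trans_le (hQ Ψ))
  refine ⟨ν, fun Ψ => by rw [hν, hβ], fun Ψ => ?_⟩
  rw [hJ.charFunctional_map, hν, hβ]

/-- Each given measure coincides with the image of a Gaussian measure on `H`, since the
characteristic functionals agree. Concentration on `V` is thereby a conclusion and not an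
assumption. -/
theorem IsRealization.weaklyConverges_gaussian (hJ : IsRealization J e) (hD : TraceBound e D K)
    {ι A : Type*} {V : Set (State n)} {N : ι → State n → ℝ≥0∞} (hV : ∀ h, J h ∈ V)
    (hN : ∀ i, ∃ C : ℝ≥0, ∀ h, N i (J h) ≤ C * ‖h‖ₑ)
    (hadd : ∀ i Y Z, N i (Y + Z) ≤ N i Y + N i Z) {l : Filter A} {μ : A → Measure (State n)}
    {μ₀ : Measure (State n)} (hμ : ∀ a, IsProbabilityMeasure (μ a)) (hμ₀ : IsProbabilityMeasure μ₀)
    {Q : A → QuadraticForm ℝ (Fin 2 → CTest n)} {Q₀ : QuadraticForm ℝ (Fin 2 → CTest n)}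
    (h0 : ∀ a Ψ, 0 ≤ Q a Ψ) (hQ : ∀ a Ψ, Q a Ψ ≤ D Ψ) (h0' : ∀ Ψ, 0 ≤ Q₀ Ψ)
    (hQ' : ∀ Ψ, Q₀ Ψ ≤ D Ψ)
    (hμQ : ∀ a Ψ, charFunctional (μ a) Ψ = Complex.exp (-(Q a Ψ : ℂ) / 2))
    (hμQ₀ : ∀ Ψ, charFunctional μ₀ Ψ = Complex.exp (-(Q₀ Ψ : ℂ) / 2))
    (hlim : ∀ Ψ, Tendsto (fun a => Q a Ψ) l (𝓝 (Q₀ Ψ))) :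
    WeaklyConverges V N l μ μ₀ := by
  choose ν hν hν' using fun a => hJ.exists_gaussian hD (h0 a) (hQ a)
  obtain ⟨ν₀, hν₀, hν₀'⟩ := hJ.exists_gaussian hD h0' hQ'
  have e0 : μ₀ = (ν₀ : Measure H).map J := by
    have := Measure.isProbabilityMeasure_map (μ := (ν₀ : Measure H))
      hJ.measurableEmbedding.measurable.aemeasurable
    exact measure_ext_of_charFunctional fun Ψ => by rw [hμQ₀, hν₀']
  have e1 : μ = fun a => (ν a : Measure H).map J := funext fun a => by
    have := hμ a
    have := Measure.isProbabilityMeasure_map (μ := (ν a : Measure H))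
      hJ.measurableEmbedding.measurable.aemeasurable
    exact measure_ext_of_charFunctional fun Ψ => by rw [hμQ, hν']
  rw [e0, e1]
  refine hJ.weaklyConverges hV hN hadd (tendsto_gaussian e hJ.dense hD hν hν₀ (fun a t Ψ => ?_)
    h0 hQ hlim)
  rw [QuadraticMap.map_smul, smul_eq_mul, sq]

theorem IsRealization.ae_mem_of_gaussian (hJ : IsRealization J e) (hD : TraceBound e D K)
    {V : Set (State n)} (hV : ∀ h, J h ∈ V) [IsProbabilityMeasure μ]
    {Q : QuadraticForm ℝ (Fin 2 → CTest n)} (h0 : ∀ Ψ, 0 ≤ Q Ψ) (hQ : ∀ Ψ, Q Ψ ≤ D Ψ)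
    (hμQ : ∀ Ψ, charFunctional μ Ψ = Complex.exp (-(Q Ψ : ℂ) / 2)) : ∀ᵐ Y ∂μ, Y ∈ V := by
  obtain ⟨ν, -, hν⟩ := hJ.exists_gaussian hD h0 hQ
  have := Measure.isProbabilityMeasure_map (μ := (ν : Measure H))
    hJ.measurableEmbedding.measurable.aemeasurable
  have e0 : μ = (ν : Measure H).map J :=
    measure_ext_of_charFunctional fun Ψ => by rw [hμQ, hν]
  rw [e0]
  exact hJ.measurableEmbedding.ae_map_iff.2 (ae_of_all _ hV)

end Gaussian

theorem IsRandomSolution.isProbabilityMeasure_map [IsProbabilityMeasure μ] {Ω : Type*}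
    [MeasurableSpace Ω] {P : Measure Ω} {Y : ℝ → Ω → State n} (hY : IsRandomSolution m P Y μ)
    (t : ℝ) : IsProbabilityMeasure (P.map (Y t)) := by
  have hP : IsProbabilityMeasure P := ⟨by
    have h := measure_univ (μ := μ)
    rwa [← hY.initial, Measure.map_apply (hY.measurable 0) MeasurableSet.univ, preimage_univ] at h⟩
  exact Measure.isProbabilityMeasure_map (hY.measurable t).aemeasurable

/-- Quadraticity, positivity and the majorant are inherited from the covariance forms at finite
times. -/
theorem IsInitial.exists_limitForm (hn : 0 < n) (hm : 0 < m) (h : IsInitial μ q) :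
    ∃ Q : QuadraticForm ℝ (Fin 2 → CTest n), (∀ Ψ, Q Ψ = limitForm m q Ψ) ∧ (∀ Ψ, 0 ≤ Q Ψ) ∧
      ∀ Ψ, Q Ψ ≤ 8 * majorant m (spectralDensity m q) Ψ := by
  obtain ⟨hμ, Q, h0, hQ⟩ := h.gpm
  have hQt : ∀ t Ψ, Q.comp (flow hm t) Ψ = ∫ Y, pairing₂ Y (flow hm t Ψ) ^ 2 ∂μ := fun t Ψ =>
    quadratic_eq_integral_sq h0 hQ (flow hm t Ψ)
  have hlim : ∀ Ψ, Tendsto (fun t => Q.comp (flow hm t) Ψ) atTop (𝓝 (limitForm m q Ψ)) :=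
    fun Ψ => by simpa only [hQt] using h.tendsto_flow hn hm Ψ
  obtain ⟨Q', hQ'⟩ := exists_quadraticForm_of_tendsto hlim
  refine ⟨Q', hQ', fun Ψ => ?_, fun Ψ => ?_⟩
  · rw [hQ']; exact ge_of_tendsto' (hlim Ψ) fun t => h0 _
  · rw [hQ']
    exact le_of_tendsto' (hlim Ψ) fun t => (hQt t Ψ).trans_le (h.integral_sq_flow_le hm t Ψ)

/-- One weighted energy space serves for everything: it lies in the phase space and maps boundedly
to all the local spaces with ε > 0, so a single Gaussian measure on it is the limit for every ε. -/
theorem IsInitial.exists_isLimitingMeasure (hn : 0 < n) (hm : 0 < m) (h : IsInitial μ q)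
    {Ω : Type*} [MeasurableSpace Ω] {P : Measure Ω} {Y : ℝ → Ω → State n}
    (hY : IsRandomSolution m P Y μ) :
    ∃ ν, IsLimitingMeasure (fun t => P.map (Y t)) ν ∧
      ∀ Ψ, charFunctional ν Ψ = Complex.exp (-(limitForm m q Ψ : ℂ) / 2) := by
  obtain ⟨hμ, Q, h0, hQ⟩ := h.gpm
  have hQt : ∀ t Ψ, Q.comp (flow hm t) Ψ = ∫ Y, pairing₂ Y (flow hm t Ψ) ^ 2 ∂μ := fun t Ψ =>
    quadratic_eq_integral_sq h0 hQ (flow hm t Ψ)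
  obtain ⟨Q', hQ', h0', hb'⟩ := h.exists_limitForm hn hm
  -- The weight exponent -n is merely a convenient value below -n/2, which it is because n > 0.
  have hα : -(n : ℝ) < -(n : ℝ) / 2 := by
    have : (0 : ℝ) < n := Nat.cast_pos.2 hn
    linarith
  obtain ⟨K, hK⟩ := exists_traceBound_energy hm hα h.spectralDensity_nonneg
    (h.continuous_spectralDensity (m := m)) h.integrable_spectralDensity
  have hD := hK.const_mul (c := 8) (by norm_num)
  have hJ := isRealization_realize (isRealOp_energyOp (n := n) (-(n : ℝ)))
  obtain ⟨ν, -, hν⟩ := hJ.exists_gaussian hD h0' hb'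
  have hνp := Measure.isProbabilityMeasure_map
    (μ := (ν : Measure (RealSpace (energyOp (n := n) (-(n : ℝ))))))
    hJ.measurableEmbedding.measurable.aemeasurable
  refine ⟨_, ⟨hνp, ?_, fun ε hε => ?_⟩, fun Ψ => by rw [hν, hQ']⟩
  · exact hJ.measurableEmbedding.ae_map_iff.2
      (ae_of_all _ fun h => realize_energyOp_mem_phaseSpace _ h)
  · have hε' : -ε ≤ 0 := by linarith
    refine hJ.weaklyConverges_gaussian hD (Q := fun t => Q.comp (flow hm t)) (Q₀ := Q')
      (fun h => realize_energyOp_mem_localSpace _ hε' h)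
      (fun χ => localSeminorm₂_realize_le _ hε' χ) (fun χ => localSeminorm₂_add_le _ χ)
      (fun t => hY.isProbabilityMeasure_map t) hνp (fun t Ψ => h0 _)
      (fun t Ψ => (hQt t Ψ).trans_le (h.integral_sq_flow_le hm t Ψ)) h0' hb'
      (fun t Ψ => ?_) hν fun Ψ => ?_
    · rw [hY.charFunctional_map hm, hQ]; rfl
    · simp only [hQt, hQ']
      exact h.tendsto_flow hn hm Ψ

theorem majorant_nonneg {F : E n → ℝ} (hF : ∀ ξ, 0 ≤ F ξ) (Ψ : Fin 2 → CTest n) :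
    0 ≤ majorant m F Ψ :=
  Finset.sum_nonneg fun _ _ => add_nonneg
    (integral_nonneg fun ξ => mul_nonneg (hF ξ) (sq_nonneg _))
    (integral_nonneg fun ξ => mul_nonneg (hF ξ) (sq_nonneg _))

/-! ### Consequences of the conditions on the covariance functions -/

theorem isInitial_of_lintegral_le (hm : 0 < m) (hg : IsGPM μ) (hc : HasCovFun μ q)
    (hr : IsRegularCovFun q) (h01 : ∀ z, q 0 1 z = q 1 0 z) {C : ℝ≥0}
    (hC : ∀ a b, ∫⁻ z, (‖q 1 1 z a b‖ₑ + ‖Δ (fun y => q 0 0 y a b) z‖ₑ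
      + ENNReal.ofReal (m ^ 2) * ‖q 0 0 z a b‖ₑ) ≤ C) : IsInitial μ q where
  gpm := hg
  cov := hc
  reg := hr
  symm := h01
  int₁ a b := ⟨(hr.2 1 1 a b).aestronglyMeasurable, (lintegral_mono fun z =>
    le_self_add.trans le_self_add).trans_lt ((hC a b).trans_lt ENNReal.coe_lt_top)⟩
  int₀ a b := by
    refine ⟨(hr.2 0 0 a b).aestronglyMeasurable, ?_⟩
    have h1 : ENNReal.ofReal (m ^ 2) * ∫⁻ z, ‖q 0 0 z a b‖ₑ < ∞ := by
      rw [← lintegral_const_mul _ (hr.2 0 0 a b).enorm.measurable]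
      exact (lintegral_mono fun z => le_add_self).trans_lt ((hC a b).trans_lt ENNReal.coe_lt_top)
    exact ENNReal.lt_top_of_mul_ne_top_right h1.ne (ENNReal.ofReal_pos.2 (by positivity)).ne'
  intΔ a b := ⟨(continuous_laplacian (hr.1 a b)).aestronglyMeasurable, (lintegral_mono fun z =>
    le_add_self.trans le_self_add).trans_lt ((hC a b).trans_lt ENNReal.coe_lt_top)⟩

theorem integral_abs_energyCovFun_le (hr : IsRegularCovFun q) {C : ℝ≥0} {a b : Fin 2}
    (hC : ∫⁻ z, (‖q 1 1 z a b‖ₑ + ‖Δ (fun y => q 0 0 y a b) z‖ₑ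
      + ENNReal.ofReal (m ^ 2) * ‖q 0 0 z a b‖ₑ) ≤ C) :
    ∫ z, |energyCovFun m q a b z| ≤ C := by
  have h1 : ∫ z, |energyCovFun m q a b z| = (∫⁻ z, ‖energyCovFun m q a b z‖ₑ).toReal :=
    integral_norm_eq_lintegral_enorm (continuous_energyCovFun hr a b).aestronglyMeasurable
  rw [h1]
  refine ENNReal.toReal_le_coe_of_le_coe ((lintegral_mono fun z => ?_).trans hC)
  rw [energyCovFun]
  refine (enorm_add_le _ _).trans (add_le_add (enorm_sub_le) ?_)
  rw [enorm_mul, Real.enorm_of_nonneg (sq_nonneg m)]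

/-! ### The convergence to the canonical Gibbs distribution -/

theorem exists_isCanonicalGibbs (hm : 0 < m) (hn : 0 < n) {T : ℝ} (hT : 0 < T)
    {Q : QuadraticForm ℝ (Fin 2 → CTest n)} (hQ : ∀ Ψ, Q Ψ = gibbsForm m T Ψ) :
    ∃ g : Measure (State n), IsCanonicalGibbs m T g := by
  have hα : -(n : ℝ) < -(n : ℝ) / 2 := by
    have : (0 : ℝ) < n := Nat.cast_pos.2 hn
    linarith
  obtain ⟨K, hK⟩ := exists_traceBound_weighted hm hα hα
  have hJ := isRealization_realize (isRealOp_weightedOp (n := n) (-(n : ℝ)) (-(n : ℝ)))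
  obtain ⟨ν, -, hν⟩ := hJ.exists_gaussian (hK.const_mul hT.le) (Q := Q)
    (fun Ψ => by
      rw [hQ, gibbsForm_eq hm]
      exact mul_nonneg hT.le (majorant_nonneg (fun _ => zero_le_one) Ψ))
    (fun Ψ => ((hQ Ψ).trans (gibbsForm_eq hm T Ψ)).le)
  exact ⟨_, Measure.isProbabilityMeasure_map hJ.measurableEmbedding.measurable.aemeasurable,
    fun Ψ => by rw [hν, hQ]⟩

theorem IsCanonicalGibbs.unique {T : ℝ} {g g' : Measure (State n)} (h : IsCanonicalGibbs m T g)
    (h' : IsCanonicalGibbs m T g') : g' = g := by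
  have := h.1
  have := h'.1
  exact measure_ext_of_charFunctional fun Ψ => by rw [h.2, h'.2]

end KleinGordon

end

/-! ### The limits t → ∞ and r → 0 combined -/

open KleinGordon in
theorem mainTheorem4 (n : ℕ) (hn : 1 ≤ n) (m T : ℝ) (hm : 0 < m) (hT : 0 < T)
    -- the initial measures and their covariance functions
    (μ₀ : ℝ → Measure (State n)) (q : ℝ → CovFun n)
    (hgauss : ∀ r ∈ Ioc (0 : ℝ) 1, IsGPM (μ₀ r))
    (hcov : ∀ r ∈ Ioc (0 : ℝ) 1, HasCovFun (μ₀ r) (q r))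
    (hreg : ∀ r ∈ Ioc (0 : ℝ) 1, IsRegularCovFun (q r))
    -- the random solutions
    {Ω : ℝ → Type*} [∀ r, MeasurableSpace (Ω r)] (P : ∀ r, Measure (Ω r))
    (Y : ∀ r, ℝ → Ω r → State n)
    (hY : ∀ r ∈ Ioc (0 : ℝ) 1, IsRandomSolution m (P r) (Y r) (μ₀ r))
    -- the conditions on the covariance functions
    (G0 : ∀ r ∈ Ioc (0 : ℝ) 1, ∀ z, q r 0 1 z = q r 1 0 z)
    (G1 : ∀ r ∈ Ioc (0 : ℝ) 1, ∀ z, r ≤ ‖z‖ → ∀ a b, energyCovFun m (q r) a b z = 0)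
    (G2 : ∀ a b, Tendsto (fun r => (1 / 2 : ℝ) * ∫ z, energyCovFun m (q r) a b z) (𝓝[>] 0)
      (𝓝 (T * (1 : Matrix (Fin 2) (Fin 2) ℝ) a b)))
    (G3 : ∃ C : ℝ≥0, ∀ r ∈ Ioc (0 : ℝ) 1, ∀ a b,
      ∫⁻ z, (‖q r 1 1 z a b‖ₑ + ‖Δ (fun y => q r 0 0 y a b) z‖ₑ
        + ENNReal.ofReal (m ^ 2) * ‖q r 0 0 z a b‖ₑ) ≤ C) :
    ∃ (μinf : ℝ → Measure (State n)) (g : Measure (State n)),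
      -- `μinf r` is the unique limiting measure of the distributions of `Y r t` as `t → ∞`
      (∀ r ∈ Ioc (0 : ℝ) 1,
        IsLimitingMeasure (fun t => (P r).map (Y r t)) (μinf r) ∧
        ∀ ν, IsLimitingMeasure (fun t => (P r).map (Y r t)) ν → ν = μinf r) ∧
      -- `g` is the unique canonical Gibbs distribution of temperature `T`
      (IsCanonicalGibbs m T g ∧ ∀ g', IsCanonicalGibbs m T g' → g' = g) ∧
      ∀ s α : ℝ, s < -(n : ℝ) / 2 → α < -(n : ℝ) / 2 →
        (∀ r ∈ Ioc (0 : ℝ) 1, ∀ᵐ Z ∂(μinf r), Z ∈ weightedSpace n s α) ∧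
        WeaklyConverges (weightedSpace n s α) (fun _ : Unit => weightedNorm₂ s α) (𝓝[>] 0)
          μinf g := by
  classical
  obtain ⟨C, hC⟩ := G3
  have hI : ∀ r ∈ Ioc (0 : ℝ) 1, IsInitial (μ₀ r) (q r) := fun r hr =>
    isInitial_of_lintegral_le hm (hgauss r hr) (hcov r hr) (hreg r hr) (G0 r hr) (hC r hr)
  have hE : ∀ r ∈ Ioc (0 : ℝ) 1, ∀ a b, ∫ z, |energyCovFun m (q r) a b z| ≤ C := fun r hr a b =>
    integral_abs_energyCovFun_le (hreg r hr) (hC r hr a b)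
  have hlim := fun Ψ => tendsto_limitForm hm (fun r hr => (hI r hr).integrable_energyCovFun) G1 G2
    hE Ψ
  have hev : ∀ᶠ r in 𝓝[>] (0 : ℝ), r ∈ Ioc (0 : ℝ) 1 := Ioc_mem_nhdsGT one_pos
  choose! Q hQ hQ0 hQb using fun r (hr : r ∈ Ioc (0 : ℝ) 1) => (hI r hr).exists_limitForm hn hm
  choose! ν hν hνQ using fun r (hr : r ∈ Ioc (0 : ℝ) 1) =>
    (hI r hr).exists_isLimitingMeasure hn hm (hY r hr)
  -- The Gibbs form is recognised as quadratic because it is a pointwise limit of the forms `Q r`.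
  obtain ⟨QG, hQG⟩ := exists_quadraticForm_of_tendsto (Q := Q) (l := 𝓝[>] (0 : ℝ)) fun Ψ =>
    (hlim Ψ).congr' (hev.mono fun r hr => (hQ r hr Ψ).symm)
  obtain ⟨g, hg⟩ := exists_isCanonicalGibbs hm hn hT hQG
  have hmaj : ∀ Ψ : Fin 2 → CTest n, 0 ≤ majorant m (fun _ => 1) Ψ :=
    majorant_nonneg fun _ => zero_le_one
  -- the bounds of the covariances by a common majorant
  have hQb' : ∀ r ∈ Ioc (0 : ℝ) 1, ∀ Ψ,
      Q r Ψ ≤ (8 * (2 * C) + T) * majorant m (fun _ => 1) Ψ := fun r hr Ψ => by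
    -- The two diagonal entries contribute C each, and the factor 8 is that of
    -- `IsInitial.exists_limitForm`. The summand T in the constant is there so that the same
    -- majorant covers the Gibbs form.
    have h1 : ∀ ξ, spectralDensity m (q r) ξ ≤ 2 * C := fun ξ =>
      (spectralDensity_le ξ).trans ((Finset.sum_le_sum fun a _ => hE r hr a a).trans_eq (by simp))
    have h2 := majorant_le hm (hI r hr).continuous_spectralDensity
      (hI r hr).spectralDensity_nonneg h1 Ψ
    have h3 := mul_nonneg hT.le (hmaj Ψ)
    have h4 := hQb r hr Ψ
    linarith
  have hGb : ∀ Ψ, QG Ψ ≤ (8 * (2 * C) + T) * majorant m (fun _ => 1) Ψ := fun Ψ => by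
    rw [hQG, gibbsForm_eq hm, add_mul]
    exact le_add_of_nonneg_left (mul_nonneg (by positivity) (hmaj Ψ))
  have hG0 : ∀ Ψ, 0 ≤ QG Ψ := fun Ψ => by
    rw [hQG, gibbsForm_eq hm]
    exact mul_nonneg hT.le (hmaj Ψ)
  -- Values outside (0, 1] are irrelevant to the limit; taking `g` there keeps every member of the
  -- family a Gaussian probability measure below the common majorant.
  refine ⟨fun r => if r ∈ Ioc (0 : ℝ) 1 then ν r else g, g, fun r hr => ?_,
    ⟨hg, fun g' hg' => hg.unique hg'⟩, fun s α hs hα => ?_⟩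
  · beta_reduce
    rw [if_pos hr]
    exact ⟨hν r hr, fun ν' hν' => (hν r hr).unique hν'⟩
  obtain ⟨K, hK⟩ := exists_traceBound_weighted hm hs hα
  have hD := hK.const_mul (c := 8 * (2 * C) + T) (by positivity)
  have hJ := isRealization_realize (isRealOp_weightedOp (n := n) s α)
  refine ⟨fun r hr => ?_, ?_⟩
  · beta_reduce
    rw [if_pos hr]
    have := (hν r hr).prob
    exact hJ.ae_mem_of_gaussian hD (realize_mem_weightedSpace s α) (hQ0 r hr) (hQb' r hr)
      fun Ψ => by rw [hνQ r hr, hQ r hr]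
  · refine hJ.weaklyConverges_gaussian hD (Q := fun r => if r ∈ Ioc (0 : ℝ) 1 then Q r else QG)
      (Q₀ := QG) (realize_mem_weightedSpace s α) (fun _ => ⟨2, weightedNorm₂_realize_le s α⟩)
      (fun _ => weightedNorm₂_add_le s α) (fun r => ?_) hg.1 (fun r Ψ => ?_) (fun r Ψ => ?_)
      hG0 hGb (fun r Ψ => ?_) (fun Ψ => by rw [hg.2, hQG]) (fun Ψ => ?_)
    · split_ifs with hr
      exacts [(hν r hr).prob, hg.1]
    · split_ifs with hr
      exacts [hQ0 r hr Ψ, hG0 Ψ]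
    · split_ifs with hr
      exacts [hQb' r hr Ψ, hGb Ψ]
    · split_ifs with hr
      · rw [hνQ r hr, hQ r hr]
      · rw [hg.2, hQG]
    · rw [hQG]
      refine (hlim Ψ).congr' (hev.mono fun r hr => ?_)
      beta_reduce
      rw [if_pos hr, hQ r hr]
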